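/- **Setting.** Let $d\ge 1$, $\chi_A$ denote the indicator function of $A\subset\mathbb{R}^d$, and $\sigma>0$. Let $\mu_0$ be a finite measure on $\mathbb{R}^d\times\mathbb{S}^{d-1}$ (an oriented varifold) with mass measure $\omega_0$ (its projection to $\mathbb{R}^d$), and let $\chi_0\in BV(\mathbb{R}^d;\{0,1\})$. A *De Giorgi type varifold solution* with initial data $(\mu_0,\chi_0)$ is a pair $(\mu,\chi)$ consisting of a weakly-$*$ measurable family of finite oriented varifolds $(\mu_t)_{t>0}$ on $\mathbb{R}^d\times\mathbb{S}^{d-1}$ with mass measures $\omega_t$, and of $\chi(\cdot,t)=\chi_{A(t)}$ for open sets $A(t)$ of finite perimeter with $\chi\in L^\infty((0,\infty);BV(\mathbb{R}^d;\{0,1\}))$, such that there exist $V\in L^2((0,\infty);L^2(\mathbb{R}^d,d\omega_t))$ and $\mathbf H\in L^2((0,\infty);L^2(\mathbb{R}^d,d\omega_t;\mathbb{R}^d))$ with: 1. for a.e. $T>0$ and all $\zeta\in C_c^\infty(\mathbb{R}^d\times[0,\infty))$: $\sigma\int\chi(\cdot,T)\zeta(\cdot,T)\,dx-\sigma\int\chi_0\zeta(\cdot,0)\,dx=\sigma\int_0^T\!\int\chi\,\partial_t\zeta\,dx\,dt-\int_0^T\!\int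 V\zeta\,d\omega_t\,dt$; 2. for all $B\in C_c^\infty(\mathbb{R}^d\times[0,\infty);\mathbb{R}^d)$: $\int_0^\infty\!\int\mathbf H\cdot B\,d\omega_t\,dt=-\int_0^\infty\!\int(I_d-p\otimes p):\nabla B\,d\mu_t\,dt$; 3. for a.e. $T>0$: $\omega_T(\mathbb{R}^d)+\frac12\int_0^T\!\int|V|^2\,d\omega_t\,dt+\frac12\int_0^T\!\int|\mathbf H|^2\,d\omega_t\,dt\le\omega_0(\mathbb{R}^d)$; 4. for a.e. $t>0$ and all $X\in C_c^\infty(\mathbb{R}^d;\mathbb{R}^d)$: $\int X\cdot\sigma\,d\nabla\chi(\cdot,t)=\int X\cdot p\,d\mu_t(x,p)$. Let $T_{\mathrm{strong}}\in(0,\infty)$ and let $(\mathscr A(t))_{t\in[0,T_{\mathrm{strong}}]}$ be a smoothly evolving family of (uniformly) bounded domains in $\mathbb{R}^d$ whose interfaces $\mathcal I(t)=\partial\mathscr A(t)$ evolve smoothly by their mean curvature. Let $s(\cdot,t)$ be the signed distance to $\mathcal I(t)$, positive inside $\mathscr A(t)$, and let $n_{\mathcal I(t)}$ be the inner unit normal.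 Fix - $r_c\in(0,1)$ such that $((x,t),s)\mapsto(x+s\,n_{\mathcal I(t)}(x),t)$, for $x\in\mathcal I(t)$, $t\in[0,T_{\mathrm{strong}}]$, $|s|<2r_c$, is a smooth diffeomorphism onto $\{(x,t):\operatorname{dist}(x,\mathcal I(t))<2r_c\}$; - a smooth $\kappa:\mathbb{R}\to[0,1]$ with $\kappa=1$ on $[-\frac12,\frac12]$ and $\kappa=0$ outside $(-1,1)$; - a smooth $\bar\vartheta:\mathbb{R}\to[-1,1]$ with $\bar\vartheta=1$ on $(-\infty,-1]$, $\bar\vartheta=-1$ on $[1,\infty)$, $\bar\vartheta'<0$ on $(-1,1)$, $\bar\vartheta(0)=0$ and $|\bar\vartheta(r)|\ge|r|$ on $[-1,1]$. Put $\zeta(r)=(1-r^2)\kappa(r^2)$, $\xi=\zeta(s/r_c)\nabla s$, $\vartheta=\bar\vartheta(s/r_c)$, and $$E[\mu,\chi|\mathscr A](t)=\int 1-p\cdot\xi(x,t)\,d\mu_t(x,p),\qquad E_{\mathrm{bulk}}[\chi|\mathscr A](t)=\sigma\int|\chi(\cdot,t)-\chi_{\mathscr A(t)}||\vartheta(\cdot,t)|\,dx,$$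 and analogously at time $0$ with $\mu_0,\chi_0$. **Theorem.** Such $r_c,\kappa,\bar\vartheta$ exist. For each choice of them there is a constant $C>0$, depending only on $\mathscr A$ and this choice, such that for every $\sigma>0$ and every De Giorgi type varifold solution $(\mu,\chi)$ whose initial data $(\mu_0,\chi_0)$ are compatible, i.e. $\int X\cdot\sigma\,d\nabla\chi_0=\int X\cdot p\,d\mu_0$ for all $X\in C_c^\infty(\mathbb{R}^d;\mathbb{R}^d)$, one has for a.e. $T\in[0,T_{\mathrm{strong}}]$ $$E[\mu,\chi|\mathscr A](T)\le E[\mu_0,\chi_0|\mathscr A(0)]+C\int_0^T E[\mu,\chi|\mathscr A](t)\,dt,$$ $$E_{\mathrm{bulk}}[\chi|\mathscr A](T)\le E_{\mathrm{bulk}}[\chi_0|\mathscr A(0)]+E[\mu_0,\chi_0|\mathscr A(0)]+C\int_0^T E_{\mathrm{bulk}}[\chi|\mathscr A](t)+E[\mu,\chi|\mathscr A](t)\,dt.$$ Moreover, for every $\sigma>0$ and every De Giorgi type varifold solution, if $\chi_0=\chi_{\mathscr A(0)}$ a.e. and $\mu_0=\sigma|\nabla\chi_0|\otimes(\delta_{\frac{\nabla\chi_0}{|\nabla\chi_0|}(x)})_{x\in\mathbb{R}^d}$,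 then for a.e. $t\in[0,T_{\mathrm{strong}}]$ $$\chi(\cdot,t)=\chi_{\mathscr A(t)}\ \text{a.e. in }\mathbb{R}^d,\qquad \mu_t=\sigma|\nabla\chi(\cdot,t)|\otimes(\delta_{\frac{\nabla\chi(\cdot,t)}{|\nabla\chi(\cdot,t)|}(x)})_{x\in\mathbb{R}^d}.$$ -/

import Mathlib

open MeasureTheory Set Filter Topology
open scoped ContDiff ENNReal NNReal ZeroAtInfty RealInnerProductSpace

noncomputable section

namespace TwoPhaseMCF

/-- The ambient space `ℝ^d`. -/
abbrev Euc (d : ℕ) := EuclideanSpace ℝ (Fin d)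

/-- The unit sphere `𝕊^{d-1}` of `ℝ^d`. -/
abbrev Sph (d : ℕ) := Metric.sphere (0 : Euc d) 1

variable {d : ℕ}

/-- The divergence `∑ i, ∂_i X_i` of a vector field. -/
def divergence (X : Euc d → Euc d) (x : Euc d) : ℝ :=
  ∑ i : Fin d, (fderiv ℝ X x (EuclideanSpace.single i 1)) i

/-- Smooth compactly supported maps. Test functions of class `C_c^∞(ℝ^d × [0,∞))` are obtained
as restrictions to nonnegative times of the test functions on `ℝ × Euc d` (time comes first). -/
structure IsTest {F G : Type*} [NormedAddCommGroup F] [NormedSpace ℝ F]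
    [NormedAddCommGroup G] [NormedSpace ℝ G] (f : F → G) : Prop where
  smooth : ContDiff ℝ ∞ f
  compact : HasCompactSupport f

/-! ### Sets of finite perimeter and oriented varifolds -/

/-- The distributional gradient of the indicator function `χ_A` is the finite vector-valued measure
`n ν`, given in polar form: `ν = |∇χ_A|` and `n = ∇χ_A / |∇χ_A|` (a unit vector). -/
structure IsPolarGradient (A : Set (Euc d)) (ν : Measure (Euc d)) (n : Euc d → Sph d) : Prop where
  finite : IsFiniteMeasure ν
  measurable : Measurable n
  integral_eq : ∀ X : Euc d → Euc d, IsTest X →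
    ∫ x in A, divergence X x = - ∫ x, ⟪X x, (n x : Euc d)⟫ ∂ν

/-- `χ_A ∈ BV(ℝ^d; {0,1})` with norm control: `A` is (Lebesgue) measurable, and both the volume
of `A` and its perimeter `|∇χ_A|(ℝ^d)` are at most `M`. -/
def BVNormBound (A : Set (Euc d)) (M : ℝ≥0) : Prop :=
  NullMeasurableSet A volume ∧ volume A ≤ M ∧
    ∃ (ν : Measure (Euc d)) (n : Euc d → Sph d), IsPolarGradient A ν n ∧ ν univ ≤ M

/-- `A` has finite perimeter in `ℝ^d`. -/
def HasFinitePerimeter (A : Set (Euc d)) : Prop :=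
  NullMeasurableSet A volume ∧
    ∃ (ν : Measure (Euc d)) (n : Euc d → Sph d), IsPolarGradient A ν n

/-- The compatibility condition `∫ X · σ d∇χ_A = ∫ X · p dμ(x,p)` for all test fields `X`. -/
def Compatible (σ : ℝ) (A : Set (Euc d)) (μ : Measure (Euc d × Sph d)) : Prop :=
  ∃ (ν : Measure (Euc d)) (n : Euc d → Sph d), IsPolarGradient A ν n ∧
    ∀ X : Euc d → Euc d, IsTest X →
      σ * ∫ x, ⟪X x, (n x : Euc d)⟫ ∂ν = ∫ q, ⟪X q.1, (q.2 : Euc d)⟫ ∂μ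

/-- `μ = σ |∇χ_A| ⊗ (δ_{n(x)})_x` with `n = ∇χ_A / |∇χ_A|`. -/
def IsUnitDensityVarifold (σ : ℝ) (A : Set (Euc d)) (μ : Measure (Euc d × Sph d)) : Prop :=
  ∃ (ν : Measure (Euc d)) (n : Euc d → Sph d), IsPolarGradient A ν n ∧
    μ = ENNReal.ofReal σ • ν.map (fun x => (x, n x))

/-! ### De Giorgi type varifold solutions -/

/-- `(μ, χ_A)` is a De Giorgi type varifold solution with initial data `(μ₀, χ_{A₀})`, surface
tension `σ`, normal speed `V` and generalized mean curvature vector `H`.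
The mass measure of `μ t` is `ω_t = (μ t).fst`. Only times `t > 0` matter. -/
structure IsDeGiorgiSolutionWith (σ : ℝ) (μ₀ : Measure (Euc d × Sph d)) (A₀ : Set (Euc d))
    (μ : ℝ → Measure (Euc d × Sph d)) (A : ℝ → Set (Euc d))
    (V : ℝ → Euc d → ℝ) (H : ℝ → Euc d → Euc d) : Prop where
  -- the family of oriented varifolds
  finite_initial : IsFiniteMeasure μ₀
  finite : ∀ t, 0 < t → IsFiniteMeasure (μ t)
  weak_measurable : ∀ η : ℝ → C₀(Euc d × Sph d, ℝ), IntegrableOn η (Ioi 0) →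
    AEMeasurable (fun t => ∫ q, η t q ∂(μ t)) (volume.restrict (Ioi 0))
  -- the family of phases
  bv_initial : ∃ M : ℝ≥0, BVNormBound A₀ M
  isOpen : ∀ t, 0 < t → IsOpen (A t)
  finite_perimeter : ∀ t, 0 < t → HasFinitePerimeter (A t)
  measurable_phase :
    NullMeasurableSet {q : ℝ × Euc d | 0 < q.1 ∧ q.2 ∈ A q.1} volume
  bv_bound : ∃ M : ℝ≥0, ∀ᵐ t ∂(volume.restrict (Ioi (0 : ℝ))), BVNormBound (A t) M
  -- `V` and `H` are square integrable with respect to `dω_t dt`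
  measurable_V : Measurable (Function.uncurry V)
  sq_integrable_V : ∫⁻ t in Ioi (0 : ℝ), ∫⁻ x, ‖V t x‖ₑ ^ 2 ∂(μ t).fst < ⊤
  measurable_H : Measurable (Function.uncurry H)
  sq_integrable_H : ∫⁻ t in Ioi (0 : ℝ), ∫⁻ x, ‖H t x‖ₑ ^ 2 ∂(μ t).fst < ⊤
  -- `V` is a normal speed
  evolution : ∀ᵐ T ∂(volume.restrict (Ioi (0 : ℝ))), ∀ ζ : ℝ × Euc d → ℝ, IsTest ζ →
    σ * (∫ x in A T, ζ (T, x)) - σ * (∫ x in A₀, ζ (0, x))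
      = σ * (∫ t in (0 : ℝ)..T, ∫ x in A t, deriv (fun s => ζ (s, x)) t)
        - ∫ t in (0 : ℝ)..T, ∫ x, V t x * ζ (t, x) ∂(μ t).fst
  -- `H` is a generalized mean curvature vector; note `(I - p ⊗ p) : ∇B = div B - p · (DB) p`
  curvature : ∀ B : ℝ × Euc d → Euc d, IsTest B →
    ∫ t in Ioi (0 : ℝ), ∫ x, ⟪H t x, B (t, x)⟫ ∂(μ t).fst
      = - ∫ t in Ioi (0 : ℝ), ∫ q : Euc d × Sph d,
          (divergence (fun x => B (t, x)) q.1
            - ⟪(q.2 : Euc d), fderiv ℝ (fun x => B (t, x)) q.1 (q.2 : Euc d)⟫) ∂(μ t)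
  -- the sharp energy dissipation inequality
  deGiorgi : ∀ᵐ T ∂(volume.restrict (Ioi (0 : ℝ))),
    (μ T).fst univ + 2⁻¹ * (∫⁻ t in Ioc 0 T, ∫⁻ x, ‖V t x‖ₑ ^ 2 ∂(μ t).fst)
      + 2⁻¹ * (∫⁻ t in Ioc 0 T, ∫⁻ x, ‖H t x‖ₑ ^ 2 ∂(μ t).fst) ≤ μ₀.fst univ
  -- compatibility of the varifolds with the phases
  compatible : ∀ᵐ t ∂(volume.restrict (Ioi (0 : ℝ))), Compatible σ (A t) (μ t)

/-- `(μ, χ_A)` is a De Giorgi type varifold solution for two-phase mean curvature flow with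
initial data `(μ₀, χ_{A₀})` and surface tension `σ`. -/
def IsDeGiorgiSolution (σ : ℝ) (μ₀ : Measure (Euc d × Sph d)) (A₀ : Set (Euc d))
    (μ : ℝ → Measure (Euc d × Sph d)) (A : ℝ → Set (Euc d)) : Prop :=
  ∃ (V : ℝ → Euc d → ℝ) (H : ℝ → Euc d → Euc d), IsDeGiorgiSolutionWith σ μ₀ A₀ μ A V H

/-! ### Smooth mean curvature flow of bounded domains -/

/-- The spatial gradient of a function of `(t, x)`. -/
def spatialGradient (φ : ℝ × Euc d → ℝ) (t : ℝ) (x : Euc d) : Euc d :=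
  gradient (fun y => φ (t, y)) x

/-- The unit normal `∇φ/|∇φ|` of the level sets of `φ(t, ·)`; it points into `{φ(t, ·) > 0}` along
`{φ(t, ·) = 0}`. -/
def levelSetNormal (φ : ℝ × Euc d → ℝ) (t : ℝ) (x : Euc d) : Euc d :=
  ‖spatialGradient φ t x‖⁻¹ • spatialGradient φ t x

/-- The speed of the level sets of `φ` in direction of `levelSetNormal φ`. -/
def levelSetSpeed (φ : ℝ × Euc d → ℝ) (t : ℝ) (x : Euc d) : ℝ :=
  - deriv (fun s => φ (s, x)) t / ‖spatialGradient φ t x‖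

/-- The scalar mean curvature (sum of the principal curvatures) of the level sets of `φ(t, ·)` with
respect to `levelSetNormal φ`, positive for spheres bounding balls `{φ(t, ·) > 0}`. -/
def levelSetMeanCurvature (φ : ℝ × Euc d → ℝ) (t : ℝ) (x : Euc d) : ℝ :=
  - divergence (fun y => levelSetNormal φ t y) x

/-- `(𝒜 t)_{t ∈ [0,T]}` is a smoothly evolving family of bounded domains in `ℝ^d` whose interfaces
`frontier (𝒜 t)` move by their mean curvature. Smoothness (in space-time, up to the times
`0` and `T`) is expressed through a smooth defining function with nonvanishing spatial gradient on
the interfaces. Domains need not be connected. -/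
def IsSmoothMCF (T : ℝ) (𝒜 : ℝ → Set (Euc d)) : Prop :=
  (∀ t ∈ Icc 0 T, (𝒜 t).Nonempty) ∧
  (∃ R : ℝ, ∀ t ∈ Icc 0 T, 𝒜 t ⊆ Metric.ball 0 R) ∧
  ∃ φ : ℝ × Euc d → ℝ, ContDiff ℝ ∞ φ ∧
    (∀ t ∈ Icc 0 T, 𝒜 t = {x | 0 < φ (t, x)}) ∧
    (∀ t ∈ Icc 0 T, ∀ x, φ (t, x) = 0 → spatialGradient φ t x ≠ 0) ∧
    ∀ t ∈ Icc 0 T, ∀ x ∈ frontier (𝒜 t), levelSetSpeed φ t x = levelSetMeanCurvature φ t x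

/-! ### Relative entropy and bulk error -/

open Classical in
/-- Signed distance to the boundary of `A`, positive inside `A`. -/
def signedDist (A : Set (Euc d)) (x : Euc d) : ℝ :=
  if x ∈ A then Metric.infDist x (frontier A) else - Metric.infDist x (frontier A)

/-- The gradient of the signed distance; along a smooth boundary this is the unit normal
pointing into `A`. -/
def innerNormal (A : Set (Euc d)) (x : Euc d) : Euc d := gradient (signedDist A) x

/-- `r ∈ (0,1)` is such that `((y,t),s) ↦ (y + s n(y,t), t)`, defined for `y ∈ frontier (𝒜 t)`,
`t ∈ [0,T]` and `|s| < 2r`, is a smooth diffeomorphism onto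
`{(x,t) | dist(x, frontier (𝒜 t)) < 2r}`: it is a bijection, and the
components `P` (nearest point projection) and `s` (signed distance) of its inverse are smooth. -/
structure IsTubularRadius (T : ℝ) (𝒜 : ℝ → Set (Euc d)) (r : ℝ) : Prop where
  pos : 0 < r
  lt_one : r < 1
  bijOn : ∀ t ∈ Icc 0 T,
    BijOn (fun q : Euc d × ℝ => q.1 + q.2 • innerNormal (𝒜 t) q.1)
      (frontier (𝒜 t) ×ˢ Ioo (-(2 * r)) (2 * r))
      {x | Metric.infDist x (frontier (𝒜 t)) < 2 * r}
  smooth_inverse : ∃ P : ℝ × Euc d → Euc d,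
    (∀ t ∈ Icc 0 T, ∀ x, Metric.infDist x (frontier (𝒜 t)) < 2 * r →
      P (t, x) ∈ frontier (𝒜 t) ∧
      x = P (t, x) + signedDist (𝒜 t) x • innerNormal (𝒜 t) (P (t, x))) ∧
    ContDiffOn ℝ ∞ P
      {q | q.1 ∈ Icc 0 T ∧ Metric.infDist q.2 (frontier (𝒜 q.1)) < 2 * r} ∧
    ContDiffOn ℝ ∞ (fun q : ℝ × Euc d => signedDist (𝒜 q.1) q.2)
      {q | q.1 ∈ Icc 0 T ∧ Metric.infDist q.2 (frontier (𝒜 q.1)) < 2 * r}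

/-- A smooth cutoff `κ : ℝ → [0,1]`, equal to `1` on `[-1/2,1/2]` and to `0` off `(-1,1)`. -/
structure IsCutoff (κ : ℝ → ℝ) : Prop where
  smooth : ContDiff ℝ ∞ κ
  mem_Icc : ∀ s, κ s ∈ Icc (0 : ℝ) 1
  eq_one : ∀ s ∈ Icc (-(1 / 2) : ℝ) (1 / 2), κ s = 1
  eq_zero : ∀ s, s ∉ Ioo (-1 : ℝ) 1 → κ s = 0

/-- A smooth truncation `θ : ℝ → [-1,1]` of `s ↦ -s`. -/
structure IsTruncation (θ : ℝ → ℝ) : Prop where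
  smooth : ContDiff ℝ ∞ θ
  mem_Icc : ∀ s, θ s ∈ Icc (-1 : ℝ) 1
  eq_one : ∀ s, s ≤ -1 → θ s = 1
  eq_neg_one : ∀ s, 1 ≤ s → θ s = -1
  deriv_neg : ∀ s ∈ Ioo (-1 : ℝ) 1, deriv θ s < 0
  zero : θ 0 = 0
  abs_le : ∀ s ∈ Icc (-1 : ℝ) 1, |s| ≤ |θ s|

/-- The data entering the construction of the relative entropy and of the bulk error. -/
structure IsCalibrationData (T : ℝ) (𝒜 : ℝ → Set (Euc d)) (r : ℝ) (κ θ : ℝ → ℝ) : Prop where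
  tubular : IsTubularRadius T 𝒜 r
  cutoff : IsCutoff κ
  truncation : IsTruncation θ

/-- The quadratic cutoff `s ↦ (1 - s²) κ(s²)`. -/
def quadraticCutoff (κ : ℝ → ℝ) (s : ℝ) : ℝ := (1 - s ^ 2) * κ (s ^ 2)

/-- The extension `ξ = ζ(s/r) ∇s` of the inner unit normal of `𝒜`, with `s` the signed distance and
`ζ` the quadratic cutoff. It vanishes at distance at least `r` from the boundary of `𝒜`. -/
def xi (𝒜 : Set (Euc d)) (r : ℝ) (κ : ℝ → ℝ) (x : Euc d) : Euc d :=
  quadraticCutoff κ (signedDist 𝒜 x / r) • innerNormal 𝒜 x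

/-- The weight `ϑ = θ(s/r)`, with `s` the signed distance. -/
def weight (𝒜 : Set (Euc d)) (r : ℝ) (θ : ℝ → ℝ) (x : Euc d) : ℝ :=
  θ (signedDist 𝒜 x / r)

/-- The relative entropy `∫ (1 - p · ξ(x)) dμ(x,p)` of an oriented varifold `μ` with respect to the
domain `𝒜`. -/
def relEntropy (𝒜 : Set (Euc d)) (r : ℝ) (κ : ℝ → ℝ) (μ : Measure (Euc d × Sph d)) : ℝ :=
  ∫ q, (1 - ⟪(q.2 : Euc d), xi 𝒜 r κ q.1⟫) ∂μ

/-- The bulk error `σ ∫ |χ_A - χ_𝒜| |ϑ| dx`. -/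
def bulkError (σ : ℝ) (𝒜 : Set (Euc d)) (r : ℝ) (θ : ℝ → ℝ) (A : Set (Euc d)) : ℝ :=
  σ * ∫ x, |A.indicator (fun _ => (1 : ℝ)) x - 𝒜.indicator (fun _ => (1 : ℝ)) x|
    * |weight 𝒜 r θ x|

end TwoPhaseMCF

end

open TwoPhaseMCF

/-! The proof is a relative entropy argument. Let s be the signed distance to the smooth interface
and ξ the cut-off extension of its normal, and extend the velocity by B = -(∂_t s) ξ. Up to errors
of order δ = min(|s|/r, 1), the field ξ is transported by B, and B = -(div ξ) ξ; the latter is the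
evolution law, which reads Δs = ∂_t s on the interface. The quadratic cutoff gives δ² ≤ 1 - |ξ| ≤ 1
- p·ξ, and |p - ξ|² ≤ 2(1 - p·ξ) for unit vectors p. Hence every error that is quadratic in δ and |p
- ξ| is controlled by the relative entropy. `Calibration` collects what is needed from the smooth
flow; both stability estimates are derived from it alone.

Entropy: compatibility rewrites -∫ p·ξ dμ as σ∫_A div ξ dx. The mass is then controlled by the
dissipation inequality, and the bulk integral by the evolution equation tested with div ξ. Two
vanishing quantities are added to the resulting rate: the first variation identity tested with B,
and the flux of (div B) ξ + (B·∇)ξ - (div ξ) B - (ξ·∇)B, a divergence free field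
(`divergence_commutator`). Now squares can be completed: -½(V + div ξ)² remains as dissipation, and
½|(div ξ) p + B|² together with the transport terms is bounded by a multiple of 1 - p·ξ
(`entropy_density_le`).

Bulk error: the smooth domain is {ϑ < 0}, so the error equals σ(∫_A ϑ - ∫_{ϑ<0} ϑ). The first
integral is evolved by the weak equation, the second by differentiating min(ϑ, 0) in time. Adding
div(ϑB), which integrates to zero over {ϑ < 0}, leaves a bulk integrand of order |ϑ| and the surface
term ϑ(B·p - V). In the latter, ½(V + div ξ)² is absorbed by the dissipation saved in the entropy
inequality (`bulk_density_le`); this is why the initial entropy occurs in the second estimate.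

Uniqueness: for matching initial data both errors start at zero, and Gronwall's inequality keeps
them there. A vanishing bulk error determines the phase, because {ϑ = 0} is a null set. A vanishing
entropy forces p = ξ almost everywhere. The divergence theorem on {ϑ < 0} shows that the measure
theoretic normal is also ξ (`CalibratedDomain.normal_eq`), and compatibility tested with f ξ
identifies the mass measure.

Existence of the radius: (t, y, s) ↦ (t, y + s N(t,y), φ(t,y)) is a map between spaces of equal
dimension, with φ the defining function and N its normalized gradient. Its restriction to φ = 0
gives the normal coordinates. It fixes the compact set of points (t, y, 0) with y on the interface
and is locally invertible there, uniformly. -/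

noncomputable section

namespace TwoPhaseMCF

open ProbabilityTheory

section

/-! ### Traces and divergences -/

/-- The trace as a continuous linear functional on endomorphisms of `ℝ^d`. -/
def traceL (d : ℕ) : (Euc d →L[ℝ] Euc d) →L[ℝ] ℝ :=
  ∑ i : Fin d, (EuclideanSpace.proj (𝕜 := ℝ) i).comp
    (ContinuousLinearMap.apply ℝ (Euc d) (EuclideanSpace.single i 1))

theorem traceL_apply {d : ℕ} (L : Euc d →L[ℝ] Euc d) :
    traceL d L = ∑ i : Fin d, (L (EuclideanSpace.single i 1)) i := by
  simp [traceL]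

theorem divergence_eq_traceL {d : ℕ} (X : Euc d → Euc d) (x : Euc d) :
    divergence X x = traceL d (fderiv ℝ X x) := by
  simp [traceL, divergence]

theorem traceL_eq_trace {d : ℕ} (L : Euc d →L[ℝ] Euc d) :
    traceL d L = LinearMap.trace ℝ (Euc d) (L : Euc d →ₗ[ℝ] Euc d) := by
  rw [traceL_apply, LinearMap.trace_eq_sum_inner _ (EuclideanSpace.basisFun (Fin d) ℝ)]
  simp [PiLp.inner_apply]

theorem traceL_comp_comm {d : ℕ} (L M : Euc d →L[ℝ] Euc d) :
    traceL d (L.comp M) = traceL d (M.comp L) := by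
  rw [traceL_eq_trace, traceL_eq_trace]
  exact LinearMap.trace_mul_comm ℝ (L : Euc d →ₗ[ℝ] Euc d) (M : Euc d →ₗ[ℝ] Euc d)

theorem sum_single {d : ℕ} (x : Euc d) :
    ∑ i : Fin d, x i • (EuclideanSpace.single i (1 : ℝ) : Euc d) = x := by
  have h := (EuclideanSpace.basisFun (Fin d) ℝ).sum_repr x
  simpa using h

theorem traceL_smulRight {d : ℕ} (l : Euc d →L[ℝ] ℝ) (v : Euc d) :
    traceL d (l.smulRight v) = l v := by
  conv_rhs => rw [← sum_single v]
  rw [traceL_apply, map_sum]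
  refine Finset.sum_congr rfl fun i _ => ?_
  simp [mul_comm]

theorem divergence_smul {d : ℕ} {f : Euc d → ℝ} {X : Euc d → Euc d} {x : Euc d}
    (hf : DifferentiableAt ℝ f x) (hX : DifferentiableAt ℝ X x) :
    divergence (fun y => f y • X y) x = f x * divergence X x + fderiv ℝ f x (X x) := by
  rw [divergence_eq_traceL, divergence_eq_traceL, fderiv_fun_smul hf hX, map_add, map_smul,
    traceL_smulRight, smul_eq_mul]

theorem divergence_add {d : ℕ} {X Y : Euc d → Euc d} {x : Euc d}
    (hX : DifferentiableAt ℝ X x) (hY : DifferentiableAt ℝ Y x) :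
    divergence (fun y => X y + Y y) x = divergence X x + divergence Y x := by
  simp only [divergence_eq_traceL, fderiv_fun_add hX hY, map_add]

theorem divergence_sub {d : ℕ} {X Y : Euc d → Euc d} {x : Euc d}
    (hX : DifferentiableAt ℝ X x) (hY : DifferentiableAt ℝ Y x) :
    divergence (fun y => X y - Y y) x = divergence X x - divergence Y x := by
  simp only [divergence_eq_traceL, fderiv_fun_sub hX hY, map_sub]

theorem contDiff_divergence {d : ℕ} {X : Euc d → Euc d} (hX : ContDiff ℝ ∞ X) :
    ContDiff ℝ ∞ (divergence X) := by
  have : divergence X = fun x => traceL d (fderiv ℝ X x) := funext (divergence_eq_traceL X)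
  rw [this]
  exact (traceL d).contDiff.comp (hX.fderiv_right (m := ∞) (by simp))

theorem hasCompactSupport_divergence {d : ℕ} {X : Euc d → Euc d} (hX : HasCompactSupport X) :
    HasCompactSupport (divergence X) := by
  have : divergence X = fun x => traceL d (fderiv ℝ X x) := funext (divergence_eq_traceL X)
  rw [this]
  exact (hX.fderiv ℝ).comp_left (g := fun L => traceL d L) (by simp)

/-- Each partial derivative integrates to zero by integration by parts against the constant function
1. -/
theorem integral_divergence_eq_zero {d : ℕ} {X : Euc d → Euc d} (hX : ContDiff ℝ 1 X)
    (hc : HasCompactSupport X) : ∫ x, divergence X x = 0 := by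
  have hc' : ∀ v : Euc d, HasCompactSupport fun x => fderiv ℝ X x v := fun v =>
    (hc.fderiv ℝ).comp_left (g := fun L : Euc d →L[ℝ] Euc d => L v) (by simp)
  have hcont : ∀ v : Euc d, Continuous fun x => fderiv ℝ X x v := fun v =>
    (hX.continuous_fderiv (by norm_num)).clm_apply continuous_const
  have hint : ∀ v : Euc d, Integrable fun x => fderiv ℝ X x v := fun v =>
    (hcont v).integrable_of_hasCompactSupport (hc' v)
  have h0 : ∀ v : Euc d, ∫ x, fderiv ℝ X x v = 0 := fun v => by
    have := integral_smul_fderiv_eq_neg_fderiv_smul_of_integrable (μ := volume) (v := v)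
      (f := fun _ : Euc d => (1 : ℝ)) (g := X) (by simp) (by simpa using hint v)
      (by simpa using hX.continuous.integrable_of_hasCompactSupport hc)
      (fun x _ => differentiableAt_const _) (fun x _ => (hX.differentiable (by norm_num)) x)
    simpa using this
  unfold divergence
  rw [integral_finsetSum]
  · refine Finset.sum_eq_zero fun i _ => ?_
    have := (EuclideanSpace.proj i : Euc d →L[ℝ] ℝ).integral_comp_comm
      (hint (EuclideanSpace.single i 1))
    rw [h0, map_zero] at this
    exact this
  · intro i _
    exact (EuclideanSpace.proj i : Euc d →L[ℝ] ℝ).integrable_comp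
      (hint (EuclideanSpace.single i 1))

/-- The divergence of `x ↦ DX(x) Y(x)`. -/
theorem divergence_fderiv_apply {d : ℕ} {X Y : Euc d → Euc d} (hX : ContDiff ℝ ∞ X)
    (hY : ContDiff ℝ ∞ Y) (x : Euc d) :
    divergence (fun y => fderiv ℝ X y (Y y)) x
      = fderiv ℝ (divergence X) x (Y x) + traceL d ((fderiv ℝ X x).comp (fderiv ℝ Y x)) := by
  have hX' : ContDiff ℝ ∞ (fderiv ℝ X) := hX.fderiv_right (m := ∞) (by simp)
  have hdX : DifferentiableAt ℝ (fderiv ℝ X) x := (hX'.differentiable (by simp)) x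
  have hdY : DifferentiableAt ℝ Y x := (hY.differentiable (by simp)) x
  rw [divergence_eq_traceL, fderiv_clm_apply hdX hdY, map_add, add_comm]
  congr 1
  have h1 : fderiv ℝ (divergence X) x = (traceL d).comp (fderiv ℝ (fderiv ℝ X) x) := by
    have : divergence X = fun x => traceL d (fderiv ℝ X x) := funext (divergence_eq_traceL X)
    rw [this]
    exact ((traceL d).hasFDerivAt.comp x hdX.hasFDerivAt).fderiv
  rw [h1, ContinuousLinearMap.comp_apply]
  congr 1
  ext1 v
  -- Symmetry of the second derivative exchanges v and Y(x), so that the trace of v ↦ D²X(v, Y)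
  -- becomes the derivative of div X in direction Y.
  have hsym : IsSymmSndFDerivAt ℝ X x :=
    (hX.contDiffAt (n := ∞)).isSymmSndFDerivAt (by simp [minSmoothness_of_isRCLikeNormedField]; exact WithTop.coe_le_coe.2 le_top)
  simpa using congrArg id (hsym v (Y x))

/-- The divergence of the divergence of the antisymmetric tensor `X ⊗ Y - Y ⊗ X` vanishes. -/
theorem divergence_commutator {d : ℕ} {X Y : Euc d → Euc d} (hX : ContDiff ℝ ∞ X)
    (hY : ContDiff ℝ ∞ Y) (x : Euc d) :
    divergence (fun y => (divergence Y y • X y + fderiv ℝ X y (Y y))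
      - (divergence X y • Y y + fderiv ℝ Y y (X y))) x = 0 := by
  have dX := hX.differentiable (by simp)
  have dY := hY.differentiable (by simp)
  have ddX := (contDiff_divergence hX).differentiable (by simp)
  have ddY := (contDiff_divergence hY).differentiable (by simp)
  have dX' : Differentiable ℝ (fderiv ℝ X) :=
    (hX.fderiv_right (m := ∞) (by simp)).differentiable (by simp)
  have dY' : Differentiable ℝ (fderiv ℝ Y) :=
    (hY.fderiv_right (m := ∞) (by simp)).differentiable (by simp)
  have e1 : DifferentiableAt ℝ (fun y => fderiv ℝ X y (Y y)) x := (dX' x).clm_apply (dY x)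
  have e2 : DifferentiableAt ℝ (fun y => fderiv ℝ Y y (X y)) x := (dY' x).clm_apply (dX x)
  -- The divergence of the first bracket is div X div Y + D(div Y)X + D(div X)Y + tr(DX DY), which
  -- is symmetric in X and Y because the trace is cyclic.
  rw [divergence_sub (((ddY x).fun_smul (dX x)).fun_add e1) (((ddX x).fun_smul (dY x)).fun_add e2),
    divergence_add ((ddY x).fun_smul (dX x)) e1, divergence_add ((ddX x).fun_smul (dY x)) e2,
    divergence_smul (ddY x) (dX x), divergence_smul (ddX x) (dY x),
    divergence_fderiv_apply hX hY, divergence_fderiv_apply hY hX, traceL_comp_comm]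
  ring

/-! ### The divergence theorem on sublevel sets -/

/-- A smooth approximation of the indicator function of the negative reals. -/
def negStep (n : ℕ) (y : ℝ) : ℝ := Real.smoothTransition (-((n : ℝ) * y))

theorem contDiff_negStep (n : ℕ) : ContDiff ℝ ∞ (negStep n) :=
  Real.smoothTransition.contDiff.comp ((contDiff_const.mul contDiff_id).neg)

theorem negStep_mem (n : ℕ) (y : ℝ) : 0 ≤ negStep n y ∧ negStep n y ≤ 1 :=
  ⟨Real.smoothTransition.nonneg _, Real.smoothTransition.le_one _⟩

theorem negStep_of_nonneg (n : ℕ) {y : ℝ} (hy : 0 ≤ y) : negStep n y = 0 :=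
  Real.smoothTransition.zero_of_nonpos (by have := mul_nonneg (Nat.cast_nonneg (α := ℝ) n) hy; linarith)

theorem eventually_negStep {y : ℝ} (hy : y < 0) : ∀ᶠ n : ℕ in atTop, negStep n y = 1 := by
  have h : Tendsto (fun n : ℕ => (n : ℝ) * (-y)) atTop atTop :=
    tendsto_natCast_atTop_atTop.atTop_mul_const (by linarith)
  filter_upwards [h.eventually_ge_atTop 1] with n hn
  exact Real.smoothTransition.one_of_one_le (by linarith)

theorem tendsto_negStep (y : ℝ) :
    Tendsto (fun n => negStep n y) atTop (𝓝 ((Iio (0 : ℝ)).indicator (fun _ => 1) y)) := by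
  by_cases hy : y < 0
  · rw [indicator_of_mem (by exact hy)]
    exact tendsto_const_nhds.congr' ((eventually_negStep hy).mono fun n hn => hn.symm)
  · rw [indicator_of_notMem (by exact hy)]
    simp [negStep_of_nonneg _ (not_lt.1 hy)]

theorem deriv_negStep (n : ℕ) (y : ℝ) :
    deriv (negStep n) y = - (n * deriv Real.smoothTransition (-((n : ℝ) * y))) := by
  have h1 : HasDerivAt (fun y : ℝ => -((n : ℝ) * y)) (-(n : ℝ)) y := by
    simpa using ((hasDerivAt_id y).const_mul (n : ℝ)).fun_neg
  have h2 : HasDerivAt Real.smoothTransition (deriv Real.smoothTransition (-((n : ℝ) * y)))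
      (-((n : ℝ) * y)) :=
    ((Real.smoothTransition.contDiff (n := 1)).differentiable (by norm_num) _).hasDerivAt
  have := h2.comp y h1
  rw [show negStep n = Real.smoothTransition ∘ fun y : ℝ => -((n : ℝ) * y) from rfl, this.deriv]
  ring

theorem monotone_smoothTransition : Monotone Real.smoothTransition := by
  exact Real.smoothTransition.monotone

theorem deriv_negStep_nonpos (n : ℕ) (y : ℝ) : deriv (negStep n) y ≤ 0 := by
  rw [deriv_negStep]
  have := monotone_smoothTransition.deriv_nonneg (x := -((n : ℝ) * y))
  have h2 := Nat.cast_nonneg (α := ℝ) n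
  nlinarith [mul_nonneg h2 this]

/-- All these points are global extrema of the transition, the endpoints 0 and 1 included. -/
theorem deriv_smoothTransition_eq_zero {y : ℝ} (hy : y ≤ 0 ∨ 1 ≤ y) :
    deriv Real.smoothTransition y = 0 := by
  apply IsLocalExtr.deriv_eq_zero
  rcases hy with hy | hy
  · left
    exact Eventually.of_forall fun z => by
      rw [Real.smoothTransition.zero_of_nonpos hy]; exact Real.smoothTransition.nonneg _
  · right
    exact Eventually.of_forall fun z => by
      rw [Real.smoothTransition.one_of_one_le hy]; exact Real.smoothTransition.le_one _

/-- The product is scale invariant: with z = -n y it equals S'(z) z for the fixed transition S, and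
S' vanishes off [0,1]. The bound is therefore independent of n, although the derivative itself grows
like n. -/
theorem exists_bound_mul_deriv_negStep :
    ∃ M : ℝ, 0 ≤ M ∧ ∀ n y, |deriv (negStep n) y * y| ≤ M := by
  have hc : Continuous (deriv Real.smoothTransition) :=
    (Real.smoothTransition.contDiff (n := 1)).continuous_deriv (by norm_num)
  obtain ⟨M, hM⟩ := (isCompact_Icc (a := (0 : ℝ)) (b := 1)).exists_bound_of_continuousOn
    (f := fun z => deriv Real.smoothTransition z * z) (by fun_prop)
  refine ⟨max M 0, le_max_right _ _, fun n y => ?_⟩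
  have : deriv (negStep n) y * y
      = deriv Real.smoothTransition (-((n : ℝ) * y)) * (-((n : ℝ) * y)) := by
    rw [deriv_negStep]; ring
  rw [this]
  by_cases h : -((n : ℝ) * y) ∈ Icc (0 : ℝ) 1
  · exact (hM _ h).trans (le_max_left _ _)
  · rw [deriv_smoothTransition_eq_zero]
    · simp
    · by_contra! h'
      exact h ⟨h'.1.le, h'.2.le⟩

theorem eventually_deriv_negStep (y : ℝ) : ∀ᶠ n : ℕ in atTop, deriv (negStep n) y * y = 0 := by
  by_cases hy : y < 0
  · have h : Tendsto (fun n : ℕ => (n : ℝ) * (-y)) atTop atTop :=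
      tendsto_natCast_atTop_atTop.atTop_mul_const (by linarith)
    filter_upwards [h.eventually_ge_atTop 1] with n hn
    rw [deriv_negStep, deriv_smoothTransition_eq_zero (Or.inr (by linarith))]; simp
  · refine Eventually.of_forall fun n => ?_
    rw [deriv_negStep, deriv_smoothTransition_eq_zero (Or.inl ?_)]
    · simp
    · have := mul_nonneg (Nat.cast_nonneg (α := ℝ) n) (not_lt.1 hy); linarith

theorem divergence_negStep_smul {d : ℕ} {w : Euc d → ℝ} {X : Euc d → Euc d}
    (hw : ContDiff ℝ ∞ w) (hX : ContDiff ℝ ∞ X) (n : ℕ) (x : Euc d) :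
    divergence (fun x => negStep n (w x) • X x) x
      = negStep n (w x) * divergence X x + deriv (negStep n) (w x) * fderiv ℝ w x (X x) := by
  have hd : HasDerivAt (negStep n) (deriv (negStep n) (w x)) (w x) :=
    ((contDiff_negStep n).differentiable (by simp) _).hasDerivAt
  have hwd : DifferentiableAt ℝ w x := hw.differentiable (by simp) x
  have hc := hd.comp_hasFDerivAt x hwd.hasFDerivAt
  have hc' : HasFDerivAt (fun x => negStep n (w x)) (deriv (negStep n) (w x) • fderiv ℝ w x) x := hc
  rw [divergence_smul hc'.differentiableAt (hX.differentiable (by simp) x), hc'.fderiv]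
  rfl

theorem integral_negStep_mul_divergence {d : ℕ} {w : Euc d → ℝ} {X : Euc d → Euc d}
    (hw : ContDiff ℝ ∞ w) (hX : ContDiff ℝ ∞ X) (hc : HasCompactSupport X) (n : ℕ) :
    ∫ x, negStep n (w x) * divergence X x
      = - ∫ x, deriv (negStep n) (w x) * fderiv ℝ w x (X x) := by
  have hs : ContDiff ℝ ∞ fun x => negStep n (w x) := (contDiff_negStep n).comp hw
  have hsX : ContDiff ℝ 1 fun x => negStep n (w x) • X x :=
    (hs.smul hX).of_le (by simp)
  have hsc : HasCompactSupport fun x => negStep n (w x) • X x :=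
    hc.mono' fun x hx => subset_tsupport _ fun hX0 => hx (by
      change negStep n (w x) • X x = 0
      rw [hX0, smul_zero])
  have h0 := integral_divergence_eq_zero hsX hsc
  simp_rw [divergence_negStep_smul hw hX n] at h0
  have i1 : Integrable fun x => negStep n (w x) * divergence X x :=
    (hs.continuous.mul (contDiff_divergence hX).continuous).integrable_of_hasCompactSupport
      (hasCompactSupport_divergence hc).mul_left
  have hc2 : HasCompactSupport fun x => fderiv ℝ w x (X x) :=
    hc.mono' fun x hx => subset_tsupport _ fun hX0 => hx (by
      change fderiv ℝ w x (X x) = 0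
      rw [hX0, map_zero])
  have hd : Continuous (deriv (negStep n)) := (contDiff_negStep n).continuous_deriv (by simp)
  have i2 : Integrable fun x => deriv (negStep n) (w x) * fderiv ℝ w x (X x) :=
    ((hd.comp hw.continuous).mul
      ((hw.continuous_fderiv (by simp)).clm_apply hX.continuous)).integrable_of_hasCompactSupport
      hc2.mul_left
  rw [integral_add i1 i2] at h0
  exact eq_neg_of_add_eq_zero_left h0

theorem tendsto_integral_negStep_mul {d : ℕ} {w f : Euc d → ℝ}
    (hw : Continuous w) (hf : Continuous f) (hc : HasCompactSupport f) :
    Tendsto (fun n => ∫ x, negStep n (w x) * f x) atTop (𝓝 (∫ x in {x | w x < 0}, f x)) := by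
  rw [← integral_indicator (show MeasurableSet {x | w x < 0} from hw.measurable measurableSet_Iio)]
  refine tendsto_integral_of_dominated_convergence (fun x => ‖f x‖)
    (fun n => ((contDiff_negStep n).continuous.comp hw |>.mul hf).aestronglyMeasurable)
    (hf.integrable_of_hasCompactSupport hc).norm (fun n => ae_of_all _ fun x => ?_)
    (ae_of_all _ fun x => ?_)
  · rw [norm_mul, Real.norm_of_nonneg (negStep_mem n _).1]
    exact mul_le_of_le_one_left (norm_nonneg _) (negStep_mem n _).2
  · have := (tendsto_negStep (w x)).mul_const (f x)
    convert this using 2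
    by_cases h : w x < 0 <;> simp [indicator, h]

/-- Divergence theorem on a sublevel set, for fields tangential to its boundary. -/
theorem setIntegral_divergence_eq_zero {d : ℕ} {w : Euc d → ℝ} {X : Euc d → Euc d} {M : ℝ}
    (hw : ContDiff ℝ ∞ w) (hX : ContDiff ℝ ∞ X) (hc : HasCompactSupport X)
    (hM : ∀ x, |fderiv ℝ w x (X x)| ≤ M * |w x|) :
    ∫ x in {x | w x < 0}, divergence X x = 0 := by
  have h1 := tendsto_integral_negStep_mul hw.continuous (contDiff_divergence hX).continuous
    (hasCompactSupport_divergence hc)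
  simp_rw [integral_negStep_mul_divergence hw hX hc] at h1
  refine tendsto_nhds_unique h1 ?_
  obtain ⟨M', hM'0, hM'⟩ := exists_bound_mul_deriv_negStep
  have hcw : Continuous fun x => fderiv ℝ w x (X x) :=
    (hw.continuous_fderiv (by simp)).clm_apply hX.continuous
  -- Tangency trades ∇w·X for a multiple of w, which compensates the growth of the derivative of the
  -- step function.
  have key : ∀ n x, |deriv (negStep n) (w x) * fderiv ℝ w x (X x)|
      ≤ M * |deriv (negStep n) (w x) * w x| := fun n x => by
    rw [abs_mul, abs_mul]
    nlinarith [hM x, abs_nonneg (deriv (negStep n) (w x))]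
  have : Tendsto (fun n => ∫ x, deriv (negStep n) (w x) * fderiv ℝ w x (X x)) atTop
      (𝓝 (∫ x : Euc d, (0 : ℝ))) := by
    refine tendsto_integral_of_dominated_convergence
      ((tsupport X).indicator fun _ => |M| * M')
      (fun n => (((((contDiff_negStep n).continuous_deriv (by simp)).comp hw.continuous).mul
        hcw)).aestronglyMeasurable) ?_ (fun n => ae_of_all _ fun x => ?_)
      (ae_of_all _ fun x => ?_)
    · rw [integrable_indicator_iff (isClosed_tsupport X).measurableSet]
      exact integrableOn_const (hc.isCompact.measure_lt_top.ne)
    · by_cases hx : x ∈ tsupport X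
      · rw [indicator_of_mem hx, Real.norm_eq_abs]
        refine (key n x).trans ?_
        calc M * |deriv (negStep n) (w x) * w x| ≤ |M| * |deriv (negStep n) (w x) * w x| :=
              mul_le_mul_of_nonneg_right (le_abs_self _) (abs_nonneg _)
          _ ≤ |M| * M' := mul_le_mul_of_nonneg_left (hM' n _) (abs_nonneg _)
      · rw [image_eq_zero_of_notMem_tsupport hx]
        simp [hx]
    · refine tendsto_const_nhds.congr' ?_
      filter_upwards [eventually_deriv_negStep (w x)] with n hn
      have := key n x
      rw [hn] at this
      exact (abs_nonpos_iff.1 (this.trans (by simp))).symm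
  simpa using this.neg

/-- Divergence theorem on a sublevel set, for fields pointing inward along its boundary. -/
theorem setIntegral_divergence_nonpos {d : ℕ} {w : Euc d → ℝ} {X : Euc d → Euc d}
    (hw : ContDiff ℝ ∞ w) (hX : ContDiff ℝ ∞ X) (hc : HasCompactSupport X)
    (hM : ∀ x, fderiv ℝ w x (X x) ≤ 0) :
    ∫ x in {x | w x < 0}, divergence X x ≤ 0 := by
  have h1 := tendsto_integral_negStep_mul hw.continuous (contDiff_divergence hX).continuous
    (hasCompactSupport_divergence hc)
  simp_rw [integral_negStep_mul_divergence hw hX hc] at h1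
  refine le_of_tendsto h1 (Eventually.of_forall fun n => ?_)
  rw [neg_nonpos]
  exact integral_nonneg fun x =>
    mul_nonneg_of_nonpos_of_nonpos (deriv_negStep_nonpos n _) (hM x)

end

section

/-! ### The negative part along a differentiable function of time -/

/-- The negative part is not differentiable at zeros of f, so it is approximated by f · `negStep n`
f. The derivatives converge boundedly to f' on {f < 0} and to 0 elsewhere, because y · (`negStep
n`)'(y) is uniformly bounded and eventually zero for each y. -/
theorem min_sub_min_eq_integral {f f' : ℝ → ℝ} {T M : ℝ} (hT : 0 ≤ T)
    (hf : ContinuousOn f (Icc 0 T)) (hd : ∀ t ∈ Ioo 0 T, HasDerivAt f (f' t) t)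
    (hc : ContinuousOn f' (Ioo 0 T)) (hM : ∀ t ∈ Ioo 0 T, |f' t| ≤ M) :
    min (f T) 0 - min (f 0) 0
      = ∫ t in (0 : ℝ)..T, (Iio (0 : ℝ)).indicator (fun _ => f' t) (f t) := by
  obtain ⟨M', hM'0, hM'⟩ := exists_bound_mul_deriv_negStep
  have hlim : ∀ y : ℝ, Tendsto (fun n => y * negStep n y) atTop (𝓝 (min y 0)) := by
    intro y
    have := (tendsto_negStep y).const_mul y
    convert this using 2
    by_cases h : y < 0
    · simp [h, h.le]
    · simp [h, not_lt.1 h]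
  have hderiv : ∀ (n : ℕ), ∀ t ∈ Ioo 0 T, HasDerivAt (fun t => f t * negStep n (f t))
      ((negStep n (f t) + deriv (negStep n) (f t) * f t) * f' t) t := by
    intro n t ht
    have h1 : HasDerivAt (negStep n) (deriv (negStep n) (f t)) (f t) :=
      ((contDiff_negStep n).differentiable (by simp) _).hasDerivAt
    have h2 := (hd t ht).mul (h1.comp t (hd t ht))
    refine HasDerivAt.congr_deriv h2 ?_
    simp only [Function.comp]
    ring
  have hcn : ∀ n, Continuous fun y => negStep n y + deriv (negStep n) y * y := fun n =>
    (contDiff_negStep n).continuous.add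
      (((contDiff_negStep n).continuous_deriv (by simp)).mul continuous_id)
  have hIoo : ∀ g : ℝ → ℝ, ∫ t in (0 : ℝ)..T, g t = ∫ t in Ioo 0 T, g t := fun g => by
    rw [intervalIntegral.integral_of_le hT, integral_Ioc_eq_integral_Ioo]
  have hfc : ContinuousOn f (Ioo 0 T) := hf.mono Ioo_subset_Icc_self
  have hmeas : ∀ n, AEStronglyMeasurable
      (fun t => (negStep n (f t) + deriv (negStep n) (f t) * f t) * f' t)
      (volume.restrict (Ioo 0 T)) := fun n =>
    (((hcn n).comp_continuousOn hfc).mul hc).aestronglyMeasurable measurableSet_Ioo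
  have hbd : ∀ n, ∀ t ∈ Ioo 0 T,
      ‖(negStep n (f t) + deriv (negStep n) (f t) * f t) * f' t‖ ≤ (1 + M') * M := by
    intro n t ht
    rw [norm_mul]
    refine mul_le_mul ?_ (hM t ht) (norm_nonneg _) (by linarith)
    refine (norm_add_le _ _).trans (add_le_add ?_ (hM' n _))
    rw [Real.norm_of_nonneg (negStep_mem n _).1]
    exact (negStep_mem n _).2
  have hftc : ∀ n, ∫ t in (0 : ℝ)..T, (negStep n (f t) + deriv (negStep n) (f t) * f t) * f' t
      = f T * negStep n (f T) - f 0 * negStep n (f 0) := by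
    intro n
    refine intervalIntegral.integral_eq_sub_of_hasDerivAt_of_le hT
      (f := fun t => f t * negStep n (f t))
      (hf.mul ((contDiff_negStep n).continuous.comp_continuousOn hf)) (hderiv n) ?_
    rw [intervalIntegrable_iff_integrableOn_Ioo_of_le hT]
    exact (integrable_const ((1 + M') * M)).mono' (hmeas n)
      ((ae_restrict_iff' measurableSet_Ioo).2 (ae_of_all _ (hbd n)))
  have l1 : Tendsto (fun n => f T * negStep n (f T) - f 0 * negStep n (f 0)) atTop
      (𝓝 (min (f T) 0 - min (f 0) 0)) := (hlim _).sub (hlim _)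
  simp_rw [← hftc, hIoo] at l1
  rw [hIoo]
  refine tendsto_nhds_unique l1 ?_
  refine tendsto_integral_of_dominated_convergence (fun _ => (1 + M') * M) hmeas
    (integrable_const _)
    (fun n => (ae_restrict_iff' measurableSet_Ioo).2 (ae_of_all _ (hbd n)))
    (ae_of_all _ fun t => ?_)
  have h1 := (tendsto_negStep (f t)).add (tendsto_const_nhds.congr'
    ((eventually_deriv_negStep (f t)).mono fun n hn => hn.symm))
  have h2 := h1.mul_const (f' t)
  convert h2 using 2
  by_cases h : f t < 0 <;> simp [h]

/-! ### Noncritical level sets are null sets -/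

/-- Let K be compactly supported with K(y) = y near 0, and f a cutoff. The field n⁻¹ K(n w) f ∇w has
total divergence zero. As n → ∞ only K'(n w) f |∇w|² survives, and it converges to f |∇w|² on {w =
0} and to 0 elsewhere; so f |∇w|² has integral zero over {w = 0}. -/
theorem volume_noncritical_zeros {d : ℕ} {w : Euc d → ℝ} (hw : ContDiff ℝ ∞ w) :
    volume {x | w x = 0 ∧ gradient w x ≠ 0} = 0 := by
  let b : ContDiffBump (0 : ℝ) := ⟨1, 2, by norm_num, by norm_num⟩
  have hb : ContDiff ℝ ∞ (b : ℝ → ℝ) := b.contDiff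
  set K : ℝ → ℝ := fun y => y * b y with hK
  have hKs : ContDiff ℝ ∞ K := contDiff_id.mul hb
  have hKc : HasCompactSupport K := b.hasCompactSupport.mul_left
  have hK0 : deriv K 0 = 1 := by
    have h1 : K =ᶠ[𝓝 0] id := by
      filter_upwards [b.eventuallyEq_one] with y hy
      simp [hK, hy]
    rw [h1.deriv_eq]; simp
  have hK2 : ∀ y : ℝ, 3 ≤ |y| → deriv K y = 0 := by
    intro y hy
    have : y ∉ tsupport K := fun h => by
      have h2 := (tsupport_mul_subset_right (f := fun y : ℝ => y) (g := b)) h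
      rw [b.tsupport_eq] at h2
      have : |y| ≤ 2 := by simpa using h2
      linarith
    exact image_eq_zero_of_notMem_tsupport (fun h => this (support_deriv_subset.trans' (by
      exact fun z hz => hz) |> fun h' => closure_minimal h' (isClosed_tsupport K) h))
  obtain ⟨M, hM⟩ := (hKs.continuous_deriv (by simp)).bounded_above_of_compact_support hKc.deriv
  obtain ⟨M0, hM0⟩ := hKs.continuous.bounded_above_of_compact_support hKc
  have hgw : ContDiff ℝ ∞ (gradient w) := by
    exact (InnerProductSpace.toDual ℝ (Euc d)).symm.contDiff.comp
      (hw.fderiv_right (m := ∞) (by simp))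
  have hgrad : ∀ x v, fderiv ℝ w x v = ⟪gradient w x, v⟫ := fun x v => by
    simp [gradient]
  have main : ∀ R : ℕ, volume ({x | w x = 0 ∧ gradient w x ≠ 0} ∩ Metric.ball 0 (R + 1 : ℝ)) = 0 := by
    intro R
    let f : ContDiffBump (0 : Euc d) := ⟨R + 1, R + 2, by positivity, by linarith⟩
    have hf : ContDiff ℝ ∞ (f : Euc d → ℝ) := f.contDiff
    set Y : Euc d → Euc d := fun x => f x • gradient w x
    have hY : ContDiff ℝ ∞ Y := hf.smul hgw
    have hYc : HasCompactSupport Y := f.hasCompactSupport.smul_right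
    have hkn : ∀ n : ℕ, ContDiff ℝ ∞ fun x => ((n : ℝ) + 1)⁻¹ * K ((n + 1) * w x) := fun n =>
      contDiff_const.mul (hKs.comp (contDiff_const.mul hw))
    have hdiv : ∀ (n : ℕ) x, divergence (fun x => (((n : ℝ) + 1)⁻¹ * K ((n + 1) * w x)) • Y x) x
        = ((n : ℝ) + 1)⁻¹ * K ((n + 1) * w x) * divergence Y x
          + deriv K ((n + 1) * w x) * (f x * ‖gradient w x‖ ^ 2) := by
      intro n x
      have h1 : HasDerivAt K (deriv K ((n + 1) * w x)) ((n + 1) * w x) :=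
        (hKs.differentiable (by simp) _).hasDerivAt
      have h2 : HasFDerivAt (fun x => ((n : ℝ) + 1) * w x) (((n : ℝ) + 1) • fderiv ℝ w x) x :=
        (hw.differentiable (by simp) x).hasFDerivAt.const_mul _
      have h3 := ((h1.comp_hasFDerivAt x h2).const_mul ((n : ℝ) + 1)⁻¹)
      have h4 : HasFDerivAt (fun x => ((n : ℝ) + 1)⁻¹ * K ((n + 1) * w x)) _ x := h3
      rw [divergence_smul ((hkn n).differentiable (by simp) x) (hY.differentiable (by simp) x),
        h4.fderiv]
      congr 1
      have hn : (n : ℝ) + 1 ≠ 0 := by positivity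
      simp only [Y, smul_apply, smul_eq_mul, hgrad, inner_smul_right,
        real_inner_self_eq_norm_sq]
      field_simp
    have hint : ∀ n : ℕ, ∫ x, (((n : ℝ) + 1)⁻¹ * K ((n + 1) * w x) * divergence Y x
          + deriv K ((n + 1) * w x) * (f x * ‖gradient w x‖ ^ 2)) = 0 := by
      intro n
      rw [← integral_divergence_eq_zero (X := fun x => (((n : ℝ) + 1)⁻¹ * K ((n + 1) * w x)) • Y x)
        (((hkn n).smul hY).of_le (by simp)) (hYc.mono' fun x hx => subset_tsupport _ fun hX0 => hx (by
      change (((n : ℝ) + 1)⁻¹ * K ((n + 1) * w x)) • Y x = 0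
      rw [hX0, smul_zero]))]
      exact integral_congr_ae (ae_of_all _ fun x => (hdiv n x).symm)
    have hcG : Continuous fun x => f x * ‖gradient w x‖ ^ 2 :=
      hf.continuous.mul (hgw.continuous.norm.pow 2)
    have hcGc : HasCompactSupport fun x => f x * ‖gradient w x‖ ^ 2 := f.hasCompactSupport.mul_right
    have hiG := hcG.integrable_of_hasCompactSupport (μ := volume) hcGc
    have hiY := (contDiff_divergence hY).continuous.integrable_of_hasCompactSupport (μ := volume)
      (hasCompactSupport_divergence hYc)
    have hlim : Tendsto (fun n : ℕ => ∫ x, (((n : ℝ) + 1)⁻¹ * K ((n + 1) * w x) * divergence Y x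
          + deriv K ((n + 1) * w x) * (f x * ‖gradient w x‖ ^ 2))) atTop
        (𝓝 (∫ x, {x | w x = 0}.indicator (fun x => f x * ‖gradient w x‖ ^ 2) x)) := by
      refine tendsto_integral_of_dominated_convergence
        (fun x => M0 * ‖divergence Y x‖ + M * ‖f x * ‖gradient w x‖ ^ 2‖)
        (fun n => Continuous.aestronglyMeasurable ?_)
        ((hiY.norm.const_mul _).add (hiG.norm.const_mul _)) (fun n => ae_of_all _ fun x => ?_)
        (ae_of_all _ fun x => ?_)
      · refine ((hkn n).continuous.mul (contDiff_divergence hY).continuous).add (Continuous.mul ?_ hcG)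
        exact (hKs.continuous_deriv (by simp)).comp (continuous_const.mul hw.continuous)
      · refine (norm_add_le _ _).trans (add_le_add ?_ ?_)
        · rw [norm_mul, norm_mul]
          refine mul_le_mul_of_nonneg_right ?_ (norm_nonneg _)
          refine (mul_le_of_le_one_left (norm_nonneg _) ?_).trans (hM0 _)
          rw [norm_inv, Real.norm_of_nonneg (by positivity)]
          exact inv_le_one_of_one_le₀ (by linarith [Nat.cast_nonneg (α := ℝ) n])
        · rw [norm_mul]
          exact mul_le_mul_of_nonneg_right (hM _) (norm_nonneg _)
      · have t1 : Tendsto (fun n : ℕ => ((n : ℝ) + 1)⁻¹ * K ((n + 1) * w x) * divergence Y x) atTop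
            (𝓝 0) := by
          have t0 : Tendsto (fun n : ℕ => ((n : ℝ) + 1)⁻¹) atTop (𝓝 0) := by
            simpa using tendsto_one_div_add_atTop_nhds_zero_nat (𝕜 := ℝ)
          have : Tendsto (fun n : ℕ => K ((n + 1) * w x) * ((n : ℝ) + 1)⁻¹) atTop (𝓝 0) :=
            squeeze_zero_norm (a := fun n : ℕ => M0 * ((n : ℝ) + 1)⁻¹) (fun n => by
              rw [norm_mul, norm_inv, Real.norm_of_nonneg (by positivity : (0 : ℝ) ≤ n + 1)]
              exact mul_le_mul_of_nonneg_right (hM0 _) (by positivity))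
              (by simpa using t0.const_mul M0)
          have := this.mul_const (divergence Y x)
          simp only [zero_mul] at this
          exact this.congr fun n => by ring
        by_cases hx : w x = 0
        · simp only [hx, mul_zero, hK0, one_mul] at t1 ⊢
          rw [indicator_of_mem (by exact hx)]
          simpa using t1.add_const (f x * ‖gradient w x‖ ^ 2)
        · rw [indicator_of_notMem (by exact hx)]
          refine t1.congr' ?_
          have h : Tendsto (fun n : ℕ => (n : ℝ) * |w x|) atTop atTop :=
            tendsto_natCast_atTop_atTop.atTop_mul_const (abs_pos.2 hx)
          filter_upwards [h.eventually_ge_atTop 3] with n hn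
          rw [hK2 _ (by rw [abs_mul, abs_of_nonneg (by positivity : (0 : ℝ) ≤ n + 1)]
                        nlinarith [abs_nonneg (w x)])]
          simp
    simp_rw [hint] at hlim
    have hz := tendsto_nhds_unique hlim tendsto_const_nhds
    have hmeas : MeasurableSet {x | w x = 0} := hw.continuous.measurable (measurableSet_singleton 0)
    rw [integral_eq_zero_iff_of_nonneg
      (indicator_nonneg fun x _ => mul_nonneg f.nonneg (by positivity)) (hiG.indicator hmeas)] at hz
    refine measure_mono_null ?_ hz
    rintro x ⟨⟨hx0, hx1⟩, hxR⟩ hx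
    change {x | w x = 0}.indicator (fun x => f x * ‖gradient w x‖ ^ 2) x = 0 at hx
    rw [indicator_of_mem (by exact hx0), f.one_of_mem_closedBall
      (Metric.ball_subset_closedBall hxR), one_mul] at hx
    exact hx1 (norm_eq_zero.1 (pow_eq_zero_iff (two_ne_zero)|>.1 hx))
  have : {x | w x = 0 ∧ gradient w x ≠ 0}
      ⊆ ⋃ R : ℕ, ({x | w x = 0 ∧ gradient w x ≠ 0} ∩ Metric.ball 0 (R + 1 : ℝ)) := by
    intro x hx
    obtain ⟨R, hR⟩ := exists_nat_gt ‖x‖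
    exact mem_iUnion.2 ⟨R, hx, by simp; linarith⟩
  exact measure_mono_null this (measure_iUnion_null main)

end

/-! ### Weakly-* measurable families of varifolds as kernels. -/

section

open ProbabilityTheory in
/-- A weakly-* measurable family of measures with uniformly bounded mass coincides almost everywhere
with a finite kernel. -/
theorem exists_kernel_ae_eq {d : ℕ} {μ : ℝ → Measure (Euc d × Sph d)} {T : ℝ} {m : ℝ≥0}
    (hfin : ∀ t, 0 < t → IsFiniteMeasure (μ t))
    (hm : ∀ᵐ t ∂(volume.restrict (Ioc 0 T)), μ t univ ≤ m)
    (hw : ∀ η : ℝ → C₀(Euc d × Sph d, ℝ), IntegrableOn η (Ioi 0) →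
      AEMeasurable (fun t => ∫ q, η t q ∂(μ t)) (volume.restrict (Ioi 0))) :
    ∃ κ : Kernel ℝ (Euc d × Sph d), IsFiniteKernel κ ∧ (∀ t, κ t univ ≤ m) ∧
      ∀ᵐ t ∂(volume.restrict (Ioc 0 T)), κ t = μ t := by
  -- integrals of compactly supported functions
  have hC : ∀ f : Euc d × Sph d → ℝ, Continuous f → HasCompactSupport f →
      AEMeasurable (fun t => ∫ q, f q ∂(μ t)) (volume.restrict (Ioc 0 T)) := by
    intro f hf hc
    let f₀ : C₀(Euc d × Sph d, ℝ) := ⟨⟨f, hf⟩, hc.is_zero_at_infty⟩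
    have h0 : Integrable ((Ioc 0 T).indicator fun _ => (1 : ℝ)) :=
      (integrable_indicator_iff measurableSet_Ioc).2
        (integrable_const (μ := volume.restrict (Ioc 0 T)) (1 : ℝ))
    have h1 : IntegrableOn (fun t => (Ioc 0 T).indicator (fun _ => (1 : ℝ)) t • f₀) (Ioi 0) volume :=
      (h0.smul_const f₀).integrableOn
    have h2 := (hw _ h1).mono_measure
      (Measure.restrict_mono_set volume (show Ioc 0 T ⊆ Ioi 0 from fun t ht => ht.1))
    refine h2.congr ((ae_restrict_iff' measurableSet_Ioc).2 (ae_of_all _ fun t ht => ?_))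
    simp only [indicator_of_mem ht, one_smul]
    rfl
  -- masses of closed sets
  have hF : ∀ F : Set (Euc d × Sph d), IsClosed F →
      AEMeasurable (fun t => μ t F) (volume.restrict (Ioc 0 T)) := by
    intro F hFc
    -- Thickened indicators of F, cut off only in the variable of `Euc d`, since the sphere is
    -- compact.
    let f : ℕ → Euc d × Sph d → ℝ := fun n q =>
      (thickenedIndicator (δ := 1 / ((n : ℝ) + 1)) (by positivity) F q : ℝ)
        * max 0 (min 1 (n + 1 - ‖q.1‖))
    have hfc : ∀ n, Continuous (f n) := fun n =>
      (NNReal.continuous_coe.comp (thickenedIndicator _ F).continuous).mul (by fun_prop)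
    have hfs : ∀ n, HasCompactSupport (f n) := by
      intro n
      refine HasCompactSupport.intro
        ((isCompact_closedBall (0 : Euc d) (n + 1)).prod (isCompact_univ (X := Sph d))) ?_
      intro q hq
      have : (n : ℝ) + 1 < ‖q.1‖ := by
        by_contra! h
        exact hq ⟨by simpa using h, mem_univ _⟩
      have : min (1 : ℝ) (n + 1 - ‖q.1‖) ≤ 0 := (min_le_right _ _).trans (by linarith)
      simp [f, max_eq_left this]
    have hf1 : ∀ n q, ‖f n q‖ ≤ 1 := by
      intro n q
      have h1 : ((thickenedIndicator (δ := 1 / ((n : ℝ) + 1)) (by positivity) F q : ℝ≥0) : ℝ) ≤ 1 := by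
        exact_mod_cast thickenedIndicator_le_one _ F q
      have h2 : max 0 (min 1 ((n : ℝ) + 1 - ‖q.1‖)) ≤ 1 := max_le (by norm_num) (min_le_left _ _)
      have h3 : 0 ≤ max 0 (min 1 ((n : ℝ) + 1 - ‖q.1‖)) := le_max_left _ _
      rw [Real.norm_of_nonneg (mul_nonneg (NNReal.coe_nonneg _) h3)]
      exact mul_le_one₀ h1 h3 h2
    have hlim : ∀ q, Tendsto (fun n => f n q) atTop (𝓝 (F.indicator (fun _ => (1 : ℝ)) q)) := by
      intro q
      have h1 := thickenedIndicator_tendsto_indicator_closure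
        (δseq := fun n : ℕ => 1 / ((n : ℝ) + 1)) (fun n => by positivity)
        tendsto_one_div_add_atTop_nhds_zero_nat F
      rw [tendsto_pi_nhds] at h1
      have h2 := (NNReal.tendsto_coe.2 (h1 q))
      have h3 : Tendsto (fun n : ℕ => max 0 (min 1 ((n : ℝ) + 1 - ‖q.1‖))) atTop (𝓝 1) := by
        refine tendsto_const_nhds.congr' ?_
        filter_upwards [tendsto_natCast_atTop_atTop.eventually_ge_atTop ‖q.1‖] with n hn
        rw [min_eq_left (by linarith), max_eq_right zero_le_one]
      have h4 := h2.mul h3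
      rw [hFc.closure_eq] at h4
      convert h4 using 2
      by_cases h : q ∈ F <;> simp [h]
    have hreal : AEMeasurable (fun t => (μ t).real F) (volume.restrict (Ioc 0 T)) := by
      refine aemeasurable_of_tendsto_metrizable_ae atTop (fun n => hC _ (hfc n) (hfs n)) ?_
      refine (ae_restrict_iff' measurableSet_Ioc).2 (ae_of_all _ fun t ht => ?_)
      have := hfin t ht.1
      rw [← integral_indicator_one hFc.measurableSet]
      exact tendsto_integral_of_dominated_convergence (fun _ => 1)
        (fun n => (hfc n).aestronglyMeasurable) (integrable_const _)
        (fun n => ae_of_all _ (hf1 n)) (ae_of_all _ hlim)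
    refine hreal.ennreal_ofReal.congr
      ((ae_restrict_iff' measurableSet_Ioc).2 (ae_of_all _ fun t ht => ?_))
    have := hfin t ht.1
    exact ofReal_measureReal
  -- a countable π-system of closed sets
  let b := TopologicalSpace.countableBasis (Euc d × Sph d)
  have hbc : b.Countable := TopologicalSpace.countable_countableBasis _
  have : Countable b := hbc.to_subtype
  -- Finite intersections of complements of basic open sets. The empty intersection is the whole
  -- space, which later yields measurability of the total mass.
  let C : Finset b → Set (Euc d × Sph d) := fun s => ⋂ i ∈ s, (i : Set (Euc d × Sph d))ᶜ
  have hCc : ∀ s, IsClosed (C s) := fun s => isClosed_biInter fun i _ =>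
    (TopologicalSpace.isOpen_of_mem_countableBasis i.2).isClosed_compl
  have hpi : IsPiSystem (range C) := by
    classical
    rintro _ ⟨s, rfl⟩ _ ⟨s', rfl⟩ _
    exact ⟨s ∪ s', Finset.set_biInter_inter _ _ _⟩
  have hgen : (inferInstance : MeasurableSpace (Euc d × Sph d))
      = MeasurableSpace.generateFrom (range C) := by
    apply le_antisymm
    · have h1 : (inferInstance : MeasurableSpace (Euc d × Sph d)) = borel _ :=
        BorelSpace.measurable_eq
      rw [h1, (TopologicalSpace.isBasis_countableBasis (Euc d × Sph d)).borel_eq_generateFrom]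
      refine MeasurableSpace.generateFrom_le fun o ho => ?_
      have h2 : @MeasurableSet _ (MeasurableSpace.generateFrom (range C)) (C {⟨o, ho⟩}) :=
        MeasurableSpace.measurableSet_generateFrom ⟨_, rfl⟩
      have h3 : o = (C {⟨o, ho⟩})ᶜ := by
        simp only [C, Finset.mem_singleton, iInter_iInter_eq_left, compl_compl]
      rw [h3]
      exact h2.compl
    · refine MeasurableSpace.generateFrom_le ?_
      rintro _ ⟨s, rfl⟩
      exact (hCc s).measurableSet
  -- the exceptional null set
  have hae : ∀ᵐ t ∂(volume.restrict (Ioc 0 T)), t ∈ Ioc 0 T ∧ μ t univ ≤ m ∧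
      ∀ s, μ t (C s) = (hF _ (hCc s)).mk _ t := by
    filter_upwards [ae_restrict_mem measurableSet_Ioc, hm,
      ae_all_iff.2 fun s => (hF _ (hCc s)).ae_eq_mk] with t h1 h2 h3 using ⟨h1, h2, h3⟩
  set N := toMeasurable (volume.restrict (Ioc 0 T)) {t | ¬(t ∈ Ioc 0 T ∧ μ t univ ≤ m ∧
      ∀ s, μ t (C s) = (hF _ (hCc s)).mk _ t)} with hN
  have hN0 : (volume.restrict (Ioc 0 T)) N = 0 := by rw [hN, measure_toMeasurable]; exact hae
  have hNm : MeasurableSet N := measurableSet_toMeasurable _ _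
  have hNc : ∀ t, t ∉ N → t ∈ Ioc 0 T ∧ μ t univ ≤ m ∧
      ∀ s, μ t (C s) = (hF _ (hCc s)).mk _ t := by
    intro t ht
    by_contra h
    exact ht (subset_toMeasurable _ _ h)
  classical
  -- Setting the kernel to zero on N preserves the mass bound at every time; all times outside (0,T]
  -- belong to N.
  let k : ℝ → Measure (Euc d × Sph d) := fun t => if t ∈ N then 0 else μ t
  have hkf : ∀ t, IsFiniteMeasure (k t) := by
    intro t
    by_cases h : t ∈ N
    · simp only [k, h, if_true]; infer_instance
    · simp only [k, h, if_false]; exact hfin t (hNc t h).1.1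
  have hkm : ∀ s, Measurable fun t => k t (C s) := by
    intro s
    have : (fun t => k t (C s)) = Nᶜ.indicator ((hF _ (hCc s)).mk _) := by
      funext t
      by_cases h : t ∈ N
      · simp [k, h]
      · simp [k, h, (hNc t h).2.2 s]
    rw [this]
    exact ((hF _ (hCc s)).measurable_mk).indicator hNm.compl
  have hk : Measurable k := by
    refine Measurable.measure_of_isPiSystem hgen hpi ?_ ?_
    · rintro _ ⟨s, rfl⟩; exact hkm s
    · have := hkm ∅
      simpa [C] using this
  have hkb : ∀ t, k t univ ≤ m := by
    intro t
    by_cases h : t ∈ N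
    · simp [k, h]
    · simp only [k, h, if_false]; exact (hNc t h).2.1
  refine ⟨⟨k, hk⟩, ⟨m, ENNReal.coe_lt_top, hkb⟩, hkb, ?_⟩
  have : ∀ᵐ t ∂(volume.restrict (Ioc 0 T)), t ∉ N := measure_eq_zero_iff_ae_notMem.1 hN0
  filter_upwards [this] with t ht
  simp [k, ht]

end

section

/-! ### Functions on a space-time slab -/

section Slab

variable {d : ℕ} {G : Type*} [NormedAddCommGroup G] [NormedSpace ℝ G]

/-- The derivative in time of a function of `(t, x)`. -/
def timeDeriv (F : ℝ × Euc d → G) (q : ℝ × Euc d) : G := fderiv ℝ F q (1, 0)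

/-- The derivative in space of a function of `(t, x)`. -/
def spaceDeriv (F : ℝ × Euc d → G) (q : ℝ × Euc d) : Euc d →L[ℝ] G :=
  (fderiv ℝ F q).comp (ContinuousLinearMap.inr ℝ ℝ (Euc d))

/-- The divergence in space of a vector field depending on `(t, x)`. -/
def spaceDiv (F : ℝ × Euc d → Euc d) (q : ℝ × Euc d) : ℝ := divergence (fun y => F (q.1, y)) q.2

/-- Smooth functions on the slab `[0,T] × ℝ^d`. -/
def SlabSmooth (T : ℝ) (F : ℝ × Euc d → G) : Prop := ContDiffOn ℝ ∞ F (Icc 0 T ×ˢ univ)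

/-- Smooth functions on the slab `[0,T] × ℝ^d` vanishing far away. -/
structure SlabField (T : ℝ) (F : ℝ × Euc d → G) : Prop where
  smooth : SlabSmooth T F
  supp : ∃ R : ℝ, ∀ t ∈ Icc 0 T, ∀ x : Euc d, R < ‖x‖ → F (t, x) = 0

theorem hasFDerivAt_space {F : ℝ × Euc d → G} {t : ℝ} {x : Euc d}
    (h : DifferentiableAt ℝ F (t, x)) :
    HasFDerivAt (fun y => F (t, y)) (spaceDeriv F (t, x)) x := by
  have h1 : HasFDerivAt (fun y : Euc d => ((t, y) : ℝ × Euc d))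
      (ContinuousLinearMap.inr ℝ ℝ (Euc d)) x := by
    have := (hasFDerivAt_const (𝕜 := ℝ) t x).prodMk (hasFDerivAt_id (𝕜 := ℝ) x)
    exact this
  exact h.hasFDerivAt.comp x h1

theorem hasDerivAt_time {F : ℝ × Euc d → G} {t : ℝ} {x : Euc d}
    (h : DifferentiableAt ℝ F (t, x)) :
    HasDerivAt (fun s => F (s, x)) (timeDeriv F (t, x)) t := by
  have h1 : HasDerivAt (fun s : ℝ => ((s, x) : ℝ × Euc d)) (1, 0) t :=
    (hasDerivAt_id t).prodMk (hasDerivAt_const t x)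
  exact h.hasFDerivAt.comp_hasDerivAt t h1

theorem slab_mem_nhds {T t : ℝ} (ht : t ∈ Ioo 0 T) (x : Euc d) :
    Icc 0 T ×ˢ (univ : Set (Euc d)) ∈ 𝓝 (t, x) :=
  prod_mem_nhds (Icc_mem_nhds ht.1 ht.2) univ_mem

theorem uniqueDiffOn_slab {T : ℝ} (hT : 0 < T) :
    UniqueDiffOn ℝ (Icc 0 T ×ˢ (univ : Set (Euc d))) :=
  (uniqueDiffOn_Icc hT).prod uniqueDiffOn_univ

theorem SlabSmooth.contDiffAt {T : ℝ} {F : ℝ × Euc d → G} (hF : SlabSmooth T F) {t : ℝ}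
    (ht : t ∈ Ioo 0 T) (x : Euc d) : ContDiffAt ℝ ∞ F (t, x) :=
  ContDiffOn.contDiffAt hF (slab_mem_nhds ht x)

theorem SlabSmooth.differentiableAt {T : ℝ} {F : ℝ × Euc d → G} (hF : SlabSmooth T F) {t : ℝ}
    (ht : t ∈ Ioo 0 T) (x : Euc d) : DifferentiableAt ℝ F (t, x) :=
  (hF.contDiffAt ht x).differentiableAt (by simp)

theorem SlabSmooth.slice {T : ℝ} {F : ℝ × Euc d → G} (hF : SlabSmooth T F) {t : ℝ}
    (ht : t ∈ Icc 0 T) : ContDiff ℝ ∞ (fun x => F (t, x)) := by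
  rw [← contDiffOn_univ]
  refine ContDiffOn.comp hF (contDiff_const.prodMk contDiff_id).contDiffOn ?_
  exact fun x _ => ⟨ht, mem_univ _⟩

theorem SlabSmooth.time_continuousOn {T : ℝ} {F : ℝ × Euc d → G} (hF : SlabSmooth T F)
    (x : Euc d) : ContinuousOn (fun t => F (t, x)) (Icc 0 T) :=
  ContDiffOn.continuousOn hF |>.comp (by fun_prop) fun t ht => ⟨ht, mem_univ _⟩

theorem SlabSmooth.fderiv_slice {T : ℝ} {F : ℝ × Euc d → G} (hF : SlabSmooth T F)
    {t : ℝ} (ht : t ∈ Icc 0 T) (x : Euc d) :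
    fderiv ℝ (fun y => F (t, y)) x
      = (fderivWithin ℝ F (Icc 0 T ×ˢ univ) (t, x)).comp (ContinuousLinearMap.inr ℝ ℝ (Euc d)) := by
  have h1 : HasFDerivWithinAt (fun y : Euc d => ((t, y) : ℝ × Euc d))
      (ContinuousLinearMap.inr ℝ ℝ (Euc d)) univ x := by
    have := (hasFDerivAt_const (𝕜 := ℝ) t x).prodMk (hasFDerivAt_id (𝕜 := ℝ) x)
    exact this.hasFDerivWithinAt
  have h2 := (ContDiffOn.differentiableOn hF (by simp) (t, x) ⟨ht, mem_univ _⟩).hasFDerivWithinAt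
  have h3 := h2.comp x h1 (fun y _ => ⟨ht, mem_univ _⟩)
  exact (hasFDerivWithinAt_univ.1 h3).fderiv

/-- Nothing is known about F outside the closed slab, so derivatives are taken within it. They are
smooth up to the times 0 and T, and at interior times they are the usual ones. -/
theorem SlabSmooth.fderivWithin {T : ℝ} (hT : 0 < T) {F : ℝ × Euc d → G} (hF : SlabSmooth T F) :
    SlabSmooth T (fderivWithin ℝ F (Icc 0 T ×ˢ univ)) :=
  ContDiffOn.fderivWithin hF (uniqueDiffOn_slab hT) (by simp)

theorem fderivWithin_slab {T : ℝ} {F : ℝ × Euc d → G} {t : ℝ} (ht : t ∈ Ioo 0 T) (x : Euc d) :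
    fderivWithin ℝ F (Icc 0 T ×ˢ univ) (t, x) = fderiv ℝ F (t, x) :=
  fderivWithin_of_mem_nhds (slab_mem_nhds ht x)

theorem SlabField.slice {T : ℝ} {F : ℝ × Euc d → G} (hF : SlabField T F) {t : ℝ}
    (ht : t ∈ Icc 0 T) : HasCompactSupport (fun x => F (t, x)) := by
  obtain ⟨R, hR⟩ := hF.supp
  refine HasCompactSupport.intro (isCompact_closedBall (0 : Euc d) R) fun x hx => hR t ht x ?_
  simpa using hx

theorem SlabField.isTest {T : ℝ} {F : ℝ × Euc d → G} (hF : SlabField T F) {t : ℝ}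
    (ht : t ∈ Icc 0 T) : IsTest (fun x => F (t, x)) :=
  ⟨hF.smooth.slice ht, hF.slice ht⟩

theorem SlabField.exists_bound {T : ℝ} {F : ℝ × Euc d → G} (hF : SlabField T F) :
    ∃ M : ℝ, 0 ≤ M ∧ ∀ t ∈ Icc 0 T, ∀ x : Euc d, ‖F (t, x)‖ ≤ M := by
  obtain ⟨R, hR⟩ := hF.supp
  obtain ⟨M, hM⟩ := (isCompact_Icc.prod (isCompact_closedBall (0 : Euc d) R)).exists_bound_of_continuousOn
    (f := F) ((ContDiffOn.continuousOn hF.smooth).mono (prod_mono_right (subset_univ _)))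
  refine ⟨max M 0, le_max_right _ _, fun t ht x => ?_⟩
  by_cases hx : ‖x‖ ≤ R
  · exact (hM (t, x) ⟨ht, by simpa using hx⟩).trans (le_max_left _ _)
  · rw [hR t ht x (not_le.1 hx)]; simp

theorem SlabField.fderivWithin {T : ℝ} (hT : 0 < T) {F : ℝ × Euc d → G} (hF : SlabField T F) :
    SlabField T (fderivWithin ℝ F (Icc 0 T ×ˢ univ)) := by
  refine ⟨hF.smooth.fderivWithin hT, ?_⟩
  obtain ⟨R, hR⟩ := hF.supp
  refine ⟨R, fun t ht x hx => ?_⟩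
  have h : F =ᶠ[𝓝[Icc 0 T ×ˢ univ] (t, x)] fun _ => 0 := by
    have h1 : {q : ℝ × Euc d | R < ‖q.2‖} ∈ 𝓝 (t, x) :=
      (isOpen_lt continuous_const (by fun_prop)).mem_nhds hx
    filter_upwards [self_mem_nhdsWithin, mem_nhdsWithin_of_mem_nhds h1] with q hq hq'
    exact hR q.1 hq.1 q.2 hq'
  rw [h.fderivWithin_eq (hR t ht x hx)]
  simp

theorem SlabField.exists_bound_fderiv {T : ℝ} (hT : 0 < T) {F : ℝ × Euc d → G}
    (hF : SlabField T F) :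
    ∃ M : ℝ, 0 ≤ M ∧ ∀ t ∈ Ioo 0 T, ∀ x : Euc d, ‖fderiv ℝ F (t, x)‖ ≤ M := by
  obtain ⟨M, hM0, hM⟩ := (hF.fderivWithin hT).exists_bound
  refine ⟨M, hM0, fun t ht x => ?_⟩
  rw [← fderivWithin_slab ht]
  exact hM t (Ioo_subset_Icc_self ht) x

theorem SlabField.clm_comp {G' : Type*} [NormedAddCommGroup G'] [NormedSpace ℝ G'] {T : ℝ}
    {F : ℝ × Euc d → G} (hF : SlabField T F) (L : G →L[ℝ] G') :
    SlabField T (fun q => L (F q)) := by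
  refine ⟨ContDiffOn.continuousLinearMap_comp L hF.smooth, ?_⟩
  obtain ⟨R, hR⟩ := hF.supp
  exact ⟨R, fun t ht x hx => by rw [hR t ht x hx, map_zero]⟩

theorem SlabField.congr {T : ℝ} {F F' : ℝ × Euc d → G} (hF : SlabField T F)
    (h : ∀ t ∈ Icc 0 T, ∀ x, F' (t, x) = F (t, x)) : SlabField T F' := by
  refine ⟨ContDiffOn.congr hF.smooth fun q hq => h q.1 hq.1 q.2, ?_⟩
  obtain ⟨R, hR⟩ := hF.supp
  exact ⟨R, fun t ht x hx => by rw [h t ht, hR t ht x hx]⟩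

/-- The functional `L ↦ tr (L ∘ (v ↦ (0, v)))`. -/
def spaceTrace (d : ℕ) : (ℝ × Euc d →L[ℝ] Euc d) →L[ℝ] ℝ :=
  (traceL d).comp ((ContinuousLinearMap.compL ℝ (Euc d) (ℝ × Euc d) (Euc d)).flip
    (ContinuousLinearMap.inr ℝ ℝ (Euc d)))

theorem spaceTrace_apply (L : ℝ × Euc d →L[ℝ] Euc d) :
    spaceTrace d L = traceL d (L.comp (ContinuousLinearMap.inr ℝ ℝ (Euc d))) := rfl

theorem SlabSmooth.spaceDiv_eq {T : ℝ} {F : ℝ × Euc d → Euc d} (hF : SlabSmooth T F)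
    {t : ℝ} (ht : t ∈ Icc 0 T) (x : Euc d) :
    spaceDiv F (t, x) = spaceTrace d (_root_.fderivWithin ℝ F (Icc 0 T ×ˢ univ) (t, x)) := by
  rw [spaceTrace_apply, ← hF.fderiv_slice ht, ← divergence_eq_traceL]; rfl

theorem SlabField.spaceDiv {T : ℝ} (hT : 0 < T) {F : ℝ × Euc d → Euc d} (hF : SlabField T F) :
    SlabField T (spaceDiv F) :=
  ((hF.fderivWithin hT).clm_comp (spaceTrace d)).congr fun _ ht x =>
    hF.smooth.spaceDiv_eq ht x

theorem spaceDiv_eq_traceL {F : ℝ × Euc d → Euc d} {t : ℝ} {x : Euc d}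
    (h : DifferentiableAt ℝ F (t, x)) : spaceDiv F (t, x) = traceL d (spaceDeriv F (t, x)) := by
  have := (hasFDerivAt_space h).fderiv
  unfold spaceDiv
  rw [divergence_eq_traceL, this]

theorem SlabField.timeDerivWithin {T : ℝ} (hT : 0 < T) {F : ℝ × Euc d → G} (hF : SlabField T F) :
    SlabField T (fun q => _root_.fderivWithin ℝ F (Icc 0 T ×ˢ univ) q (1, 0)) :=
  (hF.fderivWithin hT).clm_comp (ContinuousLinearMap.apply ℝ G ((1, 0) : ℝ × Euc d))

theorem timeDeriv_eq_within {T : ℝ} {F : ℝ × Euc d → G} {t : ℝ} (ht : t ∈ Ioo 0 T) (x : Euc d) :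
    timeDeriv F (t, x) = fderivWithin ℝ F (Icc 0 T ×ˢ univ) (t, x) (1, 0) := by
  rw [fderivWithin_slab ht]; rfl

theorem SlabField.isTest_timeDeriv {T : ℝ} (hT : 0 < T) {F : ℝ × Euc d → G} (hF : SlabField T F)
    {t : ℝ} (ht : t ∈ Ioo 0 T) : IsTest (fun x => timeDeriv F (t, x)) := by
  simp_rw [fun x => timeDeriv_eq_within (F := F) ht x]
  exact (hF.timeDerivWithin hT).isTest (Ioo_subset_Icc_self ht)

theorem SlabField.exists_bound_timeDeriv {T : ℝ} (hT : 0 < T) {F : ℝ × Euc d → G}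
    (hF : SlabField T F) :
    ∃ M : ℝ, 0 ≤ M ∧ ∀ t ∈ Ioo 0 T, ∀ x : Euc d, ‖timeDeriv F (t, x)‖ ≤ M := by
  obtain ⟨M, hM0, hM⟩ := (hF.timeDerivWithin hT).exists_bound
  refine ⟨M, hM0, fun t ht x => ?_⟩
  rw [timeDeriv_eq_within ht]
  exact hM t (Ioo_subset_Icc_self ht) x

/-- The divergence in space commutes with the derivative in time. -/
theorem SlabField.timeDeriv_spaceDiv {T : ℝ} {F : ℝ × Euc d → Euc d}
    (hF : SlabField T F) {t : ℝ} (ht : t ∈ Ioo 0 T) (x : Euc d) :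
    timeDeriv (TwoPhaseMCF.spaceDiv F) (t, x) = divergence (fun y => timeDeriv F (t, y)) x := by
  have hC : ContDiffAt ℝ ∞ F (t, x) := hF.smooth.contDiffAt ht x
  have hC' : ContDiffAt ℝ ∞ (fderiv ℝ F) (t, x) := hC.fderiv_right (by simp)
  have hd : HasFDerivAt (fderiv ℝ F) (fderiv ℝ (fderiv ℝ F) (t, x)) (t, x) :=
    (hC'.differentiableAt (by simp)).hasFDerivAt
  have e1 : TwoPhaseMCF.spaceDiv F =ᶠ[𝓝 (t, x)] fun q => spaceTrace d (fderiv ℝ F q) := by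
    filter_upwards [prod_mem_nhds (Ioo_mem_nhds ht.1 ht.2) univ_mem] with q hq
    rw [show q = (q.1, q.2) from rfl, spaceDiv_eq_traceL (hF.smooth.differentiableAt hq.1 q.2)]
    rfl
  have h1 : timeDeriv (TwoPhaseMCF.spaceDiv F) (t, x)
      = spaceTrace d (fderiv ℝ (fderiv ℝ F) (t, x) (1, 0)) := by
    unfold timeDeriv
    have e2 : HasFDerivAt (fun q => spaceTrace d (fderiv ℝ F q))
        ((spaceTrace d).comp (fderiv ℝ (fderiv ℝ F) (t, x))) (t, x) :=
      (spaceTrace d).hasFDerivAt.comp (t, x) hd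
    rw [e1.fderiv_eq, e2.fderiv]
    rfl
  have h2 : HasFDerivAt (fun q => timeDeriv F q)
      ((ContinuousLinearMap.apply ℝ (Euc d) ((1, 0) : ℝ × Euc d)).comp
        (fderiv ℝ (fderiv ℝ F) (t, x))) (t, x) :=
    (ContinuousLinearMap.apply ℝ (Euc d) ((1, 0) : ℝ × Euc d)).hasFDerivAt.comp (t, x) hd
  have h3 := (hasFDerivAt_space h2.differentiableAt).fderiv
  rw [h1, divergence_eq_traceL, h3, spaceTrace_apply]
  congr 1
  ext1 v
  have hsym : IsSymmSndFDerivAt ℝ F (t, x) := hC.isSymmSndFDerivAt (by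
    simp [minSmoothness_of_isRCLikeNormedField]; exact WithTop.coe_le_coe.2 le_top)
  unfold spaceDeriv
  rw [h2.fderiv]
  exact hsym _ _

theorem SlabSmooth.prod_smul {T : ℝ} {f : ℝ × Euc d → ℝ} {F : ℝ × Euc d → G}
    (hf : SlabSmooth T f) (hF : SlabField T F) : SlabField T (fun q => f q • F q) := by
  refine ⟨ContDiffOn.smul hf hF.smooth, ?_⟩
  obtain ⟨R, hR⟩ := hF.supp
  exact ⟨R, fun t ht x hx => by rw [hR t ht x hx, smul_zero]⟩

/-- Off the slab F is arbitrary; measurability is available only after extension by zero. -/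
theorem SlabSmooth.measurable_slab_indicator [MeasurableSpace G] [BorelSpace G] {T : ℝ}
    {F : ℝ × Euc d → G} (hF : SlabSmooth T F) :
    Measurable ((Icc 0 T ×ˢ univ).indicator F) := by
  have hm : MeasurableSet (Icc 0 T ×ˢ (univ : Set (Euc d))) := measurableSet_Icc.prod .univ
  classical
  rw [← piecewise_eq_indicator]
  exact (ContDiffOn.continuousOn hF).measurable_piecewise continuousOn_const hm

end Slab

end

section

/-! ### De Giorgi solutions on a time interval -/

open ProbabilityTheory in
/-- The restriction of a De Giorgi type varifold solution to a time interval `(0,T]`, with the family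
of varifolds given by a kernel. -/
structure SlabSolution {d : ℕ} (T σ m₀ : ℝ) (A₀ : Set (Euc d)) (κ : Kernel ℝ (Euc d × Sph d))
    (A : ℝ → Set (Euc d)) (V : ℝ → Euc d → ℝ) (H : ℝ → Euc d → Euc d) : Prop where
  finite : IsFiniteKernel κ
  isOpen : ∀ t, 0 < t → IsOpen (A t)
  phase : NullMeasurableSet {q : ℝ × Euc d | 0 < q.1 ∧ q.2 ∈ A q.1} volume
  volume_le : ∃ M : ℝ≥0, ∀ᵐ t ∂(volume.restrict (Ioc 0 T)), volume (A t) ≤ M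
  volume_initial : volume A₀ ≠ ⊤
  measurable_V : Measurable (Function.uncurry V)
  sq_V : Integrable (fun q : ℝ × (Euc d × Sph d) => V q.1 q.2.1 ^ 2)
    ((volume.restrict (Ioc 0 T)) ⊗ₘ κ)
  measurable_H : Measurable (Function.uncurry H)
  sq_H : Integrable (fun q : ℝ × (Euc d × Sph d) => ‖H q.1 q.2.1‖ ^ 2)
    ((volume.restrict (Ioc 0 T)) ⊗ₘ κ)
  evolution : ∀ᵐ τ ∂(volume.restrict (Ioc 0 T)), ∀ ζ : ℝ × Euc d → ℝ, IsTest ζ →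
    σ * (∫ x in A τ, ζ (τ, x)) - σ * (∫ x in A₀, ζ (0, x))
      = σ * (∫ t in Ioc 0 τ, ∫ x in A t, timeDeriv ζ (t, x))
        - ∫ t in Ioc 0 τ, ∫ q, V t q.1 * ζ (t, q.1) ∂(κ t)
  curvature : ∀ B : ℝ × Euc d → Euc d, IsTest B → (∀ t, t ∉ Ioo 0 T → ∀ x, B (t, x) = 0) →
    ∫ t in Ioc 0 T, ∫ q, ⟪H t q.1, B (t, q.1)⟫ ∂(κ t)
      = - ∫ t in Ioc 0 T, ∫ q : Euc d × Sph d, (spaceDiv B (t, q.1)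
            - ⟪(q.2 : Euc d), spaceDeriv B (t, q.1) (q.2 : Euc d)⟫) ∂(κ t)
  energy : ∀ᵐ τ ∂(volume.restrict (Ioc 0 T)),
    (κ τ).real univ + 2⁻¹ * (∫ t in Ioc 0 τ, ∫ q, V t q.1 ^ 2 ∂(κ t))
      + 2⁻¹ * (∫ t in Ioc 0 τ, ∫ q, ‖H t q.1‖ ^ 2 ∂(κ t)) ≤ m₀
  compat : ∀ᵐ t ∂(volume.restrict (Ioc 0 T)), ∀ X : Euc d → Euc d, IsTest X →
    σ * ∫ x in A t, divergence X x = - ∫ q, ⟪X q.1, (q.2 : Euc d)⟫ ∂(κ t)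

/-- Compatibility in terms of divergences. -/
theorem Compatible.integral_eq {d : ℕ} {σ : ℝ} {A : Set (Euc d)} {μ : Measure (Euc d × Sph d)}
    (h : Compatible σ A μ) {X : Euc d → Euc d} (hX : IsTest X) :
    σ * ∫ x in A, divergence X x = - ∫ q, ⟪X q.1, (q.2 : Euc d)⟫ ∂μ := by
  obtain ⟨ν, n, hn, hc⟩ := h
  rw [← hc X hX, hn.integral_eq X hX]
  ring

theorem integral_fst_eq {d : ℕ} (μ : Measure (Euc d × Sph d)) {f : Euc d → ℝ} (hf : Measurable f) :
    ∫ x, f x ∂μ.fst = ∫ q, f q.1 ∂μ :=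
  integral_map measurable_fst.aemeasurable hf.aestronglyMeasurable

theorem lintegral_fst_eq {d : ℕ} (μ : Measure (Euc d × Sph d)) {f : Euc d → ℝ≥0∞}
    (hf : Measurable f) : ∫⁻ x, f x ∂μ.fst = ∫⁻ q, f q.1 ∂μ :=
  lintegral_map hf measurable_fst

-- Translates square integrability from iterated lower integrals over the mass measures to Bochner
-- integrability against the kernel. The second part supplies the partial time integrals that enter
-- the dissipation inequality.
open ProbabilityTheory in
theorem integrable_sq_of_lintegral {d : ℕ} {T : ℝ} {F : Type*} [NormedAddCommGroup F]
    [MeasurableSpace F] [BorelSpace F] [SecondCountableTopology F]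
    {κ : Kernel ℝ (Euc d × Sph d)} [IsFiniteKernel κ] {μ : ℝ → Measure (Euc d × Sph d)}
    (hκ : ∀ᵐ t ∂(volume.restrict (Ioc 0 T)), κ t = μ t) {W : ℝ → Euc d → F}
    (hW : Measurable (Function.uncurry W))
    (hW2 : ∫⁻ t in Ioi (0 : ℝ), ∫⁻ x, ‖W t x‖ₑ ^ 2 ∂(μ t).fst < ⊤) :
    Integrable (fun q : ℝ × (Euc d × Sph d) => ‖W q.1 q.2.1‖ ^ 2)
      ((volume.restrict (Ioc 0 T)) ⊗ₘ κ) ∧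
    ∀ τ ∈ Ioc 0 T, ∫⁻ t in Ioc 0 τ, ∫⁻ x, ‖W t x‖ₑ ^ 2 ∂(μ t).fst
      = ENNReal.ofReal (∫ t in Ioc 0 τ, ∫ q, ‖W t q.1‖ ^ 2 ∂(κ t)) := by
  have hWm : Measurable fun q : ℝ × (Euc d × Sph d) => W q.1 q.2.1 :=
    hW.comp (measurable_fst.prodMk (measurable_fst.comp measurable_snd))
  have hWt : ∀ t, Measurable fun x => ‖W t x‖ₑ ^ 2 := fun t =>
    ((hW.comp measurable_prodMk_left).enorm).pow_const 2
  have heq : ∀ τ ∈ Ioc 0 T, ∫⁻ t in Ioc 0 τ, ∫⁻ x, ‖W t x‖ₑ ^ 2 ∂(μ t).fst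
      = ∫⁻ q, ‖‖W q.1 q.2.1‖ ^ 2‖ₑ ∂((volume.restrict (Ioc 0 τ)) ⊗ₘ κ) := by
    intro τ hτ
    rw [Measure.lintegral_compProd (by fun_prop)]
    have h1 : ∀ᵐ t ∂(volume.restrict (Ioc 0 τ)), κ t = μ t :=
      ae_restrict_of_ae_restrict_of_subset (Ioc_subset_Ioc_right hτ.2) hκ
    refine lintegral_congr_ae (h1.mono fun t ht => ?_)
    simp only
    rw [lintegral_fst_eq _ (hWt t), ht]
    refine lintegral_congr fun q => ?_
    simp [enorm_pow]
  have hint : ∀ τ ∈ Ioc 0 T, Integrable (fun q : ℝ × (Euc d × Sph d) => ‖W q.1 q.2.1‖ ^ 2)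
      ((volume.restrict (Ioc 0 τ)) ⊗ₘ κ) := by
    intro τ hτ
    refine ⟨(hWm.norm.pow_const 2).aestronglyMeasurable, ?_⟩
    rw [hasFiniteIntegral_iff_enorm, ← heq τ hτ]
    exact (lintegral_mono_set (fun t ht => ht.1)).trans_lt hW2
  constructor
  · by_cases hT : 0 < T
    · exact hint T ⟨hT, le_rfl⟩
    · simp [Ioc_eq_empty hT]
  · intro τ hτ
    rw [heq τ hτ, ← Measure.integral_compProd (hint τ hτ),
      ofReal_integral_eq_lintegral_ofReal (hint τ hτ) (ae_of_all _ fun q => by positivity)]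
    refine lintegral_congr fun q => ?_
    rw [Real.enorm_of_nonneg (by positivity)]

open ProbabilityTheory in
/-- De Giorgi type varifold solutions restrict to bounded time intervals. -/
theorem IsDeGiorgiSolutionWith.exists_slabSolution {d : ℕ} {σ : ℝ} {μ₀ : Measure (Euc d × Sph d)}
    {A₀ : Set (Euc d)} {μ : ℝ → Measure (Euc d × Sph d)} {A : ℝ → Set (Euc d)}
    {V : ℝ → Euc d → ℝ} {H : ℝ → Euc d → Euc d}
    (h : IsDeGiorgiSolutionWith σ μ₀ A₀ μ A V H) {T : ℝ} :
    ∃ κ : Kernel ℝ (Euc d × Sph d), SlabSolution T σ (μ₀.real univ) A₀ κ A V H ∧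
      ∀ᵐ t ∂(volume.restrict (Ioc 0 T)), κ t = μ t := by
  have hIoc : Ioc 0 T ⊆ Ioi 0 := fun t ht => ht.1
  have := h.finite_initial
  have hae : ∀ {p : ℝ → Prop}, (∀ᵐ t ∂(volume.restrict (Ioi (0 : ℝ))), p t) →
      ∀ᵐ t ∂(volume.restrict (Ioc 0 T)), p t := fun hp =>
    ae_restrict_of_ae_restrict_of_subset hIoc hp
  have hfstu : ∀ ν : Measure (Euc d × Sph d), ν.fst univ = ν univ := fun ν => Measure.fst_univ
  -- The dissipation inequality bounds the mass by its initial value; this is the uniform bound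
  -- needed to pass to a kernel.
  have hmass : ∀ᵐ t ∂(volume.restrict (Ioc 0 T)), μ t univ ≤ (μ₀ univ).toNNReal := by
    filter_upwards [hae h.deGiorgi] with t ht
    rw [ENNReal.coe_toNNReal (measure_ne_top _ _), ← hfstu, ← hfstu μ₀]
    exact (le_self_add.trans le_self_add).trans ht
  obtain ⟨κ, hκf, hκm, hκ⟩ := exists_kernel_ae_eq h.finite hmass h.weak_measurable
  obtain ⟨iV, eV⟩ := integrable_sq_of_lintegral hκ h.measurable_V h.sq_integrable_V
  obtain ⟨iH, eH⟩ := integrable_sq_of_lintegral hκ h.measurable_H h.sq_integrable_H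
  refine ⟨κ, ⟨hκf, h.isOpen, h.measurable_phase, ?_, ?_, h.measurable_V, ?_, h.measurable_H, iH,
    ?_, ?_, ?_, ?_⟩, hκ⟩
  · obtain ⟨M, hM⟩ := h.bv_bound
    exact ⟨M, hae (hM.mono fun t ht => ht.2.1)⟩
  · obtain ⟨M, hM⟩ := h.bv_initial
    exact ne_top_of_le_ne_top ENNReal.coe_ne_top hM.2.1
  · simpa using iV
  · filter_upwards [hae h.evolution, ae_restrict_mem measurableSet_Ioc] with τ hτ hτm ζ hζ
    have hdiff : Differentiable ℝ ζ := hζ.smooth.differentiable (by simp)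
    rw [hτ ζ hζ, intervalIntegral.integral_of_le hτm.1.le, intervalIntegral.integral_of_le hτm.1.le]
    congr 1
    · congr 1
      refine setIntegral_congr_fun measurableSet_Ioc fun t _ => ?_
      congr 1
      funext x
      exact (hasDerivAt_time (hdiff (t, x))).deriv
    · have h1 : ∀ᵐ t ∂(volume.restrict (Ioc 0 τ)), κ t = μ t :=
        ae_restrict_of_ae_restrict_of_subset (Ioc_subset_Ioc_right hτm.2) hκ
      refine integral_congr_ae (h1.mono fun t ht => ?_)
      simp only
      rw [ht]
      refine integral_fst_eq (μ t) (f := fun x => V t x * ζ (t, x)) ?_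
      exact (h.measurable_V.comp measurable_prodMk_left).mul
        (hζ.smooth.continuous.comp (by fun_prop)).measurable
  · intro B hB hB0
    have hdiff : Differentiable ℝ B := hB.smooth.differentiable (by simp)
    have hz : ∀ t ∉ Ioo 0 T, (fun x => B (t, x)) = fun _ => 0 := fun t ht => funext (hB0 t ht)
    have hsub : ∀ f : ℝ → ℝ, (∀ t ∉ Ioo 0 T, f t = 0) →
        ∫ t in Ioi (0 : ℝ), f t = ∫ t in Ioc 0 T, f t := fun f hf =>
      setIntegral_eq_of_subset_of_forall_sdiff_eq_zero measurableSet_Ioi hIoc fun t ht =>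
        hf t fun h' => ht.2 ⟨h'.1, h'.2.le⟩
    have h1 := h.curvature B hB
    rw [hsub, hsub] at h1
    · refine Eq.trans ?_ (h1.trans ?_)
      · refine integral_congr_ae (hκ.mono fun t ht => ?_)
        simp only
        rw [ht]
        refine (integral_fst_eq (μ t) (f := fun x => ⟪H t x, B (t, x)⟫) ?_).symm
        exact (h.measurable_H.comp measurable_prodMk_left).inner
          (hB.smooth.continuous.comp (by fun_prop)).measurable
      · congr 1
        refine integral_congr_ae (hκ.mono fun t ht => ?_)
        simp only
        rw [ht]
        refine integral_congr_ae (ae_of_all _ fun q => ?_)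
        simp only
        rw [(hasFDerivAt_space (hdiff (t, q.1))).fderiv]
        rfl
    · intro t ht
      rw [hz t ht]
      simp [divergence]
    · intro t ht
      simp [hB0 t ht]
  · filter_upwards [hae h.deGiorgi, ae_restrict_mem measurableSet_Ioc, hκ] with τ hτ hτm hκτ
    rw [eV τ hτm, eH τ hτm, hfstu, hfstu, ← hκτ] at hτ
    simp only [Real.norm_eq_abs, sq_abs] at hτ
    have e1 : κ τ univ = ENNReal.ofReal ((κ τ).real univ) := (ofReal_measureReal).symm
    have e2 : μ₀ univ = ENNReal.ofReal (μ₀.real univ) := (ofReal_measureReal).symm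
    have e3 : (2⁻¹ : ℝ≥0∞) = ENNReal.ofReal 2⁻¹ := by
      rw [ENNReal.ofReal_inv_of_pos (by norm_num)]; simp
    have p1 : 0 ≤ ∫ t in Ioc 0 τ, ∫ q, V t q.1 ^ 2 ∂(κ t) :=
      integral_nonneg fun t => integral_nonneg fun q => sq_nonneg _
    have p2 : 0 ≤ ∫ t in Ioc 0 τ, ∫ q, ‖H t q.1‖ ^ 2 ∂(κ t) :=
      integral_nonneg fun t => integral_nonneg fun q => by positivity
    rw [e1, e2, e3, ← ENNReal.ofReal_mul (by norm_num), ← ENNReal.ofReal_mul (by norm_num),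
      ← ENNReal.ofReal_add measureReal_nonneg (by positivity),
      ← ENNReal.ofReal_add (by positivity) (by positivity),
      ENNReal.ofReal_le_ofReal_iff measureReal_nonneg] at hτ
    exact hτ
  · filter_upwards [hae h.compatible, hκ] with t ht hκt X hX
    rw [hκt]
    exact ht.integral_eq hX

end

section

/-! ### Admissible test functions on a time slab -/

section Squeeze

/-- Contraction of the time axis around the midpoint of `[0,T]`. -/
def squeeze (T : ℝ) (n : ℕ) (t : ℝ) : ℝ := T / 2 + (1 - 1 / ((n : ℝ) + 2)) * (t - T / 2)

/-- A time cutoff equal to one on `[0,T]`. -/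
def timeBump {T : ℝ} (hT : 0 < T) (n : ℕ) : ContDiffBump (T / 2) where
  rIn := T / 2
  rOut := T / 2 * (1 + 1 / ((n : ℝ) + 2))
  rIn_pos := by positivity
  rIn_lt_rOut := by
    have : 0 < 1 / ((n : ℝ) + 2) := by positivity
    nlinarith

/-- A space cutoff equal to one on a large ball. -/
def spaceBump (d : ℕ) (n : ℕ) : ContDiffBump (0 : Euc d) where
  rIn := n + 1
  rOut := n + 2
  rIn_pos := by positivity
  rIn_lt_rOut := by linarith

variable {T : ℝ}

theorem squeeze_factor (n : ℕ) : 0 ≤ 1 - 1 / ((n : ℝ) + 2) ∧ 1 - 1 / ((n : ℝ) + 2) < 1 := by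
  have h1 : 0 < 1 / ((n : ℝ) + 2) := by positivity
  have h2 : 1 / ((n : ℝ) + 2) ≤ 1 := by
    rw [div_le_one (by positivity)]; linarith [Nat.cast_nonneg (α := ℝ) n]
  constructor <;> linarith

/-- The contraction allows a function that is smooth only on [0,T] to be evaluated at interior
times, even on the slightly larger support of the time cutoff: with c = 1/(n+2) one has (1 - c)(1 +
c) < 1. -/
theorem squeeze_mem (hT : 0 < T) (n : ℕ) {t : ℝ}
    (ht : t ∈ Metric.closedBall (T / 2) (T / 2 * (1 + 1 / ((n : ℝ) + 2)))) :
    squeeze T n t ∈ Ioo 0 T := by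
  obtain ⟨h0, h1⟩ := squeeze_factor n
  set c := 1 / ((n : ℝ) + 2) with hc
  have hcpos : 0 < c := by positivity
  rw [Metric.mem_closedBall, Real.dist_eq] at ht
  have h2 : |(1 - c) * (t - T / 2)| < T / 2 := by
    rw [abs_mul, abs_of_nonneg h0]
    calc (1 - c) * |t - T / 2| ≤ (1 - c) * (T / 2 * (1 + c)) := mul_le_mul_of_nonneg_left ht h0
      _ < T / 2 := by nlinarith [mul_pos hT (mul_pos hcpos hcpos)]
  rw [abs_lt] at h2
  simp only [squeeze, ← hc]
  constructor <;> linarith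

theorem squeeze_mem_of_Icc (hT : 0 < T) (n : ℕ) {t : ℝ} (ht : t ∈ Icc 0 T) :
    squeeze T n t ∈ Ioo 0 T := by
  refine squeeze_mem hT n ?_
  rw [Metric.mem_closedBall, Real.dist_eq, abs_le]
  have : 0 < T / 2 * (1 / ((n : ℝ) + 2)) := by positivity
  constructor <;> nlinarith [ht.1, ht.2]

theorem tendsto_squeeze (t : ℝ) : Tendsto (fun n => squeeze T n t) atTop (𝓝 t) := by
  have h0 : Tendsto (fun n : ℕ => 1 / ((n : ℝ) + 2)) atTop (𝓝 0) :=
    tendsto_const_nhds.div_atTop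
      (tendsto_atTop_add_const_right _ _ tendsto_natCast_atTop_atTop)
  have h1 : Tendsto (fun n : ℕ => T / 2 + (1 - 1 / ((n : ℝ) + 2)) * (t - T / 2)) atTop
      (𝓝 (T / 2 + (1 - 0) * (t - T / 2))) :=
    ((h0.const_sub 1).mul_const _).const_add _
  simpa [squeeze] using h1

theorem tendsto_squeeze_factor : Tendsto (fun n : ℕ => 1 - 1 / ((n : ℝ) + 2)) atTop (𝓝 1) := by
  have h0 : Tendsto (fun n : ℕ => 1 / ((n : ℝ) + 2)) atTop (𝓝 0) :=
    tendsto_const_nhds.div_atTop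
      (tendsto_atTop_add_const_right _ _ tendsto_natCast_atTop_atTop)
  simpa using h0.const_sub 1

theorem hasDerivAt_squeeze (n : ℕ) (t : ℝ) :
    HasDerivAt (squeeze T n) (1 - 1 / ((n : ℝ) + 2)) t := by
  have := (((hasDerivAt_id t).sub_const (T / 2)).const_mul (1 - 1 / ((n : ℝ) + 2))).const_add (T / 2)
  rw [mul_one] at this
  exact this

variable {d : ℕ}

/-- Smooth compactly supported approximations of a function on a time slab. -/
def approxTest (hT : 0 < T) (f : ℝ × Euc d → ℝ) (n : ℕ) (q : ℝ × Euc d) : ℝ :=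
  timeBump hT n q.1 * (f (squeeze T n q.1, q.2) * spaceBump d n q.2)

theorem isTest_approxTest (hT : 0 < T) {f : ℝ × Euc d → ℝ} (hf : SlabSmooth T f) (n : ℕ) :
    IsTest (approxTest hT f n) := by
  have hψ : ContDiff ℝ ∞ (timeBump hT n : ℝ → ℝ) := (timeBump hT n).contDiff
  have hβ : ContDiff ℝ ∞ (spaceBump d n : Euc d → ℝ) := (spaceBump d n).contDiff
  constructor
  · rw [contDiff_iff_contDiffAt]
    rintro ⟨t, x⟩
    by_cases ht : t ∈ tsupport (timeBump hT n)
    · rw [(timeBump hT n).tsupport_eq] at ht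
      have hm := squeeze_mem hT n ht
      have hs : ContDiff ℝ ∞ fun q : ℝ × Euc d => (squeeze T n q.1, q.2) := by
        unfold squeeze; fun_prop
      have h1 : ContDiffAt ℝ ∞ (fun q : ℝ × Euc d => f (squeeze T n q.1, q.2)) (t, x) :=
        ContDiffAt.comp (t, x) (hf.contDiffAt hm x) hs.contDiffAt
      exact ((hψ.comp contDiff_fst).contDiffAt).mul
        (h1.mul ((hβ.comp contDiff_snd).contDiffAt))
    · have : approxTest hT f n =ᶠ[𝓝 (t, x)] fun _ => 0 := by
        have h2 := (notMem_tsupport_iff_eventuallyEq.1 ht)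
        have h3 := (continuous_fst.tendsto (t, x)).eventually h2
        filter_upwards [h3] with q hq
        simp only [approxTest]
        rw [hq]; simp
      exact contDiffAt_const.congr_of_eventuallyEq this
  · refine HasCompactSupport.intro ((timeBump hT n).hasCompactSupport.isCompact.prod
      (spaceBump d n).hasCompactSupport.isCompact) ?_
    rintro ⟨t, x⟩ hq
    simp only [approxTest]
    by_cases ht : t ∈ tsupport (timeBump hT n)
    · have hx : x ∉ tsupport (spaceBump d n) := fun hx => hq ⟨ht, hx⟩
      rw [image_eq_zero_of_notMem_tsupport hx]; simp
    · rw [image_eq_zero_of_notMem_tsupport ht]; simp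

theorem approxTest_eq (hT : 0 < T) (f : ℝ × Euc d → ℝ) (n : ℕ) {t : ℝ} (ht : t ∈ Icc 0 T)
    (x : Euc d) : approxTest hT f n (t, x) = f (squeeze T n t, x) * spaceBump d n x := by
  have : t ∈ Metric.closedBall (T / 2) (timeBump hT n).rIn := by
    change t ∈ Metric.closedBall (T / 2) (T / 2)
    rw [Real.closedBall_eq_Icc]; convert ht using 2 <;> ring
  simp only [approxTest]
  rw [(timeBump hT n).one_of_mem_closedBall this, one_mul]

theorem timeDeriv_approxTest (hT : 0 < T) {f : ℝ × Euc d → ℝ} (hf : SlabSmooth T f) (n : ℕ)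
    {t : ℝ} (ht : t ∈ Ioo 0 T) (x : Euc d) :
    timeDeriv (approxTest hT f n) (t, x)
      = (1 - 1 / ((n : ℝ) + 2)) * timeDeriv f (squeeze T n t, x) * spaceBump d n x := by
  have h1 := hasDerivAt_time
    ((isTest_approxTest hT hf n).smooth.differentiable (by simp) (t, x))
  have h2 := ((hasDerivAt_time (hf.differentiableAt
    (squeeze_mem_of_Icc hT n (Ioo_subset_Icc_self ht)) x)).comp t
      (hasDerivAt_squeeze (T := T) n t)).mul_const (spaceBump d n x : ℝ)
  have h3 : (fun s => approxTest hT f n (s, x)) =ᶠ[𝓝 t]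
      fun s => ((fun s => f (s, x)) ∘ squeeze T n) s * spaceBump d n x := by
    filter_upwards [Icc_mem_nhds ht.1 ht.2] with s hs
    exact approxTest_eq hT f n hs x
  rw [h1.unique (h2.congr_of_eventuallyEq h3)]
  ring

theorem tendsto_spaceBump (x : Euc d) : ∀ᶠ n in atTop, (spaceBump d n x : ℝ) = 1 := by
  filter_upwards [tendsto_natCast_atTop_atTop.eventually_ge_atTop ‖x‖] with n hn
  refine (spaceBump d n).one_of_mem_closedBall ?_
  change x ∈ Metric.closedBall 0 ((n : ℝ) + 1)
  simp; linarith

theorem tendsto_approxTest (hT : 0 < T) {f : ℝ × Euc d → ℝ} (hf : SlabSmooth T f) {t : ℝ}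
    (ht : t ∈ Icc 0 T) (x : Euc d) :
    Tendsto (fun n => approxTest hT f n (t, x)) atTop (𝓝 (f (t, x))) := by
  have h1 : Tendsto (fun n => squeeze T n t) atTop (𝓝[Icc 0 T] t) :=
    tendsto_nhdsWithin_iff.2 ⟨tendsto_squeeze t, Eventually.of_forall fun n =>
      Ioo_subset_Icc_self (squeeze_mem_of_Icc hT n ht)⟩
  have h2 := (hf.time_continuousOn x t ht).tendsto.comp h1
  refine h2.congr' ?_
  filter_upwards [tendsto_spaceBump x] with n hn
  rw [approxTest_eq hT f n ht, hn, mul_one]; rfl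

theorem tendsto_timeDeriv_approxTest (hT : 0 < T) {f : ℝ × Euc d → ℝ} (hf : SlabSmooth T f) {t : ℝ}
    (ht : t ∈ Ioo 0 T) (x : Euc d) :
    Tendsto (fun n => timeDeriv (approxTest hT f n) (t, x)) atTop (𝓝 (timeDeriv f (t, x))) := by
  have hc : ContinuousAt (timeDeriv f) (t, x) := by
    have h1 : ContinuousAt (fderiv ℝ f) (t, x) :=
      ((hf.contDiffAt ht x).fderiv_right (m := ∞) (by simp)).continuousAt
    exact h1.clm_apply continuousAt_const
  have h1 : Tendsto (fun n => (squeeze T n t, x)) atTop (𝓝 (t, x)) :=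
    (tendsto_squeeze t).prodMk_nhds tendsto_const_nhds
  have h2 := tendsto_squeeze_factor.mul (hc.tendsto.comp h1)
  rw [one_mul] at h2
  refine h2.congr' ?_
  filter_upwards [tendsto_spaceBump x] with n hn
  rw [timeDeriv_approxTest hT hf n ht, hn, mul_one]; rfl

theorem abs_approxTest_le (hT : 0 < T) {f : ℝ × Euc d → ℝ} {M : ℝ}
    (hM : ∀ t ∈ Icc 0 T, ∀ x, |f (t, x)| ≤ M) (n : ℕ) {t : ℝ} (ht : t ∈ Icc 0 T) (x : Euc d) :
    |approxTest hT f n (t, x)| ≤ M := by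
  rw [approxTest_eq hT f n ht, abs_mul, abs_of_nonneg (spaceBump d n).nonneg]
  have h := hM _ (Ioo_subset_Icc_self (squeeze_mem_of_Icc hT n ht)) x
  exact (mul_le_of_le_one_right (abs_nonneg _) (spaceBump d n).le_one).trans h

theorem abs_timeDeriv_approxTest_le (hT : 0 < T) {f : ℝ × Euc d → ℝ} (hf : SlabSmooth T f) {M : ℝ}
    (hM : ∀ t ∈ Ioo 0 T, ∀ x, |timeDeriv f (t, x)| ≤ M) (n : ℕ) {t : ℝ} (ht : t ∈ Ioo 0 T)
    (x : Euc d) : |timeDeriv (approxTest hT f n) (t, x)| ≤ M := by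
  rw [timeDeriv_approxTest hT hf n ht, abs_mul, abs_mul, abs_of_nonneg (spaceBump d n).nonneg,
    abs_of_nonneg (squeeze_factor n).1]
  have h := hM _ (squeeze_mem_of_Icc hT n (Ioo_subset_Icc_self ht)) x
  refine (mul_le_of_le_one_right (by have := (squeeze_factor n).1; positivity)
    (spaceBump d n).le_one).trans ?_
  exact (mul_le_of_le_one_left (abs_nonneg _) (squeeze_factor n).2.le).trans h

end Squeeze

end

/-! ### Evolution equation and first variation for smooth functions on the slab. -/

section


section CompProd

variable {α β : Type*} {mα : MeasurableSpace α} {mβ : MeasurableSpace β} {μ : Measure α} [SFinite μ]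
  {κ : Kernel α β} [IsSFiniteKernel κ] {f : α × β → ℝ}

theorem integrable_integral_of_compProd (hf : Integrable f (μ ⊗ₘ κ)) :
    Integrable (fun a => ∫ b, f (a, b) ∂(κ a)) μ := by
  have := Integrable.integral_compProd (κ := Kernel.const Unit μ) (η := Kernel.prodMkLeft Unit κ)
    (a := ()) hf
  simpa using this

theorem ae_integrable_of_compProd {F : Type*} [NormedAddCommGroup F] {f : α × β → F}
    (hf : Integrable f (μ ⊗ₘ κ)) :
    ∀ᵐ a ∂μ, Integrable (fun b => f (a, b)) (κ a) :=
  ((Measure.integrable_compProd_iff hf.aestronglyMeasurable).1 hf).1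

theorem aestronglyMeasurable_integral_of_compProd (hf : AEStronglyMeasurable f (μ ⊗ₘ κ)) :
    AEStronglyMeasurable (fun a => ∫ b, f (a, b) ∂(κ a)) μ := by
  have := AEStronglyMeasurable.integral_kernel_compProd (κ := Kernel.const Unit μ)
    (η := Kernel.prodMkLeft Unit κ) (a := ()) hf
  simpa using this

end CompProd

variable {d : ℕ} {T σ m₀ : ℝ} {A₀ : Set (Euc d)} {κ : Kernel ℝ (Euc d × Sph d)}
  {A : ℝ → Set (Euc d)} {V : ℝ → Euc d → ℝ} {H : ℝ → Euc d → Euc d}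

theorem ae_compProd_mem_Ioo [IsFiniteKernel κ] :
    ∀ᵐ q ∂((volume.restrict (Ioc 0 T)) ⊗ₘ κ), q.1 ∈ Ioo 0 T := by
  refine Measure.ae_compProd_of_ae_fst κ measurableSet_Ioo ?_
  rw [← restrict_Ioo_eq_restrict_Ioc]
  exact ae_restrict_mem measurableSet_Ioo

theorem SlabSmooth.aestronglyMeasurable_compProd {G : Type*} [NormedAddCommGroup G]
    [NormedSpace ℝ G] [SecondCountableTopology G] [MeasurableSpace G] [BorelSpace G]
    [IsFiniteKernel κ] {F : ℝ × Euc d → G} (hF : SlabSmooth T F) :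
    AEStronglyMeasurable (fun q : ℝ × (Euc d × Sph d) => F (q.1, q.2.1))
      ((volume.restrict (Ioc 0 T)) ⊗ₘ κ) := by
  have h1 : Measurable fun q : ℝ × (Euc d × Sph d) =>
      (Icc 0 T ×ˢ univ).indicator F (q.1, q.2.1) :=
    hF.measurable_slab_indicator.comp (by fun_prop)
  refine h1.aestronglyMeasurable.congr ?_
  filter_upwards [ae_compProd_mem_Ioo (T := T) (κ := κ)] with q hq
  exact indicator_of_mem (show (q.1, q.2.1) ∈ Icc 0 T ×ˢ univ from
    ⟨Ioo_subset_Icc_self hq, mem_univ _⟩) F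

theorem SlabSmooth.integrable_compProd [IsFiniteKernel κ] {f : ℝ × Euc d → ℝ} (hf : SlabSmooth T f)
    {M : ℝ} (hM : ∀ t ∈ Icc 0 T, ∀ x, |f (t, x)| ≤ M) :
    Integrable (fun q : ℝ × (Euc d × Sph d) => f (q.1, q.2.1))
      ((volume.restrict (Ioc 0 T)) ⊗ₘ κ) := by
  refine (integrable_const M).mono' hf.aestronglyMeasurable_compProd ?_
  filter_upwards [ae_compProd_mem_Ioo (T := T) (κ := κ)] with q hq
  exact hM _ (Ioo_subset_Icc_self hq) _

namespace SlabSolution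

theorem integrable_V (h : SlabSolution T σ m₀ A₀ κ A V H) :
    Integrable (fun q : ℝ × (Euc d × Sph d) => V q.1 q.2.1) ((volume.restrict (Ioc 0 T)) ⊗ₘ κ) := by
  have := h.finite
  refine ((integrable_const (1 : ℝ)).add h.sq_V).mono' ?_ (ae_of_all _ fun q => ?_)
  · exact (h.measurable_V.comp
      (measurable_fst.prodMk (measurable_fst.comp measurable_snd))).aestronglyMeasurable
  · simp only [Pi.add_apply, Real.norm_eq_abs]
    nlinarith [sq_nonneg (|V q.1 q.2.1| - 1), sq_abs (V q.1 q.2.1)]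

theorem integrable_H (h : SlabSolution T σ m₀ A₀ κ A V H) :
    Integrable (fun q : ℝ × (Euc d × Sph d) => H q.1 q.2.1) ((volume.restrict (Ioc 0 T)) ⊗ₘ κ) := by
  have := h.finite
  refine ((integrable_const (1 : ℝ)).add h.sq_H).mono' ?_ (ae_of_all _ fun q => ?_)
  · exact (h.measurable_H.comp
      (measurable_fst.prodMk (measurable_fst.comp measurable_snd))).aestronglyMeasurable
  · simp only [Pi.add_apply]
    nlinarith [sq_nonneg (‖H q.1 q.2.1‖ - 1)]

/-- The space-time region of the phase is only null measurable. Measurability in time comes from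
Fubini's theorem applied to its indicator. -/
theorem aestronglyMeasurable_phase (h : SlabSolution T σ m₀ A₀ κ A V H) {g : ℝ × Euc d → ℝ}
    (hg : AEStronglyMeasurable g ((volume.restrict (Ioc 0 T)).prod volume)) :
    AEStronglyMeasurable (fun t => ∫ x in A t, g (t, x)) (volume.restrict (Ioc 0 T)) := by
  set P : Set (ℝ × Euc d) := {q | 0 < q.1 ∧ q.2 ∈ A q.1}
  have hle : (volume.restrict (Ioc 0 T)).prod (volume : Measure (Euc d))
      ≪ (volume : Measure (ℝ × Euc d)) := by
    rw [Measure.volume_eq_prod]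
    exact Measure.AbsolutelyContinuous.prod Measure.absolutelyContinuous_restrict .rfl
  have h1 : AEStronglyMeasurable (P.indicator g)
      ((volume.restrict (Ioc 0 T)).prod (volume : Measure (Euc d))) :=
    hg.indicator₀ (h.phase.mono_ac hle)
  refine (h1.integral_prod_right').congr ?_
  refine (ae_restrict_iff' measurableSet_Ioc).2 (ae_of_all _ fun t ht => ?_)
  simp only
  rw [← integral_indicator (h.isOpen t ht.1).measurableSet]
  refine integral_congr_ae (ae_of_all _ fun x => ?_)
  by_cases hx : x ∈ A t
  · simp [P, indicator, hx, ht.1]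
  · simp [P, indicator, hx]

theorem aestronglyMeasurable_timeDeriv {f : ℝ × Euc d → ℝ} (hf : SlabSmooth T f) :
    AEStronglyMeasurable (timeDeriv f) ((volume.restrict (Ioc 0 T)).prod volume) := by
  rw [← restrict_Ioo_eq_restrict_Ioc]
  have h2 : (volume.restrict (Ioo 0 T)).prod (volume : Measure (Euc d))
      = (volume.prod volume).restrict (Ioo 0 T ×ˢ univ) := by
    rw [← Measure.prod_restrict, Measure.restrict_univ]
  rw [h2]
  refine ContinuousOn.aestronglyMeasurable ?_ (measurableSet_Ioo.prod .univ)
  rintro ⟨t, x⟩ ⟨ht, -⟩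
  have h1 : ContinuousAt (fderiv ℝ f) (t, x) :=
    ((hf.contDiffAt ht x).fderiv_right (m := ∞) (by simp)).continuousAt
  exact (h1.clm_apply continuousAt_const).continuousWithinAt

/-- The evolution equation for test functions that are smooth and bounded on the slab. -/
theorem evolution_slab (h : SlabSolution T σ m₀ A₀ κ A V H) (hT : 0 < T) {f : ℝ × Euc d → ℝ}
    (hf : SlabSmooth T f) {M : ℝ} (hM : ∀ t ∈ Icc 0 T, ∀ x, |f (t, x)| ≤ M)
    (hM' : ∀ t ∈ Ioo 0 T, ∀ x, |timeDeriv f (t, x)| ≤ M) :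
    ∀ᵐ τ ∂(volume.restrict (Ioc 0 T)),
      σ * (∫ x in A τ, f (τ, x)) - σ * (∫ x in A₀, f (0, x))
        = σ * (∫ t in Ioc 0 τ, ∫ x in A t, timeDeriv f (t, x))
          - ∫ t in Ioc 0 τ, ∫ q, V t q.1 * f (t, q.1) ∂(κ t) := by
  have := h.finite
  have hM0 : 0 ≤ M := (abs_nonneg _).trans (hM 0 ⟨le_rfl, hT.le⟩ 0)
  obtain ⟨W, hW⟩ := h.volume_le
  set ζ := approxTest hT f with hζ
  have hζt : ∀ n, IsTest (ζ n) := isTest_approxTest hT hf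
  have hslice : ∀ n t, Continuous fun x => ζ n (t, x) := fun n t =>
    (hζt n).smooth.continuous.comp (by fun_prop)
  -- Constants dominate on sets of finite volume, so f need not have compact support in space.
  have hlim1 : ∀ S : Set (Euc d), volume S ≠ ⊤ → ∀ t ∈ Icc 0 T,
      Tendsto (fun n => ∫ x in S, ζ n (t, x)) atTop (𝓝 (∫ x in S, f (t, x))) := by
    intro S hS t ht
    have : IsFiniteMeasure (volume.restrict S) := ⟨by simpa using hS.lt_top⟩
    exact tendsto_integral_of_dominated_convergence (fun _ => M)
      (fun n => (hslice n t).aestronglyMeasurable) (integrable_const _)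
      (fun n => ae_of_all _ fun x => abs_approxTest_le hT hM n ht x)
      (ae_of_all _ fun x => tendsto_approxTest hT hf ht x)
  have hVt : ∀ t, Measurable (V t) := fun t => h.measurable_V.comp measurable_prodMk_left
  have hV1 := h.integrable_V.norm
  have hIoo : ∀ᵐ t ∂(volume.restrict (Ioc 0 T)), t ∈ Ioo 0 T := by
    rw [← restrict_Ioo_eq_restrict_Ioc]
    exact ae_restrict_mem measurableSet_Ioo
  -- The exceptional set of times in the evolution equation does not depend on the test function,
  -- hence not on n.
  filter_upwards [h.evolution, hIoo, hW] with τ hτ hτm hWτ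
  have hsub : Ioc 0 τ ⊆ Ioc 0 T := Ioc_subset_Ioc_right hτm.2.le
  have hres : ∀ {p : ℝ → Prop}, (∀ᵐ t ∂(volume.restrict (Ioc 0 T)), p t) →
      ∀ᵐ t ∂(volume.restrict (Ioc 0 τ)), p t := fun hp =>
    ae_restrict_of_ae_restrict_of_subset hsub hp
  have l1 := ((hlim1 (A τ) (ne_top_of_le_ne_top ENNReal.coe_ne_top hWτ) τ
    (Ioo_subset_Icc_self hτm)).const_mul σ).sub
    ((hlim1 A₀ h.volume_initial 0 ⟨le_rfl, hT.le⟩).const_mul σ)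
  have l2 : Tendsto (fun n => ∫ t in Ioc 0 τ, ∫ x in A t, timeDeriv (ζ n) (t, x)) atTop
      (𝓝 (∫ t in Ioc 0 τ, ∫ x in A t, timeDeriv f (t, x))) := by
    refine tendsto_integral_of_dominated_convergence (fun _ => M * W) (fun n => ?_)
      (integrable_const _) (fun n => ?_) ?_
    · refine (h.aestronglyMeasurable_phase ?_).mono_measure (Measure.restrict_mono_set _ hsub)
      exact aestronglyMeasurable_timeDeriv (hζt n).smooth.contDiffOn
    · filter_upwards [hres hIoo, hres hW] with t ht hWt
      refine (norm_setIntegral_le_of_norm_le_const (hWt.trans_lt ENNReal.coe_lt_top)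
        fun x _ => abs_timeDeriv_approxTest_le hT hf hM' n ht x).trans ?_
      exact mul_le_mul_of_nonneg_left (ENNReal.toReal_le_coe_of_le_coe hWt) hM0
    · filter_upwards [hres hIoo, hres hW] with t ht hWt
      have : IsFiniteMeasure (volume.restrict (A t)) :=
        ⟨by simpa using hWt.trans_lt ENNReal.coe_lt_top⟩
      refine tendsto_integral_of_dominated_convergence (fun _ => M)
        (fun n => Continuous.aestronglyMeasurable ?_) (integrable_const _)
        (fun n => ae_of_all _ fun x => abs_timeDeriv_approxTest_le hT hf hM' n ht x)
        (ae_of_all _ fun x => tendsto_timeDeriv_approxTest hT hf ht x)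
      have h1 : Continuous fun q => timeDeriv (ζ n) q :=
        ((hζt n).smooth.continuous_fderiv (by simp)).clm_apply continuous_const
      exact h1.comp (by fun_prop : Continuous fun x : Euc d => ((t, x) : ℝ × Euc d))
  have l3 : Tendsto (fun n => ∫ t in Ioc 0 τ, ∫ q, V t q.1 * ζ n (t, q.1) ∂(κ t)) atTop
      (𝓝 (∫ t in Ioc 0 τ, ∫ q, V t q.1 * f (t, q.1) ∂(κ t))) := by
    have hb : ∀ n, ∀ t ∈ Ioo 0 T, ∀ x, ‖V t x * ζ n (t, x)‖ ≤ ‖V t x‖ * M := by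
      intro n t ht x
      rw [norm_mul]
      exact mul_le_mul_of_nonneg_left
        (abs_approxTest_le hT hM n (Ioo_subset_Icc_self ht) x) (norm_nonneg _)
    refine tendsto_integral_of_dominated_convergence
      (fun t => ∫ q, ‖V t q.1‖ * M ∂(κ t)) (fun n => ?_) ?_ (fun n => ?_) ?_
    · have h1 : AEStronglyMeasurable
          (fun q : ℝ × (Euc d × Sph d) => V q.1 q.2.1 * ζ n (q.1, q.2.1))
          ((volume.restrict (Ioc 0 T)) ⊗ₘ κ) := by
        refine h.integrable_V.aestronglyMeasurable.mul ?_
        exact ((hζt n).smooth.continuous.comp (by fun_prop)).aestronglyMeasurable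
      exact (aestronglyMeasurable_integral_of_compProd h1).mono_measure
        (Measure.restrict_mono_set _ hsub)
    · exact (integrable_integral_of_compProd (hV1.mul_const M)).mono_measure
        (Measure.restrict_mono_set _ hsub)
    · filter_upwards [hres hIoo, hres (ae_integrable_of_compProd hV1)] with t ht hi
      refine norm_integral_le_of_norm_le (hi.mul_const M) (ae_of_all _ fun q => ?_)
      exact hb n t ht q.1
    · filter_upwards [hres hIoo, hres (ae_integrable_of_compProd hV1)] with t ht hi
      refine tendsto_integral_of_dominated_convergence (fun q => ‖V t q.1‖ * M)
        (fun n => ?_) (hi.mul_const M) (fun n => ae_of_all _ fun q => hb n t ht q.1)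
        (ae_of_all _ fun q =>
          (tendsto_approxTest hT hf (Ioo_subset_Icc_self ht) q.1).const_mul _)
      exact (((hVt t).comp measurable_fst).mul
        (((hslice n t).measurable).comp measurable_fst)).aestronglyMeasurable
  have l4 := (l2.const_mul σ).sub l3
  refine tendsto_nhds_unique l1 (l4.congr fun n => ?_)
  exact (hτ (ζ n) (hζt n)).symm

/-- The first variation identity at almost every time. -/
theorem curvature_slab (h : SlabSolution T σ m₀ A₀ κ A V H) (hT : 0 < T) {B : ℝ × Euc d → Euc d}
    (hB : SlabField T B) :
    ∀ᵐ t ∂(volume.restrict (Ioc 0 T)),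
      ∫ q, ⟪H t q.1, B (t, q.1)⟫ ∂(κ t)
        = - ∫ q : Euc d × Sph d, (spaceDiv B (t, q.1)
            - ⟪(q.2 : Euc d), spaceDeriv B (t, q.1) (q.2 : Euc d)⟫) ∂(κ t) := by
  have := h.finite
  obtain ⟨M, hM0, hM⟩ := hB.exists_bound
  obtain ⟨M1, hM10, hM1⟩ := (hB.spaceDiv hT).exists_bound
  obtain ⟨M2, hM20, hM2⟩ := hB.exists_bound_fderiv hT
  have i1 : Integrable (fun q : ℝ × (Euc d × Sph d) => ⟪H q.1 q.2.1, B (q.1, q.2.1)⟫)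
      ((volume.restrict (Ioc 0 T)) ⊗ₘ κ) := by
    refine (h.integrable_H.norm.mul_const M).mono'
      (h.integrable_H.aestronglyMeasurable.inner hB.smooth.aestronglyMeasurable_compProd) ?_
    filter_upwards [ae_compProd_mem_Ioo (T := T) (κ := κ)] with q hq
    refine (norm_inner_le_norm _ _).trans ?_
    exact mul_le_mul_of_nonneg_left (hM _ (Ioo_subset_Icc_self hq) _) (norm_nonneg _)
  have i2 : Integrable (fun q : ℝ × (Euc d × Sph d) => spaceDiv B (q.1, q.2.1))
      ((volume.restrict (Ioc 0 T)) ⊗ₘ κ) := (hB.spaceDiv hT).smooth.integrable_compProd hM1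
  have i3 : Integrable (fun q : ℝ × (Euc d × Sph d) =>
      ⟪(q.2.2 : Euc d), spaceDeriv B (q.1, q.2.1) (q.2.2 : Euc d)⟫)
      ((volume.restrict (Ioc 0 T)) ⊗ₘ κ) := by
    have hp : Measurable fun q : ℝ × (Euc d × Sph d) => (q.2.2 : Euc d) :=
      measurable_subtype_coe.comp (measurable_snd.comp measurable_snd)
    have h1 := (hB.fderivWithin hT).smooth.aestronglyMeasurable_compProd (κ := κ)
    have h2 : AEStronglyMeasurable (fun q : ℝ × (Euc d × Sph d) =>
        fderivWithin ℝ B (Icc 0 T ×ˢ univ) (q.1, q.2.1) (0, (q.2.2 : Euc d)))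
        ((volume.restrict (Ioc 0 T)) ⊗ₘ κ) :=
      isBoundedBilinearMap_apply.continuous.comp_aestronglyMeasurable
        (h1.prodMk (measurable_const.prodMk hp).aestronglyMeasurable)
    refine (integrable_const M2).mono' ((hp.aestronglyMeasurable.inner h2).congr ?_) ?_
    · filter_upwards [ae_compProd_mem_Ioo (T := T) (κ := κ)] with q hq
      rw [fderivWithin_slab hq]; rfl
    · filter_upwards [ae_compProd_mem_Ioo (T := T) (κ := κ)] with q hq
      have hq1 : ‖(q.2.2 : Euc d)‖ = 1 := by simp
      refine (norm_inner_le_norm _ _).trans ?_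
      rw [hq1, one_mul]
      refine (ContinuousLinearMap.le_opNorm (fderiv ℝ B (q.1, q.2.1)) (0, (q.2.2 : Euc d))).trans ?_
      have : ‖((0 : ℝ), (q.2.2 : Euc d))‖ = 1 := by simp [Prod.norm_def]
      rw [this, mul_one]
      exact hM2 _ hq _
  have i23 := i2.sub i3
  set g : ℝ → ℝ := fun t => ∫ q, ⟪H t q.1, B (t, q.1)⟫ ∂(κ t)
    + ∫ q : Euc d × Sph d, (spaceDiv B (t, q.1)
            - ⟪(q.2 : Euc d), spaceDeriv B (t, q.1) (q.2 : Euc d)⟫) ∂(κ t) with hg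
  have j1 := integrable_integral_of_compProd i1
  have j2 := integrable_integral_of_compProd i23
  have hgi : Integrable g (volume.restrict (Ioc 0 T)) := j1.add j2
  have hgo : IntegrableOn g (Ioo 0 T) := IntegrableOn.mono_set hgi Ioo_subset_Ioc_self
  -- Localization in time: the identity tested with η(t) B for all η ∈ C_c^∞(0,T) forces g to vanish
  -- almost everywhere.
  have key := isOpen_Ioo.ae_eq_zero_of_integral_contDiff_smul_eq_zero (U := Ioo 0 T)
    (μ := volume) hgo.locallyIntegrableOn (fun η hη hηc hηs => ?_)
  · rw [← restrict_Ioo_eq_restrict_Ioc, ae_restrict_iff' measurableSet_Ioo]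
    filter_upwards [key] with t ht htm
    linarith [ht htm]
  · have hη0 : ∀ t ∉ Ioo 0 T, η t = 0 := fun t ht =>
      image_eq_zero_of_notMem_tsupport fun h' => ht (hηs h')
    have htest : IsTest fun q : ℝ × Euc d => η q.1 • B q := by
      constructor
      · rw [contDiff_iff_contDiffAt]
        rintro ⟨t, x⟩
        by_cases ht : t ∈ tsupport η
        · exact ((hη.comp contDiff_fst).contDiffAt).smul (hB.smooth.contDiffAt (hηs ht) x)
        · have h2 := (continuous_fst.tendsto (t, x)).eventually (notMem_tsupport_iff_eventuallyEq.1 ht)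
          refine contDiffAt_const (c := (0 : Euc d)) |>.congr_of_eventuallyEq ?_
          filter_upwards [h2] with q hq
          rw [hq]; simp
      · obtain ⟨R, hR⟩ := hB.supp
        refine HasCompactSupport.intro (hηc.isCompact.prod (isCompact_closedBall (0 : Euc d) R)) ?_
        rintro ⟨t, x⟩ hq
        by_cases ht : t ∈ tsupport η
        · have hx : R < ‖x‖ := by
            by_contra! hx
            exact hq ⟨ht, by simpa using hx⟩
          simp [hR t (Ioo_subset_Icc_self (hηs ht)) x hx]
        · simp [image_eq_zero_of_notMem_tsupport ht]
    have hcur := h.curvature _ htest fun t ht x => by simp [hη0 t ht]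
    have e1 : ∀ t, ∫ q, ⟪H t q.1, η t • B (t, q.1)⟫ ∂(κ t)
        = η t * ∫ q, ⟪H t q.1, B (t, q.1)⟫ ∂(κ t) := fun t => by
      simp_rw [inner_smul_right, integral_const_mul]
    have hIooae : ∀ᵐ t ∂(volume.restrict (Ioc 0 T)), t ∈ Ioo 0 T := by
      rw [← restrict_Ioo_eq_restrict_Ioc]
      exact ae_restrict_mem measurableSet_Ioo
    have e2 : ∀ t ∈ Ioo 0 T, ∫ q : Euc d × Sph d, (spaceDiv (fun q => η q.1 • B q) (t, q.1)
            - ⟪(q.2 : Euc d), spaceDeriv (fun q => η q.1 • B q) (t, q.1) (q.2 : Euc d)⟫) ∂(κ t)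
        = η t * ∫ q : Euc d × Sph d, (spaceDiv B (t, q.1)
            - ⟪(q.2 : Euc d), spaceDeriv B (t, q.1) (q.2 : Euc d)⟫) ∂(κ t) := by
      intro t ht
      rw [← integral_const_mul]
      refine integral_congr_ae (ae_of_all _ fun q => ?_)
      have hd := hB.smooth.differentiableAt ht q.1
      have hd' : DifferentiableAt ℝ (fun q : ℝ × Euc d => η q.1 • B q) (t, q.1) :=
        htest.smooth.differentiable (by simp) _
      have e3 : spaceDeriv (fun q => η q.1 • B q) (t, q.1) = η t • spaceDeriv B (t, q.1) :=
        (hasFDerivAt_space hd').unique ((hasFDerivAt_space hd).const_smul (η t))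
      simp only
      rw [spaceDiv_eq_traceL hd', spaceDiv_eq_traceL hd, e3, map_smul]
      simp only [smul_apply, inner_smul_right, smul_eq_mul]
      ring
    simp only [e1] at hcur
    rw [integral_congr_ae (hIooae.mono e2)] at hcur
    have hcη : Continuous η := hη.continuous
    obtain ⟨C, hC⟩ := hcη.bounded_above_of_compact_support hηc
    have j1' : Integrable (fun t => η t * ∫ q, ⟪H t q.1, B (t, q.1)⟫ ∂(κ t))
        (volume.restrict (Ioc 0 T)) :=
      j1.bdd_mul hcη.aestronglyMeasurable (ae_of_all _ hC)
    have j2' : Integrable (fun t => η t * ∫ q : Euc d × Sph d, (spaceDiv B (t, q.1)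
            - ⟪(q.2 : Euc d), spaceDeriv B (t, q.1) (q.2 : Euc d)⟫) ∂(κ t))
        (volume.restrict (Ioc 0 T)) :=
      j2.bdd_mul hcη.aestronglyMeasurable (ae_of_all _ hC)
    have e4 : ∫ t, η t • g t = ∫ t in Ioc 0 T, η t • g t := by
      refine (setIntegral_eq_integral_of_forall_compl_eq_zero fun t ht => ?_).symm
      rw [hη0 t fun h' => ht ⟨h'.1, h'.2.le⟩, zero_smul]
    rw [e4]
    simp only [hg, smul_eq_mul, mul_add]
    rw [integral_add j1' j2', hcur]
    ring

end SlabSolution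

end

section


/-! ### Calibrations -/

/-- A calibration of an evolving domain `𝒜`: an extension `ξ` of the inner unit normal, a velocity
field `B` and a weight `ϑ`, whose errors are controlled by a distance function `δ`. -/
structure Calibration {d : ℕ} (T M : ℝ) (𝒜 : ℝ → Set (Euc d)) (ξ B : ℝ × Euc d → Euc d)
    (ϑ δ : ℝ × Euc d → ℝ) : Prop where
  nonneg : 0 ≤ M
  xi_field : SlabField T ξ
  velocity_field : SlabField T B
  weight_smooth : SlabSmooth T ϑ
  weight_far : ∃ R : ℝ, ∀ t ∈ Icc 0 T, ∀ x : Euc d, R < ‖x‖ → ϑ (t, x) = 1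
  abs_weight_le_one : ∀ t ∈ Icc 0 T, ∀ x, |ϑ (t, x)| ≤ 1
  domain_eq : ∀ t ∈ Icc 0 T, 𝒜 t = {x | ϑ (t, x) < 0}
  norm_xi_le : ∀ t ∈ Icc 0 T, ∀ x, ‖ξ (t, x)‖ ≤ 1
  delta_nonneg : ∀ t ∈ Icc 0 T, ∀ x, 0 ≤ δ (t, x)
  delta_sq_le : ∀ t ∈ Icc 0 T, ∀ x, δ (t, x) ^ 2 ≤ 1 - ‖ξ (t, x)‖
  transport : ∀ t ∈ Ioo 0 T, ∀ x w, |⟪timeDeriv ξ (t, x), w⟫ + ⟪spaceDeriv ξ (t, x) (B (t, x)), w⟫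
    + ⟪ξ (t, x), spaceDeriv B (t, x) w⟫| ≤ M * δ (t, x) * ‖w‖
  transport_length : ∀ t ∈ Ioo 0 T, ∀ x,
    |⟪ξ (t, x), timeDeriv ξ (t, x) + spaceDeriv ξ (t, x) (B (t, x))⟫| ≤ M * δ (t, x) ^ 2
  curvature : ∀ t ∈ Ioo 0 T, ∀ x, ‖spaceDiv ξ (t, x) • ξ (t, x) + B (t, x)‖ ≤ M * δ (t, x)
  curvature_normal : ∀ t ∈ Ioo 0 T, ∀ x,
    |⟪B (t, x), ξ (t, x)⟫ + spaceDiv ξ (t, x)| ≤ M * δ (t, x)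
  abs_weight_le : ∀ t ∈ Ioo 0 T, ∀ x, |ϑ (t, x)| ≤ M * δ (t, x)
  weight_transport : ∀ t ∈ Ioo 0 T, ∀ x,
    |timeDeriv ϑ (t, x) + spaceDeriv ϑ (t, x) (B (t, x))| ≤ M * |ϑ (t, x)|
  weight_normal : ∀ t ∈ Icc 0 T, ∀ x, fderiv ℝ (fun y => ϑ (t, y)) x (ξ (t, x)) ≤ 0
  weight_tangential : ∀ t ∈ Icc 0 T, ∀ x w,
    |fderiv ℝ (fun y => ϑ (t, y)) x (w - ⟪w, ξ (t, x)⟫ • ξ (t, x))| ≤ M * ‖w‖ * |ϑ (t, x)|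
  weight_null : ∀ t ∈ Icc 0 T, volume {x | ϑ (t, x) = 0} = 0

/-! ### Pointwise inequalities for the two error densities. -/

section Pointwise

variable {E : Type*} [NormedAddCommGroup E] [InnerProductSpace ℝ E]

theorem norm_sub_sq_le_of_norm_eq_one {p ξ : E} (hp : ‖p‖ = 1) (hξ : ‖ξ‖ ≤ 1) :
    ‖p - ξ‖ ^ 2 ≤ 2 * (1 - ⟪p, ξ⟫) := by
  rw [norm_sub_sq_real, hp]
  nlinarith [norm_nonneg ξ]

theorem inner_le_norm_of_norm_eq_one {p ξ : E} (hp : ‖p‖ = 1) : ⟪p, ξ⟫ ≤ ‖ξ‖ := by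
  have := real_inner_le_norm p ξ
  rwa [hp, one_mul] at this

/-- In the application a = div ξ and b = div B. Completing squares in V and H leaves ½|a p + B|²,
where a p + B = (a ξ + B) + a(p - ξ). The remaining terms are the transport error tested with p - ξ,
its component along ξ, the product b(1 - p·ξ), and the quadratic form of DB at p - ξ. Errors of
first order in δ are always paired with another first order quantity, so everything is of order 1 -
p·ξ. -/
theorem entropy_density_le {p ξ B H ξt : E} {Dξ DB : E →L[ℝ] E} {V a b δ M M₁ : ℝ}
    (hp : ‖p‖ = 1) (hξ : ‖ξ‖ ≤ 1) (hM : 0 ≤ M) (hδ2 : δ ^ 2 ≤ 1 - ‖ξ‖)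
    (ha : |a| ≤ M₁) (hb : |b| ≤ M₁) (hDB : ‖DB‖ ≤ M₁)
    (h1 : ∀ w, |⟪ξt, w⟫ + ⟪Dξ B, w⟫ + ⟪ξ, DB w⟫| ≤ M * δ * ‖w‖)
    (h2 : |⟪ξ, ξt + Dξ B⟫| ≤ M * δ ^ 2) (h3 : ‖a • ξ + B‖ ≤ M * δ) :
    -⟪ξt, p⟫ - ⟪(b • ξ + Dξ B) - (a • B + DB ξ), p⟫ + ⟪H, B⟫ + (b - ⟪p, DB p⟫) - V * a
        - 2⁻¹ * V ^ 2 - 2⁻¹ * ‖H‖ ^ 2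
      ≤ -(2⁻¹ * (V + a) ^ 2) + (3 * M + 3 * M₁ + M ^ 2 + 2 * M₁ ^ 2) * (1 - ⟪p, ξ⟫) := by
  set e := 1 - ⟪p, ξ⟫ with he
  have hM₁ : 0 ≤ M₁ := (abs_nonneg _).trans ha
  -- Since p·ξ ≤ |ξ|, the length deficit 1 - |ξ| is at most e.
  have hδe : δ ^ 2 ≤ e := hδ2.trans (by have := inner_le_norm_of_norm_eq_one (ξ := ξ) hp; linarith)
  have he0 : 0 ≤ e := (sq_nonneg _).trans hδe
  have hpe : ‖p - ξ‖ ^ 2 ≤ 2 * e := norm_sub_sq_le_of_norm_eq_one hp hξ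
  -- the transport error
  have t1 : -(⟪ξt, p - ξ⟫ + ⟪Dξ B, p - ξ⟫ + ⟪ξ, DB (p - ξ)⟫) ≤ 2 * M * e := by
    have := (abs_le.1 (h1 (p - ξ))).1
    nlinarith [sq_nonneg (δ - ‖p - ξ‖)]
  have t2 : -⟪ξ, ξt + Dξ B⟫ ≤ M * e := by
    have := (abs_le.1 h2).1
    nlinarith
  have t3 : b * e ≤ M₁ * e := mul_le_mul_of_nonneg_right ((le_abs_self _).trans hb) he0
  have t4 : -⟪p - ξ, DB (p - ξ)⟫ ≤ 2 * M₁ * e := by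
    have q1 := abs_real_inner_le_norm (p - ξ) (DB (p - ξ))
    have q2 := (DB.le_opNorm (p - ξ))
    have q3 : ‖p - ξ‖ * ‖DB (p - ξ)‖ ≤ M₁ * ‖p - ξ‖ ^ 2 := by
      have := mul_le_mul_of_nonneg_right hDB (norm_nonneg (p - ξ))
      nlinarith [norm_nonneg (p - ξ)]
    have := (abs_le.1 q1).1
    nlinarith
  -- the dissipation
  have t5 : 2⁻¹ * ‖a • p + B‖ ^ 2 ≤ (M ^ 2 + 2 * M₁ ^ 2) * e := by
    have q0 : a • p + B = (a • ξ + B) + a • (p - ξ) := by rw [smul_sub]; abel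
    have q1 : ‖a • p + B‖ ≤ M * δ + M₁ * ‖p - ξ‖ := by
      rw [q0]
      refine (norm_add_le _ _).trans (add_le_add h3 ?_)
      rw [norm_smul]
      exact mul_le_mul_of_nonneg_right ha (norm_nonneg _)
    have q2 : ‖a • p + B‖ ^ 2 ≤ 2 * (M * δ) ^ 2 + 2 * (M₁ * ‖p - ξ‖) ^ 2 := by
      nlinarith [sq_nonneg (M * δ - M₁ * ‖p - ξ‖), norm_nonneg (a • p + B)]
    have q3 : (M * δ) ^ 2 ≤ M ^ 2 * e := by
      rw [mul_pow]; exact mul_le_mul_of_nonneg_left hδe (sq_nonneg _)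
    have q4 : (M₁ * ‖p - ξ‖) ^ 2 ≤ M₁ ^ 2 * (2 * e) := by
      rw [mul_pow]; exact mul_le_mul_of_nonneg_left hpe (sq_nonneg _)
    linarith
  have t6 : ‖a • p + B‖ ^ 2 = a ^ 2 + 2 * a * ⟪p, B⟫ + ‖B‖ ^ 2 := by
    rw [norm_add_sq_real, norm_smul, mul_pow, hp, real_inner_smul_left, Real.norm_eq_abs, sq_abs]
    ring
  -- Young's inequality for H·B; the square that is dropped is ½|H - B|².
  have t7 : 0 ≤ ‖H‖ ^ 2 - 2 * ⟪H, B⟫ + ‖B‖ ^ 2 := by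
    rw [← norm_sub_sq_real]; positivity
  have c1 : ⟪(b • ξ + Dξ B) - (a • B + DB ξ), p⟫
      = b * ⟪p, ξ⟫ + ⟪Dξ B, p⟫ - a * ⟪p, B⟫ - ⟪p, DB ξ⟫ := by
    rw [inner_sub_left, inner_add_left, inner_add_left, real_inner_smul_left, real_inner_smul_left,
      real_inner_comm p ξ, real_inner_comm p B, real_inner_comm p (DB ξ)]
    ring
  have c2 : ⟪ξt, p - ξ⟫ + ⟪Dξ B, p - ξ⟫ + ⟪ξ, DB (p - ξ)⟫
      = ⟪ξt, p⟫ - ⟪ξt, ξ⟫ + ⟪Dξ B, p⟫ - ⟪Dξ B, ξ⟫ + ⟪ξ, DB p⟫ - ⟪ξ, DB ξ⟫ := by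
    rw [map_sub, inner_sub_right, inner_sub_right, inner_sub_right]; ring
  have c3 : ⟪ξ, ξt + Dξ B⟫ = ⟪ξt, ξ⟫ + ⟪Dξ B, ξ⟫ := by
    rw [inner_add_right, real_inner_comm ξt, real_inner_comm (Dξ B)]
  have c4 : ⟪p - ξ, DB (p - ξ)⟫ = ⟪p, DB p⟫ - ⟪p, DB ξ⟫ - ⟪ξ, DB p⟫ + ⟪ξ, DB ξ⟫ := by
    rw [map_sub, inner_sub_right, inner_sub_left, inner_sub_left]; ring
  have c5 : ⟪p, ξ⟫ = 1 - e := by rw [he]; ring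
  rw [c2] at t1
  rw [c3] at t2
  rw [c4] at t4
  rw [t6] at t5
  rw [c1, c5]
  linarith

/-- Split B·p - V = B·(p - ξ) + (B·ξ + a) - (V + a). The first two terms are of first order and are
multiplied by θ, itself of order δ; the last goes into the square by Young's inequality. -/
theorem bulk_density_le {p ξ B : E} {V a θ δ M M₁ : ℝ}
    (hp : ‖p‖ = 1) (hξ : ‖ξ‖ ≤ 1) (hM : 0 ≤ M) (hδ : 0 ≤ δ) (hδ2 : δ ^ 2 ≤ 1 - ‖ξ‖)
    (hB : ‖B‖ ≤ M₁) (h1 : |⟪B, ξ⟫ + a| ≤ M * δ) (hθ : |θ| ≤ M * δ) :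
    θ * ⟪B, p⟫ - V * θ ≤ 2⁻¹ * (V + a) ^ 2 + (2 * M ^ 2 + M ^ 2 * M₁ ^ 2 + 1) * (1 - ⟪p, ξ⟫) := by
  set e := 1 - ⟪p, ξ⟫ with he
  have hM₁ : 0 ≤ M₁ := (norm_nonneg _).trans hB
  have hδe : δ ^ 2 ≤ e := hδ2.trans (by have := inner_le_norm_of_norm_eq_one (ξ := ξ) hp; linarith)
  have he0 : 0 ≤ e := (sq_nonneg _).trans hδe
  have hpe : ‖p - ξ‖ ^ 2 ≤ 2 * e := norm_sub_sq_le_of_norm_eq_one hp hξ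
  have hMδ : (M * δ) ^ 2 ≤ M ^ 2 * e := by
    rw [mul_pow]; exact mul_le_mul_of_nonneg_left hδe (sq_nonneg _)
  have hθ2 : θ ^ 2 ≤ M ^ 2 * e := by
    rw [← sq_abs]
    exact (pow_le_pow_left₀ (abs_nonneg _) hθ 2).trans hMδ
  have s1 : θ * ⟪B, p - ξ⟫ ≤ M ^ 2 * M₁ ^ 2 * e + e := by
    have q1 := (le_abs_self _).trans (abs_real_inner_le_norm (θ • B) (p - ξ))
    rw [real_inner_smul_left, norm_smul, Real.norm_eq_abs] at q1
    have q2 : |θ| * ‖B‖ ≤ |θ| * M₁ := mul_le_mul_of_nonneg_left hB (abs_nonneg _)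
    have q3 : (|θ| * M₁) ^ 2 ≤ M ^ 2 * e * M₁ ^ 2 := by
      rw [mul_pow, sq_abs]; exact mul_le_mul_of_nonneg_right hθ2 (sq_nonneg _)
    have q4 : |θ| * ‖B‖ * ‖p - ξ‖ ≤ |θ| * M₁ * ‖p - ξ‖ :=
      mul_le_mul_of_nonneg_right q2 (norm_nonneg _)
    have q5 : 0 ≤ M ^ 2 * e * M₁ ^ 2 := by positivity
    nlinarith [sq_nonneg (|θ| * M₁ - ‖p - ξ‖)]
  have s2 : θ * (⟪B, ξ⟫ + a) ≤ M ^ 2 * e := by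
    have q1 : |θ * (⟪B, ξ⟫ + a)| ≤ M * δ * (M * δ) := by
      rw [abs_mul]
      exact mul_le_mul hθ h1 (abs_nonneg _) (by positivity)
    have := (le_abs_self _).trans q1
    nlinarith
  have s3 : -(θ * (V + a)) ≤ 2⁻¹ * (V + a) ^ 2 + M ^ 2 * e := by
    nlinarith [sq_nonneg (V + a + θ), sq_nonneg θ]
  rw [inner_sub_right] at s1
  linarith

end Pointwise

end

/-! ### Rate of change of the relative entropy. -/

section


variable {d : ℕ} {T σ m₀ M : ℝ} {A₀ : Set (Euc d)} {κ : Kernel ℝ (Euc d × Sph d)}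
  {A : ℝ → Set (Euc d)} {V : ℝ → Euc d → ℝ} {H : ℝ → Euc d → Euc d}
  {𝒜 : ℝ → Set (Euc d)} {ξ B : ℝ × Euc d → Euc d} {ϑ δ : ℝ × Euc d → ℝ}

/-- `f` is integrable with integral `a`. -/
def IntegralIs {α : Type*} [MeasurableSpace α] (μ : Measure α) (f : α → ℝ) (a : ℝ) : Prop :=
  Integrable f μ ∧ ∫ x, f x ∂μ = a

section IntegralIs

variable {α : Type*} [MeasurableSpace α] {μ : Measure α} {f g : α → ℝ} {a b : ℝ}

theorem integralIs (hf : Integrable f μ) : IntegralIs μ f (∫ x, f x ∂μ) := ⟨hf, rfl⟩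

theorem IntegralIs.add (hf : IntegralIs μ f a) (hg : IntegralIs μ g b) :
    IntegralIs μ (fun x => f x + g x) (a + b) :=
  ⟨hf.1.add hg.1, by rw [integral_add hf.1 hg.1, hf.2, hg.2]⟩

theorem IntegralIs.sub (hf : IntegralIs μ f a) (hg : IntegralIs μ g b) :
    IntegralIs μ (fun x => f x - g x) (a - b) :=
  ⟨hf.1.sub hg.1, by rw [integral_sub hf.1 hg.1, hf.2, hg.2]⟩

theorem IntegralIs.neg (hf : IntegralIs μ f a) : IntegralIs μ (fun x => -f x) (-a) :=
  ⟨hf.1.neg, by rw [integral_neg, hf.2]⟩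

theorem IntegralIs.const_mul (c : ℝ) (hf : IntegralIs μ f a) :
    IntegralIs μ (fun x => c * f x) (c * a) :=
  ⟨hf.1.const_mul c, by rw [integral_const_mul, hf.2]⟩

theorem IntegralIs.mono (hf : IntegralIs μ f a) (hg : IntegralIs μ g b) (h : ∀ x, f x ≤ g x) :
    a ≤ b := by
  rw [← hf.2, ← hg.2]
  exact integral_mono hf.1 hg.1 h

end IntegralIs

/-- The entropy of a measure relative to a vector field. -/
def fieldEntropy (X : Euc d → Euc d) (μ : Measure (Euc d × Sph d)) : ℝ :=
  ∫ q, (1 - ⟪(q.2 : Euc d), X q.1⟫) ∂μ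

theorem integrable_of_continuous_of_bound {α : Type*} [TopologicalSpace α] [MeasurableSpace α]
    [OpensMeasurableSpace α] {μ : Measure α} [IsFiniteMeasure μ] {f : α → ℝ} (hf : Continuous f)
    {C : ℝ} (hC : ∀ x, |f x| ≤ C) : Integrable f μ :=
  (integrable_const C).mono' (by exact hf.measurable.aestronglyMeasurable) (ae_of_all _ hC)

theorem IsTest.exists_bound {F G : Type*} [NormedAddCommGroup F] [NormedSpace ℝ F]
    [NormedAddCommGroup G] [NormedSpace ℝ G] {X : F → G} (hX : IsTest X) : ∃ C, ∀ x, ‖X x‖ ≤ C :=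
  hX.smooth.continuous.bounded_above_of_compact_support hX.compact

theorem norm_sphere (p : Sph d) : ‖(p : Euc d)‖ = 1 := by simp

theorem IsTest.integrable_inner {X : Euc d → Euc d} (hX : IsTest X) (μ : Measure (Euc d × Sph d))
    [IsFiniteMeasure μ] : Integrable (fun q : Euc d × Sph d => ⟪X q.1, (q.2 : Euc d)⟫) μ := by
  obtain ⟨C, hC⟩ := hX.exists_bound
  refine integrable_of_continuous_of_bound (C := C) ?_ fun q => ?_
  · exact (hX.smooth.continuous.comp continuous_fst).inner
      (continuous_subtype_val.comp continuous_snd)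
  · refine (abs_real_inner_le_norm _ _).trans ?_
    rw [norm_sphere, mul_one]; exact hC _

theorem IsTest.integrable_fst {f : Euc d → ℝ} (hf : IsTest f) (μ : Measure (Euc d × Sph d))
    [IsFiniteMeasure μ] : Integrable (fun q : Euc d × Sph d => f q.1) μ := by
  obtain ⟨C, hC⟩ := hf.exists_bound
  exact integrable_of_continuous_of_bound (C := C) (hf.smooth.continuous.comp continuous_fst)
    fun q => hC _

theorem fieldEntropy_eq {X : Euc d → Euc d} (hX : IsTest X) (μ : Measure (Euc d × Sph d))
    [IsFiniteMeasure μ] :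
    fieldEntropy X μ = μ.real univ - ∫ q, ⟪X q.1, (q.2 : Euc d)⟫ ∂μ := by
  unfold fieldEntropy
  simp_rw [real_inner_comm (X _)]
  rw [integral_sub (integrable_const _) (hX.integrable_inner μ)]
  simp

namespace SlabSolution

/-- The left side is the formal time derivative of the relative entropy, with the mass estimated by
the dissipation inequality. After adding the first variation with B and the commutator field, which
contribute nothing, `entropy_density_le` applies under the integral. The constant is fixed before
the weak solution is introduced. -/
theorem exists_entropy_rate_bound (hT : 0 < T) (hc : Calibration T M 𝒜 ξ B ϑ δ) :
    ∃ C : ℝ, 0 ≤ C ∧ ∀ {σ m₀ : ℝ} {A₀ : Set (Euc d)} {κ : Kernel ℝ (Euc d × Sph d)}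
      {A : ℝ → Set (Euc d)} {V : ℝ → Euc d → ℝ} {H : ℝ → Euc d → Euc d},
      SlabSolution T σ m₀ A₀ κ A V H →
      ∀ᵐ t ∂(volume.restrict (Ioc 0 T)),
        σ * (∫ x in A t, timeDeriv (spaceDiv ξ) (t, x)) - ∫ q, V t q.1 * spaceDiv ξ (t, q.1) ∂(κ t)
          - 2⁻¹ * ∫ q, V t q.1 ^ 2 ∂(κ t) - 2⁻¹ * ∫ q, ‖H t q.1‖ ^ 2 ∂(κ t)
        ≤ -(2⁻¹ * ∫ q, (V t q.1 + spaceDiv ξ (t, q.1)) ^ 2 ∂(κ t))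
          + C * fieldEntropy (fun x => ξ (t, x)) (κ t) := by
  obtain ⟨Ma, hMa0, hMa⟩ := (hc.xi_field.spaceDiv hT).exists_bound
  obtain ⟨Mb, hMb0, hMb⟩ := (hc.velocity_field.spaceDiv hT).exists_bound
  obtain ⟨MB, hMB0, hMB⟩ := hc.velocity_field.exists_bound_fderiv hT
  set M₁ := max Ma (max Mb MB) with hM₁
  have hM₁0 : 0 ≤ M₁ := hMa0.trans (le_max_left _ _)
  have hM0 := hc.nonneg
  refine ⟨3 * M + 3 * M₁ + M ^ 2 + 2 * M₁ ^ 2, by positivity, ?_⟩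
  intro σ m₀ A₀ κ A V H h
  have := h.finite
  have hIoo : ∀ᵐ t ∂(volume.restrict (Ioc 0 T)), t ∈ Ioo 0 T := by
    rw [← restrict_Ioo_eq_restrict_Ioc]
    exact ae_restrict_mem measurableSet_Ioo
  filter_upwards [hIoo, h.compat, h.curvature_slab hT hc.velocity_field,
    ae_integrable_of_compProd h.integrable_V, ae_integrable_of_compProd h.sq_V,
    ae_integrable_of_compProd h.integrable_H, ae_integrable_of_compProd h.sq_H]
    with t ht hcompat hcurv iV iV2 iH iH2
  have ht' := Ioo_subset_Icc_self ht
  set X : Euc d → Euc d := fun x => ξ (t, x) with hX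
  set Y : Euc d → Euc d := fun x => B (t, x) with hY
  have tX : IsTest X := hc.xi_field.isTest ht'
  have tY : IsTest Y := hc.velocity_field.isTest ht'
  have tXt : IsTest fun x => timeDeriv ξ (t, x) := hc.xi_field.isTest_timeDeriv hT ht
  have fX : ∀ x, fderiv ℝ X x = spaceDeriv ξ (t, x) := fun x =>
    (hasFDerivAt_space (hc.xi_field.smooth.differentiableAt ht x)).fderiv
  have fY : ∀ x, fderiv ℝ Y x = spaceDeriv B (t, x) := fun x =>
    (hasFDerivAt_space (hc.velocity_field.smooth.differentiableAt ht x)).fderiv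
  have hdX' : ContDiff ℝ ∞ (fderiv ℝ X) := tX.smooth.fderiv_right (m := ∞) (by simp)
  have hdY' : ContDiff ℝ ∞ (fderiv ℝ Y) := tY.smooth.fderiv_right (m := ∞) (by simp)
  -- the antisymmetric field
  set Z : Euc d → Euc d := fun y => (divergence Y y • X y + fderiv ℝ X y (Y y))
      - (divergence X y • Y y + fderiv ℝ Y y (X y)) with hZ
  have tZ : IsTest Z := by
    constructor
    · exact (((contDiff_divergence tY.smooth).smul tX.smooth).add (hdX'.clm_apply tY.smooth)).sub
        (((contDiff_divergence tX.smooth).smul tY.smooth).add (hdY'.clm_apply tX.smooth))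
    · refine HasCompactSupport.intro (tX.compact.isCompact.union tY.compact.isCompact) fun x hx => ?_
      have h1 : X x = 0 := image_eq_zero_of_notMem_tsupport fun h' => hx (Or.inl h')
      have h2 : Y x = 0 := image_eq_zero_of_notMem_tsupport fun h' => hx (Or.inr h')
      simp [Z, h1, h2]
  -- Z is divergence free, so compatibility makes its pairing with the orientation vanish.
  have eZ := hcompat Z tZ
  simp_rw [hZ, divergence_commutator tX.smooth tY.smooth] at eZ
  simp only [integral_zero, mul_zero] at eZ
  -- Compatibility turns the bulk term σ∫_A ∂_t div ξ into the surface term -∫ ∂_t ξ·p dμ.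
  have eT := hcompat _ tXt
  simp_rw [← hc.xi_field.timeDeriv_spaceDiv ht] at eT
  -- integrability
  have iT := tXt.integrable_inner (κ t)
  have iZ := tZ.integrable_inner (κ t)
  have tdX : IsTest fun x => spaceDiv ξ (t, x) := (hc.xi_field.spaceDiv hT).isTest ht'
  have tdY : IsTest fun x => spaceDiv B (t, x) := (hc.velocity_field.spaceDiv hT).isTest ht'
  obtain ⟨CX, hCX⟩ := tdX.exists_bound
  obtain ⟨CY, hCY⟩ := tY.exists_bound
  have icX : AEStronglyMeasurable (fun q : Euc d × Sph d => spaceDiv ξ (t, q.1)) (κ t) :=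
    (tdX.integrable_fst (κ t)).aestronglyMeasurable
  have iVX : Integrable (fun q : Euc d × Sph d => V t q.1 * spaceDiv ξ (t, q.1)) (κ t) :=
    iV.mul_bdd icX (ae_of_all _ fun q => hCX q.1)
  have iX2 : Integrable (fun q : Euc d × Sph d => spaceDiv ξ (t, q.1) ^ 2) (κ t) := by
    have := (tdX.integrable_fst (κ t)).mul_bdd icX (ae_of_all _ fun q => hCX q.1)
    exact this.congr (ae_of_all _ fun q => by simp only; ring)
  have iVX2 : Integrable (fun q : Euc d × Sph d => (V t q.1 + spaceDiv ξ (t, q.1)) ^ 2) (κ t) := by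
    refine ((iV2.add (iVX.const_mul 2)).add iX2).congr (ae_of_all _ fun q => ?_)
    simp only [Pi.add_apply]; ring
  have iHB : Integrable (fun q : Euc d × Sph d => ⟪H t q.1, B (t, q.1)⟫) (κ t) := by
    refine (iH.norm.mul_const CY).mono' (iH.aestronglyMeasurable.inner
      (tY.smooth.continuous.comp continuous_fst).aestronglyMeasurable) (ae_of_all _ fun q => ?_)
    exact (norm_inner_le_norm _ _).trans (mul_le_mul_of_nonneg_left (hCY _) (norm_nonneg _))
  have iDB : Integrable (fun q : Euc d × Sph d =>
      ⟪(q.2 : Euc d), spaceDeriv B (t, q.1) (q.2 : Euc d)⟫) (κ t) := by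
    have hDBb : ∀ x, ‖spaceDeriv B (t, x)‖ ≤ MB := by
      intro x
      refine (ContinuousLinearMap.opNorm_comp_le _ _).trans ?_
      exact (mul_le_of_le_one_right (norm_nonneg _)
        (ContinuousLinearMap.norm_inr_le_one ..)).trans (hMB t ht x)
    refine integrable_of_continuous_of_bound (C := MB) ?_ fun q => ?_
    · simp_rw [← fY]
      have c1 : Continuous fun q : Euc d × Sph d => (q.2 : Euc d) :=
        continuous_subtype_val.comp continuous_snd
      exact c1.inner ((hdY'.continuous.comp continuous_fst).clm_apply c1)
    · refine (abs_real_inner_le_norm _ _).trans ?_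
      rw [norm_sphere, one_mul]
      refine (ContinuousLinearMap.le_opNorm _ _).trans ?_
      rw [norm_sphere, mul_one]; exact hDBb _
  have iE : Integrable (fun q : Euc d × Sph d => 1 - ⟪(q.2 : Euc d), ξ (t, q.1)⟫) (κ t) := by
    have := (integrable_const (μ := κ t) (1 : ℝ)).sub (tX.integrable_inner (κ t))
    exact this.congr (ae_of_all _ fun q => by
      simp only [Pi.sub_apply, X]; rw [real_inner_comm])
  have iDiv : Integrable (fun q : Euc d × Sph d => (spaceDiv B (t, q.1)
      - ⟪(q.2 : Euc d), spaceDeriv B (t, q.1) (q.2 : Euc d)⟫)) (κ t) :=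
    (tdY.integrable_fst (κ t)).sub iDB
  -- sum up
  have eZ' : ∫ q, ⟪Z q.1, (q.2 : Euc d)⟫ ∂(κ t) = 0 := by
    rw [eq_comm, neg_eq_zero] at eZ; exact eZ
  have hlhs := ((((((integralIs iT).neg.sub (integralIs iZ)).add (integralIs iHB)).add
    (integralIs iDiv)).sub (integralIs iVX)).sub ((integralIs iV2).const_mul 2⁻¹)).sub
      ((integralIs iH2).const_mul 2⁻¹)
  have hrhs := ((integralIs iVX2).const_mul 2⁻¹).neg.add
    ((integralIs iE).const_mul (3 * M + 3 * M₁ + M ^ 2 + 2 * M₁ ^ 2))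
  refine le_trans (le_of_eq ?_) (hlhs.mono hrhs fun q => ?_)
  -- The added integrals sum to zero: the commutator term vanishes and the two sides of the first
  -- variation identity cancel.
  · rw [eT, hcurv, eZ']; ring
  have hZq : Z q.1 = (spaceDiv B (t, q.1) • ξ (t, q.1) + spaceDeriv ξ (t, q.1) (B (t, q.1)))
      - (spaceDiv ξ (t, q.1) • B (t, q.1) + spaceDeriv B (t, q.1) (ξ (t, q.1))) := by
    rw [← fX, ← fY]; rfl
  rw [hZq]
  refine entropy_density_le (δ := δ (t, q.1)) (norm_sphere q.2) (hc.norm_xi_le t ht' _) hM0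
    (hc.delta_sq_le t ht' _) ((hMa t ht' _).trans (le_max_left _ _))
    ((hMb t ht' _).trans ((le_max_left _ _).trans (le_max_right _ _))) ?_
    (hc.transport t ht _) (hc.transport_length t ht _) (hc.curvature t ht _)
  refine (ContinuousLinearMap.opNorm_comp_le _ _).trans ?_
  exact (mul_le_of_le_one_right (norm_nonneg _)
    (ContinuousLinearMap.norm_inr_le_one ..)).trans ((hMB t ht _).trans
      ((le_max_right _ _).trans (le_max_right _ _)))

end SlabSolution

end

/-! ### The integrated relative entropy inequality. -/

section


variable {d : ℕ} {T σ m₀ M : ℝ} {A₀ : Set (Euc d)} {κ : Kernel ℝ (Euc d × Sph d)}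
  {A : ℝ → Set (Euc d)} {V : ℝ → Euc d → ℝ} {H : ℝ → Euc d → Euc d}
  {𝒜 : ℝ → Set (Euc d)} {ξ B : ℝ × Euc d → Euc d} {ϑ δ : ℝ × Euc d → ℝ}

theorem ae_restrict_Ioc_mem_Ioo : ∀ᵐ t ∂(volume.restrict (Ioc 0 T)), t ∈ Ioo 0 T := by
  rw [← restrict_Ioo_eq_restrict_Ioc]
  exact ae_restrict_mem measurableSet_Ioo

theorem SlabField.integrable_inner [IsFiniteKernel κ] (hξ : SlabField T ξ) :
    Integrable (fun q : ℝ × (Euc d × Sph d) => ⟪(q.2.2 : Euc d), ξ (q.1, q.2.1)⟫)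
      ((volume.restrict (Ioc 0 T)) ⊗ₘ κ) := by
  obtain ⟨C, -, hC⟩ := hξ.exists_bound
  have hp : Measurable fun q : ℝ × (Euc d × Sph d) => (q.2.2 : Euc d) :=
    measurable_subtype_coe.comp (measurable_snd.comp measurable_snd)
  refine (integrable_const C).mono'
    (hp.aestronglyMeasurable.inner hξ.smooth.aestronglyMeasurable_compProd) ?_
  filter_upwards [ae_compProd_mem_Ioo (T := T) (κ := κ)] with q hq
  refine (norm_inner_le_norm _ _).trans ?_
  rw [norm_sphere, one_mul]
  exact hC _ (Ioo_subset_Icc_self hq) _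

theorem SlabField.integrable_fieldEntropy [IsFiniteKernel κ] (hξ : SlabField T ξ) :
    Integrable (fun t => fieldEntropy (fun x => ξ (t, x)) (κ t)) (volume.restrict (Ioc 0 T)) :=
  integrable_integral_of_compProd ((integrable_const (1 : ℝ)).sub hξ.integrable_inner)

theorem fieldEntropy_nonneg {X : Euc d → Euc d} (hX : ∀ x, ‖X x‖ ≤ 1)
    (μ : Measure (Euc d × Sph d)) : 0 ≤ fieldEntropy X μ := by
  refine integral_nonneg fun q => ?_
  have := inner_le_norm_of_norm_eq_one (ξ := X q.1) (norm_sphere q.2)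
  have := hX q.1
  simp only [Pi.zero_apply]; linarith

namespace SlabSolution

theorem integrable_phase (h : SlabSolution T σ m₀ A₀ κ A V H) {g : ℝ × Euc d → ℝ}
    (hg : AEStronglyMeasurable g ((volume.restrict (Ioc 0 T)).prod volume)) {C : ℝ}
    (hC : ∀ t ∈ Ioo 0 T, ∀ x, |g (t, x)| ≤ C) :
    Integrable (fun t => ∫ x in A t, g (t, x)) (volume.restrict (Ioc 0 T)) := by
  obtain ⟨W, hW⟩ := h.volume_le
  refine (integrable_const (|C| * W)).mono' (h.aestronglyMeasurable_phase hg) ?_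
  filter_upwards [ae_restrict_Ioc_mem_Ioo, hW] with t ht hWt
  refine (norm_setIntegral_le_of_norm_le_const (hWt.trans_lt ENNReal.coe_lt_top)
    fun x _ => (hC t ht x).trans (le_abs_self C)).trans ?_
  exact mul_le_mul_of_nonneg_left (ENNReal.toReal_le_coe_of_le_coe hWt) (abs_nonneg _)

theorem integrable_V_mul (h : SlabSolution T σ m₀ A₀ κ A V H) {f : ℝ × Euc d → ℝ}
    (hf : SlabSmooth T f) {C : ℝ} (hC : ∀ t ∈ Icc 0 T, ∀ x, |f (t, x)| ≤ C) :
    Integrable (fun q : ℝ × (Euc d × Sph d) => V q.1 q.2.1 * f (q.1, q.2.1))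
      ((volume.restrict (Ioc 0 T)) ⊗ₘ κ) := by
  have := h.finite
  refine h.integrable_V.mul_bdd hf.aestronglyMeasurable_compProd (c := C) ?_
  filter_upwards [ae_compProd_mem_Ioo (T := T) (κ := κ)] with q hq
  exact hC _ (Ioo_subset_Icc_self hq) _

theorem integrable_sq_add (h : SlabSolution T σ m₀ A₀ κ A V H) {f : ℝ × Euc d → ℝ}
    (hf : SlabSmooth T f) {C : ℝ} (hC : ∀ t ∈ Icc 0 T, ∀ x, |f (t, x)| ≤ C) :
    Integrable (fun q : ℝ × (Euc d × Sph d) => (V q.1 q.2.1 + f (q.1, q.2.1)) ^ 2)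
      ((volume.restrict (Ioc 0 T)) ⊗ₘ κ) := by
  have := h.finite
  have h1 := (hf.integrable_compProd (κ := κ) hC).mul_bdd
    (hf.aestronglyMeasurable_compProd (κ := κ)) (c := C) (by
      filter_upwards [ae_compProd_mem_Ioo (T := T) (κ := κ)] with q hq
      exact hC _ (Ioo_subset_Icc_self hq) _)
  refine ((h.sq_V.add ((h.integrable_V_mul hf hC).const_mul 2)).add h1).congr
    (ae_of_all _ fun q => ?_)
  simp only [Pi.add_apply]; ring

/-- At time τ compatibility expresses the entropy as mass plus σ∫_A div ξ. The dissipation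
inequality for the mass and the evolution equation tested with div ξ are added, and the rate bound
is integrated. The square on the left is kept for use in the bulk estimate. -/
theorem exists_entropy_inequality (hT : 0 < T) (hc : Calibration T M 𝒜 ξ B ϑ δ) :
    ∃ C : ℝ, 0 ≤ C ∧ ∀ {σ m₀ : ℝ} {A₀ : Set (Euc d)} {κ : Kernel ℝ (Euc d × Sph d)}
      {A : ℝ → Set (Euc d)} {V : ℝ → Euc d → ℝ} {H : ℝ → Euc d → Euc d},
      SlabSolution T σ m₀ A₀ κ A V H →
      ∀ᵐ τ ∂(volume.restrict (Ioc 0 T)),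
        fieldEntropy (fun x => ξ (τ, x)) (κ τ)
          + 2⁻¹ * ∫ t in Ioc 0 τ, ∫ q, (V t q.1 + spaceDiv ξ (t, q.1)) ^ 2 ∂(κ t)
        ≤ m₀ + σ * (∫ x in A₀, spaceDiv ξ (0, x))
          + C * ∫ t in Ioc 0 τ, fieldEntropy (fun x => ξ (t, x)) (κ t) := by
  obtain ⟨C, hC0, hC⟩ := exists_entropy_rate_bound hT hc
  refine ⟨C, hC0, fun {σ m₀ A₀ κ A V H} h => ?_⟩
  have := h.finite
  have hf := hc.xi_field.spaceDiv hT
  obtain ⟨M₁, hM₁0, hM₁⟩ := hf.exists_bound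
  obtain ⟨M₂, hM₂0, hM₂⟩ := hf.exists_bound_timeDeriv hT
  have hevo := h.evolution_slab hT hf.smooth (M := max M₁ M₂)
    (fun t ht x => (hM₁ t ht x).trans (le_max_left _ _))
    (fun t ht x => (hM₂ t ht x).trans (le_max_right _ _))
  have ia := h.integrable_phase (aestronglyMeasurable_timeDeriv hf.smooth) hM₂
  have ib := integrable_integral_of_compProd (h.integrable_V_mul hf.smooth hM₁)
  have ic := integrable_integral_of_compProd h.sq_V
  have id := integrable_integral_of_compProd h.sq_H
  have ie := integrable_integral_of_compProd (h.integrable_sq_add hf.smooth hM₁)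
  have iE := hc.xi_field.integrable_fieldEntropy (κ := κ)
  simp only at ib ic id ie
  filter_upwards [hevo, h.energy, h.compat, ae_restrict_mem measurableSet_Ioc]
    with τ hτ hen hco hτm
  have hsub : Ioc 0 τ ⊆ Ioc 0 T := Ioc_subset_Ioc_right hτm.2
  have hle : volume.restrict (Ioc 0 τ) ≤ volume.restrict (Ioc 0 T) :=
    Measure.restrict_mono_set _ hsub
  have hτ' : τ ∈ Icc 0 T := ⟨hτm.1.le, hτm.2⟩
  have e1 := fieldEntropy_eq (hc.xi_field.isTest hτ') (κ τ)
  have e2 := hco _ (hc.xi_field.isTest hτ')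
  have e3 : ∫ x in A τ, divergence (fun x => ξ (τ, x)) x = ∫ x in A τ, spaceDiv ξ (τ, x) := rfl
  rw [e3] at e2
  have hl := ((((integralIs (ia.mono_measure hle)).const_mul σ).sub
    (integralIs (ib.mono_measure hle))).sub ((integralIs (ic.mono_measure hle)).const_mul 2⁻¹)).sub
    ((integralIs (id.mono_measure hle)).const_mul 2⁻¹)
  have hr := ((integralIs (ie.mono_measure hle)).const_mul 2⁻¹).neg.add
    ((integralIs (iE.mono_measure hle)).const_mul C)
  have hmono := integral_mono_ae hl.1 hr.1
    (ae_restrict_of_ae_restrict_of_subset hsub (hC h))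
  rw [hl.2, hr.2] at hmono
  linarith

end SlabSolution

end

section


variable {d : ℕ} {T σ m₀ M : ℝ} {A₀ : Set (Euc d)} {κ : Kernel ℝ (Euc d × Sph d)}
  {A : ℝ → Set (Euc d)} {V : ℝ → Euc d → ℝ} {H : ℝ → Euc d → Euc d}
  {𝒜 : ℝ → Set (Euc d)} {ξ B : ℝ × Euc d → Euc d} {ϑ δ : ℝ × Euc d → ℝ}

/-! ### The bulk error -/

/-- The weighted volume of the symmetric difference of two sets. -/
def weightedDist (w : Euc d → ℝ) (S S' : Set (Euc d)) : ℝ :=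
  ∫ x, |S.indicator (fun _ => (1 : ℝ)) x - S'.indicator (fun _ => (1 : ℝ)) x| * |w x|

theorem weightedDist_nonneg (w : Euc d → ℝ) (S S' : Set (Euc d)) : 0 ≤ weightedDist w S S' :=
  integral_nonneg fun _ => mul_nonneg (abs_nonneg _) (abs_nonneg _)

theorem integrable_indicator_sub_mul {S S' : Set (Euc d)} (hS : NullMeasurableSet S volume)
    (hS' : NullMeasurableSet S' volume) {f : Euc d → ℝ} (hf : IntegrableOn f S)
    (hf' : IntegrableOn f S') :
    IntegralIs volume (fun x => (S.indicator (fun _ => (1 : ℝ)) x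
      - S'.indicator (fun _ => (1 : ℝ)) x) * f x) ((∫ x in S, f x) - ∫ x in S', f x) := by
  have h1 : IntegralIs volume (S.indicator f) (∫ x in S, f x) :=
    ⟨hf.integrable_indicator₀ hS, integral_indicator₀ hS⟩
  have h2 : IntegralIs volume (S'.indicator f) (∫ x in S', f x) :=
    ⟨hf'.integrable_indicator₀ hS', integral_indicator₀ hS'⟩
  convert h1.sub h2 using 2 with x
  by_cases hx : x ∈ S <;> by_cases hx' : x ∈ S' <;> simp [hx, hx']

/-- Wherever the difference of the indicators is nonzero, w does not have the opposite sign: points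
of S outside {w < 0} have w ≥ 0, and points of {w < 0} outside S give -1. -/
theorem abs_indicator_sub_mul_abs {S : Set (Euc d)} {w : Euc d → ℝ} (x : Euc d) :
    |S.indicator (fun _ => (1 : ℝ)) x - {x | w x < 0}.indicator (fun _ => (1 : ℝ)) x| * |w x|
      = (S.indicator (fun _ => (1 : ℝ)) x - {x | w x < 0}.indicator (fun _ => (1 : ℝ)) x) * w x := by
  by_cases hx : x ∈ S <;> by_cases hx' : w x < 0
  · simp [hx, hx']
  · simp [hx, hx', abs_of_nonneg (not_lt.1 hx')]
  · simp [hx, hx', abs_of_neg hx']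
  · simp [hx, hx']

theorem weightedDist_eq {S : Set (Euc d)} (hS : NullMeasurableSet S volume) {w : Euc d → ℝ}
    (hw : Measurable w) (hf : IntegrableOn w S) (hf' : IntegrableOn w {x | w x < 0}) :
    IntegralIs volume (fun x => |S.indicator (fun _ => (1 : ℝ)) x
        - {x | w x < 0}.indicator (fun _ => (1 : ℝ)) x| * |w x|) (weightedDist w S {x | w x < 0})
      ∧ weightedDist w S {x | w x < 0} = (∫ x in S, w x) - ∫ x in {x | w x < 0}, w x := by
  have h := integrable_indicator_sub_mul hS
    (hw measurableSet_Iio : MeasurableSet {x | w x < 0}).nullMeasurableSet hf hf'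
  unfold weightedDist
  simp_rw [abs_indicator_sub_mul_abs]
  exact ⟨⟨h.1, rfl⟩, h.2⟩

/-- Controls a difference of bulk integrals whose integrand vanishes on the interface at the rate of
the weight. -/
theorem sub_le_weightedDist {S : Set (Euc d)} (hS : NullMeasurableSet S volume) {w g : Euc d → ℝ}
    (hw : Measurable w) (hf : IntegrableOn w S) (hf' : IntegrableOn w {x | w x < 0})
    (hg : Integrable g) {C : ℝ} (hC : ∀ x, |g x| ≤ C * |w x|) :
    (∫ x in S, g x) - ∫ x in {x | w x < 0}, g x ≤ C * weightedDist w S {x | w x < 0} := by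
  have h := integrable_indicator_sub_mul hS
    (hw measurableSet_Iio : MeasurableSet {x | w x < 0}).nullMeasurableSet
    hg.integrableOn hg.integrableOn
  refine h.mono ((weightedDist_eq hS hw hf hf').1.const_mul C) fun x => ?_
  refine (le_abs_self _).trans ?_
  rw [abs_mul]
  calc _ ≤ |S.indicator (fun _ => (1 : ℝ)) x - {x | w x < 0}.indicator (fun _ => (1 : ℝ)) x|
        * (C * |w x|) := mul_le_mul_of_nonneg_left (hC x) (abs_nonneg _)
    _ = _ := by ring

namespace Calibration

theorem weight_field (hc : Calibration T M 𝒜 ξ B ϑ δ) : SlabField T fun q => ϑ q - 1 := by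
  refine ⟨ContDiffOn.sub hc.weight_smooth contDiffOn_const, ?_⟩
  obtain ⟨R, hR⟩ := hc.weight_far
  exact ⟨R, fun t ht x hx => by simp [hR t ht x hx]⟩

theorem timeDeriv_weight (ϑ : ℝ × Euc d → ℝ) (q : ℝ × Euc d) :
    timeDeriv (fun q => ϑ q - 1) q = timeDeriv ϑ q := by
  unfold timeDeriv; rw [fderiv_sub_const]

theorem isTest_timeDeriv_weight (hc : Calibration T M 𝒜 ξ B ϑ δ) (hT : 0 < T) {t : ℝ}
    (ht : t ∈ Ioo 0 T) : IsTest fun x => timeDeriv ϑ (t, x) := by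
  have := hc.weight_field.isTest_timeDeriv hT ht
  simp_rw [timeDeriv_weight] at this
  exact this

theorem exists_bound_timeDeriv_weight (hc : Calibration T M 𝒜 ξ B ϑ δ) (hT : 0 < T) :
    ∃ C, 0 ≤ C ∧ ∀ t ∈ Ioo 0 T, ∀ x, |timeDeriv ϑ (t, x)| ≤ C := by
  have := hc.weight_field.exists_bound_timeDeriv hT
  simp_rw [timeDeriv_weight] at this
  exact this

theorem domain_subset (hc : Calibration T M 𝒜 ξ B ϑ δ) : ∃ R : ℝ, ∀ t ∈ Icc 0 T,
    {x | ϑ (t, x) < 0} ⊆ Metric.closedBall 0 R := by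
  obtain ⟨R, hR⟩ := hc.weight_far
  refine ⟨R, fun t ht x hx => ?_⟩
  by_contra h
  have h1 := hR t ht x (by simpa using h)
  simp only [mem_ofPred_eq] at hx
  linarith

theorem integrableOn_weight (hc : Calibration T M 𝒜 ξ B ϑ δ) {t : ℝ} (ht : t ∈ Icc 0 T)
    {S : Set (Euc d)} (hS : volume S ≠ ⊤) : IntegrableOn (fun x => ϑ (t, x)) S := by
  have : IsFiniteMeasure (volume.restrict S) := ⟨by simpa using hS.lt_top⟩
  exact integrable_of_continuous_of_bound (hc.weight_smooth.slice ht).continuous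
    (hc.abs_weight_le_one t ht)

theorem volume_domain_ne_top (hc : Calibration T M 𝒜 ξ B ϑ δ) {t : ℝ} (ht : t ∈ Icc 0 T) :
    volume {x | ϑ (t, x) < 0} ≠ ⊤ := by
  obtain ⟨R, hR⟩ := hc.domain_subset
  exact ((measure_mono (hR t ht)).trans_lt measure_closedBall_lt_top).ne

/-- The weighted volume of the evolving domain. -/
theorem setIntegral_weight_sub (hc : Calibration T M 𝒜 ξ B ϑ δ) (hT : 0 < T) :
    IntegrableOn (fun t => ∫ x in {x | ϑ (t, x) < 0}, timeDeriv ϑ (t, x)) (Ioc 0 T) ∧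
    ∀ τ ∈ Ioc 0 T, (∫ x in {x | ϑ (τ, x) < 0}, ϑ (τ, x)) - ∫ x in {x | ϑ (0, x) < 0}, ϑ (0, x)
      = ∫ t in Ioc 0 τ, ∫ x in {x | ϑ (t, x) < 0}, timeDeriv ϑ (t, x) := by
  obtain ⟨R, hR⟩ := hc.domain_subset
  obtain ⟨C, hC0, hC⟩ := hc.exists_bound_timeDeriv_weight hT
  set ϑ' := (Icc 0 T ×ˢ univ).indicator ϑ with hϑ'
  have hm : Measurable ϑ' := hc.weight_smooth.measurable_slab_indicator
  set G : ℝ × Euc d → ℝ := {q | ϑ' q < 0}.indicator (timeDeriv ϑ) with hG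
  have hGm : AEStronglyMeasurable G ((volume.restrict (Ioc 0 T)).prod volume) :=
    (SlabSolution.aestronglyMeasurable_timeDeriv hc.weight_smooth).indicator (hm measurableSet_Iio)
  have hGeq : ∀ t ∈ Ioo 0 T, ∀ x, G (t, x)
      = {x | ϑ (t, x) < 0}.indicator (fun x => timeDeriv ϑ (t, x)) x := by
    intro t ht x
    have : ϑ' (t, x) = ϑ (t, x) :=
      indicator_of_mem (show (t, x) ∈ Icc 0 T ×ˢ univ from ⟨Ioo_subset_Icc_self ht, mem_univ _⟩) ϑ
    simp [hG, indicator, this]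
  have hGb : ∀ t ∈ Ioo 0 T, ∀ x,
      ‖G (t, x)‖ ≤ (univ ×ˢ Metric.closedBall (0 : Euc d) R).indicator (fun _ => C) (t, x) := by
    intro t ht x
    rw [hGeq t ht]
    by_cases hx : ϑ (t, x) < 0
    · have hx' := hR t (Ioo_subset_Icc_self ht) hx
      rw [indicator_of_mem (by exact hx), indicator_of_mem (by exact ⟨mem_univ _, hx'⟩)]
      exact hC t ht x
    · rw [indicator_of_notMem (by exact hx), norm_zero]
      exact indicator_nonneg (fun _ _ => hC0) _
  have hbi : Integrable ((univ ×ˢ Metric.closedBall (0 : Euc d) R).indicator fun _ => C)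
      ((volume.restrict (Ioc 0 T)).prod volume) := by
    rw [integrable_indicator_iff (MeasurableSet.univ.prod Metric.isClosed_closedBall.measurableSet)]
    refine integrableOn_const ?_ (by simp)
    rw [Measure.prod_prod]
    exact ENNReal.mul_ne_top (by simp) measure_closedBall_lt_top.ne
  have hae : ∀ᵐ q ∂((volume.restrict (Ioc 0 T)).prod (volume : Measure (Euc d))), q.1 ∈ Ioo 0 T :=
    Measure.quasiMeasurePreserving_fst.ae ae_restrict_Ioc_mem_Ioo
  have hGi : Integrable G ((volume.restrict (Ioc 0 T)).prod volume) := by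
    refine hbi.mono' hGm ?_
    filter_upwards [hae] with q hq using hGb q.1 hq q.2
  have hGx : ∀ t ∈ Ioo 0 T,
      ∫ x, G (t, x) = ∫ x in {x | ϑ (t, x) < 0}, timeDeriv ϑ (t, x) := by
    intro t ht
    have hms : MeasurableSet {x | ϑ (t, x) < 0} :=
      (hc.weight_smooth.slice (Ioo_subset_Icc_self ht)).continuous.measurable measurableSet_Iio
    rw [← integral_indicator hms]
    exact integral_congr_ae (ae_of_all _ fun x => hGeq t ht x)
  constructor
  · refine (hGi.integral_prod_left).congr ?_
    filter_upwards [ae_restrict_Ioc_mem_Ioo] with t ht using hGx t ht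
  · intro τ hτ
    have hsub : Ioc 0 τ ⊆ Ioc 0 T := Ioc_subset_Ioc_right hτ.2
    have hle : (volume.restrict (Ioc 0 τ)).prod (volume : Measure (Euc d))
        ≤ (volume.restrict (Ioc 0 T)).prod volume :=
      Measure.prod_mono (Measure.restrict_mono_set _ hsub) le_rfl
    -- In place of a transport theorem for moving domains, min(ϑ, 0) is differentiated in time at
    -- fixed x, and the order of integration is exchanged.
    have hneg : ∀ t ∈ Icc 0 T,
        ∫ x in {x | ϑ (t, x) < 0}, ϑ (t, x) = ∫ x, min (ϑ (t, x)) 0 := by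
      intro t ht
      have hms : MeasurableSet {x | ϑ (t, x) < 0} :=
        (hc.weight_smooth.slice ht).continuous.measurable measurableSet_Iio
      rw [← integral_indicator hms]
      refine integral_congr_ae (ae_of_all _ fun x => ?_)
      by_cases hx : ϑ (t, x) < 0
      · simp [hx, hx.le]
      · simp [hx, not_lt.1 hx]
    have hmini : ∀ t ∈ Icc 0 T, Integrable fun x => min (ϑ (t, x)) 0 := by
      intro t ht
      have hms : MeasurableSet {x | ϑ (t, x) < 0} :=
        (hc.weight_smooth.slice ht).continuous.measurable measurableSet_Iio
      refine ((integrable_indicator_iff hms).2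
        (hc.integrableOn_weight ht (hc.volume_domain_ne_top ht))).congr (ae_of_all _ fun x => ?_)
      by_cases hx : ϑ (t, x) < 0
      · simp [hx, hx.le]
      · simp [hx, not_lt.1 hx]
    have hτ' : τ ∈ Icc 0 T := ⟨hτ.1.le, hτ.2⟩
    have h0 : (0 : ℝ) ∈ Icc 0 T := ⟨le_rfl, hT.le⟩
    rw [hneg τ hτ', hneg 0 h0, ← integral_sub (hmini τ hτ') (hmini 0 h0)]
    have hIoo' : ∀ᵐ t ∂(volume.restrict (Ioc 0 τ)), t ∈ Ioo 0 T :=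
      ae_restrict_of_ae_restrict_of_subset hsub ae_restrict_Ioc_mem_Ioo
    have e1 : ∫ t in Ioc 0 τ, ∫ x in {x | ϑ (t, x) < 0}, timeDeriv ϑ (t, x)
        = ∫ t in Ioc 0 τ, ∫ x, G (t, x) :=
      integral_congr_ae (hIoo'.mono fun t ht => (hGx t ht).symm)
    rw [e1, integral_integral_swap (f := fun t x => G (t, x)) (hGi.mono_measure hle)]
    refine integral_congr_ae (ae_of_all _ fun x => ?_)
    simp only
    have hIooτ : Ioo 0 τ ⊆ Ioo 0 T := Ioo_subset_Ioo_right hτ.2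
    rw [min_sub_min_eq_integral (f := fun t => ϑ (t, x)) (f' := fun t => timeDeriv ϑ (t, x)) hτ.1.le
      ((hc.weight_smooth.time_continuousOn x).mono (Icc_subset_Icc_right hτ.2))
      (fun t ht => hasDerivAt_time (hc.weight_smooth.differentiableAt (hIooτ ht) x))
      ?_ (fun t ht => hC t (hIooτ ht) x), intervalIntegral.integral_of_le hτ.1.le]
    · refine integral_congr_ae (hIoo'.mono fun t ht => ?_)
      simp only
      rw [hGeq t ht]
      simp [indicator]
    · intro t ht
      have h1 : ContinuousAt (fderiv ℝ ϑ) (t, x) :=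
        ((hc.weight_smooth.contDiffAt (hIooτ ht) x).fderiv_right (m := ∞) (by simp)).continuousAt
      have h2 : ContinuousAt (timeDeriv ϑ) (t, x) := h1.clm_apply continuousAt_const
      exact (ContinuousAt.comp (f := fun t => (t, x)) h2 (by fun_prop)).continuousWithinAt

end Calibration

end

/-! ### Rate of change of the bulk error and the integrated bulk inequality. -/

section


variable {d : ℕ} {T σ m₀ M : ℝ} {A₀ : Set (Euc d)} {κ : Kernel ℝ (Euc d × Sph d)}
  {A : ℝ → Set (Euc d)} {V : ℝ → Euc d → ℝ} {H : ℝ → Euc d → Euc d}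
  {𝒜 : ℝ → Set (Euc d)} {ξ B : ℝ × Euc d → Euc d} {ϑ δ : ℝ × Euc d → ℝ}

namespace SlabSolution

/-- The divergence of ϑB is added on both domains. Over {ϑ < 0} it integrates to zero; over A
compatibility turns it into -∫ ϑ B·p dμ. The bulk integrand becomes ∂_tϑ + B·∇ϑ + ϑ div B, which is
of order |ϑ|, and the surface integrand ϑ(B·p - V) is treated by `bulk_density_le`. -/
theorem exists_bulk_rate_bound (hT : 0 < T) (hc : Calibration T M 𝒜 ξ B ϑ δ) :
    ∃ C : ℝ, 0 ≤ C ∧ ∀ {σ m₀ : ℝ} {A₀ : Set (Euc d)} {κ : Kernel ℝ (Euc d × Sph d)}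
      {A : ℝ → Set (Euc d)} {V : ℝ → Euc d → ℝ} {H : ℝ → Euc d → Euc d},
      SlabSolution T σ m₀ A₀ κ A V H → 0 < σ →
      ∀ᵐ t ∂(volume.restrict (Ioc 0 T)),
        σ * (∫ x in A t, timeDeriv ϑ (t, x)) - σ * (∫ x in {x | ϑ (t, x) < 0}, timeDeriv ϑ (t, x))
          - ∫ q, V t q.1 * ϑ (t, q.1) ∂(κ t)
        ≤ C * (σ * weightedDist (fun x => ϑ (t, x)) (A t) {x | ϑ (t, x) < 0}
            + fieldEntropy (fun x => ξ (t, x)) (κ t))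
          + 2⁻¹ * ∫ q, (V t q.1 + spaceDiv ξ (t, q.1)) ^ 2 ∂(κ t) := by
  obtain ⟨Ma, hMa0, hMa⟩ := (hc.velocity_field.spaceDiv hT).exists_bound
  obtain ⟨MB, hMB0, hMB⟩ := hc.velocity_field.exists_bound
  obtain ⟨Mξ, hMξ0, hMξ⟩ := (hc.xi_field.spaceDiv hT).exists_bound
  have hM0 := hc.nonneg
  refine ⟨(M + Ma) + (2 * M ^ 2 + M ^ 2 * MB ^ 2 + 1), by positivity, ?_⟩
  intro σ m₀ A₀ κ A V H h hσ
  have := h.finite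
  obtain ⟨W, hW⟩ := h.volume_le
  filter_upwards [ae_restrict_Ioc_mem_Ioo, hW, h.compat, ae_integrable_of_compProd h.integrable_V,
    ae_integrable_of_compProd
      (h.integrable_V_mul hc.weight_smooth (C := 1) hc.abs_weight_le_one),
    ae_integrable_of_compProd
      (h.integrable_sq_add (hc.xi_field.spaceDiv hT).smooth hMξ)]
    with t ht hWt hcompat iV iVϑ isq
  have ht' := Ioo_subset_Icc_self ht
  set w : Euc d → ℝ := fun x => ϑ (t, x) with hw
  set Y : Euc d → Euc d := fun x => B (t, x) with hY
  have sw : ContDiff ℝ ∞ w := hc.weight_smooth.slice ht'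
  have tY : IsTest Y := hc.velocity_field.isTest ht'
  have tX : IsTest fun x => w x • Y x := (hc.weight_smooth.prod_smul hc.velocity_field).isTest ht'
  have tt : IsTest fun x => timeDeriv ϑ (t, x) := hc.isTest_timeDeriv_weight hT ht
  have fw : ∀ x, fderiv ℝ w x = spaceDeriv ϑ (t, x) := fun x =>
    (hasFDerivAt_space (hc.weight_smooth.differentiableAt ht x)).fderiv
  have ediv : ∀ x, divergence (fun x => w x • Y x) x
      = w x * spaceDiv B (t, x) + fderiv ℝ w x (Y x) := fun x =>
    divergence_smul (sw.differentiable (by simp) x) (tY.smooth.differentiable (by simp) x)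
  have idiv : Integrable (divergence fun x => w x • Y x) :=
    (contDiff_divergence tX.smooth).continuous.integrable_of_hasCompactSupport
      (hasCompactSupport_divergence tX.compact)
  have itt : Integrable fun x => timeDeriv ϑ (t, x) :=
    tt.smooth.continuous.integrable_of_hasCompactSupport tt.compact
  -- The field w Y vanishes where w does, so it is tangential in the quantitative sense required by
  -- the divergence theorem.
  have hzero : ∫ x in {x | w x < 0}, divergence (fun x => w x • Y x) x = 0 := by
    have hcont : Continuous fun x => fderiv ℝ w x (Y x) :=
      (sw.continuous_fderiv (by simp)).clm_apply tY.smooth.continuous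
    have hcs : HasCompactSupport fun x => fderiv ℝ w x (Y x) :=
      tY.compact.mono' fun x hx => subset_tsupport _ fun h0 => hx (by
        change fderiv ℝ w x (Y x) = 0; rw [h0, map_zero])
    obtain ⟨C, hC⟩ := hcont.bounded_above_of_compact_support hcs
    refine setIntegral_divergence_eq_zero (M := C) sw tX.smooth tX.compact fun x => ?_
    rw [map_smul, smul_eq_mul, abs_mul, mul_comm]
    exact mul_le_mul_of_nonneg_right (hC x) (abs_nonneg _)
  have key := sub_le_weightedDist (S := A t) (w := w)
    (g := fun x => timeDeriv ϑ (t, x) + divergence (fun x => w x • Y x) x) (C := M + Ma)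
    (h.isOpen t ht.1).measurableSet.nullMeasurableSet sw.continuous.measurable
    (hc.integrableOn_weight ht' (hWt.trans_lt ENNReal.coe_lt_top).ne)
    (hc.integrableOn_weight ht' (hc.volume_domain_ne_top ht')) (itt.add idiv) (by
      intro x
      rw [ediv]
      have h1 := hc.weight_transport t ht x
      have h2 := hMa t ht' x
      rw [fw]
      have h3 : |w x * spaceDiv B (t, x)| ≤ |w x| * Ma := by
        rw [abs_mul]; exact mul_le_mul_of_nonneg_left h2 (abs_nonneg _)
      have h4 : timeDeriv ϑ (t, x) + (w x * spaceDiv B (t, x) + spaceDeriv ϑ (t, x) (Y x))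
        = (timeDeriv ϑ (t, x) + spaceDeriv ϑ (t, x) (B (t, x))) + w x * spaceDiv B (t, x) := by ring
      rw [h4]
      refine (abs_add_le _ _).trans ((add_le_add h1 h3).trans (le_of_eq ?_))
      ring)
  rw [integral_add itt.integrableOn idiv.integrableOn,
    integral_add itt.integrableOn idiv.integrableOn, hzero, add_zero] at key
  have eX := hcompat _ tX
  have iX := tX.integrable_inner (κ t)
  have iE : Integrable (fun q : Euc d × Sph d => 1 - ⟪(q.2 : Euc d), ξ (t, q.1)⟫) (κ t) := by
    have := (integrable_const (μ := κ t) (1 : ℝ)).sub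
      ((hc.xi_field.isTest ht').integrable_inner (κ t))
    exact this.congr (ae_of_all _ fun q => by
      simp only [Pi.sub_apply]; rw [real_inner_comm])
  have hl := (integralIs iX).sub (integralIs iVϑ)
  have hr := ((integralIs isq).const_mul 2⁻¹).add
    ((integralIs iE).const_mul (2 * M ^ 2 + M ^ 2 * MB ^ 2 + 1))
  have hmono := hl.mono hr fun q => by
    have h1 := bulk_density_le (V := V t q.1) (norm_sphere q.2) (hc.norm_xi_le t ht' q.1) hM0
      (hc.delta_nonneg t ht' q.1) (hc.delta_sq_le t ht' q.1) (hMB t ht' q.1)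
      (hc.curvature_normal t ht q.1) (hc.abs_weight_le t ht q.1)
    rw [real_inner_smul_left]
    exact h1
  have hE : fieldEntropy (fun x => ξ (t, x)) (κ t)
    = ∫ q : Euc d × Sph d, (1 - ⟪(q.2 : Euc d), ξ (t, q.1)⟫) ∂(κ t) := rfl
  have hE0 := fieldEntropy_nonneg (hc.norm_xi_le t ht') (κ t)
  have hW0 := weightedDist_nonneg w (A t) {x | w x < 0}
  have hσW := mul_nonneg hσ.le hW0
  have key' := mul_le_mul_of_nonneg_left key hσ.le
  rw [← hE] at hmono
  -- The constant is the sum of the constants for the two errors; the cross products are nonnegative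
  -- and may be added.
  have p1 : 0 ≤ (M + Ma) * fieldEntropy (fun x => ξ (t, x)) (κ t) := by positivity
  have p2 : 0 ≤ (2 * M ^ 2 + M ^ 2 * MB ^ 2 + 1) * (σ * weightedDist w (A t) {x | w x < 0}) := by
    positivity
  nlinarith

/-- The integral of the weight over the evolving domain is measurable in time because, by
`Calibration.setIntegral_weight_sub`, it is a constant plus a primitive, hence continuous. -/
theorem integrable_weightedDist (hT : 0 < T) (hc : Calibration T M 𝒜 ξ B ϑ δ)
    (h : SlabSolution T σ m₀ A₀ κ A V H) :
    Integrable (fun t => weightedDist (fun x => ϑ (t, x)) (A t) {x | ϑ (t, x) < 0})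
      (volume.restrict (Ioc 0 T)) := by
  obtain ⟨W, hW⟩ := h.volume_le
  have hm : AEStronglyMeasurable ((Icc 0 T ×ˢ univ).indicator ϑ)
      ((volume.restrict (Ioc 0 T)).prod volume) :=
    hc.weight_smooth.measurable_slab_indicator.aestronglyMeasurable
  have hind : ∀ t ∈ Icc 0 T, ∀ x, (Icc 0 T ×ˢ univ).indicator ϑ (t, x) = ϑ (t, x) := fun t ht x =>
    indicator_of_mem (show (t, x) ∈ Icc 0 T ×ˢ univ from ⟨ht, mem_univ _⟩) ϑ
  have i1 := h.integrable_phase hm (C := 1) fun t ht x => by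
    rw [hind t (Ioo_subset_Icc_self ht)]; exact hc.abs_weight_le_one t (Ioo_subset_Icc_self ht) x
  obtain ⟨j1, j2⟩ := hc.setIntegral_weight_sub hT
  have i2 : IntegrableOn (fun τ => (∫ x in {x | ϑ (0, x) < 0}, ϑ (0, x))
      + ∫ t in Ioc 0 τ, ∫ x in {x | ϑ (t, x) < 0}, timeDeriv ϑ (t, x)) (Ioc 0 T) := by
    refine (ContinuousOn.integrableOn_Icc ?_).mono_set Ioc_subset_Icc_self
    refine continuousOn_const.add (intervalIntegral.continuousOn_primitive ?_)
    rwa [integrableOn_Icc_iff_integrableOn_Ioc]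
  refine (i1.sub i2).congr ?_
  filter_upwards [ae_restrict_mem measurableSet_Ioc, hW] with t ht hWt
  have ht' : t ∈ Icc 0 T := ⟨ht.1.le, ht.2⟩
  rw [(weightedDist_eq (h.isOpen t ht.1).measurableSet.nullMeasurableSet
    (hc.weight_smooth.slice ht').continuous.measurable
    (hc.integrableOn_weight ht' (hWt.trans_lt ENNReal.coe_lt_top).ne)
    (hc.integrableOn_weight ht' (hc.volume_domain_ne_top ht'))).2]
  simp only [Pi.sub_apply, hind t ht']
  have := j2 t ht
  linarith

/-- The square produced by the bulk rate is absorbed by the dissipation in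
`exists_entropy_inequality`; the price is the initial entropy and the constant of that inequality.
-/
theorem exists_bulk_inequality (hT : 0 < T) (hc : Calibration T M 𝒜 ξ B ϑ δ) :
    ∃ C : ℝ, 0 ≤ C ∧ ∀ {σ m₀ : ℝ} {A₀ : Set (Euc d)} {κ : Kernel ℝ (Euc d × Sph d)}
      {A : ℝ → Set (Euc d)} {V : ℝ → Euc d → ℝ} {H : ℝ → Euc d → Euc d},
      SlabSolution T σ m₀ A₀ κ A V H → 0 < σ → NullMeasurableSet A₀ volume →
      ∀ᵐ τ ∂(volume.restrict (Ioc 0 T)),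
        σ * weightedDist (fun x => ϑ (τ, x)) (A τ) {x | ϑ (τ, x) < 0}
        ≤ σ * weightedDist (fun x => ϑ (0, x)) A₀ {x | ϑ (0, x) < 0}
          + (m₀ + σ * (∫ x in A₀, spaceDiv ξ (0, x)))
          + C * ∫ t in Ioc 0 τ,
            (σ * weightedDist (fun x => ϑ (t, x)) (A t) {x | ϑ (t, x) < 0}
              + fieldEntropy (fun x => ξ (t, x)) (κ t)) := by
  obtain ⟨C₁, hC₁0, hC₁⟩ := exists_entropy_inequality hT hc
  obtain ⟨C₂, hC₂0, hC₂⟩ := exists_bulk_rate_bound hT hc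
  refine ⟨C₁ + C₂, by positivity, fun {σ m₀ A₀ κ A V H} h hσ hA₀ => ?_⟩
  have := h.finite
  have hf := hc.xi_field.spaceDiv hT
  obtain ⟨M₁, hM₁0, hM₁⟩ := hf.exists_bound
  obtain ⟨M₂, hM₂0, hM₂⟩ := hc.exists_bound_timeDeriv_weight hT
  obtain ⟨W, hW⟩ := h.volume_le
  have hevo := h.evolution_slab hT hc.weight_smooth (M := max 1 M₂)
    (fun t ht x => (hc.abs_weight_le_one t ht x).trans (le_max_left _ _))
    (fun t ht x => (hM₂ t ht x).trans (le_max_right _ _))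
  obtain ⟨i0, hdom⟩ := hc.setIntegral_weight_sub hT
  have ia := h.integrable_phase (aestronglyMeasurable_timeDeriv hc.weight_smooth) hM₂
  have ib := integrable_integral_of_compProd
    (h.integrable_V_mul hc.weight_smooth (C := 1) hc.abs_weight_le_one)
  have ie := integrable_integral_of_compProd (h.integrable_sq_add hf.smooth hM₁)
  have iE := hc.xi_field.integrable_fieldEntropy (κ := κ)
  have iW := h.integrable_weightedDist hT hc
  simp only at ib ie
  filter_upwards [hevo, hC₁ h, hW, ae_restrict_mem measurableSet_Ioc] with τ hτ hen hWτ hτm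
  have hsub : Ioc 0 τ ⊆ Ioc 0 T := Ioc_subset_Ioc_right hτm.2
  have hle : volume.restrict (Ioc 0 τ) ≤ volume.restrict (Ioc 0 T) :=
    Measure.restrict_mono_set _ hsub
  have hτ' : τ ∈ Icc 0 T := ⟨hτm.1.le, hτm.2⟩
  have h0' : (0 : ℝ) ∈ Icc 0 T := ⟨le_rfl, hT.le⟩
  have e1 := (weightedDist_eq (h.isOpen τ hτm.1).measurableSet.nullMeasurableSet
    (hc.weight_smooth.slice hτ').continuous.measurable
    (hc.integrableOn_weight hτ' (hWτ.trans_lt ENNReal.coe_lt_top).ne)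
    (hc.integrableOn_weight hτ' (hc.volume_domain_ne_top hτ'))).2
  have e2 := (weightedDist_eq hA₀ (hc.weight_smooth.slice h0').continuous.measurable
    (hc.integrableOn_weight h0' h.volume_initial)
    (hc.integrableOn_weight h0' (hc.volume_domain_ne_top h0'))).2
  have e3 := hdom τ hτm
  have hl := (((integralIs (ia.mono_measure hle)).const_mul σ).sub
    ((integralIs ((show Integrable _ _ from i0).mono_measure hle)).const_mul σ)).sub
    (integralIs (ib.mono_measure hle))
  have iWE := (iW.const_mul σ).add iE
  have hr := ((integralIs (iWE.mono_measure hle)).const_mul C₂).add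
    ((integralIs (ie.mono_measure hle)).const_mul 2⁻¹)
  have hmono := integral_mono_ae hl.1 hr.1
    (ae_restrict_of_ae_restrict_of_subset hsub (hC₂ h hσ))
  rw [hl.2, hr.2] at hmono
  have hE0 := fieldEntropy_nonneg (hc.norm_xi_le τ hτ') (κ τ)
  have hEW : ∫ t in Ioc 0 τ, fieldEntropy (fun x => ξ (t, x)) (κ t)
      ≤ ∫ t in Ioc 0 τ, (σ * weightedDist (fun x => ϑ (t, x)) (A t) {x | ϑ (t, x) < 0}
              + fieldEntropy (fun x => ξ (t, x)) (κ t)) := by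
    refine integral_mono (iE.mono_measure hle) (iWE.mono_measure hle) fun t => ?_
    have := mul_nonneg hσ.le (weightedDist_nonneg (fun x => ϑ (t, x)) (A t) {x | ϑ (t, x) < 0})
    simp only; linarith
  have hEW' := mul_le_mul_of_nonneg_left hEW hC₁0
  simp only [Pi.add_apply] at hmono
  rw [e1, e2, add_mul]
  have e3' := congrArg (σ * ·) e3
  linarith

end SlabSolution

end

section

/-! ### Superlevel sets and signed distances -/

section LevelSet

variable {d : ℕ}

theorem inner_gradient {g : Euc d → ℝ} {x : Euc d} (v : Euc d) :
    ⟪gradient g x, v⟫ = fderiv ℝ g x v := by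
  simp [gradient]

theorem hasDerivAt_along {g : Euc d → ℝ} {y : Euc d} (v : Euc d) {c : ℝ}
    (hg : DifferentiableAt ℝ g (y + c • v)) :
    HasDerivAt (fun s : ℝ => g (y + s • v)) (fderiv ℝ g (y + c • v) v) c := by
  have h1 : HasDerivAt (fun s : ℝ => y + s • v) v c := by
    simpa using ((hasDerivAt_id c).smul_const v).const_add y
  exact hg.hasFDerivAt.comp_hasDerivAt c h1

theorem eventually_sign_along {g : Euc d → ℝ} {y v : Euc d} (hg : DifferentiableAt ℝ g y)
    (hy : g y = 0) (hv : 0 < fderiv ℝ g y v) :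
    ∀ᶠ s : ℝ in 𝓝 0, SignType.sign (g (y + s • v)) = SignType.sign s := by
  have h1 := hasDerivAt_along (g := g) (y := y) v (c := 0) (by simpa using hg)
  have h2 := eventually_nhdsWithin_sign_eq_of_deriv_pos (f := fun s : ℝ => g (y + s • v)) (x₀ := 0)
    (by rw [h1.deriv]; simpa using hv) (by simpa using hy)
  simpa using h2

theorem fderiv_gradient_pos {g : Euc d → ℝ} {y : Euc d} (h : gradient g y ≠ 0) :
    0 < fderiv ℝ g y (gradient g y) := by
  rw [← inner_gradient, real_inner_self_eq_norm_sq]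
  positivity

/-- Near a regular zero of `g`, there are points on a line where `g` is positive and negative. -/
theorem exists_sign_change {g : Euc d → ℝ} {y : Euc d} (hg : DifferentiableAt ℝ g y)
    (hy : g y = 0) (hn : gradient g y ≠ 0) {ε : ℝ} (hε : 0 < ε) :
    ∃ a b : Euc d, dist a y < ε ∧ dist b y < ε ∧ 0 < g a ∧ g b < 0 := by
  have h1 := eventually_sign_along hg hy (fderiv_gradient_pos hn)
  have h2 : Tendsto (fun s : ℝ => y + s • gradient g y) (𝓝 0) (𝓝 y) := by
    have : Continuous fun s : ℝ => y + s • gradient g y := by fun_prop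
    simpa using this.tendsto 0
  have h3 := h1.and (h2.eventually (Metric.ball_mem_nhds y hε))
  obtain ⟨a, ⟨ha, ha'⟩, ha0⟩ :=
    ((h3.filter_mono nhdsWithin_le_nhds).and (self_mem_nhdsWithin (s := Ioi (0 : ℝ)))).exists
  obtain ⟨b, ⟨hb, hb'⟩, hb0⟩ :=
    ((h3.filter_mono nhdsWithin_le_nhds).and (self_mem_nhdsWithin (s := Iio (0 : ℝ)))).exists
  rw [sign_pos ha0] at ha
  rw [sign_neg hb0] at hb
  exact ⟨_, _, ha', hb', sign_eq_one_iff.1 ha, sign_eq_neg_one_iff.1 hb⟩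

/-- By continuity g vanishes on the frontier. Conversely, a regular zero is a limit of points where
g is positive and is not itself such a point. -/
theorem frontier_superlevel {g : Euc d → ℝ} (hg : Differentiable ℝ g)
    (hn : ∀ x, g x = 0 → gradient g x ≠ 0) : frontier {x | 0 < g x} = {x | g x = 0} := by
  refine Subset.antisymm (fun x hx => ?_) fun x hx => ?_
  · exact (frontier_lt_subset_eq continuous_const hg.continuous hx).symm
  · refine ⟨Metric.mem_closure_iff.2 fun ε hε => ?_, fun hi => ?_⟩
    · obtain ⟨a, -, ha, -, ha0, -⟩ := exists_sign_change (hg x) hx (hn x hx) hε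
      exact ⟨a, ha0, by rwa [dist_comm]⟩
    · have hi' : x ∈ {x | 0 < g x} := interior_subset hi
      exact lt_irrefl (0 : ℝ) (hi'.trans_eq hx)

/-- A segment from `S` to its complement meets the boundary. -/
theorem exists_mem_segment_frontier {S : Set (Euc d)} {x y : Euc d} (hx : x ∈ S) (hy : y ∉ S) :
    ∃ z ∈ segment ℝ x y, z ∈ frontier S := by
  by_contra! h
  have hpre : IsPreconnected (segment ℝ x y) := (convex_segment x y).isPreconnected
  have hcov : segment ℝ x y ⊆ interior S ∪ (closure S)ᶜ := fun z hz => by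
    by_contra hc
    rw [mem_union, not_or, notMem_compl_iff] at hc
    exact h z hz ⟨hc.2, hc.1⟩
  have hdisj : Disjoint (interior S) (closure S)ᶜ :=
    disjoint_compl_right_iff_subset.2 (interior_subset.trans subset_closure)
  have hxi : x ∈ interior S := by
    rcases hcov (left_mem_segment ℝ x y) with h1 | h1
    · exact h1
    · exact absurd (subset_closure hx) h1
  have := hpre.subset_left_of_subset_union isOpen_interior isClosed_closure.isOpen_compl hdisj hcov
    ⟨x, left_mem_segment ℝ x y, hxi⟩
  exact hy (interior_subset (this (right_mem_segment ℝ x y)))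

theorem abs_signedDist (S : Set (Euc d)) (x : Euc d) :
    |signedDist S x| = Metric.infDist x (frontier S) := by
  unfold signedDist
  split_ifs
  · exact abs_of_nonneg Metric.infDist_nonneg
  · rw [abs_neg, abs_of_nonneg Metric.infDist_nonneg]

theorem signedDist_nonneg {S : Set (Euc d)} {x : Euc d} (hx : x ∈ S) : 0 ≤ signedDist S x := by
  rw [signedDist, if_pos hx]; exact Metric.infDist_nonneg

theorem signedDist_nonpos {S : Set (Euc d)} {x : Euc d} (hx : x ∉ S) : signedDist S x ≤ 0 := by
  rw [signedDist, if_neg hx]; exact neg_nonpos.2 Metric.infDist_nonneg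

theorem signedDist_frontier {S : Set (Euc d)} {x : Euc d} (hx : x ∈ frontier S) :
    signedDist S x = 0 := by
  rw [← abs_eq_zero, abs_signedDist, Metric.infDist_zero_of_mem hx]

/-- The only delicate pair is x inside, y outside: the segment between them meets the frontier, and
the two distances to that point add up to its length. -/
theorem lipschitzWith_signedDist (S : Set (Euc d)) : LipschitzWith 1 (signedDist S) := by
  refine LipschitzWith.of_le_add fun x y => ?_
  by_cases hx : x ∈ S <;> by_cases hy : y ∈ S
  · simp only [signedDist, hx, hy, if_true]
    exact Metric.infDist_le_infDist_add_dist
  · obtain ⟨z, hz, hzf⟩ := exists_mem_segment_frontier hx hy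
    have h1 := dist_add_dist_of_mem_segment hz
    have h2 := Metric.infDist_le_dist_of_mem (x := x) hzf
    have h3 := Metric.infDist_le_dist_of_mem (x := y) hzf
    rw [dist_comm y z] at h3
    simp only [signedDist, hx, hy, if_true, if_false]
    linarith
  · have := signedDist_nonpos hx
    have := signedDist_nonneg hy
    have := dist_nonneg (x := x) (y := y)
    linarith
  · simp only [signedDist, hx, hy, if_false]
    have := Metric.infDist_le_infDist_add_dist (s := frontier S) (x := y) (y := x)
    rw [dist_comm] at this
    linarith

theorem norm_gradient_signedDist_le (S : Set (Euc d)) (x : Euc d) : ‖innerNormal S x‖ ≤ 1 := by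
  have := norm_fderiv_le_of_lipschitz ℝ (lipschitzWith_signedDist S) (x₀ := x)
  simpa [innerNormal, gradient] using this

end LevelSet

/-! ### Evolving domains with a defining function -/

/-- An evolving family of bounded domains moving by mean curvature, with a smooth defining
function. -/
structure Evolution {d : ℕ} (T R : ℝ) (𝒜 : ℝ → Set (Euc d)) (φ : ℝ × Euc d → ℝ) : Prop where
  dim : 1 ≤ d
  nonempty : ∀ t ∈ Icc 0 T, (𝒜 t).Nonempty
  subset_ball : ∀ t ∈ Icc 0 T, 𝒜 t ⊆ Metric.ball 0 R
  smooth : ContDiff ℝ ∞ φ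
  domain_eq : ∀ t ∈ Icc 0 T, 𝒜 t = {x | 0 < φ (t, x)}
  gradient_ne : ∀ t ∈ Icc 0 T, ∀ x, φ (t, x) = 0 → spatialGradient φ t x ≠ 0
  speed : ∀ t ∈ Icc 0 T, ∀ x ∈ frontier (𝒜 t),
    levelSetSpeed φ t x = levelSetMeanCurvature φ t x

theorem IsSmoothMCF.exists_evolution {d : ℕ} (hd : 1 ≤ d) {T : ℝ} {𝒜 : ℝ → Set (Euc d)}
    (h : IsSmoothMCF T 𝒜) : ∃ R φ, Evolution T R 𝒜 φ := by
  obtain ⟨h1, ⟨R, h2⟩, φ, h3, h4, h5, h6⟩ := h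
  exact ⟨R, φ, hd, h1, h2, h3, h4, h5, h6⟩

namespace Evolution

variable {d : ℕ} {T R : ℝ} {𝒜 : ℝ → Set (Euc d)} {φ : ℝ × Euc d → ℝ} {t : ℝ}

theorem smooth_slice (h : Evolution T R 𝒜 φ) (t : ℝ) : ContDiff ℝ ∞ fun x => φ (t, x) :=
  h.smooth.comp (contDiff_const.prodMk contDiff_id)

theorem frontier_eq (h : Evolution T R 𝒜 φ) (ht : t ∈ Icc 0 T) :
    frontier (𝒜 t) = {x | φ (t, x) = 0} := by
  rw [h.domain_eq t ht]
  exact frontier_superlevel ((h.smooth_slice t).differentiable (by simp)) (h.gradient_ne t ht)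

theorem isOpen (h : Evolution T R 𝒜 φ) (ht : t ∈ Icc 0 T) : IsOpen (𝒜 t) := by
  rw [h.domain_eq t ht]
  exact isOpen_lt continuous_const (h.smooth_slice t).continuous

theorem frontier_nonempty (h : Evolution T R 𝒜 φ) (ht : t ∈ Icc 0 T) :
    (frontier (𝒜 t)).Nonempty := by
  refine nonempty_frontier_iff.2 ⟨h.nonempty t ht, fun hu => ?_⟩
  have : Nonempty (Fin d) := ⟨⟨0, h.dim⟩⟩
  have hb : Bornology.IsBounded (univ : Set (Euc d)) :=
    Metric.isBounded_ball.subset (hu ▸ h.subset_ball t ht)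
  exact NormedSpace.unbounded_univ ℝ (Euc d) hb

theorem frontier_subset (h : Evolution T R 𝒜 φ) (ht : t ∈ Icc 0 T) :
    frontier (𝒜 t) ⊆ Metric.closedBall 0 R :=
  frontier_subset_closure.trans (closure_minimal ((h.subset_ball t ht).trans
    Metric.ball_subset_closedBall) Metric.isClosed_closedBall)

theorem isCompact_frontier (h : Evolution T R 𝒜 φ) (ht : t ∈ Icc 0 T) :
    IsCompact (frontier (𝒜 t)) :=
  (isCompact_closedBall (0 : Euc d) R).of_isClosed_subset isClosed_frontier (h.frontier_subset ht)

theorem exists_nearest (h : Evolution T R 𝒜 φ) (ht : t ∈ Icc 0 T) (x : Euc d) :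
    ∃ y ∈ frontier (𝒜 t), Metric.infDist x (frontier (𝒜 t)) = dist x y :=
  (h.isCompact_frontier ht).exists_infDist_eq_dist (h.frontier_nonempty ht) x

/-- Upper semicontinuity of the distance to the moving interface. Near a boundary point y there are
points a, b at which φ(t,·) has opposite signs. The signs persist at nearby times, and the segment
from a to b then still meets the interface. -/
theorem eventually_infDist_lt (h : Evolution T R 𝒜 φ) (ht : t ∈ Icc 0 T) {x : Euc d} {ρ : ℝ}
    (hx : Metric.infDist x (frontier (𝒜 t)) < ρ) :
    ∀ᶠ q in 𝓝[Icc 0 T ×ˢ univ] (t, x), Metric.infDist q.2 (frontier (𝒜 q.1)) < ρ := by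
  obtain ⟨y, hy, hxy⟩ := h.exists_nearest ht x
  rw [hxy] at hx
  set ε := (ρ - dist x y) / 2 with hε
  have hε0 : 0 < ε := by rw [hε]; linarith
  have hy0 : φ (t, y) = 0 := by rw [h.frontier_eq ht] at hy; exact hy
  obtain ⟨a, b, ha, hb, ha0, hb0⟩ := exists_sign_change (g := fun x => φ (t, x))
    ((h.smooth_slice t).differentiable (by simp) y) hy0 (h.gradient_ne t ht y hy0) hε0
  have c1 : ∀ᶠ q : ℝ × Euc d in 𝓝 (t, x), 0 < φ (q.1, a) := by
    have : Continuous fun q : ℝ × Euc d => φ (q.1, a) := h.smooth.continuous.comp (by fun_prop)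
    exact this.continuousAt.eventually_const_lt ha0
  have c2 : ∀ᶠ q : ℝ × Euc d in 𝓝 (t, x), φ (q.1, b) < 0 := by
    have : Continuous fun q : ℝ × Euc d => φ (q.1, b) := h.smooth.continuous.comp (by fun_prop)
    exact this.continuousAt.eventually_lt_const hb0
  have c3 : ∀ᶠ q : ℝ × Euc d in 𝓝 (t, x), dist q.2 x < ε := by
    have : Continuous fun q : ℝ × Euc d => dist q.2 x := by fun_prop
    exact this.continuousAt.eventually_lt_const (by simpa using hε0)
  filter_upwards [nhdsWithin_le_nhds c1, nhdsWithin_le_nhds c2, nhdsWithin_le_nhds c3,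
    self_mem_nhdsWithin] with q q1 q2 q3 q4
  obtain ⟨z, hz, hzf⟩ := exists_mem_segment_frontier (S := 𝒜 q.1) (x := a) (y := b)
    (by rw [h.domain_eq _ q4.1]; exact q1) (by rw [h.domain_eq _ q4.1]; exact not_lt.2 q2.le)
  have hz' : dist z y < ε := (convex_ball y ε).segment_subset ha hb hz
  calc Metric.infDist q.2 (frontier (𝒜 q.1)) ≤ dist q.2 z := Metric.infDist_le_dist_of_mem hzf
    _ ≤ dist q.2 x + dist x y + dist y z := dist_triangle4 _ _ _ _
    _ < ε + dist x y + ε := by rw [dist_comm y z]; linarith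
    _ = ρ := by rw [hε]; ring

/-- The tube is the projection of a compact set of pairs, a space-time point together with a zero of
φ at distance at most ρ. -/
theorem isCompact_tube (h : Evolution T R 𝒜 φ) (ρ : ℝ) :
    IsCompact {q : ℝ × Euc d | q.1 ∈ Icc 0 T ∧ Metric.infDist q.2 (frontier (𝒜 q.1)) ≤ ρ} := by
  have hK : IsCompact {p : (ℝ × Euc d) × Euc d | (p.1.1 ∈ Icc 0 T ∧ ‖p.1.2‖ ≤ R + ρ ∧ ‖p.2‖ ≤ R)
      ∧ φ (p.1.1, p.2) = 0 ∧ dist p.1.2 p.2 ≤ ρ} := by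
    refine ((isCompact_Icc (a := (0 : ℝ)) (b := T)).prod (isCompact_closedBall (0 : Euc d) (R + ρ))
      |>.prod (isCompact_closedBall (0 : Euc d) R)).of_isClosed_subset ?_ ?_
    · have c1 : Continuous fun p : (ℝ × Euc d) × Euc d => φ (p.1.1, p.2) :=
        h.smooth.continuous.comp (by fun_prop)
      have c2 : Continuous fun p : (ℝ × Euc d) × Euc d => p.1.1 := by fun_prop
      have c3 : Continuous fun p : (ℝ × Euc d) × Euc d => ‖p.1.2‖ := by fun_prop
      have c4 : Continuous fun p : (ℝ × Euc d) × Euc d => ‖p.2‖ := by fun_prop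
      have c5 : Continuous fun p : (ℝ × Euc d) × Euc d => dist p.1.2 p.2 := by fun_prop
      exact ((isClosed_Icc.preimage c2).inter ((isClosed_le c3 continuous_const).inter
        (isClosed_le c4 continuous_const))).inter
        ((isClosed_eq c1 continuous_const).inter (isClosed_le c5 continuous_const))
    · rintro p ⟨⟨h1, h2, h3⟩, -⟩
      exact ⟨⟨h1, by simpa using h2⟩, by simpa using h3⟩
  convert hK.image continuous_fst using 1
  ext q
  constructor
  · rintro ⟨hq, hq'⟩
    obtain ⟨y, hy, hxy⟩ := h.exists_nearest hq q.2
    have hyR : ‖y‖ ≤ R := by simpa using h.frontier_subset hq hy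
    rw [hxy] at hq'
    refine ⟨(q, y), ⟨⟨hq, ?_, hyR⟩, by rw [h.frontier_eq hq] at hy; exact hy, hq'⟩, rfl⟩
    have := norm_le_norm_add_norm_sub' q.2 y
    rw [dist_eq_norm] at hq'
    simp only; linarith
  · rintro ⟨p, ⟨⟨h1, -, -⟩, h2, h3⟩, rfl⟩
    refine ⟨h1, (Metric.infDist_le_dist_of_mem ?_).trans h3⟩
    rw [h.frontier_eq h1]; exact h2

/-- Outside of the closed tube, the side of the interface is locally constant. -/
theorem eventually_far (h : Evolution T R 𝒜 φ) (ht : t ∈ Icc 0 T) {x : Euc d} {ρ : ℝ} (hρ : 0 ≤ ρ)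
    (hx : ρ < Metric.infDist x (frontier (𝒜 t))) :
    ∀ᶠ q in 𝓝[Icc 0 T ×ˢ univ] (t, x), ρ < Metric.infDist q.2 (frontier (𝒜 q.1)) ∧
      (q.2 ∈ 𝒜 q.1 ↔ x ∈ 𝒜 t) := by
  have h1 : ∀ᶠ q in 𝓝 (t, x),
      q ∉ {q : ℝ × Euc d | q.1 ∈ Icc 0 T ∧ Metric.infDist q.2 (frontier (𝒜 q.1)) ≤ ρ} :=
    (h.isCompact_tube ρ).isClosed.isOpen_compl.mem_nhds fun hq => hq.2.not_gt hx
  have h2 : φ (t, x) ≠ 0 := fun h0 => by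
    have : x ∈ frontier (𝒜 t) := by rw [h.frontier_eq ht]; exact h0
    rw [Metric.infDist_zero_of_mem this] at hx
    exact hx.not_ge hρ
  have h3 : ∀ᶠ q in 𝓝 (t, x), (0 < φ q ↔ 0 < φ (t, x)) := by
    rcases h2.lt_or_gt with h2 | h2
    · filter_upwards [h.smooth.continuous.continuousAt.eventually_lt_const h2] with q hq
      simp [hq.le.not_gt, h2.le.not_gt]
    · filter_upwards [h.smooth.continuous.continuousAt.eventually_const_lt h2] with q hq
      simp [hq, h2]
  filter_upwards [nhdsWithin_le_nhds h1, nhdsWithin_le_nhds h3, self_mem_nhdsWithin] with q q1 q2 q3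
  refine ⟨not_le.1 fun hle => q1 ⟨q3.1, hle⟩, ?_⟩
  rw [h.domain_eq _ q3.1, h.domain_eq _ ht]
  exact q2

end Evolution

end

section

variable {d : ℕ} {T R r : ℝ} {𝒜 : ℝ → Set (Euc d)} {φ : ℝ × Euc d → ℝ} {t : ℝ}

/-! ### The tubular neighbourhood -/

theorem inner_fderiv_eq_zero_of_norm_eq_one {E : Type*} [NormedAddCommGroup E] [NormedSpace ℝ E]
    {F : E → Euc d} {x : E} (hF : DifferentiableAt ℝ F x) (h1 : ∀ᶠ y in 𝓝 x, ‖F y‖ = 1) (w : E) :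
    ⟪F x, fderiv ℝ F x w⟫ = 0 := by
  have h2 : HasFDerivAt (fun y => ⟪F y, F y⟫) _ x := hF.hasFDerivAt.inner ℝ hF.hasFDerivAt
  have h3 : HasFDerivAt (fun y => ⟪F y, F y⟫) (0 : E →L[ℝ] ℝ) x := by
    refine (hasFDerivAt_const (1 : ℝ) x).congr_of_eventuallyEq ?_
    filter_upwards [h1] with y hy
    rw [real_inner_self_eq_norm_sq, hy, one_pow]
  have h4 := congrArg (fun L : E →L[ℝ] ℝ => L w) (h2.unique h3)
  simp only [ContinuousLinearMap.comp_apply, ContinuousLinearMap.prod_apply,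
    fderivInnerCLM_apply, zero_apply] at h4
  rw [real_inner_comm (F x)] at h4
  linarith

/-- The vector representing a linear functional. -/
def dualVec (d : ℕ) : (Euc d →L[ℝ] ℝ) →L[ℝ] Euc d :=
  ∑ i : Fin d, (ContinuousLinearMap.apply ℝ ℝ (EuclideanSpace.single i (1 : ℝ) : Euc d)).smulRight
    (EuclideanSpace.single i (1 : ℝ) : Euc d)

theorem inner_dualVec (L : Euc d →L[ℝ] ℝ) (v : Euc d) : ⟪dualVec d L, v⟫ = L v := by
  conv_rhs => rw [← sum_single v, map_sum]
  simp only [dualVec, sum_apply, ContinuousLinearMap.smulRight_apply,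
    ContinuousLinearMap.apply_apply, sum_inner, real_inner_smul_left, map_smul, smul_eq_mul]
  refine Finset.sum_congr rfl fun i _ => ?_
  simp [EuclideanSpace.inner_single_left, mul_comm]

theorem gradient_eq_dualVec (g : Euc d → ℝ) (x : Euc d) :
    gradient g x = dualVec d (fderiv ℝ g x) :=
  ext_inner_right ℝ fun v => by rw [inner_gradient, inner_dualVec]

theorem ContDiffAt.gradient {g : Euc d → ℝ} {x : Euc d} (hg : ContDiffAt ℝ ∞ g x) :
    ContDiffAt ℝ ∞ (_root_.gradient g) x := by
  rw [show _root_.gradient g = fun x => dualVec d (fderiv ℝ g x) from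
    funext (gradient_eq_dualVec g)]
  exact (dualVec d).contDiff.contDiffAt.comp x (hg.fderiv_right (m := ∞) (by simp))

theorem SlabField.spatialGradient {f : ℝ × Euc d → ℝ} (hT : 0 < T) (hf : SlabField T f) :
    SlabField T fun q => spatialGradient f q.1 q.2 := by
  refine ((hf.fderivWithin hT).clm_comp ((dualVec d).comp
    ((ContinuousLinearMap.compL ℝ (Euc d) (ℝ × Euc d) ℝ).flip
    (ContinuousLinearMap.inr ℝ ℝ (Euc d))))).congr fun t ht x => ?_
  rw [TwoPhaseMCF.spatialGradient, gradient_eq_dualVec, hf.smooth.fderiv_slice ht]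
  rfl

namespace IsTubularRadius

theorem tube_mem (h : Evolution T R 𝒜 φ) (ht : t ∈ Icc 0 T) {x : Euc d}
    (hx : Metric.infDist x (frontier (𝒜 t)) < 2 * r) :
    {q : ℝ × Euc d | q.1 ∈ Icc 0 T ∧ Metric.infDist q.2 (frontier (𝒜 q.1)) < 2 * r}
      ∈ 𝓝[Icc 0 T ×ˢ univ] (t, x) := by
  filter_upwards [h.eventually_infDist_lt ht hx, self_mem_nhdsWithin] with q q1 q2 using ⟨q2.1, q1⟩

theorem contDiffWithinAt_dist (hr : IsTubularRadius T 𝒜 r) (h : Evolution T R 𝒜 φ)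
    (ht : t ∈ Icc 0 T) {x : Euc d} (hx : Metric.infDist x (frontier (𝒜 t)) < 2 * r) :
    ContDiffWithinAt ℝ ∞ (fun q : ℝ × Euc d => signedDist (𝒜 q.1) q.2) (Icc 0 T ×ˢ univ) (t, x) := by
  obtain ⟨P, -, -, hs⟩ := hr.smooth_inverse
  exact (hs (t, x) ⟨ht, hx⟩).mono_of_mem_nhdsWithin (tube_mem h ht hx)

theorem contDiffAt_slice (hr : IsTubularRadius T 𝒜 r) (h : Evolution T R 𝒜 φ)
    (ht : t ∈ Icc 0 T) {x : Euc d} (hx : Metric.infDist x (frontier (𝒜 t)) < 2 * r) :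
    ContDiffAt ℝ ∞ (signedDist (𝒜 t)) x := by
  have h1 : ContDiffWithinAt ℝ ∞ (fun y : Euc d => ((t, y) : ℝ × Euc d)) univ x :=
    (contDiff_const.prodMk contDiff_id).contDiffWithinAt
  rw [← contDiffWithinAt_univ]
  exact (hr.contDiffWithinAt_dist h ht hx).comp x h1 fun y _ => ⟨ht, mem_univ _⟩

theorem infDist_add_lt (hr : IsTubularRadius T 𝒜 r) (ht : t ∈ Icc 0 T) {y : Euc d} {σ : ℝ}
    (hy : y ∈ frontier (𝒜 t)) (hσ : σ ∈ Ioo (-(2 * r)) (2 * r)) :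
    Metric.infDist (y + σ • innerNormal (𝒜 t) y) (frontier (𝒜 t)) < 2 * r := by
  have h1 := (hr.bijOn t ht).mapsTo
  have h2 : (y, σ) ∈ frontier (𝒜 t) ×ˢ Ioo (-(2 * r)) (2 * r) := mk_mem_prod hy hσ
  have h3 := h1 h2
  simpa only [mem_ofPred_eq] using h3

/-- The smooth inverse gives a second representation of the point, whose height is the signed
distance; injectivity of the normal coordinates identifies the heights. -/
theorem signedDist_add (hr : IsTubularRadius T 𝒜 r) (ht : t ∈ Icc 0 T) {y : Euc d} {σ : ℝ}
    (hy : y ∈ frontier (𝒜 t)) (hσ : σ ∈ Ioo (-(2 * r)) (2 * r)) :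
    signedDist (𝒜 t) (y + σ • innerNormal (𝒜 t) y) = σ := by
  obtain ⟨P, hP, -, -⟩ := hr.smooth_inverse
  have hx := hr.infDist_add_lt ht hy hσ
  set x := y + σ • innerNormal (𝒜 t) y with hxdef
  obtain ⟨p1, p2⟩ := hP t ht x hx
  have h1 : (P (t, x), signedDist (𝒜 t) x) ∈ frontier (𝒜 t) ×ˢ Ioo (-(2 * r)) (2 * r) :=
    ⟨p1, abs_lt.1 (by rw [abs_signedDist]; exact hx)⟩
  have h2 := (hr.bijOn t ht).injOn h1
    (mk_mem_prod hy hσ)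
    (by simp only; rw [← p2])
  exact congrArg Prod.snd h2

/-- By `signedDist_add` the signed distance has unit slope along the normal segment. -/
theorem inner_normal_add (hr : IsTubularRadius T 𝒜 r) (h : Evolution T R 𝒜 φ)
    (ht : t ∈ Icc 0 T) {y : Euc d} {σ : ℝ} (hy : y ∈ frontier (𝒜 t))
    (hσ : σ ∈ Ioo (-(2 * r)) (2 * r)) :
    ⟪innerNormal (𝒜 t) (y + σ • innerNormal (𝒜 t) y), innerNormal (𝒜 t) y⟫ = 1 := by
  have hd := (hr.contDiffAt_slice h ht (hr.infDist_add_lt ht hy hσ)).differentiableAt (by simp)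
  have h1 := hasDerivAt_along (innerNormal (𝒜 t) y) hd
  have h2 : HasDerivAt (fun s : ℝ => signedDist (𝒜 t) (y + s • innerNormal (𝒜 t) y)) 1 σ := by
    refine (hasDerivAt_id σ).congr_of_eventuallyEq ?_
    filter_upwards [Ioo_mem_nhds hσ.1 hσ.2] with s hs
    exact hr.signedDist_add ht hy hs
  rw [innerNormal, inner_gradient]
  exact h1.unique h2

theorem norm_innerNormal_frontier (hr : IsTubularRadius T 𝒜 r) (h : Evolution T R 𝒜 φ)
    (ht : t ∈ Icc 0 T) {y : Euc d} (hy : y ∈ frontier (𝒜 t)) : ‖innerNormal (𝒜 t) y‖ = 1 := by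
  have h1 := hr.inner_normal_add h ht hy (σ := 0) ⟨by linarith [hr.pos], by linarith [hr.pos]⟩
  rw [zero_smul, add_zero, real_inner_self_eq_norm_sq] at h1
  exact (pow_eq_one_iff_of_nonneg (norm_nonneg _) two_ne_zero).1 h1

/-- The gradient of a 1-Lipschitz function has length at most 1; having inner product 1 with a unit
vector, it must be that vector. -/
theorem innerNormal_add (hr : IsTubularRadius T 𝒜 r) (h : Evolution T R 𝒜 φ)
    (ht : t ∈ Icc 0 T) {y : Euc d} {σ : ℝ} (hy : y ∈ frontier (𝒜 t))
    (hσ : σ ∈ Ioo (-(2 * r)) (2 * r)) :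
    innerNormal (𝒜 t) (y + σ • innerNormal (𝒜 t) y) = innerNormal (𝒜 t) y := by
  have h1 := hr.inner_normal_add h ht hy hσ
  have h2 := hr.norm_innerNormal_frontier h ht hy
  have h3 := norm_gradient_signedDist_le (𝒜 t) (y + σ • innerNormal (𝒜 t) y)
  set a := innerNormal (𝒜 t) (y + σ • innerNormal (𝒜 t) y)
  set b := innerNormal (𝒜 t) y
  have h4 : ‖a - b‖ ^ 2 ≤ 0 := by
    rw [norm_sub_sq_real, h1, h2]
    nlinarith [norm_nonneg a]
  exact sub_eq_zero.1 (norm_eq_zero.1 (pow_eq_zero_iff two_ne_zero |>.1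
    (le_antisymm h4 (sq_nonneg _))))

/-- In the tube, the nearest point `x - s ∇s` lies on the interface, with the same normal. -/
theorem projection (hr : IsTubularRadius T 𝒜 r) (h : Evolution T R 𝒜 φ)
    (ht : t ∈ Icc 0 T) {x : Euc d} (hx : Metric.infDist x (frontier (𝒜 t)) < 2 * r) :
    x - signedDist (𝒜 t) x • innerNormal (𝒜 t) x ∈ frontier (𝒜 t) ∧
    innerNormal (𝒜 t) (x - signedDist (𝒜 t) x • innerNormal (𝒜 t) x) = innerNormal (𝒜 t) x := by
  obtain ⟨P, hP, -, -⟩ := hr.smooth_inverse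
  obtain ⟨p1, p2⟩ := hP t ht x hx
  have h1 := hr.innerNormal_add h ht p1 (σ := signedDist (𝒜 t) x)
    (abs_lt.1 (by rw [abs_signedDist]; exact hx))
  rw [← p2] at h1
  have h2 : x - signedDist (𝒜 t) x • innerNormal (𝒜 t) x = P (t, x) := by
    rw [h1, sub_eq_iff_eq_add]; exact p2
  rw [h2]
  exact ⟨p1, h1.symm⟩

theorem norm_innerNormal (hr : IsTubularRadius T 𝒜 r) (h : Evolution T R 𝒜 φ)
    (ht : t ∈ Icc 0 T) {x : Euc d} (hx : Metric.infDist x (frontier (𝒜 t)) < 2 * r) :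
    ‖innerNormal (𝒜 t) x‖ = 1 := by
  obtain ⟨h1, h2⟩ := hr.projection h ht hx
  rw [← h2]
  exact hr.norm_innerNormal_frontier h ht h1

/-- The normal of the level sets of the defining function agrees with the gradient of the
signed distance. -/
theorem spatialGradient_eq (hr : IsTubularRadius T 𝒜 r) (h : Evolution T R 𝒜 φ)
    (ht : t ∈ Icc 0 T) {y : Euc d} (hy : y ∈ frontier (𝒜 t)) :
    ∃ c : ℝ, 0 < c ∧ spatialGradient φ t y = c • innerNormal (𝒜 t) y := by
  have hr0 := hr.pos
  have hφd : Differentiable ℝ fun x => φ (t, x) := (h.smooth_slice t).differentiable (by simp)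
  have hy0 : φ (t, y) = 0 := by rw [h.frontier_eq ht] at hy; exact hy
  set n := innerNormal (𝒜 t) y with hn
  have hn1 : ‖n‖ = 1 := hr.norm_innerNormal_frontier h ht hy
  have htube : ∀ᶠ x in 𝓝 y, Metric.infDist x (frontier (𝒜 t)) < 2 * r :=
    (Metric.continuous_infDist_pt _).continuousAt.eventually_lt_const
      (by simp only [Metric.infDist_zero_of_mem hy]; linarith)
  have hyt : Metric.infDist y (frontier (𝒜 t)) < 2 * r := htube.self_of_nhds
  have hsd : ContDiffAt ℝ ∞ (signedDist (𝒜 t)) y := hr.contDiffAt_slice h ht hyt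
  have hnd : DifferentiableAt ℝ (innerNormal (𝒜 t)) y := hsd.gradient.differentiableAt (by simp)
  have hs0 : signedDist (𝒜 t) y = 0 := signedDist_frontier hy
  have hP : HasFDerivAt (fun x => x - signedDist (𝒜 t) x • innerNormal (𝒜 t) x)
      (ContinuousLinearMap.id ℝ (Euc d)
        - (fderiv ℝ (signedDist (𝒜 t)) y).smulRight (innerNormal (𝒜 t) y)) y := by
    refine ((hasFDerivAt_id y).fun_sub
      ((hsd.differentiableAt (by simp)).hasFDerivAt.fun_smul hnd.hasFDerivAt)).congr_fderiv ?_
    ext1 w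
    simp [hs0]
  have hcomp := (hφd (y - signedDist (𝒜 t) y • innerNormal (𝒜 t) y)).hasFDerivAt.comp y hP
  -- The projection maps into the interface, so φ vanishes along it. Its derivative at y is I - n ⊗
  -- n, whence Dφ ∘ (I - n ⊗ n) = 0 and the gradient of φ is a multiple of n.
  have hzero : HasFDerivAt ((fun x => φ (t, x)) ∘
      fun x => x - signedDist (𝒜 t) x • innerNormal (𝒜 t) x) (0 : Euc d →L[ℝ] ℝ) y := by
    refine (hasFDerivAt_const (0 : ℝ) y).congr_of_eventuallyEq ?_
    filter_upwards [htube] with x hx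
    have := (hr.projection h ht hx).1
    rw [h.frontier_eq ht] at this
    exact this
  have hu := hcomp.unique hzero
  rw [hs0, zero_smul, sub_zero] at hu
  set c := fderiv ℝ (fun x => φ (t, x)) y n with hc
  have hgrad : spatialGradient φ t y = c • n := by
    refine ext_inner_right ℝ fun w => ?_
    have h1 := congrArg (fun L : Euc d →L[ℝ] ℝ => L w) hu
    simp only [ContinuousLinearMap.comp_apply, sub_apply,
      ContinuousLinearMap.id_apply, ContinuousLinearMap.smulRight_apply, map_sub, map_smul,
      zero_apply, smul_eq_mul] at h1
    rw [spatialGradient, inner_gradient, real_inner_smul_left, hn, innerNormal, inner_gradient]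
    rw [hc, hn]
    linarith
  refine ⟨c, ?_, hgrad⟩
  -- A negative factor would make φ negative at y + σ n for small σ > 0. These points have signed
  -- distance σ, so they lie in the domain, where φ is positive.
  by_contra hneg
  have hc0 : c ≠ 0 := fun h0 => h.gradient_ne t ht y hy0 (by rw [hgrad, h0, zero_smul])
  have hcn : 0 < fderiv ℝ (fun x => φ (t, x)) y (-n) := by
    rw [map_neg]
    have := lt_of_le_of_ne (not_lt.1 hneg) hc0
    linarith
  have h1 := eventually_sign_along (hφd y) hy0 hcn
  have h2 : ∀ᶠ s : ℝ in 𝓝 0, s ∈ Ioo (-(2 * r)) (2 * r) :=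
    Ioo_mem_nhds (by linarith) (by linarith)
  obtain ⟨s, ⟨s1, s2⟩, s3⟩ := (((h1.and h2).filter_mono nhdsWithin_le_nhds).and
    (self_mem_nhdsWithin (s := Iio (0 : ℝ)))).exists
  rw [sign_neg s3] at s1
  have s3' : s < 0 := s3
  have h3 := hr.signedDist_add ht hy (σ := -s) ⟨by linarith [s2.2], by linarith [s2.1]⟩
  have h4 : y + (-s) • n ∈ 𝒜 t := by
    by_contra hmem
    have := signedDist_nonpos hmem
    rw [← hn] at h3
    linarith
  rw [h.domain_eq t ht] at h4
  have h5 : φ (t, y + s • -n) < 0 := sign_eq_neg_one_iff.1 s1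
  rw [smul_neg, ← neg_smul] at h5
  exact lt_asymm h5 h4

end IsTubularRadius

end

section

variable {d : ℕ} {T R r : ℝ} {𝒜 : ℝ → Set (Euc d)} {φ : ℝ × Euc d → ℝ} {t : ℝ}

/-! ### A smooth function agreeing with the signed distance near the interface -/

/-- Profiles of the signed distance which are constant at distance at least `r` are smooth. -/
theorem IsTubularRadius.slabSmooth_profile (hr : IsTubularRadius T 𝒜 r) (h : Evolution T R 𝒜 φ)
    {G : ℝ → ℝ} (hG : ContDiff ℝ ∞ G) {ρ : ℝ} (hρ0 : 0 ≤ ρ) (hρ : ρ < 2 * r)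
    (hG1 : ∀ u, ρ ≤ u → G u = G ρ) (hG2 : ∀ u, u ≤ -ρ → G u = G (-ρ)) :
    SlabSmooth T fun q => G (signedDist (𝒜 q.1) q.2) := by
  classical
  rintro ⟨t, x⟩ ⟨ht, -⟩
  by_cases hx : Metric.infDist x (frontier (𝒜 t)) < 2 * r
  · exact hG.contDiffAt.comp_contDiffWithinAt (t, x) (hr.contDiffWithinAt_dist h ht hx)
  · have hval : ∀ t' y, ρ < Metric.infDist y (frontier (𝒜 t')) →
        G (signedDist (𝒜 t') y) = if y ∈ 𝒜 t' then G ρ else G (-ρ) := by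
      intro t' y hy
      unfold signedDist
      split_ifs
      · exact hG1 _ hy.le
      · exact hG2 _ (neg_le_neg hy.le)
    have hx' : ρ < Metric.infDist x (frontier (𝒜 t)) := hρ.trans_le (not_lt.1 hx)
    refine (contDiffWithinAt_const (c := G (signedDist (𝒜 t) x))).congr_of_eventuallyEq ?_ rfl
    filter_upwards [h.eventually_far ht hρ0 hx'] with q hq
    rw [hval _ _ hq.1, hval _ _ hx', if_congr hq.2 rfl rfl]

/-- A smooth function `f` agreeing with the signed distance up to distance `5r/4`. -/
structure SmoothDist {d : ℕ} (T r : ℝ) (𝒜 : ℝ → Set (Euc d)) (f : ℝ × Euc d → ℝ) : Prop where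
  field : SlabField T f
  eq_dist : ∀ t ∈ Icc 0 T, ∀ x, Metric.infDist x (frontier (𝒜 t)) < 5 / 4 * r →
    f (t, x) = signedDist (𝒜 t) x

/-- The signed distance is multiplied by a bump in itself, equal to 1 up to 5r/4 and to 0 from 3r/2
< 2r on. The margin between r and 5r/4 provides an overlap with the region where ξ vanishes and the
weight is locally constant. -/
theorem IsTubularRadius.exists_smoothDist (hr : IsTubularRadius T 𝒜 r) (h : Evolution T R 𝒜 φ) :
    ∃ f, SmoothDist T r 𝒜 f := by
  have hr0 := hr.pos
  let b : ContDiffBump (0 : ℝ) := ⟨5 / 4 * r, 3 / 2 * r, by linarith, by linarith⟩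
  have hb0 : ∀ u, 3 / 2 * r ≤ |u| → b u = 0 := fun u hu =>
    b.zero_of_le_dist (by rw [Real.dist_eq, sub_zero]; exact hu)
  have hb1 : ∀ u, |u| ≤ 5 / 4 * r → b u = 1 := fun u hu =>
    b.one_of_mem_closedBall (by rw [mem_closedBall_zero_iff]; exact hu)
  refine ⟨fun q => b (signedDist (𝒜 q.1) q.2) * signedDist (𝒜 q.1) q.2, ⟨?_, ?_⟩, ?_⟩
  · refine hr.slabSmooth_profile h (G := fun u => b u * u) (b.contDiff.mul contDiff_id)
      (ρ := 3 / 2 * r) (by linarith) (by linarith) (fun u hu => ?_) fun u hu => ?_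
    · rw [hb0 u (hu.trans (le_abs_self u)), hb0 (3 / 2 * r) (le_abs_self _), zero_mul, zero_mul]
    · rw [hb0 u (by rw [abs_of_nonpos (by linarith)]; linarith),
        hb0 (-(3 / 2 * r)) (by rw [abs_neg]; exact le_abs_self _), zero_mul, zero_mul]
  · refine ⟨R + 3 / 2 * r, fun t ht x hx => ?_⟩
    obtain ⟨y, hy, hxy⟩ := h.exists_nearest ht x
    have hyR : ‖y‖ ≤ R := by simpa using h.frontier_subset ht hy
    have := norm_le_norm_add_norm_sub' x y
    simp only
    rw [hb0 _ (by rw [abs_signedDist, hxy, dist_eq_norm]; linarith), zero_mul]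
  · intro t ht x hx
    simp only
    rw [hb1 _ (by rw [abs_signedDist]; exact hx.le), one_mul]

namespace SmoothDist

variable {f : ℝ × Euc d → ℝ}

theorem eventually_near (h : Evolution T R 𝒜 φ) (ht : t ∈ Ioo 0 T) {x : Euc d} {ρ : ℝ}
    (hx : Metric.infDist x (frontier (𝒜 t)) < ρ) :
    ∀ᶠ q : ℝ × Euc d in 𝓝 (t, x), q.1 ∈ Ioo 0 T ∧ Metric.infDist q.2 (frontier (𝒜 q.1)) < ρ := by
  have h1 := h.eventually_infDist_lt (Ioo_subset_Icc_self ht) hx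
  rw [nhdsWithin_eq_nhds.2 (slab_mem_nhds ht x)] at h1
  have h2 : ∀ᶠ q : ℝ × Euc d in 𝓝 (t, x), q.1 ∈ Ioo 0 T :=
    continuous_fst.continuousAt.eventually_mem (Ioo_mem_nhds ht.1 ht.2)
  exact h2.and h1

theorem slice_eventuallyEq (hf : SmoothDist T r 𝒜 f) (ht : t ∈ Icc 0 T) {x : Euc d}
    (hx : Metric.infDist x (frontier (𝒜 t)) < 5 / 4 * r) :
    (fun y => f (t, y)) =ᶠ[𝓝 x] signedDist (𝒜 t) := by
  filter_upwards [(Metric.continuous_infDist_pt _).continuousAt.eventually_lt_const hx] with y hy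
    using hf.eq_dist t ht y hy

theorem spatialGradient_eq (hf : SmoothDist T r 𝒜 f) (ht : t ∈ Icc 0 T) {x : Euc d}
    (hx : Metric.infDist x (frontier (𝒜 t)) < 5 / 4 * r) :
    spatialGradient f t x = innerNormal (𝒜 t) x := by
  unfold spatialGradient innerNormal gradient
  rw [(hf.slice_eventuallyEq ht hx).fderiv_eq]

/-- The velocity of the interface is the mean curvature, in terms of the signed distance. -/
theorem laplacian_eq (hf : SmoothDist T r 𝒜 f) (hr : IsTubularRadius T 𝒜 r)
    (h : Evolution T R 𝒜 φ) (hT : 0 < T) (ht : t ∈ Ioo 0 T) {y : Euc d}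
    (hy : y ∈ frontier (𝒜 t)) :
    spaceDiv (fun q => spatialGradient f q.1 q.2) (t, y) = timeDeriv f (t, y) := by
  have hr0 := hr.pos
  have ht' := Ioo_subset_Icc_self ht
  have hy0 : φ (t, y) = 0 := by rw [h.frontier_eq ht'] at hy; exact hy
  have hyr : Metric.infDist y (frontier (𝒜 t)) < 5 / 4 * r := by
    rw [Metric.infDist_zero_of_mem hy]; linarith
  set N : ℝ × Euc d → Euc d := fun q => spatialGradient f q.1 q.2 with hN
  have hNf : SlabField T N := hf.field.spatialGradient hT
  set L : Euc d → Euc d := fun x => levelSetNormal φ t x with hL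
  have hs0 : f (t, y) = 0 := by rw [hf.eq_dist t ht' y hyr, signedDist_frontier hy]
  have hnear := eventually_near h ht hyr
  -- the unit normals agree on the interface
  have hLn : ∀ z ∈ frontier (𝒜 t), L z = innerNormal (𝒜 t) z := by
    intro z hz
    obtain ⟨c, hc, hcz⟩ := hr.spatialGradient_eq h ht' hz
    simp only [hL, levelSetNormal]
    rw [hcz, norm_smul, hr.norm_innerNormal_frontier h ht' hz, mul_one, Real.norm_eq_abs,
      abs_of_pos hc, smul_smul, inv_mul_cancel₀ hc.ne', one_smul]
  obtain ⟨c, hc, hcy⟩ := hr.spatialGradient_eq h ht' hy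
  have hn1 : ‖innerNormal (𝒜 t) y‖ = 1 := hr.norm_innerNormal_frontier h ht' hy
  have hNy : N (t, y) = innerNormal (𝒜 t) y := hf.spatialGradient_eq ht' hyr
  -- projection to the interface
  have hfd := hf.field.smooth.differentiableAt ht y
  have hNd := hNf.smooth.differentiableAt ht y
  set Q : ℝ × Euc d → Euc d := fun q => q.2 - f q • N q with hQ
  have hQy : Q (t, y) = y := by simp [hQ, hs0]
  have hQd : HasFDerivAt Q (ContinuousLinearMap.snd ℝ ℝ (Euc d)
      - (fderiv ℝ f (t, y)).smulRight (N (t, y))) (t, y) := by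
    refine (hasFDerivAt_snd.fun_sub (hfd.hasFDerivAt.fun_smul hNd.hasFDerivAt)).congr_fderiv ?_
    refine ContinuousLinearMap.ext fun w => ?_
    simp [hs0]
  have hQfront : ∀ᶠ q in 𝓝 (t, y), q.1 ∈ Icc 0 T ∧ Q q ∈ frontier (𝒜 q.1) ∧
      innerNormal (𝒜 q.1) (Q q) = N q := by
    filter_upwards [hnear] with q hq
    have hq1 := Ioo_subset_Icc_self hq.1
    have hQq : Q q = q.2 - signedDist (𝒜 q.1) q.2 • innerNormal (𝒜 q.1) q.2 := by
      simp only [hQ, hN]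
      rw [hf.spatialGradient_eq hq1 hq.2, ← hf.eq_dist q.1 hq1 q.2 hq.2]
    have := hr.projection h hq1 (x := q.2) (by linarith [hq.2])
    rw [hQq]
    refine ⟨hq1, this.1, this.2.trans ?_⟩
    rw [hN]; exact (hf.spatialGradient_eq hq1 hq.2).symm
  -- the normal speed
  have hφd : DifferentiableAt ℝ φ (t, y) := h.smooth.differentiable (by simp) _
  have hspeed : timeDeriv φ (t, y) = c * timeDeriv f (t, y) := by
    have hQφ : HasFDerivAt (fun q : ℝ × Euc d => φ (q.1, Q q))
        ((fderiv ℝ φ (t, y)).comp ((ContinuousLinearMap.fst ℝ ℝ (Euc d)).prod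
          (ContinuousLinearMap.snd ℝ ℝ (Euc d)
          - (fderiv ℝ f (t, y)).smulRight (N (t, y))))) (t, y) := by
      have h1 : HasFDerivAt φ (fderiv ℝ φ (t, y)) (((t, y) : ℝ × Euc d).1, Q (t, y)) := by
        rw [hQy]; exact hφd.hasFDerivAt
      exact h1.comp (t, y) (hasFDerivAt_fst.prodMk hQd)
    -- Q takes values in the moving interface, so φ vanishes along it; the time derivative of this
    -- identity gives ∂_tφ = |∇φ| ∂_t f.
    have hzero : HasFDerivAt (fun q : ℝ × Euc d => φ (q.1, Q q)) (0 : ℝ × Euc d →L[ℝ] ℝ) (t, y) := by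
      refine (hasFDerivAt_const (0 : ℝ) (t, y)).congr_of_eventuallyEq ?_
      filter_upwards [hQfront] with q hq
      have := hq.2.1
      rw [h.frontier_eq hq.1] at this
      exact this
    have h1 := congrArg (fun L : ℝ × Euc d →L[ℝ] ℝ => L (1, 0)) (hQφ.unique hzero)
    simp only [ContinuousLinearMap.comp_apply, ContinuousLinearMap.prod_apply, sub_apply,
      ContinuousLinearMap.coe_fst', ContinuousLinearMap.coe_snd', ContinuousLinearMap.smulRight_apply,
      zero_apply, zero_sub] at h1
    have h2 : ((1 : ℝ), -((fderiv ℝ f (t, y)) (1, 0) • N (t, y)))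
        = ((1, 0) : ℝ × Euc d) - (fderiv ℝ f (t, y)) (1, 0) • ((0, N (t, y)) : ℝ × Euc d) := by
      ext <;> simp
    rw [h2, map_sub, map_smul, smul_eq_mul] at h1
    have h3 : fderiv ℝ φ (t, y) (0, N (t, y)) = c := by
      have e1 : fderiv ℝ φ (t, y) (0, N (t, y)) = fderiv ℝ (fun x => φ (t, x)) y (N (t, y)) := by
        rw [(hasFDerivAt_space hφd).fderiv]; rfl
      rw [e1, ← inner_gradient]
      change ⟪spatialGradient φ t y, _⟫ = c
      rw [hcy, hNy, real_inner_smul_left, real_inner_self_eq_norm_sq, hn1]; ring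
    rw [h3] at h1
    unfold timeDeriv
    linarith
  -- the curvature
  have hLd : DifferentiableAt ℝ L y := by
    have h1 : ContDiffAt ℝ ∞ (fun x => spatialGradient φ t x) y :=
      ContDiffAt.gradient (h.smooth_slice t).contDiffAt
    have h2 : DifferentiableAt ℝ (fun x => spatialGradient φ t x) y := h1.differentiableAt (by simp)
    exact ((h2.norm ℝ (h.gradient_ne t ht' y hy0)).inv
      (norm_ne_zero_iff.2 (h.gradient_ne t ht' y hy0))).smul h2
  have hLunit : ∀ᶠ x in 𝓝 y, ‖L x‖ = 1 := by
    have h1 : ContDiffAt ℝ ∞ (fun x => spatialGradient φ t x) y :=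
      ContDiffAt.gradient (h.smooth_slice t).contDiffAt
    filter_upwards [h1.continuousAt.eventually_ne (h.gradient_ne t ht' y hy0)] with x hx
    simp only [hL, levelSetNormal]
    rw [norm_smul, norm_inv, norm_norm, inv_mul_cancel₀ (norm_ne_zero_iff.2 hx)]
  have hcurv : spaceDiv N (t, y) = divergence L y := by
    have hQs : HasFDerivAt (fun x => Q (t, x)) (ContinuousLinearMap.id ℝ (Euc d)
        - (spaceDeriv f (t, y)).smulRight (N (t, y))) y := by
      refine (hasFDerivAt_space hQd.differentiableAt).congr_fderiv ?_
      rw [spaceDeriv, hQd.fderiv]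
      ext1 w
      simp [spaceDeriv]
    have h1 : HasFDerivAt (fun x => L (Q (t, x))) ((fderiv ℝ L y).comp
        (ContinuousLinearMap.id ℝ (Euc d) - (spaceDeriv f (t, y)).smulRight (N (t, y)))) y := by
      have h2 : HasFDerivAt L (fderiv ℝ L y) (Q (t, y)) := by rw [hQy]; exact hLd.hasFDerivAt
      exact h2.comp y hQs
    -- The normal is constant along normal segments, so N = L ∘ Q and DN = DL (I - n ⊗ n). The
    -- correction to the trace is n·(DL n), which vanishes because L has unit length.
    have h3 : (fun x => N (t, x)) =ᶠ[𝓝 y] fun x => L (Q (t, x)) := by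
      have hc : ContinuousAt (fun x : Euc d => ((t, x) : ℝ × Euc d)) y := by fun_prop
      filter_upwards [hc.eventually hQfront] with x hx
      rw [hLn _ hx.2.1, hx.2.2]
    unfold spaceDiv
    simp only
    rw [divergence_eq_traceL, divergence_eq_traceL, h3.fderiv_eq, h1.fderiv,
      ContinuousLinearMap.comp_sub, map_sub]
    have h4 : (fderiv ℝ L y).comp ((spaceDeriv f (t, y)).smulRight (N (t, y)))
        = (spaceDeriv f (t, y)).smulRight (fderiv ℝ L y (N (t, y))) := by
      ext1 w; simp
    rw [h4, traceL_smulRight, ContinuousLinearMap.comp_id, sub_eq_self]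
    have h5 : spaceDeriv f (t, y) = fderiv ℝ (fun x => f (t, x)) y :=
      (hasFDerivAt_space hfd).fderiv.symm
    rw [h5, ← inner_gradient]
    change ⟪N (t, y), _⟫ = 0
    rw [hNy, ← hLn y hy]
    exact inner_fderiv_eq_zero_of_norm_eq_one hLd hLunit _
  have hmcf := h.speed t ht' y hy
  unfold levelSetSpeed levelSetMeanCurvature at hmcf
  rw [(hasDerivAt_time hφd).deriv, hspeed, hcy, norm_smul, hn1, mul_one, Real.norm_eq_abs,
    abs_of_pos hc, ← hL] at hmcf
  rw [hcurv]
  field_simp at hmcf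
  linarith

/-- Near the interface, the mean curvature and the speed of the level sets of the distance agree
up to an error controlled by the distance. -/
theorem exists_laplacian_bound (hf : SmoothDist T r 𝒜 f) (hr : IsTubularRadius T 𝒜 r)
    (h : Evolution T R 𝒜 φ) (hT : 0 < T) : ∃ C, 0 ≤ C ∧ ∀ t ∈ Ioo 0 T, ∀ x,
      |spaceDiv (fun q => spatialGradient f q.1 q.2) (t, x) - timeDeriv f (t, x)|
        ≤ C * Metric.infDist x (frontier (𝒜 t)) := by
  -- Taking the time derivative within the slab makes G smooth up to the end times, hence Lipschitz
  -- in space uniformly in time. G vanishes on the interface, and the mean value inequality from the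
  -- nearest point gives the bound.
  set G : ℝ × Euc d → ℝ := fun q => spaceDiv (fun q => spatialGradient f q.1 q.2) q
    - fderivWithin ℝ f (Icc 0 T ×ˢ univ) q (1, 0) with hG
  have hGf : SlabField T G := by
    have h1 := (hf.field.spatialGradient hT).spaceDiv hT
    have h2 := hf.field.timeDerivWithin hT
    refine ⟨ContDiffOn.sub h1.smooth h2.smooth, ?_⟩
    obtain ⟨R₁, hR₁⟩ := h1.supp
    obtain ⟨R₂, hR₂⟩ := h2.supp
    refine ⟨max R₁ R₂, fun t ht x hx => ?_⟩
    simp only [hG]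
    rw [hR₁ t ht x ((le_max_left _ _).trans_lt hx)]
    have := hR₂ t ht x ((le_max_right _ _).trans_lt hx)
    rw [this, sub_zero]
  obtain ⟨C, hC0, hC⟩ := hGf.exists_bound_fderiv hT
  refine ⟨C, hC0, fun t ht x => ?_⟩
  have ht' := Ioo_subset_Icc_self ht
  obtain ⟨y, hy, hxy⟩ := h.exists_nearest ht' x
  have e1 : ∀ z, G (t, z) = spaceDiv (fun q => spatialGradient f q.1 q.2) (t, z)
      - timeDeriv f (t, z) := fun z => by
    simp only [hG]; rw [timeDeriv_eq_within ht]
  have h0 : G (t, y) = 0 := by rw [e1, hf.laplacian_eq hr h hT ht hy, sub_self]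
  have h1 := Convex.norm_image_sub_le_of_norm_fderiv_le (𝕜 := ℝ) (f := fun z => G (t, z)) (C := C)
    (s := univ) (x := y) (y := x)
    (fun z _ => (hasFDerivAt_space (hGf.smooth.differentiableAt ht z)).differentiableAt)
    (fun z _ => by
      rw [(hasFDerivAt_space (hGf.smooth.differentiableAt ht z)).fderiv]
      refine (ContinuousLinearMap.opNorm_comp_le _ _).trans ?_
      exact (mul_le_of_le_one_right (norm_nonneg _)
        (ContinuousLinearMap.norm_inr_le_one ..)).trans (hC t ht z))
    convex_univ (mem_univ _) (mem_univ _)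
  rw [h0, sub_zero, e1, Real.norm_eq_abs, ← dist_eq_norm] at h1
  rwa [hxy]

end SmoothDist

end

section

/-! ### Profiles -/

section Profile

variable {G : ℝ → ℝ}

/-- Near zero the mean value inequality applies, elsewhere the global bound. -/
theorem exists_bound_min (hG : ContDiff ℝ ∞ G) (h0 : G 0 = 0) {C : ℝ} (hC : ∀ u, |G u| ≤ C) :
    ∃ K, 0 ≤ K ∧ ∀ u, |G u| ≤ K * min |u| 1 := by
  obtain ⟨C₁, hC₁⟩ := (isCompact_Icc (a := (-1 : ℝ)) (b := 1)).exists_bound_of_continuousOn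
    (hG.continuous_deriv (by simp)).continuousOn
  have hC0 : 0 ≤ C := (abs_nonneg _).trans (hC 0)
  refine ⟨max C C₁, hC0.trans (le_max_left _ _), fun u => ?_⟩
  rcases le_total |u| 1 with hu | hu
  · rw [min_eq_left hu]
    have := Convex.norm_image_sub_le_of_norm_deriv_le (𝕜 := ℝ) (f := G) (C := C₁)
      (s := Icc (-1) 1) (x := 0) (y := u) (fun z _ => hG.differentiable (by simp) z)
      hC₁ (convex_Icc _ _) (by simp) (abs_le.1 hu)
    rw [h0, sub_zero, sub_zero] at this
    exact this.trans (mul_le_mul_of_nonneg_right (le_max_right _ _) (norm_nonneg _))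
  · rw [min_eq_right hu, mul_one]
    exact (hC u).trans (le_max_left _ _)

theorem deriv_eq_zero_of_one_lt_abs (h1 : ∀ u, 1 ≤ u → G u = G 1) (h2 : ∀ u, u ≤ -1 → G u = G (-1))
    {u : ℝ} (hu : 1 < |u|) : deriv G u = 0 := by
  rcases lt_abs.1 hu with hu | hu
  · have : G =ᶠ[𝓝 u] fun _ => G 1 := by
      filter_upwards [Ioi_mem_nhds hu] with z hz using h1 z hz.le
    rw [this.deriv_eq, deriv_const]
  · have : G =ᶠ[𝓝 u] fun _ => G (-1) := by
      filter_upwards [Iio_mem_nhds (show u < -1 by linarith)] with z hz using h2 z hz.le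
    rw [this.deriv_eq, deriv_const]

theorem exists_bound_deriv (hG : ContDiff ℝ ∞ G) (h1 : ∀ u, 1 ≤ u → G u = G 1)
    (h2 : ∀ u, u ≤ -1 → G u = G (-1)) : ∃ K, 0 ≤ K ∧ ∀ u, |deriv G u| ≤ K := by
  obtain ⟨C₁, hC₁⟩ := (isCompact_Icc (a := (-1 : ℝ)) (b := 1)).exists_bound_of_continuousOn
    (hG.continuous_deriv (by simp)).continuousOn
  refine ⟨max C₁ 0, le_max_right _ _, fun u => ?_⟩
  rcases le_or_gt |u| 1 with hu | hu
  · exact (hC₁ u (abs_le.1 hu)).trans (le_max_left _ _)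
  · rw [deriv_eq_zero_of_one_lt_abs h1 h2 hu, abs_zero]; exact le_max_right _ _

end Profile

namespace IsCutoff

variable {κ : ℝ → ℝ}

theorem contDiff_quadraticCutoff (hκ : IsCutoff κ) : ContDiff ℝ ∞ (quadraticCutoff κ) :=
  (contDiff_const.sub (contDiff_id.pow 2)).mul (hκ.smooth.comp (contDiff_id.pow 2))

theorem quadraticCutoff_eq_zero (hκ : IsCutoff κ) {u : ℝ} (hu : 1 ≤ |u|) :
    quadraticCutoff κ u = 0 := by
  have : 1 ≤ u ^ 2 := by rw [← sq_abs]; nlinarith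
  rw [quadraticCutoff, hκ.eq_zero _ (fun h => absurd h.2 (not_lt.2 this)), mul_zero]

theorem quadraticCutoff_zero (hκ : IsCutoff κ) : quadraticCutoff κ 0 = 1 := by
  simp [quadraticCutoff, hκ.eq_one 0 (by norm_num)]

theorem quadraticCutoff_nonneg (hκ : IsCutoff κ) (u : ℝ) : 0 ≤ quadraticCutoff κ u := by
  rcases le_or_gt 1 |u| with hu | hu
  · rw [hκ.quadraticCutoff_eq_zero hu]
  · have : u ^ 2 < 1 := by rw [← sq_abs]; nlinarith [abs_nonneg u]
    exact mul_nonneg (by linarith) (hκ.mem_Icc _).1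

/-- This is the coercivity of the entropy: 1 - |ξ| dominates the square of the truncated distance.
-/
theorem quadraticCutoff_le (hκ : IsCutoff κ) (u : ℝ) :
    quadraticCutoff κ u ≤ 1 - min |u| 1 ^ 2 := by
  rcases le_or_gt 1 |u| with hu | hu
  · rw [hκ.quadraticCutoff_eq_zero hu, min_eq_right hu]; norm_num
  · have : u ^ 2 < 1 := by rw [← sq_abs]; nlinarith [abs_nonneg u]
    rw [min_eq_left hu.le, sq_abs]
    exact mul_le_of_le_one_right (by linarith) (hκ.mem_Icc _).2

theorem quadraticCutoff_le_one (hκ : IsCutoff κ) (u : ℝ) : quadraticCutoff κ u ≤ 1 :=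
  (hκ.quadraticCutoff_le u).trans (by nlinarith [sq_nonneg (min |u| 1)])

/-- Both ζ - 1 and ζ' vanish at 0, the latter because ζ is maximal there. Hence differentiating the
cutoff in ξ costs only errors of order δ. -/
theorem exists_quadraticCutoff_bound (hκ : IsCutoff κ) : ∃ K, 0 ≤ K ∧ ∀ u,
    |deriv (quadraticCutoff κ) u| ≤ K * min |u| 1 ∧
    |quadraticCutoff κ u - 1| ≤ K * min |u| 1 := by
  have hc := hκ.contDiff_quadraticCutoff
  have hd : ContDiff ℝ ∞ (deriv (quadraticCutoff κ)) :=
    (contDiff_infty_iff_deriv.1 hc).2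
  have h1 : ∀ u : ℝ, 1 ≤ u → quadraticCutoff κ u = quadraticCutoff κ 1 := fun u hu => by
    rw [hκ.quadraticCutoff_eq_zero (hu.trans (le_abs_self u)),
      hκ.quadraticCutoff_eq_zero (by simp)]
  have h2 : ∀ u : ℝ, u ≤ -1 → quadraticCutoff κ u = quadraticCutoff κ (-1) := fun u hu => by
    rw [hκ.quadraticCutoff_eq_zero (by rw [abs_of_nonpos (by linarith)]; linarith),
      hκ.quadraticCutoff_eq_zero (by simp)]
  obtain ⟨C, hC0, hC⟩ := exists_bound_deriv hc h1 h2
  have hmax : IsLocalMax (quadraticCutoff κ) 0 := Eventually.of_forall fun u => by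
    rw [hκ.quadraticCutoff_zero]; exact hκ.quadraticCutoff_le_one u
  obtain ⟨K₁, hK₁0, hK₁⟩ := exists_bound_min hd hmax.deriv_eq_zero hC
  obtain ⟨K₂, hK₂0, hK₂⟩ := exists_bound_min (hc.sub (contDiff_const (c := (1 : ℝ))))
    (by simp [hκ.quadraticCutoff_zero]) (C := 1) (fun u => by
      have := hκ.quadraticCutoff_nonneg u
      have := hκ.quadraticCutoff_le_one u
      simp only [abs_le]; constructor <;> linarith)
  refine ⟨max K₁ K₂, hK₁0.trans (le_max_left _ _), fun u => ?_⟩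
  have hm : 0 ≤ min |u| 1 := le_min (abs_nonneg _) zero_le_one
  exact ⟨(hK₁ u).trans (mul_le_mul_of_nonneg_right (le_max_left _ _) hm),
    (hK₂ u).trans (mul_le_mul_of_nonneg_right (le_max_right _ _) hm)⟩

end IsCutoff

namespace IsTruncation

variable {θ : ℝ → ℝ}

theorem strictAntiOn (hθ : IsTruncation θ) : StrictAntiOn θ (Icc (-1) 1) :=
  strictAntiOn_of_deriv_neg (convex_Icc _ _) hθ.smooth.continuous.continuousOn fun u hu =>
    hθ.deriv_neg u (by rwa [interior_Icc] at hu)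

theorem neg_iff (hθ : IsTruncation θ) (u : ℝ) : θ u < 0 ↔ 0 < u := by
  rcases le_or_gt u (-1) with h | h
  · rw [hθ.eq_one u h]; constructor <;> intro <;> linarith
  rcases le_or_gt 1 u with h' | h'
  · rw [hθ.eq_neg_one u h']; constructor <;> intro <;> linarith
  · have := hθ.strictAntiOn.lt_iff_gt ⟨h.le, h'.le⟩ (show (0 : ℝ) ∈ Icc (-1) 1 by norm_num)
    rwa [hθ.zero] at this

theorem abs_le_one (hθ : IsTruncation θ) (u : ℝ) : |θ u| ≤ 1 :=
  _root_.abs_le.2 (hθ.mem_Icc u)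

theorem min_le_abs (hθ : IsTruncation θ) (u : ℝ) : min |u| 1 ≤ |θ u| := by
  rcases le_total |u| 1 with hu | hu
  · rw [min_eq_left hu]; exact hθ.abs_le u (_root_.abs_le.1 hu)
  · rw [min_eq_right hu]
    rcases le_abs.1 hu with hu | hu
    · rw [hθ.eq_neg_one u hu]; norm_num
    · rw [hθ.eq_one u (by linarith)]; norm_num

theorem eq_zero_iff (hθ : IsTruncation θ) (u : ℝ) : θ u = 0 ↔ u = 0 := by
  refine ⟨fun h => ?_, fun h => by rw [h, hθ.zero]⟩
  have := hθ.min_le_abs u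
  rw [h, abs_zero, min_le_iff] at this
  rcases this with h | h
  · exact abs_nonpos_iff.1 h
  · norm_num at h

theorem deriv_nonpos (hθ : IsTruncation θ) (u : ℝ) : deriv θ u ≤ 0 := by
  rcases le_or_gt u (-1) with h | h
  · have : IsLocalMax θ u := Eventually.of_forall fun z => by
      rw [hθ.eq_one u h]; exact (hθ.mem_Icc z).2
    exact this.deriv_eq_zero.le
  rcases le_or_gt 1 u with h' | h'
  · have : IsLocalMin θ u := Eventually.of_forall fun z => by
      rw [hθ.eq_neg_one u h']; exact (hθ.mem_Icc z).1
    exact this.deriv_eq_zero.le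
  · exact (hθ.deriv_neg u ⟨h, h'⟩).le

theorem exists_bound (hθ : IsTruncation θ) : ∃ K, 0 ≤ K ∧ ∀ u,
    |θ u| ≤ K * min |u| 1 ∧ |deriv θ u| ≤ K := by
  obtain ⟨K₁, hK₁0, hK₁⟩ := exists_bound_min hθ.smooth hθ.zero hθ.abs_le_one
  obtain ⟨K₂, hK₂0, hK₂⟩ := exists_bound_deriv hθ.smooth
    (fun u hu => by rw [hθ.eq_neg_one u hu, hθ.eq_neg_one 1 le_rfl])
    (fun u hu => by rw [hθ.eq_one u hu, hθ.eq_one (-1) le_rfl])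
  refine ⟨max K₁ K₂, hK₁0.trans (le_max_left _ _), fun u => ?_⟩
  have hm : 0 ≤ min |u| 1 := le_min (abs_nonneg _) zero_le_one
  exact ⟨(hK₁ u).trans (mul_le_mul_of_nonneg_right (le_max_left _ _) hm),
    (hK₂ u).trans (le_max_right _ _)⟩

end IsTruncation

/-! ### Errors of the calibration at a point -/

section Pointwise

variable {E : Type*} [NormedAddCommGroup E] [InnerProductSpace ℝ E]
  {n m : E} {a a' τ Δ K δ : ℝ}

/-- Here n = ∇s, m = ∂_t n, D = Dn, τ = ∂_t s, a = ζ(s/r) and a' = ζ'(s/r)/r; the velocity is -τ a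
n, and its derivative uses ∇∂_t s = m. The terms of order one cancel, and what remains is a' τ (1 -
2a) n·w - a (a - 1) m·w. -/
theorem transport_error {D : E → E} (hn : ‖n‖ = 1) (hD : ∀ w, ⟪n, D w⟫ = 0) (hDn : D n = 0)
    (hDs : ∀ (c : ℝ) w, D (c • w) = c • D w) (ha0 : 0 ≤ a) (ha1 : a ≤ 1) (hδ : 0 ≤ δ) (hK : 0 ≤ K)
    (ha' : |a'| ≤ K * δ) (haδ : |a - 1| ≤ K * δ) (hτ : |τ| ≤ K) (hm : ‖m‖ ≤ K) (w : E) :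
    |⟪a • m + (a' * τ) • n, w⟫
      + ⟪a • D ((-τ) • a • n) + (a' * ⟪n, (-τ) • a • n⟫) • n, w⟫
      + ⟪a • n, (-τ) • (a • D w + (a' * ⟪n, w⟫) • n) - ⟪m, w⟫ • a • n⟫|
      ≤ 2 * K ^ 2 * δ * ‖w‖ := by
  have hnn : ⟪n, n⟫ = 1 := by rw [real_inner_self_eq_norm_sq, hn]; norm_num
  have e : ⟪a • m + (a' * τ) • n, w⟫
      + ⟪a • D ((-τ) • a • n) + (a' * ⟪n, (-τ) • a • n⟫) • n, w⟫
      + ⟪a • n, (-τ) • (a • D w + (a' * ⟪n, w⟫) • n) - ⟪m, w⟫ • a • n⟫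
      = a' * (τ * (1 - 2 * a)) * ⟪n, w⟫ - a * (a - 1) * ⟪m, w⟫ := by
    rw [hDs, hDs, hDn]
    simp only [inner_add_left, inner_sub_right, inner_add_right, real_inner_smul_left,
      real_inner_smul_right, hD, hnn, smul_zero, inner_zero_left]
    ring
  rw [e]
  have hnw : |⟪n, w⟫| ≤ ‖w‖ := by
    have := abs_real_inner_le_norm n w
    rwa [hn, one_mul] at this
  have hmw : |⟪m, w⟫| ≤ K * ‖w‖ :=
    (abs_real_inner_le_norm m w).trans (mul_le_mul_of_nonneg_right hm (norm_nonneg _))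
  have h2a : |1 - 2 * a| ≤ 1 := abs_le.2 ⟨by linarith, by linarith⟩
  have b1 : |a' * (τ * (1 - 2 * a)) * ⟪n, w⟫| ≤ K * δ * (K * 1) * ‖w‖ := by
    rw [abs_mul, abs_mul, abs_mul τ]
    gcongr
  have b2 : |a * (a - 1) * ⟪m, w⟫| ≤ 1 * (K * δ) * (K * ‖w‖) := by
    rw [abs_mul, abs_mul, abs_of_nonneg ha0]
    gcongr
  refine (abs_sub _ _).trans ((add_le_add b1 b2).trans (le_of_eq ?_))
  ring

/-- Tested with ξ itself, the derivatives of n drop out, m being orthogonal to n and D n being zero.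
The remainder carries both small factors a' and a - 1, hence the square of δ. -/
theorem transport_length_error {D : E → E} (hn : ‖n‖ = 1) (hDn : D n = 0) (hnm : ⟪n, m⟫ = 0)
    (hDs : ∀ (c : ℝ) w, D (c • w) = c • D w) (ha0 : 0 ≤ a) (ha1 : a ≤ 1) (hδ : 0 ≤ δ) (hK : 0 ≤ K)
    (ha' : |a'| ≤ K * δ) (haδ : |a - 1| ≤ K * δ) (hτ : |τ| ≤ K) :
    |⟪a • n, a • m + (a' * τ) • n
      + (a • D ((-τ) • a • n) + (a' * ⟪n, (-τ) • a • n⟫) • n)⟫| ≤ K ^ 3 * δ ^ 2 := by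
  have hnn : ⟪n, n⟫ = 1 := by rw [real_inner_self_eq_norm_sq, hn]; norm_num
  have e : ⟪a • n, a • m + (a' * τ) • n
      + (a • D ((-τ) • a • n) + (a' * ⟪n, (-τ) • a • n⟫) • n)⟫ = -(a * a' * τ * (a - 1)) := by
    rw [hDs, hDs, hDn]
    simp only [inner_add_right, real_inner_smul_left,
      real_inner_smul_right, hnm, hnn, smul_zero, inner_zero_right]
    ring
  rw [e, abs_neg, abs_mul, abs_mul, abs_mul, abs_of_nonneg ha0]
  calc a * |a'| * |τ| * |a - 1| ≤ 1 * (K * δ) * K * (K * δ) := by gcongr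
    _ = _ := by ring

/-- With Δ = div n, the quantity a Δ + a' is the divergence of ξ. The difference Δ - τ is the defect
in the evolution law away from the interface. -/
theorem curvature_error (hn : ‖n‖ = 1) (ha0 : 0 ≤ a) (ha1 : a ≤ 1) (hδ : 0 ≤ δ) (hK : 0 ≤ K)
    (ha' : |a'| ≤ K * δ) (haδ : |a - 1| ≤ K * δ) (hΔ : |Δ| ≤ K) (hΔτ : |Δ - τ| ≤ K * δ) :
    ‖(a * Δ + a') • a • n + (-τ) • a • n‖ ≤ (2 * K + K ^ 2) * δ := by
  rw [← add_smul, norm_smul, norm_smul, hn, mul_one, Real.norm_eq_abs, Real.norm_eq_abs,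
    abs_of_nonneg ha0]
  have e : a * Δ + a' + -τ = a' + ((Δ - τ) + (a - 1) * Δ) := by ring
  have b : |a * Δ + a' + -τ| ≤ K * δ + (K * δ + K * δ * K) := by
    rw [e]
    refine (abs_add_le _ _).trans (add_le_add ha' ((abs_add_le _ _).trans (add_le_add hΔτ ?_)))
    rw [abs_mul]
    gcongr
  refine (mul_le_of_le_one_right (abs_nonneg _) ha1).trans (b.trans (le_of_eq ?_))
  ring

theorem curvature_normal_error (hn : ‖n‖ = 1) (ha0 : 0 ≤ a) (ha1 : a ≤ 1) (hδ : 0 ≤ δ) (hK : 0 ≤ K)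
    (ha' : |a'| ≤ K * δ) (haδ : |a - 1| ≤ K * δ) (hτ : |τ| ≤ K) (hΔ : |Δ| ≤ K)
    (hΔτ : |Δ - τ| ≤ K * δ) :
    |⟪(-τ) • a • n, a • n⟫ + (a * Δ + a')| ≤ (2 * K + 3 * K ^ 2) * δ := by
  have hnn : ⟪n, n⟫ = 1 := by rw [real_inner_self_eq_norm_sq, hn]; norm_num
  have e : ⟪(-τ) • a • n, a • n⟫ + (a * Δ + a')
      = a' + ((Δ - τ) + ((a - 1) * Δ + (a - 1) * (-τ * (1 + a)))) := by
    simp only [real_inner_smul_left, real_inner_smul_right, hnn]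
    ring
  rw [e]
  have b1 : |(a - 1) * Δ| ≤ K * δ * K := by rw [abs_mul]; gcongr
  have b2 : |(a - 1) * (-τ * (1 + a))| ≤ K * δ * (K * 2) := by
    rw [abs_mul, abs_mul, abs_neg, abs_of_nonneg (show 0 ≤ 1 + a by linarith)]
    gcongr
    linarith
  refine (abs_add_le _ _).trans ((add_le_add ha' ((abs_add_le _ _).trans (add_le_add hΔτ
    ((abs_add_le _ _).trans (add_le_add b1 b2))))).trans (le_of_eq ?_))
  ring

theorem weight_transport_error {b : ℝ} (hn : ‖n‖ = 1) (haδ : |a - 1| ≤ K * δ) (hK : 0 ≤ K)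
    (hb : |b| ≤ K) (hτ : |τ| ≤ K) :
    |b * τ + b * ⟪n, (-τ) • a • n⟫| ≤ K ^ 3 * δ := by
  have hnn : ⟪n, n⟫ = 1 := by rw [real_inner_self_eq_norm_sq, hn]; norm_num
  have e : b * τ + b * ⟪n, (-τ) • a • n⟫ = -(b * τ * (a - 1)) := by
    simp only [real_inner_smul_right, hnn]; ring
  rw [e, abs_neg, abs_mul, abs_mul]
  calc |b| * |τ| * |a - 1| ≤ K * K * (K * δ) := by gcongr
    _ = _ := by ring

/-- The weight depends on s alone, so only the normal component counts, and n·(w - (w·ξ)ξ) = (1 -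
a²) n·w. -/
theorem weight_tangential_error {b : ℝ} (hn : ‖n‖ = 1) (ha0 : 0 ≤ a) (ha1 : a ≤ 1)
    (haδ : |a - 1| ≤ K * δ) (hK : 0 ≤ K) (hδ : 0 ≤ δ) (hb : |b| ≤ K) (w : E) :
    |b * ⟪n, w - ⟪w, a • n⟫ • a • n⟫| ≤ 2 * K ^ 2 * ‖w‖ * δ := by
  have hnn : ⟪n, n⟫ = 1 := by rw [real_inner_self_eq_norm_sq, hn]; norm_num
  have e : b * ⟪n, w - ⟪w, a • n⟫ • a • n⟫ = -(b * ((a - 1) * (1 + a)) * ⟪n, w⟫) := by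
    simp only [inner_sub_right, real_inner_smul_right, hnn, real_inner_comm n w]; ring
  have hnw : |⟪n, w⟫| ≤ ‖w‖ := by
    have := abs_real_inner_le_norm n w
    rwa [hn, one_mul] at this
  rw [e, abs_neg, abs_mul, abs_mul, abs_mul, abs_of_nonneg (show 0 ≤ 1 + a by linarith)]
  calc |b| * (|a - 1| * (1 + a)) * |⟪n, w⟫| ≤ K * ((K * δ) * 2) * ‖w‖ := by
        gcongr
        linarith
    _ = _ := by ring

end Pointwise

end

section

variable {d : ℕ} {T R r : ℝ} {𝒜 : ℝ → Set (Euc d)} {φ f : ℝ × Euc d → ℝ} {t : ℝ}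

/-! ### Derivatives of the calibration near the interface -/

namespace SmoothDist

/-- The normal field and its first derivatives near the interface. -/
theorem normal_relations (hf : SmoothDist T r 𝒜 f) (hr : IsTubularRadius T 𝒜 r)
    (h : Evolution T R 𝒜 φ) (hT : 0 < T) (ht : t ∈ Ioo 0 T) {x : Euc d}
    (hx : Metric.infDist x (frontier (𝒜 t)) < 5 / 4 * r) {N : ℝ × Euc d → Euc d}
    (hN : N = fun q => spatialGradient f q.1 q.2) :
    ‖N (t, x)‖ = 1 ∧ (∀ w, spaceDeriv f (t, x) w = ⟪N (t, x), w⟫) ∧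
    ⟪N (t, x), timeDeriv N (t, x)⟫ = 0 ∧ (∀ w, ⟪N (t, x), spaceDeriv N (t, x) w⟫ = 0) ∧
    spaceDeriv N (t, x) (N (t, x)) = 0 ∧
    ∀ w, spaceDeriv (timeDeriv f) (t, x) w = ⟪timeDeriv N (t, x), w⟫ := by
  have hr0 := hr.pos
  have hNf : SlabField T N := by rw [hN]; exact hf.field.spatialGradient hT
  have hnear := eventually_near h ht hx
  have hunit : ∀ᶠ q in 𝓝 (t, x), ‖N q‖ = 1 := by
    filter_upwards [hnear] with q hq
    rw [hN]
    simp only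
    rw [hf.spatialGradient_eq (Ioo_subset_Icc_self hq.1) hq.2]
    exact hr.norm_innerNormal h (Ioo_subset_Icc_self hq.1) (by linarith [hq.2])
  have hNd := hNf.smooth.differentiableAt ht x
  have hC : ContDiffAt ℝ ∞ f (t, x) := hf.field.smooth.contDiffAt ht x
  have hD : DifferentiableAt ℝ (fderiv ℝ f) (t, x) :=
    (hC.fderiv_right (m := ∞) (by simp)).differentiableAt (by simp)
  have hinner : ∀ᶠ q in 𝓝 (t, x), ∀ w, ⟪N q, w⟫ = fderiv ℝ f q (0, w) := by
    filter_upwards [hnear] with q hq w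
    rw [hN]
    simp only
    rw [spatialGradient, inner_gradient,
      (hasFDerivAt_space (hf.field.smooth.differentiableAt hq.1 q.2)).fderiv]
    rfl
  have hDN : ∀ z w, ⟪fderiv ℝ N (t, x) z, w⟫ = fderiv ℝ (fderiv ℝ f) (t, x) z (0, w) := by
    intro z w
    have h1 : HasFDerivAt (fun q => ⟪N q, w⟫)
        ((innerSL ℝ w).comp (fderiv ℝ N (t, x))) (t, x) := by
      have := (innerSL ℝ w).hasFDerivAt.comp (t, x) hNd.hasFDerivAt
      refine this.congr_of_eventuallyEq (Eventually.of_forall fun q => ?_)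
      simp [real_inner_comm]
    have h2 : HasFDerivAt (fun q => fderiv ℝ f q (0, w))
        ((ContinuousLinearMap.apply ℝ ℝ ((0, w) : ℝ × Euc d)).comp
          (fderiv ℝ (fderiv ℝ f) (t, x))) (t, x) :=
      (ContinuousLinearMap.apply ℝ ℝ ((0, w) : ℝ × Euc d)).hasFDerivAt.comp (t, x) hD.hasFDerivAt
    have h3 := h1.unique (h2.congr_of_eventuallyEq (hinner.mono fun q hq => hq w))
    have h4 := congrArg (fun L : ℝ × Euc d →L[ℝ] ℝ => L z) h3
    simp only [ContinuousLinearMap.comp_apply, innerSL_apply_apply,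
      ContinuousLinearMap.apply_apply] at h4
    rw [real_inner_comm, h4]
  have hsymm : IsSymmSndFDerivAt ℝ f (t, x) := hC.isSymmSndFDerivAt (by
    simp [minSmoothness_of_isRCLikeNormedField]; exact WithTop.coe_le_coe.2 le_top)
  have horth := inner_fderiv_eq_zero_of_norm_eq_one hNd hunit
  refine ⟨hunit.self_of_nhds, fun w => (hinner.self_of_nhds w).symm, horth _, fun w => horth _,
    ?_, fun w => ?_⟩
  -- By symmetry of D²f, (DN N)·w equals (DN w)·N, which vanishes because N has unit length.
  · refine ext_inner_right ℝ fun w => ?_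
    rw [inner_zero_left]
    have h1 := hDN (0, N (t, x)) w
    have h2 := hDN (0, w) (N (t, x))
    rw [hsymm.eq] at h1
    change ⟪fderiv ℝ N (t, x) (0, N (t, x)), w⟫ = 0
    rw [h1, ← h2, real_inner_comm]
    exact horth _
  · have h2 : HasFDerivAt (timeDeriv f)
        ((ContinuousLinearMap.apply ℝ ℝ ((1, 0) : ℝ × Euc d)).comp
          (fderiv ℝ (fderiv ℝ f) (t, x))) (t, x) :=
      (ContinuousLinearMap.apply ℝ ℝ ((1, 0) : ℝ × Euc d)).hasFDerivAt.comp (t, x) hD.hasFDerivAt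
    have e1 : spaceDeriv (timeDeriv f) (t, x) w
        = fderiv ℝ (fderiv ℝ f) (t, x) (0, w) (1, 0) := by
      rw [spaceDeriv, h2.fderiv]; rfl
    rw [e1, hsymm.eq, timeDeriv, hDN]

/-- Derivatives of profiles of the distance multiplied with the normal. -/
theorem xi_derivs (hf : SmoothDist T r 𝒜 f) (hr : IsTubularRadius T 𝒜 r)
    (h : Evolution T R 𝒜 φ) (hT : 0 < T) (ht : t ∈ Ioo 0 T) {x : Euc d}
    (hx : Metric.infDist x (frontier (𝒜 t)) < 5 / 4 * r) {N : ℝ × Euc d → Euc d}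
    (hN : N = fun q => spatialGradient f q.1 q.2) {G : ℝ → ℝ} (hG : ContDiff ℝ ∞ G)
    {ξ : ℝ × Euc d → Euc d} (hξ : ξ =ᶠ[𝓝 (t, x)] fun q => G (f q / r) • N q) :
    timeDeriv ξ (t, x) = G (f (t, x) / r) • timeDeriv N (t, x)
      + (deriv G (f (t, x) / r) / r * timeDeriv f (t, x)) • N (t, x) ∧
    (∀ w, spaceDeriv ξ (t, x) w = G (f (t, x) / r) • spaceDeriv N (t, x) w
      + (deriv G (f (t, x) / r) / r * ⟪N (t, x), w⟫) • N (t, x)) ∧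
    spaceDiv ξ (t, x) = G (f (t, x) / r) * spaceDiv N (t, x) + deriv G (f (t, x) / r) / r := by
  obtain ⟨hn1, hfN, -, -, -, -⟩ := hf.normal_relations hr h hT ht hx hN
  have hNf : SlabField T N := by rw [hN]; exact hf.field.spatialGradient hT
  have hNd := hNf.smooth.differentiableAt ht x
  have hfd := hf.field.smooth.differentiableAt ht x
  have hGd : HasDerivAt G (deriv G (f (t, x) / r)) (f (t, x) / r) :=
    (hG.differentiable (by simp) _).hasDerivAt
  have h1 : HasFDerivAt (fun q => G (f q / r))
      ((deriv G (f (t, x) / r) / r) • fderiv ℝ f (t, x)) (t, x) := by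
    have h2 : HasFDerivAt (fun q => f q / r) (r⁻¹ • fderiv ℝ f (t, x)) (t, x) := by
      simpa only [div_eq_inv_mul] using hfd.hasFDerivAt.const_mul r⁻¹
    have := hGd.comp_hasFDerivAt (t, x) h2
    rwa [smul_smul, ← div_eq_mul_inv] at this
  have h3 : HasFDerivAt ξ (G (f (t, x) / r) • fderiv ℝ N (t, x)
      + ((deriv G (f (t, x) / r) / r) • fderiv ℝ f (t, x)).smulRight (N (t, x))) (t, x) :=
    (h1.fun_smul hNd.hasFDerivAt).congr_of_eventuallyEq hξ
  have h4 : ∀ w, spaceDeriv ξ (t, x) w = G (f (t, x) / r) • spaceDeriv N (t, x) w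
      + (deriv G (f (t, x) / r) / r * ⟪N (t, x), w⟫) • N (t, x) := fun w => by
    rw [← hfN, spaceDeriv, h3.fderiv]; rfl
  refine ⟨by rw [timeDeriv, h3.fderiv]; rfl, h4, ?_⟩
  rw [spaceDiv_eq_traceL h3.differentiableAt, spaceDiv_eq_traceL hNd]
  have h5 : spaceDeriv ξ (t, x) = G (f (t, x) / r) • spaceDeriv N (t, x)
      + ((deriv G (f (t, x) / r) / r) • spaceDeriv f (t, x)).smulRight (N (t, x)) := by
    refine ContinuousLinearMap.ext fun w => ?_
    rw [h4, ← hfN]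
    rfl
  rw [h5, map_add, map_smul, traceL_smulRight, smul_eq_mul, smul_apply, hfN,
    real_inner_self_eq_norm_sq, hn1]
  simp

/-- The second term comes from the derivative of the speed, via ∇∂_t f = ∂_t N. -/
theorem velocity_derivs (hf : SmoothDist T r 𝒜 f) (hr : IsTubularRadius T 𝒜 r)
    (h : Evolution T R 𝒜 φ) (hT : 0 < T) (ht : t ∈ Ioo 0 T) {x : Euc d}
    (hx : Metric.infDist x (frontier (𝒜 t)) < 5 / 4 * r) {N : ℝ × Euc d → Euc d}
    (hN : N = fun q => spatialGradient f q.1 q.2)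
    {ξ B : ℝ × Euc d → Euc d} (hξ : DifferentiableAt ℝ ξ (t, x))
    (hB : B =ᶠ[𝓝 (t, x)] fun q => (-timeDeriv f q) • ξ q) (w : Euc d) :
    spaceDeriv B (t, x) w = (-timeDeriv f (t, x)) • spaceDeriv ξ (t, x) w
      - ⟪timeDeriv N (t, x), w⟫ • ξ (t, x) := by
  obtain ⟨-, -, -, -, -, hv⟩ := hf.normal_relations hr h hT ht hx hN
  have hC : ContDiffAt ℝ ∞ f (t, x) := hf.field.smooth.contDiffAt ht x
  have hD : DifferentiableAt ℝ (timeDeriv f) (t, x) := by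
    have : DifferentiableAt ℝ (fderiv ℝ f) (t, x) :=
      (hC.fderiv_right (m := ∞) (by simp)).differentiableAt (by simp)
    exact this.clm_apply (differentiableAt_const _)
  have h1 := (hD.hasFDerivAt.fun_neg.fun_smul hξ.hasFDerivAt).congr_of_eventuallyEq hB
  rw [← hv, spaceDeriv, h1.fderiv]
  simp [spaceDeriv, sub_eq_add_neg]

theorem weight_derivs (hf : SmoothDist T r 𝒜 f) (ht : t ∈ Ioo 0 T) {x : Euc d}
    {G : ℝ → ℝ} (hG : ContDiff ℝ ∞ G) {ϑ : ℝ × Euc d → ℝ}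
    (hϑ : ϑ =ᶠ[𝓝 (t, x)] fun q => G (f q / r)) :
    timeDeriv ϑ (t, x) = deriv G (f (t, x) / r) / r * timeDeriv f (t, x) ∧
    ∀ w, spaceDeriv ϑ (t, x) w = deriv G (f (t, x) / r) / r * spaceDeriv f (t, x) w := by
  have hfd := hf.field.smooth.differentiableAt ht x
  have hGd : HasDerivAt G (deriv G (f (t, x) / r)) (f (t, x) / r) :=
    (hG.differentiable (by simp) _).hasDerivAt
  have h1 : HasFDerivAt ϑ ((deriv G (f (t, x) / r) / r) • fderiv ℝ f (t, x)) (t, x) := by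
    have h2 : HasFDerivAt (fun q => f q / r) (r⁻¹ • fderiv ℝ f (t, x)) (t, x) := by
      simpa only [div_eq_inv_mul] using hfd.hasFDerivAt.const_mul r⁻¹
    have := hGd.comp_hasFDerivAt (t, x) h2
    rw [smul_smul, ← div_eq_mul_inv] at this
    exact this.congr_of_eventuallyEq hϑ
  constructor
  · rw [timeDeriv, h1.fderiv]; rfl
  · intro w; rw [spaceDeriv, h1.fderiv]; rfl

end SmoothDist

end

section

variable {d : ℕ} {T R r : ℝ} {𝒜 : ℝ → Set (Euc d)} {φ f : ℝ × Euc d → ℝ} {t : ℝ} {κ θ : ℝ → ℝ}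

/-! ### The calibration of a smooth mean curvature flow -/

theorem weight_neg_iff (hθ : IsTruncation θ) (h : Evolution T R 𝒜 φ) (hr : 0 < r)
    (ht : t ∈ Icc 0 T) (x : Euc d) : weight (𝒜 t) r θ x < 0 ↔ x ∈ 𝒜 t := by
  rw [weight, hθ.neg_iff, div_pos_iff_of_pos_right hr]
  refine ⟨fun hs => ?_, fun hx => ?_⟩
  · by_contra hx
    exact absurd (signedDist_nonpos hx) (not_le.2 hs)
  · rw [signedDist, if_pos hx]
    have hxf : x ∉ frontier (𝒜 t) := fun hf => by
      rw [(h.isOpen ht).frontier_eq] at hf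
      exact hf.2 hx
    exact (isClosed_frontier.notMem_iff_infDist_pos (h.frontier_nonempty ht)).1 hxf

theorem weight_eq_zero_iff (hθ : IsTruncation θ) (h : Evolution T R 𝒜 φ) (hr : 0 < r)
    (ht : t ∈ Icc 0 T) (x : Euc d) : weight (𝒜 t) r θ x = 0 ↔ φ (t, x) = 0 := by
  rw [weight, hθ.eq_zero_iff, div_eq_zero_iff, or_iff_left hr.ne', ← abs_eq_zero, abs_signedDist]
  have := h.frontier_eq ht
  rw [← isClosed_frontier.mem_iff_infDist_zero (h.frontier_nonempty ht), this]
  rfl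

theorem norm_xi_le (hκ : IsCutoff κ) (S : Set (Euc d)) (x : Euc d) :
    ‖xi S r κ x‖ ≤ 1 - min |signedDist S x / r| 1 ^ 2 := by
  rw [xi, norm_smul, Real.norm_eq_abs, abs_of_nonneg (hκ.quadraticCutoff_nonneg _)]
  exact (mul_le_of_le_one_right (hκ.quadraticCutoff_nonneg _)
    (norm_gradient_signedDist_le _ _)).trans (hκ.quadraticCutoff_le _)

theorem xi_eq_zero (hκ : IsCutoff κ) (hr : 0 < r) {S : Set (Euc d)} {x : Euc d}
    (hx : r ≤ Metric.infDist x (frontier S)) : xi S r κ x = 0 := by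
  rw [xi, hκ.quadraticCutoff_eq_zero, zero_smul]
  rw [abs_div, abs_signedDist, abs_of_pos hr, one_le_div hr]
  exact hx

theorem weight_eq_of_far (hθ : IsTruncation θ) (hr : 0 < r) {S : Set (Euc d)} {x : Euc d}
    [Decidable (x ∈ S)] (hx : r ≤ Metric.infDist x (frontier S)) :
    weight S r θ x = if x ∈ S then -1 else 1 := by
  rw [weight]
  split_ifs with hxS
  · exact hθ.eq_neg_one _ (by rw [signedDist, if_pos hxS, one_le_div hr]; exact hx)
  · exact hθ.eq_one _ (by rw [signedDist, if_neg hxS, neg_div, neg_le_neg_iff, one_le_div hr]; exact hx)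

theorem fderiv_weight (hr : IsTubularRadius T 𝒜 r) (h : Evolution T R 𝒜 φ) (hθ : IsTruncation θ)
    (ht : t ∈ Icc 0 T) {x : Euc d} (hx : Metric.infDist x (frontier (𝒜 t)) < 2 * r) (w : Euc d) :
    fderiv ℝ (fun y => weight (𝒜 t) r θ y) x w
      = deriv θ (signedDist (𝒜 t) x / r) / r * ⟪innerNormal (𝒜 t) x, w⟫ := by
  have hs := (hr.contDiffAt_slice h ht hx).differentiableAt (by simp)
  have hθd : HasDerivAt θ (deriv θ (signedDist (𝒜 t) x / r)) (signedDist (𝒜 t) x / r) :=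
    (hθ.smooth.differentiable (by simp) _).hasDerivAt
  have h2 : HasFDerivAt (fun y => signedDist (𝒜 t) y / r)
      (r⁻¹ • fderiv ℝ (signedDist (𝒜 t)) x) x := by
    simpa only [div_eq_inv_mul] using hs.hasFDerivAt.const_mul r⁻¹
  have h3 := hθd.comp_hasFDerivAt x h2
  have h4 : HasFDerivAt (fun y => weight (𝒜 t) r θ y) _ x := h3
  rw [h4.fderiv, innerNormal, inner_gradient]
  simp only [smul_apply, smul_eq_mul]
  ring

theorem fderiv_weight_of_far (hr : 0 < r) (h : Evolution T R 𝒜 φ) (hθ : IsTruncation θ)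
    (ht : t ∈ Icc 0 T) {x : Euc d} (hx : r < Metric.infDist x (frontier (𝒜 t))) :
    fderiv ℝ (fun y => weight (𝒜 t) r θ y) x = 0 := by
  classical
  have h1 : Tendsto (fun y : Euc d => ((t, y) : ℝ × Euc d)) (𝓝 x) (𝓝[Icc 0 T ×ˢ univ] (t, x)) :=
    tendsto_nhdsWithin_iff.2 ⟨(by fun_prop : Continuous fun y : Euc d => (t, y)).tendsto x,
      Eventually.of_forall fun y => ⟨ht, mem_univ _⟩⟩
  have h2 : (fun y => weight (𝒜 t) r θ y) =ᶠ[𝓝 x] fun _ => weight (𝒜 t) r θ x := by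
    filter_upwards [h1.eventually (h.eventually_far ht hr.le hx)] with y hy
    rw [weight_eq_of_far hθ hr hy.1.le, weight_eq_of_far hθ hr hx.le, if_congr hy.2 rfl rfl]
  rw [h2.fderiv_eq]
  exact fderiv_const_apply _

-- The velocity is B = -(∂_t s) ξ and the error scale is δ = min(|s|/r, 1). The differential
-- conditions are checked in two overlapping regions: within distance 5r/4 of the interface by
-- explicit derivatives and the pointwise error lemmas, and beyond distance r, where ξ and B vanish
-- locally and the weight is locally constant.
set_option maxHeartbeats 1600000 in
theorem IsCalibrationData.exists_calibration (hc : IsCalibrationData T 𝒜 r κ θ)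
    (h : Evolution T R 𝒜 φ) (hT : 0 < T) :
    ∃ (M : ℝ) (B : ℝ × Euc d → Euc d) (δ : ℝ × Euc d → ℝ),
      Calibration T M 𝒜 (fun q => xi (𝒜 q.1) r κ q.2) B (fun q => weight (𝒜 q.1) r θ q.2) δ := by
  classical
  have hr := hc.tubular
  have hr0 := hr.pos
  have hκ := hc.cutoff
  have hθ := hc.truncation
  obtain ⟨f, hf⟩ := hr.exists_smoothDist h
  set N : ℝ × Euc d → Euc d := fun q => spatialGradient f q.1 q.2 with hN
  have hNf : SlabField T N := hf.field.spatialGradient hT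
  set ζ := quadraticCutoff κ with hζ
  have hζs : ContDiff ℝ ∞ ζ := hκ.contDiff_quadraticCutoff
  set ξ : ℝ × Euc d → Euc d := fun q => xi (𝒜 q.1) r κ q.2 with hξ
  set ϑ : ℝ × Euc d → ℝ := fun q => weight (𝒜 q.1) r θ q.2 with hϑ
  set δ : ℝ × Euc d → ℝ := fun q => min |signedDist (𝒜 q.1) q.2 / r| 1 with hδ
  have hδ0 : ∀ q, 0 ≤ δ q := fun q => le_min (abs_nonneg _) zero_le_one
  -- smoothness
  have hprofile : ∀ {G : ℝ → ℝ}, ContDiff ℝ ∞ G → (∀ u, 1 ≤ u → G u = G 1) →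
      (∀ u, u ≤ -1 → G u = G (-1)) → SlabSmooth T fun q => G (signedDist (𝒜 q.1) q.2 / r) := by
    intro G hG h1 h2
    refine hr.slabSmooth_profile h (G := fun u => G (u / r)) (hG.comp (contDiff_id.div_const r))
      hr0.le (by linarith) (fun u hu => ?_) fun u hu => ?_
    · rw [div_self hr0.ne', h1 _ ((one_le_div hr0).2 hu)]
    · rw [neg_div, div_self hr0.ne', h2 _ (by rw [div_le_iff₀ hr0]; linarith)]
  have hζ1 : ∀ u : ℝ, 1 ≤ u → ζ u = ζ 1 := fun u hu => by
    rw [hζ, hκ.quadraticCutoff_eq_zero (hu.trans (le_abs_self u)),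
      hκ.quadraticCutoff_eq_zero (by simp)]
  have hζ2 : ∀ u : ℝ, u ≤ -1 → ζ u = ζ (-1) := fun u hu => by
    rw [hζ, hκ.quadraticCutoff_eq_zero (by rw [abs_of_nonpos (by linarith)]; linarith),
      hκ.quadraticCutoff_eq_zero (by simp)]
  have hξN : ∀ t ∈ Icc 0 T, ∀ x, ξ (t, x) = ζ (signedDist (𝒜 t) x / r) • N (t, x) := by
    intro t ht x
    rcases lt_or_ge (Metric.infDist x (frontier (𝒜 t))) (5 / 4 * r) with hx | hx
    · rw [hN]; simp only; rw [hf.spatialGradient_eq ht hx]; rfl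
    · simp only [hξ]
      rw [xi_eq_zero hκ hr0 (by linarith), hζ, hκ.quadraticCutoff_eq_zero, zero_smul]
      rw [abs_div, abs_signedDist, abs_of_pos hr0, one_le_div hr0]
      linarith
  have hξf : SlabField T ξ := ((hprofile hζs hζ1 hζ2).prod_smul hNf).congr hξN
  -- The derivative within the slab keeps B smooth up to the end times; the factor ξ removes the
  -- region where f differs from the signed distance.
  set B : ℝ × Euc d → Euc d := fun q => (-fderivWithin ℝ f (Icc 0 T ×ˢ univ) q (1, 0)) • ξ q with hB
  have hBf : SlabField T B :=
    SlabSmooth.prod_smul (ContDiffOn.neg (hf.field.timeDerivWithin hT).smooth) hξf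
  have hϑs : SlabSmooth T ϑ := hprofile hθ.smooth
    (fun u hu => by rw [hθ.eq_neg_one u hu, hθ.eq_neg_one 1 le_rfl])
    (fun u hu => by rw [hθ.eq_one u hu, hθ.eq_one (-1) le_rfl])
  -- constants
  obtain ⟨K₁, hK₁0, hK₁⟩ := hκ.exists_quadraticCutoff_bound
  obtain ⟨K₂, hK₂0, hK₂⟩ := hθ.exists_bound
  obtain ⟨K₃, hK₃0, hK₃⟩ := hf.field.exists_bound_timeDeriv hT
  obtain ⟨K₄, hK₄0, hK₄⟩ := hNf.exists_bound_timeDeriv hT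
  obtain ⟨K₅, hK₅0, hK₅⟩ := (hNf.spaceDiv hT).exists_bound
  obtain ⟨K₆, hK₆0, hK₆⟩ := hf.exists_laplacian_bound hr h hT
  -- One constant for all pointwise error lemmas. The quotients by r come from the chain rule for
  -- s/r, and the factor 5r/4 from comparing the distance with r δ, which saturates at distance r.
  set K := 1 + K₁ + K₁ / r + K₂ + K₂ / r + K₃ + K₄ + K₅ + K₆ * (5 / 4 * r) with hK
  have p1 : 0 ≤ K₁ / r := by positivity
  have p2 : 0 ≤ K₂ / r := by positivity
  have p3 : 0 ≤ K₆ * (5 / 4 * r) := by positivity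
  have hK0 : 0 ≤ K := by positivity
  have hζ' : ∀ u, |deriv ζ u / r| ≤ K * min |u| 1 := fun u => by
    rw [abs_div, abs_of_pos hr0, div_le_iff₀ hr0]
    refine (hK₁ u).1.trans ?_
    have hm : 0 ≤ min |u| 1 := le_min (abs_nonneg _) zero_le_one
    have : K₁ ≤ K * r := by
      rw [← div_le_iff₀ hr0]; linarith
    exact (mul_le_mul_of_nonneg_right this hm).trans (le_of_eq (by ring))
  have hζδ : ∀ u, |ζ u - 1| ≤ K * min |u| 1 := fun u =>
    (hK₁ u).2.trans (mul_le_mul_of_nonneg_right (by linarith) (le_min (abs_nonneg _) zero_le_one))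
  have hθ' : ∀ u, |deriv θ u / r| ≤ K := fun u => by
    rw [abs_div, abs_of_pos hr0, div_le_iff₀ hr0]
    refine (hK₂ u).2.trans ?_
    rw [← div_le_iff₀ hr0]; linarith
  have hθδ : ∀ u, |θ u| ≤ K * min |u| 1 := fun u =>
    (hK₂ u).1.trans (mul_le_mul_of_nonneg_right (by linarith) (le_min (abs_nonneg _) zero_le_one))
  have hδϑ : ∀ q, δ q ≤ |ϑ q| := fun q => hθ.min_le_abs _
  set M := 1 + 2 * K + 3 * K ^ 2 + K ^ 3 with hM
  have hK2 : 0 ≤ K ^ 2 := by positivity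
  have hK3 : 0 ≤ K ^ 3 := by positivity
  have hM1 : 2 * K ^ 2 ≤ M := by linarith
  have hM2 : K ^ 3 ≤ M := by linarith
  have hM3 : 2 * K + K ^ 2 ≤ M := by linarith
  have hM4 : 2 * K + 3 * K ^ 2 ≤ M := by linarith
  have hM0 : 0 ≤ M := by positivity
  -- the situation near the interface
  have near : ∀ t ∈ Ioo 0 T, ∀ x, Metric.infDist x (frontier (𝒜 t)) < 5 / 4 * r →
      f (t, x) = signedDist (𝒜 t) x ∧
      (ξ =ᶠ[𝓝 (t, x)] fun q => ζ (f q / r) • N q) ∧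
      (B =ᶠ[𝓝 (t, x)] fun q => (-timeDeriv f q) • ξ q) ∧
      (ϑ =ᶠ[𝓝 (t, x)] fun q => θ (f q / r)) ∧
      |spaceDiv N (t, x) - timeDeriv f (t, x)| ≤ K * δ (t, x) ∧
      ξ (t, x) = ζ (signedDist (𝒜 t) x / r) • N (t, x) ∧
      B (t, x) = (-timeDeriv f (t, x)) • ζ (signedDist (𝒜 t) x / r) • N (t, x) := by
    intro t ht x hx
    have hξ1 := hξN t (Ioo_subset_Icc_self ht) x
    have hn := SmoothDist.eventually_near h ht hx
    refine ⟨hf.eq_dist t (Ioo_subset_Icc_self ht) x hx, ?_, ?_, ?_, ?_, hξ1, ?_⟩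
    · filter_upwards [hn] with q hq
      have hq1 := Ioo_subset_Icc_self hq.1
      rw [hf.eq_dist q.1 hq1 q.2 hq.2, hξN q.1 hq1 q.2]
    · filter_upwards [hn] with q hq
      simp only [hB]
      rw [timeDeriv_eq_within hq.1]
    · filter_upwards [hn] with q hq
      rw [hf.eq_dist q.1 (Ioo_subset_Icc_self hq.1) q.2 hq.2]; rfl
    · refine (hK₆ t ht x).trans ?_
      have h1 : Metric.infDist x (frontier (𝒜 t)) ≤ 5 / 4 * r * δ (t, x) := by
        simp only [hδ]
        rw [abs_div, abs_signedDist, abs_of_pos hr0]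
        rcases min_choice (Metric.infDist x (frontier (𝒜 t)) / r) 1 with hm | hm <;> rw [hm]
        · rw [mul_assoc, mul_div_cancel₀ _ hr0.ne']
          linarith [Metric.infDist_nonneg (x := x) (s := frontier (𝒜 t))]
        · linarith
      calc _ ≤ K₆ * (5 / 4 * r * δ (t, x)) := mul_le_mul_of_nonneg_left h1 hK₆0
        _ = K₆ * (5 / 4 * r) * δ (t, x) := by ring
        _ ≤ K * δ (t, x) := mul_le_mul_of_nonneg_right (by linarith) (hδ0 _)
    · rw [← hξ1, timeDeriv_eq_within ht]
  have far : ∀ t ∈ Ioo 0 T, ∀ x, r < Metric.infDist x (frontier (𝒜 t)) →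
      (ξ =ᶠ[𝓝 (t, x)] fun _ => 0) ∧ (B =ᶠ[𝓝 (t, x)] fun _ => 0) ∧
      (ϑ =ᶠ[𝓝 (t, x)] fun _ => ϑ (t, x)) := by
    intro t ht x hx
    have hn := h.eventually_far (Ioo_subset_Icc_self ht) hr0.le hx
    rw [nhdsWithin_eq_nhds.2 (slab_mem_nhds ht x)] at hn
    have hξ0 : ξ =ᶠ[𝓝 (t, x)] fun _ => 0 := by
      filter_upwards [hn] with q hq using xi_eq_zero hκ hr0 hq.1.le
    refine ⟨hξ0, ?_, ?_⟩
    · filter_upwards [hξ0] with q hq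
      simp only [hB]; rw [hq, smul_zero]
    · filter_upwards [hn] with q hq
      simp only [hϑ]
      rw [weight_eq_of_far hθ hr0 hq.1.le, weight_eq_of_far hθ hr0 hx.le, if_congr hq.2 rfl rfl]
  have timeDeriv_const : ∀ {G : Type} [NormedAddCommGroup G] [NormedSpace ℝ G]
      {F : ℝ × Euc d → G} {c : G} {q}, (F =ᶠ[𝓝 q] fun _ => c) →
      timeDeriv F q = 0 ∧ spaceDeriv F q = 0 := by
    intro G _ _ F c q hF
    have : fderiv ℝ F q = 0 := by rw [hF.fderiv_eq]; exact fderiv_const_apply c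
    constructor
    · rw [timeDeriv, this]; rfl
    · rw [spaceDeriv, this, ContinuousLinearMap.zero_comp]
  have spaceDiv_far : ∀ t ∈ Ioo 0 T, ∀ x, r < Metric.infDist x (frontier (𝒜 t)) →
      spaceDiv ξ (t, x) = 0 := by
    intro t ht x hx
    rw [spaceDiv_eq_traceL (hξf.smooth.differentiableAt ht x),
      (timeDeriv_const (far t ht x hx).1).2, map_zero]
  have cases : ∀ t x, Metric.infDist x (frontier (𝒜 t)) < 5 / 4 * r ∨
      r < Metric.infDist x (frontier (𝒜 t)) := fun t x => by
    rcases lt_or_ge (Metric.infDist x (frontier (𝒜 t))) (5 / 4 * r) with hx | hx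
    · exact Or.inl hx
    · exact Or.inr (by linarith)
  have hDs : ∀ q (c : ℝ) w, spaceDeriv N q (c • w) = c • spaceDeriv N q w :=
    fun q c w => map_smul _ c w
  refine ⟨M, B, δ, ?_⟩
  constructor
  case nonneg => exact hM0
  case xi_field => exact hξf
  case velocity_field => exact hBf
  case weight_smooth => exact hϑs
  case weight_far =>
    refine ⟨R + r, fun t ht x hx => ?_⟩
    obtain ⟨y, hy, hxy⟩ := h.exists_nearest ht x
    have hyR : ‖y‖ ≤ R := by simpa using h.frontier_subset ht hy
    have := norm_le_norm_add_norm_sub' x y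
    have hxS : x ∉ 𝒜 t := fun hxS => by
      have : ‖x‖ < R := by simpa using h.subset_ball t ht hxS
      linarith
    simp only [hϑ]
    rw [weight_eq_of_far hθ hr0 (by rw [hxy, dist_eq_norm]; linarith), if_neg hxS]
  case abs_weight_le_one => exact fun t _ x => hθ.abs_le_one _
  case domain_eq => exact fun t ht => Set.ext fun x => (weight_neg_iff hθ h hr0 ht x).symm
  case norm_xi_le =>
    exact fun t _ x => (norm_xi_le hκ _ _).trans (sub_le_self _ (sq_nonneg _))
  case delta_nonneg => exact fun t _ x => hδ0 _
  case delta_sq_le => exact fun t _ x => by linarith [norm_xi_le (r := r) hκ (𝒜 t) x]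
  case transport =>
    intro t ht x w
    rcases cases t x with hx | hx
    · obtain ⟨e1, e2, e3, e4, e5, e6, e7⟩ := near t ht x hx
      obtain ⟨n1, n2, n3, n4, n5, n6⟩ := hf.normal_relations hr h hT ht hx hN
      obtain ⟨d1, d2, d3⟩ := hf.xi_derivs hr h hT ht hx hN hζs e2
      have d4 := hf.velocity_derivs hr h hT ht hx hN (hξf.smooth.differentiableAt ht x) e3 w
      rw [d1, d4, d2, d2, e7, e6, e1]
      have hb := transport_error n1 n4 n5 (hDs _) (hκ.quadraticCutoff_nonneg _)
        (hκ.quadraticCutoff_le_one _) (hδ0 (t, x)) hK0 (hζ' _) (hζδ _)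
        ((hK₃ t ht x).trans (by linarith)) ((hK₄ t ht x).trans (by linarith)) w
      exact hb.trans (mul_le_mul_of_nonneg_right (mul_le_mul_of_nonneg_right hM1 (hδ0 _))
        (norm_nonneg _))
    · obtain ⟨e1, e2, e3⟩ := far t ht x hx
      rw [(timeDeriv_const e1).1, (timeDeriv_const e1).2, (timeDeriv_const e2).2]
      simp only [inner_zero_left, zero_apply, inner_zero_right, add_zero, abs_zero]
      have := hδ0 (t, x)
      positivity
  case transport_length =>
    intro t ht x
    rcases cases t x with hx | hx
    · obtain ⟨e1, e2, e3, e4, e5, e6, e7⟩ := near t ht x hx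
      obtain ⟨n1, n2, n3, n4, n5, n6⟩ := hf.normal_relations hr h hT ht hx hN
      obtain ⟨d1, d2, d3⟩ := hf.xi_derivs hr h hT ht hx hN hζs e2
      rw [d1, d2, e7, e6, e1]
      refine (transport_length_error n1 n5 n3 (hDs _) (hκ.quadraticCutoff_nonneg _)
        (hκ.quadraticCutoff_le_one _) (hδ0 (t, x)) hK0 (hζ' _) (hζδ _)
        ((hK₃ t ht x).trans (by linarith))).trans ?_
      exact mul_le_mul_of_nonneg_right hM2 (sq_nonneg _)
    · obtain ⟨e1, e2, e3⟩ := far t ht x hx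
      rw [(timeDeriv_const e1).1, (timeDeriv_const e1).2, e1.self_of_nhds]
      simp only [inner_zero_left, abs_zero]
      positivity
  case curvature =>
    intro t ht x
    rcases cases t x with hx | hx
    · obtain ⟨e1, e2, e3, e4, e5, e6, e7⟩ := near t ht x hx
      obtain ⟨n1, n2, n3, n4, n5, n6⟩ := hf.normal_relations hr h hT ht hx hN
      obtain ⟨d1, d2, d3⟩ := hf.xi_derivs hr h hT ht hx hN hζs e2
      rw [d3, e7, e6, e1]
      refine (curvature_error n1 (hκ.quadraticCutoff_nonneg _)
        (hκ.quadraticCutoff_le_one _) (hδ0 (t, x)) hK0 (hζ' _) (hζδ _)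
        ((hK₅ t (Ioo_subset_Icc_self ht) x).trans (by linarith)) e5).trans ?_
      exact mul_le_mul_of_nonneg_right hM3 (hδ0 _)
    · obtain ⟨e1, e2, e3⟩ := far t ht x hx
      rw [e1.self_of_nhds, e2.self_of_nhds, smul_zero, add_zero, norm_zero]
      have := hδ0 (t, x)
      positivity
  case curvature_normal =>
    intro t ht x
    rcases cases t x with hx | hx
    · obtain ⟨e1, e2, e3, e4, e5, e6, e7⟩ := near t ht x hx
      obtain ⟨n1, n2, n3, n4, n5, n6⟩ := hf.normal_relations hr h hT ht hx hN
      obtain ⟨d1, d2, d3⟩ := hf.xi_derivs hr h hT ht hx hN hζs e2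
      rw [d3, e7, e6, e1]
      refine (curvature_normal_error n1 (hκ.quadraticCutoff_nonneg _)
        (hκ.quadraticCutoff_le_one _) (hδ0 (t, x)) hK0 (hζ' _) (hζδ _)
        ((hK₃ t ht x).trans (by linarith))
        ((hK₅ t (Ioo_subset_Icc_self ht) x).trans (by linarith)) e5).trans ?_
      exact mul_le_mul_of_nonneg_right hM4 (hδ0 _)
    · obtain ⟨e1, e2, e3⟩ := far t ht x hx
      rw [e1.self_of_nhds, spaceDiv_far t ht x hx, inner_zero_right, add_zero, abs_zero]
      have := hδ0 (t, x)
      positivity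
  case abs_weight_le =>
    intro t ht x
    refine (hθδ _).trans ?_
    have := hδ0 (t, x)
    exact mul_le_mul_of_nonneg_right (by linarith) this
  case weight_transport =>
    intro t ht x
    rcases cases t x with hx | hx
    · obtain ⟨e1, e2, e3, e4, e5, e6, e7⟩ := near t ht x hx
      obtain ⟨n1, n2, n3, n4, n5, n6⟩ := hf.normal_relations hr h hT ht hx hN
      obtain ⟨d1, d2⟩ := hf.weight_derivs ht hθ.smooth e4
      rw [d1, d2, n2, e7, e1]
      refine (weight_transport_error (δ := δ (t, x)) n1 (hζδ _) hK0 (hθ' _)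
        ((hK₃ t ht x).trans (by linarith))).trans ?_
      refine mul_le_mul (by linarith) (hδϑ _) (hδ0 _) (by positivity)
    · obtain ⟨e1, e2, e3⟩ := far t ht x hx
      rw [(timeDeriv_const e3).1, (timeDeriv_const e3).2, zero_apply, add_zero, abs_zero]
      positivity
  case weight_normal =>
    intro t ht x
    rcases cases t x with hx | hx
    · have e1 : ξ (t, x) = ζ (signedDist (𝒜 t) x / r) • innerNormal (𝒜 t) x := rfl
      rw [e1, fderiv_weight hr h hθ ht (by linarith), real_inner_smul_right,
        real_inner_self_eq_norm_sq, hr.norm_innerNormal h ht (by linarith), one_pow, mul_one]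
      exact mul_nonpos_of_nonpos_of_nonneg
        (div_nonpos_of_nonpos_of_nonneg (hθ.deriv_nonpos _) hr0.le) (hκ.quadraticCutoff_nonneg _)
    · rw [fderiv_weight_of_far hr0 h hθ ht hx, zero_apply]
  case weight_tangential =>
    intro t ht x w
    rcases cases t x with hx | hx
    · have e1 : ξ (t, x) = ζ (signedDist (𝒜 t) x / r) • innerNormal (𝒜 t) x := rfl
      rw [e1, fderiv_weight hr h hθ ht (by linarith)]
      refine (weight_tangential_error (hr.norm_innerNormal h ht (by linarith))
        (hκ.quadraticCutoff_nonneg _) (hκ.quadraticCutoff_le_one _) (hζδ _) hK0 (hδ0 (t, x))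
        (hθ' _) w).trans ?_
      exact mul_le_mul (mul_le_mul_of_nonneg_right hM1 (norm_nonneg _)) (hδϑ _) (hδ0 _)
        (mul_nonneg hM0 (norm_nonneg _))
    · rw [fderiv_weight_of_far hr0 h hθ ht hx, zero_apply, abs_zero]
      exact mul_nonneg (mul_nonneg hM0 (norm_nonneg _)) (abs_nonneg _)
  case weight_null =>
    intro t ht
    refine measure_mono_null (fun x hx => ?_) (volume_noncritical_zeros (h.smooth_slice t))
    have := (weight_eq_zero_iff hθ h hr0 ht x).1 hx
    exact ⟨this, h.gradient_ne t ht x this⟩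

end

section

/-! ### Existence of a tubular neighbourhood -/

/-- Uniform version of the inverse function theorem along a compact set of fixed points. -/
theorem exists_uniform_inverse {E : Type*} [NormedAddCommGroup E] [NormedSpace ℝ E]
    [FiniteDimensional ℝ E] {Ψ : E → E} {K : Set E} (hK : IsCompact K) (hfix : ∀ p ∈ K, Ψ p = p)
    (hsm : ∀ p ∈ K, ∀ᶠ q in 𝓝 p, ContDiffAt ℝ ∞ Ψ q)
    (hinj : ∀ p ∈ K, ∀ v, fderiv ℝ Ψ p v = 0 → v = 0) :
    ∃ δ > 0, ∀ p ∈ K, ∃ e : OpenPartialHomeomorph E E, (∀ q, e q = Ψ q) ∧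
      Metric.ball p δ ⊆ e.source ∧ Metric.ball p δ ⊆ e.target ∧
      ∀ q ∈ Metric.ball p δ, ContDiffAt ℝ ∞ e.symm (Ψ q) := by
  have : CompleteSpace E := FiniteDimensional.complete ℝ E
  have hlocal : ∀ p : K, ∃ e : OpenPartialHomeomorph E E, (∀ q, e q = Ψ q) ∧
      ∀ᶠ q in 𝓝 (p : E), q ∈ e.source ∧ q ∈ e.target ∧ ContDiffAt ℝ ∞ e.symm (Ψ q) := by
    rintro ⟨p, hp⟩
    have hC : ContDiffAt ℝ ∞ Ψ p := (hsm p hp).self_of_nhds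
    let A : E ≃L[ℝ] E := (LinearEquiv.ofInjectiveEndo (fderiv ℝ Ψ p : E →ₗ[ℝ] E)
      ((injective_iff_map_eq_zero _).2 (hinj p hp))).toContinuousLinearEquiv
    have hA : HasFDerivAt Ψ (A : E →L[ℝ] E) p := by
      refine (hC.differentiableAt (by simp)).hasFDerivAt.congr_fderiv ?_
      ext v; rfl
    let e := hC.toOpenPartialHomeomorph Ψ hA (by simp)
    have hes : p ∈ e.source := hC.mem_toOpenPartialHomeomorph_source hA (by simp)
    have het : p ∈ e.target := by
      have := hC.image_mem_toOpenPartialHomeomorph_target hA (by simp)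
      rwa [hfix p hp] at this
    refine ⟨e, fun q => rfl, ?_⟩
    -- Invertibility of the derivative is an open condition, so the inverse is smooth on a whole
    -- neighbourhood and not only at the image of p.
    have hder : ∀ᶠ q in 𝓝 p, fderiv ℝ Ψ q ∈ range ((↑) : (E ≃L[ℝ] E) → E →L[ℝ] E) := by
      have h1 : ContinuousAt (fderiv ℝ Ψ) p := (hC.fderiv_right (m := ∞) (by simp)).continuousAt
      refine h1.eventually ?_
      rw [hA.fderiv]
      exact ContinuousLinearEquiv.nhds A
    filter_upwards [e.open_source.mem_nhds hes, e.open_target.mem_nhds het, hder, hsm p hp]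
      with q q1 q2 q3 q4
    refine ⟨q1, q2, ?_⟩
    obtain ⟨Aq, hAq⟩ := q3
    have hsymm : e.symm (Ψ q) = q := e.left_inv q1
    refine e.contDiffAt_symm (f₀' := Aq) (e.map_source q1) ?_ ?_
    · rw [hsymm, hAq]
      exact (q4.differentiableAt (by simp)).hasFDerivAt
    · rw [hsymm]; exact q4
  choose e he hev using hlocal
  -- A Lebesgue number of the cover by these neighbourhoods is a common radius for all of K.
  obtain ⟨δ, hδ, hb⟩ := lebesgue_number_lemma_of_metric hK
    (c := fun p : K => interior {q | q ∈ (e p).source ∧ q ∈ (e p).target ∧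
      ContDiffAt ℝ ∞ (e p).symm (Ψ q)}) (fun p => isOpen_interior)
    (fun p hp => mem_iUnion.2 ⟨⟨p, hp⟩, mem_interior_iff_mem_nhds.2 (hev ⟨p, hp⟩)⟩)
  refine ⟨δ, hδ, fun p hp => ?_⟩
  obtain ⟨i, hi⟩ := hb p hp
  have hi' := hi.trans interior_subset
  exact ⟨e i, he i, fun q hq => (hi' hq).1, fun q hq => (hi' hq).2.1, fun q hq => (hi' hq).2.2⟩

variable {d : ℕ} {T R ρ : ℝ} {𝒜 : ℝ → Set (Euc d)} {φ : ℝ × Euc d → ℝ} {t : ℝ}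

theorem contDiff_spatialGradient (hφ : ContDiff ℝ ∞ φ) :
    ContDiff ℝ ∞ fun q : ℝ × Euc d => spatialGradient φ q.1 q.2 := by
  have h1 : (fun q : ℝ × Euc d => spatialGradient φ q.1 q.2) = fun q => (dualVec d)
      ((fderiv ℝ φ q).comp (ContinuousLinearMap.inr ℝ ℝ (Euc d))) := by
    funext q
    rw [spatialGradient, gradient_eq_dualVec,
      (hasFDerivAt_space (hφ.differentiable (by simp) (q.1, q.2))).fderiv]
    rfl
  rw [h1]
  exact (dualVec d).contDiff.comp ((hφ.fderiv_right (m := ∞) (by simp)).clm_comp contDiff_const)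

theorem contDiffAt_levelSetNormal (hφ : ContDiff ℝ ∞ φ) {q : ℝ × Euc d}
    (hq : spatialGradient φ q.1 q.2 ≠ 0) :
    ContDiffAt ℝ ∞ (fun q : ℝ × Euc d => levelSetNormal φ q.1 q.2) q := by
  have h1 := (contDiff_spatialGradient hφ).contDiffAt (x := q)
  exact ((h1.norm ℝ hq).inv (norm_ne_zero_iff.2 hq)).smul h1

theorem norm_levelSetNormal {x : Euc d} (h : spatialGradient φ t x ≠ 0) :
    ‖levelSetNormal φ t x‖ = 1 := by
  rw [levelSetNormal, norm_smul, norm_inv, norm_norm, inv_mul_cancel₀ (norm_ne_zero_iff.2 h)]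

/-- The map `(t, y, s) ↦ (t, y + s N(t, y), φ(t, y))`. -/
def tubeMap (φ : ℝ × Euc d → ℝ) (p : ℝ × Euc d × ℝ) : ℝ × Euc d × ℝ :=
  (p.1, p.2.1 + p.2.2 • levelSetNormal φ p.1 p.2.1, φ (p.1, p.2.1))

theorem contDiffAt_tubeMap (hφ : ContDiff ℝ ∞ φ) {p : ℝ × Euc d × ℝ}
    (hp : spatialGradient φ p.1 p.2.1 ≠ 0) : ContDiffAt ℝ ∞ (tubeMap φ) p := by
  have c1 : ContDiff ℝ ∞ fun p : ℝ × Euc d × ℝ => (p.1, p.2.1) :=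
    contDiff_fst.prodMk (contDiff_fst.comp contDiff_snd)
  have c2 : ContDiffAt ℝ ∞ (fun p : ℝ × Euc d × ℝ => levelSetNormal φ p.1 p.2.1) p :=
    ContDiffAt.comp (g := fun q : ℝ × Euc d => levelSetNormal φ q.1 q.2)
      (f := fun p : ℝ × Euc d × ℝ => (p.1, p.2.1)) p
      (contDiffAt_levelSetNormal hφ (q := (p.1, p.2.1)) hp) c1.contDiffAt
  have c3 : ContDiff ℝ ∞ fun p : ℝ × Euc d × ℝ => p.2.1 := contDiff_fst.comp contDiff_snd
  have c4 : ContDiff ℝ ∞ fun p : ℝ × Euc d × ℝ => p.2.2 := contDiff_snd.comp contDiff_snd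
  exact contDiff_fst.contDiffAt.prodMk ((c3.contDiffAt.add (c4.contDiffAt.smul c2)).prodMk
    (hφ.comp c1).contDiffAt)

/-- For a kernel vector (τ, w, μ) the first component gives τ = 0, the second w = -μ N, and the
third ∇φ·w = 0. Since ∇φ·N = |∇φ| ≠ 0, also μ = 0 and w = 0. -/
theorem fderiv_tubeMap_injective (hφ : ContDiff ℝ ∞ φ) {y : Euc d}
    (hy : spatialGradient φ t y ≠ 0) {v : ℝ × Euc d × ℝ}
    (hv : fderiv ℝ (tubeMap φ) (t, y, 0) v = 0) : v = 0 := by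
  have hd : HasFDerivAt (tubeMap φ) (fderiv ℝ (tubeMap φ) (t, y, 0)) (t, y, 0) :=
    ((contDiffAt_tubeMap hφ (p := (t, y, 0)) hy).differentiableAt (by simp)).hasFDerivAt
  obtain ⟨τ, w, μ⟩ := v
  -- the curve through the base point in direction `v`
  have hcurve : HasDerivAt (fun s : ℝ => ((t + s * τ, y + s • w, s * μ) : ℝ × Euc d × ℝ))
      (τ, w, μ) 0 := by
    have h1 : HasDerivAt (fun s : ℝ => t + s * τ) τ 0 := by
      simpa using ((hasDerivAt_id (0 : ℝ)).mul_const τ).const_add t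
    have h2 : HasDerivAt (fun s : ℝ => y + s • w) w 0 := by
      simpa using ((hasDerivAt_id (0 : ℝ)).smul_const w).const_add y
    have h3 : HasDerivAt (fun s : ℝ => s * μ) μ 0 := by
      simpa using (hasDerivAt_id (0 : ℝ)).mul_const μ
    exact h1.prodMk (h2.prodMk h3)
  have hcomp : HasDerivAt (fun s : ℝ => tubeMap φ (t + s * τ, y + s • w, s * μ)) 0 0 := by
    have h0 : ((t, y, 0) : ℝ × Euc d × ℝ) = (t + (0 : ℝ) * τ, y + (0 : ℝ) • w, (0 : ℝ) * μ) := by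
      simp
    rw [← hv]
    rw [h0] at hd ⊢
    exact hd.comp_hasDerivAt (0 : ℝ) hcurve
  have k1 : HasDerivAt (fun s : ℝ => t + s * τ) 0 0 :=
    (ContinuousLinearMap.fst ℝ ℝ (Euc d × ℝ)).hasFDerivAt.comp_hasDerivAt (0 : ℝ) hcomp
  have k2 : HasDerivAt (fun s : ℝ => y + s • w
      + (s * μ) • levelSetNormal φ (t + s * τ) (y + s • w)) 0 0 :=
    ((ContinuousLinearMap.fst ℝ (Euc d) ℝ).comp
      (ContinuousLinearMap.snd ℝ ℝ (Euc d × ℝ))).hasFDerivAt.comp_hasDerivAt (0 : ℝ) hcomp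
  have k3 : HasDerivAt (fun s : ℝ => φ (t + s * τ, y + s • w)) 0 0 :=
    ((ContinuousLinearMap.snd ℝ (Euc d) ℝ).comp
      (ContinuousLinearMap.snd ℝ ℝ (Euc d × ℝ))).hasFDerivAt.comp_hasDerivAt (0 : ℝ) hcomp
  have hτ : τ = 0 := by
    have h1 : HasDerivAt (fun s : ℝ => t + s * τ) τ 0 := by
      simpa using ((hasDerivAt_id (0 : ℝ)).mul_const τ).const_add t
    exact h1.unique k1
  subst hτ
  simp only [mul_zero, add_zero] at k2 k3
  have hy2 : HasDerivAt (fun s : ℝ => y + s • w) w 0 := by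
    simpa using ((hasDerivAt_id (0 : ℝ)).smul_const w).const_add y
  have hw : w + μ • levelSetNormal φ t y = 0 := by
    have hN : ContDiffAt ℝ ∞ (fun x : Euc d => levelSetNormal φ t x) y :=
      ContDiffAt.comp (g := fun q : ℝ × Euc d => levelSetNormal φ q.1 q.2)
        (f := fun x : Euc d => (t, x)) y (contDiffAt_levelSetNormal hφ (q := (t, y)) hy)
        (contDiff_const.prodMk contDiff_id).contDiffAt
    have hN' : DifferentiableAt ℝ (fun s : ℝ => levelSetNormal φ t (y + s • w)) 0 := by
      have h0 : DifferentiableAt ℝ (fun x : Euc d => levelSetNormal φ t x) (y + (0 : ℝ) • w) := by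
        simpa using hN.differentiableAt (by simp)
      exact DifferentiableAt.comp (g := fun x : Euc d => levelSetNormal φ t x)
        (f := fun s : ℝ => y + s • w) (0 : ℝ) h0 hy2.differentiableAt
    have h3 : HasDerivAt (fun s : ℝ => s * μ) μ 0 := by
      simpa using (hasDerivAt_id (0 : ℝ)).mul_const μ
    have h4 := hy2.add (h3.smul hN'.hasDerivAt)
    have h5 := h4.unique k2
    simpa using h5
  have hg : fderiv ℝ (fun x => φ (t, x)) y w = 0 := by
    have hφt : DifferentiableAt ℝ (fun x => φ (t, x)) (y + (0 : ℝ) • w) :=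
      ((hφ.comp (contDiff_const.prodMk contDiff_id)).differentiable (by simp)) _
    have h1 := hasDerivAt_along (g := fun x => φ (t, x)) w hφt
    have h2 := h1.unique k3
    simpa using h2
  have hw' : w = -(μ • levelSetNormal φ t y) := eq_neg_of_add_eq_zero_left hw
  rw [hw', map_neg, map_smul, smul_eq_mul, neg_eq_zero, mul_eq_zero, ← inner_gradient] at hg
  have hμ : μ = 0 := by
    refine hg.resolve_right fun h0 => ?_
    change ⟪spatialGradient φ t y, ‖spatialGradient φ t y‖⁻¹ • spatialGradient φ t y⟫ = 0 at h0
    rw [real_inner_smul_right, real_inner_self_eq_norm_sq] at h0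
    have : 0 < ‖spatialGradient φ t y‖ := norm_pos_iff.2 hy
    have : 0 < ‖spatialGradient φ t y‖⁻¹ * ‖spatialGradient φ t y‖ ^ 2 := by positivity
    linarith
  rw [hw', hμ]; simp

/-- A point is connected with its nearest zero of `g` along the normal. -/
theorem exists_eq_add_smul_of_nearest {g : Euc d → ℝ} (hg : ContDiff ℝ ∞ g) {x y : Euc d}
    (hy : g y = 0) (hn : gradient g y ≠ 0) (hmin : ∀ z, g z = 0 → dist x y ≤ dist x z) :
    ∃ c : ℝ, x = y + c • (‖gradient g y‖⁻¹ • gradient g y) ∧ |c| = dist x y := by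
  -- The nearest zero minimizes |z - x|² on the level set, so x - y is parallel to the gradient by
  -- Lagrange's rule. The multiplier of the distance cannot vanish, as the zero is regular.
  have hext : IsLocalExtrOn (fun z => ‖z - x‖ ^ 2) {z | g z = g y} y := by
    refine Or.inl (IsMinOn.localize fun z hz => ?_)
    have := hmin z ((show g z = g y from hz).trans hy)
    rw [dist_comm, dist_eq_norm, dist_comm, dist_eq_norm] at this
    exact pow_le_pow_left₀ (norm_nonneg _) this 2
  have h1 : HasStrictFDerivAt g (fderiv ℝ g y) y := hg.contDiffAt.hasStrictFDerivAt (by simp)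
  have h2 : HasStrictFDerivAt (fun z : Euc d => ‖z - x‖ ^ 2) (2 • (innerSL ℝ (y - x))) y := by
    have h3 := (hasStrictFDerivAt_norm_sq (y - x)).comp y ((hasStrictFDerivAt_id y).sub_const x)
    simpa using h3
  obtain ⟨a, b, hab, hsum⟩ := hext.exists_multipliers_of_hasStrictFDerivAt_1d h1 h2
  have hvec : a • gradient g y + (2 * b) • (y - x) = 0 := by
    refine ext_inner_right ℝ fun w => ?_
    have := congrArg (fun L : Euc d →L[ℝ] ℝ => L w) hsum
    simp only [add_apply, smul_apply, innerSL_apply_apply, zero_apply, smul_eq_mul,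
      nsmul_eq_mul] at this
    rw [inner_zero_left, inner_add_left, real_inner_smul_left, real_inner_smul_left, inner_gradient]
    push_cast at this
    linarith
  have hb : b ≠ 0 := fun hb => by
    rw [hb, mul_zero, zero_smul, add_zero, smul_eq_zero] at hvec
    exact hab (by rw [hvec.resolve_right hn, hb]; rfl)
  have hG : ‖gradient g y‖ ≠ 0 := norm_ne_zero_iff.2 hn
  have hx : x = y + (a / (2 * b) * ‖gradient g y‖) • (‖gradient g y‖⁻¹ • gradient g y) := by
    rw [smul_smul, mul_assoc, mul_inv_cancel₀ hG, mul_one]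
    have h3 : (y - x) = -((a / (2 * b)) • gradient g y) := by
      have h4 := congrArg (fun v => (2 * b)⁻¹ • v) hvec
      simp only [smul_add, smul_smul, smul_zero] at h4
      rw [inv_mul_cancel₀ (by positivity), one_smul] at h4
      rw [eq_neg_iff_add_eq_zero, add_comm, div_eq_inv_mul]
      exact h4
    rw [← sub_eq_iff_eq_add', ← neg_sub, h3, neg_neg]
  refine ⟨_, hx, ?_⟩
  rw [dist_eq_norm]
  conv_rhs => rw [hx, add_sub_cancel_left, norm_smul, norm_smul, norm_inv, norm_norm,
    inv_mul_cancel₀ hG, mul_one, Real.norm_eq_abs]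

end

/-! ### Normal coordinates about the interfaces. -/

section

variable {d : ℕ} {T R : ℝ} {𝒜 : ℝ → Set (Euc d)} {φ : ℝ × Euc d → ℝ} {t : ℝ}

/-- The normal coordinates `(y, s) ↦ y + s N(y)` about the interfaces are injective for `|s| < ρ`
and locally invertible by smooth maps. -/
structure NormalCoordinates (T : ℝ) (𝒜 : ℝ → Set (Euc d)) (φ : ℝ × Euc d → ℝ) (ρ : ℝ) : Prop where
  pos : 0 < ρ
  injective : ∀ t ∈ Icc 0 T, ∀ y ∈ frontier (𝒜 t), ∀ y' ∈ frontier (𝒜 t), ∀ s s' : ℝ,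
    |s| < ρ → |s'| < ρ → y + s • levelSetNormal φ t y = y' + s' • levelSetNormal φ t y' →
      y = y' ∧ s = s'
  smooth : ∀ t ∈ Icc 0 T, ∀ y ∈ frontier (𝒜 t), ∀ s : ℝ, |s| < ρ →
    ∃ F : ℝ × Euc d → Euc d × ℝ,
      ContDiffAt ℝ ∞ F (t, y + s • levelSetNormal φ t y) ∧
      ∀ᶠ q in 𝓝 (t, y + s • levelSetNormal φ t y), φ (q.1, (F q).1) = 0 ∧ |(F q).2| < ρ ∧
        q.2 = (F q).1 + (F q).2 • levelSetNormal φ q.1 (F q).1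

/-- The extra component φ of `tubeMap` equalizes dimensions, so the inverse function theorem applies
without charts of the interface; the normal coordinates are the restriction to φ = 0. The points (t,
y, 0) with y on the interface are fixed and form a compact set. -/
theorem Evolution.exists_normalCoordinates (h : Evolution T R 𝒜 φ) :
    ∃ ρ, NormalCoordinates T 𝒜 φ ρ := by
  set K : Set (ℝ × Euc d × ℝ) := {p | (p.1 ∈ Icc 0 T ∧ p.2.1 ∈ Metric.closedBall 0 R) ∧
    p.2.2 = 0 ∧ φ (p.1, p.2.1) = 0} with hKdef
  have hK : IsCompact K := by
    refine ((isCompact_Icc (a := (0 : ℝ)) (b := T)).prod ((isCompact_closedBall (0 : Euc d) R).prod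
      (isCompact_singleton (x := (0 : ℝ))))).of_isClosed_subset ?_ ?_
    · have c1 : Continuous fun p : ℝ × Euc d × ℝ => φ (p.1, p.2.1) :=
        h.smooth.continuous.comp (by fun_prop)
      have c2 : Continuous fun p : ℝ × Euc d × ℝ => p.1 := by fun_prop
      have c3 : Continuous fun p : ℝ × Euc d × ℝ => p.2.1 := by fun_prop
      have c4 : Continuous fun p : ℝ × Euc d × ℝ => p.2.2 := by fun_prop
      exact ((isClosed_Icc.preimage c2).inter (Metric.isClosed_closedBall.preimage c3)).inter
        ((isClosed_eq c4 continuous_const).inter (isClosed_eq c1 continuous_const))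
    · rintro p ⟨⟨h1, h2⟩, h3, -⟩
      exact ⟨h1, h2, h3⟩
  have hKmem : ∀ t ∈ Icc 0 T, ∀ y ∈ frontier (𝒜 t), (t, y, (0 : ℝ)) ∈ K := fun t ht y hy =>
    ⟨⟨ht, h.frontier_subset ht hy⟩, rfl, by rw [h.frontier_eq ht] at hy; exact hy⟩
  have hKgrad : ∀ p ∈ K, spatialGradient φ p.1 p.2.1 ≠ 0 := fun p hp =>
    h.gradient_ne _ hp.1.1 _ hp.2.2
  obtain ⟨δ, hδ, hinv⟩ := exists_uniform_inverse (Ψ := tubeMap φ) hK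
    (by
      rintro ⟨t, y, s⟩ ⟨-, h2, h3⟩
      simp only at h2 h3
      simp [tubeMap, h2, h3])
    (by
      intro p hp
      have hc : Continuous fun p : ℝ × Euc d × ℝ => spatialGradient φ p.1 p.2.1 :=
        (contDiff_spatialGradient h.smooth).continuous.comp
          (f := fun p : ℝ × Euc d × ℝ => (p.1, p.2.1)) (by fun_prop)
      filter_upwards [hc.continuousAt.eventually_ne (hKgrad p hp)] with q hq
      exact contDiffAt_tubeMap h.smooth hq)
    (by
      rintro ⟨t, y, s⟩ hp v hv
      obtain rfl : s = 0 := hp.2.1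
      exact fderiv_tubeMap_injective h.smooth (hKgrad _ hp) hv)
  have hΨ : ∀ t ∈ Icc 0 T, ∀ y ∈ frontier (𝒜 t), ∀ s : ℝ,
      tubeMap φ (t, y, s) = (t, y + s • levelSetNormal φ t y, 0) := fun t ht y hy s => by
    rw [h.frontier_eq ht] at hy
    simp only [tubeMap]
    rw [show φ (t, y) = 0 from hy]
  have hball : ∀ (t : ℝ) (y y' : Euc d) (s : ℝ), dist y' y < δ → |s| < δ →
      (t, y', s) ∈ Metric.ball (t, y, (0 : ℝ)) δ := fun t y y' s h1 h2 => by
    rw [Metric.mem_ball, Prod.dist_eq, Prod.dist_eq, dist_self, Real.dist_eq, sub_zero]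
    exact max_lt hδ (max_lt h1 h2)
  -- Half of the radius: two representations of one point have base points at distance at most |s| +
  -- |s'| < δ, so both lie in a ball on which `tubeMap` is injective.
  refine ⟨δ / 2, half_pos hδ, fun t ht y hy y' hy' s s' hs hs' heq => ?_,
    fun t ht y hy s hs => ?_⟩
  · obtain ⟨e, he, hsrc, -, -⟩ := hinv _ (hKmem t ht y hy)
    have hN : ∀ z ∈ frontier (𝒜 t), ‖levelSetNormal φ t z‖ = 1 := fun z hz =>
      norm_levelSetNormal (h.gradient_ne t ht z (by rw [h.frontier_eq ht] at hz; exact hz))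
    have hd : dist y' y < δ := by
      have h1 : y' - y = s • levelSetNormal φ t y - s' • levelSetNormal φ t y' := by
        rw [sub_eq_sub_iff_add_eq_add, add_comm y', ← sub_eq_iff_eq_add] at *
        rw [← heq]; abel
      rw [dist_eq_norm, h1]
      refine (norm_sub_le _ _).trans_lt ?_
      rw [norm_smul, norm_smul, hN y hy, hN y' hy', mul_one, mul_one, Real.norm_eq_abs,
        Real.norm_eq_abs]
      linarith
    have h2 := e.injOn (hsrc (hball t y y s (by simpa using hδ) (by linarith)))
      (hsrc (hball t y y' s' hd (by linarith))) (by
        rw [he, he, hΨ t ht y hy, hΨ t ht y' hy', heq])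
    simp only [Prod.mk.injEq, true_and] at h2
    exact h2
  · obtain ⟨e, he, hsrc, -, hsm⟩ := hinv _ (hKmem t ht y hy)
    have hp := hball t y y s (by simpa using hδ) (by linarith)
    set x := y + s • levelSetNormal φ t y with hx
    have hsmooth : ContDiffAt ℝ ∞ e.symm (t, x, (0 : ℝ)) := by
      have := hsm _ hp
      rwa [hΨ t ht y hy] at this
    have hG : ContDiffAt ℝ ∞ (fun q : ℝ × Euc d => e.symm (q.1, q.2, (0 : ℝ))) (t, x) :=
      ContDiffAt.comp (g := e.symm) (f := fun q : ℝ × Euc d => (q.1, q.2, (0 : ℝ))) (t, x) hsmooth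
        (contDiff_fst.prodMk (contDiff_snd.prodMk contDiff_const)).contDiffAt
    have hval : e.symm (t, x, (0 : ℝ)) = (t, y, s) := by
      have := e.left_inv (hsrc hp)
      rwa [he, hΨ t ht y hy] at this
    have htar : (t, x, (0 : ℝ)) ∈ e.target := by
      have := e.map_source (hsrc hp)
      rwa [he, hΨ t ht y hy] at this
    -- On the slice with last coordinate 0 the local inverse returns a base point at which φ
    -- vanishes.
    refine ⟨fun q => (e.symm (q.1, q.2, (0 : ℝ))).2, contDiff_snd.contDiffAt.comp _ hG, ?_⟩
    have c1 : ContinuousAt (fun q : ℝ × Euc d => (q.1, q.2, (0 : ℝ))) (t, x) := by fun_prop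
    have c2 : ContinuousAt (fun q : ℝ × Euc d => |(e.symm (q.1, q.2, (0 : ℝ))).2.2|) (t, x) :=
      (continuous_abs.comp (continuous_snd.comp continuous_snd)).continuousAt.comp hG.continuousAt
    have hlt : |(e.symm ((t, x).1, (t, x).2, (0 : ℝ))).2.2| < δ / 2 := by
      simp only [hval]; exact hs
    filter_upwards [c1.eventually (e.open_target.mem_nhds htar), c2.eventually_lt_const hlt]
      with q q1 q2
    have h3 := e.right_inv q1
    rw [he] at h3
    simp only [tubeMap, Prod.mk.injEq] at h3
    obtain ⟨h4, h5, h6⟩ := h3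
    rw [h4] at h5 h6
    exact ⟨h6, q2, h5.symm⟩

namespace NormalCoordinates

variable {ρ s : ℝ} {x y : Euc d}

theorem norm_normal (h : Evolution T R 𝒜 φ) (ht : t ∈ Icc 0 T) (hy : y ∈ frontier (𝒜 t)) :
    ‖levelSetNormal φ t y‖ = 1 :=
  norm_levelSetNormal (h.gradient_ne t ht y (by rw [h.frontier_eq ht] at hy; exact hy))

theorem exists_nearest (h : Evolution T R 𝒜 φ) (ht : t ∈ Icc 0 T) (x : Euc d) :
    ∃ y ∈ frontier (𝒜 t), ∃ s : ℝ, x = y + s • levelSetNormal φ t y ∧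
      |s| = Metric.infDist x (frontier (𝒜 t)) := by
  obtain ⟨y, hy, hxy⟩ := h.exists_nearest ht x
  have hy0 : φ (t, y) = 0 := by rw [h.frontier_eq ht] at hy; exact hy
  obtain ⟨c, hc, hc'⟩ := exists_eq_add_smul_of_nearest (h.smooth_slice t) hy0
    (h.gradient_ne t ht y hy0) (x := x) fun z hz => by
      rw [← hxy]
      exact Metric.infDist_le_dist_of_mem (by rw [h.frontier_eq ht]; exact hz)
  exact ⟨y, hy, c, hc, hc'.trans hxy.symm⟩

/-- A nearest point gives a second representation, with height at most |s|; injectivity then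
applies. -/
theorem infDist_eq (hN : NormalCoordinates T 𝒜 φ ρ) (h : Evolution T R 𝒜 φ) (ht : t ∈ Icc 0 T)
    (hy : y ∈ frontier (𝒜 t)) (hs : |s| < ρ) :
    Metric.infDist (y + s • levelSetNormal φ t y) (frontier (𝒜 t)) = |s| := by
  obtain ⟨z, hz, c, hc, hc'⟩ := exists_nearest h ht (y + s • levelSetNormal φ t y)
  have hle : |c| ≤ |s| := by
    rw [hc']
    refine (Metric.infDist_le_dist_of_mem hy).trans_eq ?_
    rw [dist_eq_norm, add_sub_cancel_left, norm_smul, norm_normal h ht hy, mul_one,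
      Real.norm_eq_abs]
  obtain ⟨-, h2⟩ := hN.injective t ht y hy z hz s c hs (hle.trans_lt hs) hc
  rw [← hc', h2]

/-- By `infDist_eq`, φ has no zero on the normal segment except at s = 0. Its sign is therefore
constant on either side, and it is determined near s = 0 by the positive derivative along the
normal. -/
theorem sign_eq (hN : NormalCoordinates T 𝒜 φ ρ) (h : Evolution T R 𝒜 φ) (ht : t ∈ Icc 0 T)
    (hy : y ∈ frontier (𝒜 t)) (hs : |s| < ρ) :
    SignType.sign (φ (t, y + s • levelSetNormal φ t y)) = SignType.sign s := by
  have hy0 : φ (t, y) = 0 := by rw [h.frontier_eq ht] at hy; exact hy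
  rcases eq_or_ne s 0 with rfl | hs0
  · simp [hy0]
  have hg := h.gradient_ne t ht y hy0
  set g : ℝ → ℝ := fun c => φ (t, y + c • levelSetNormal φ t y) with hgdef
  have hcont : Continuous g := h.smooth.continuous.comp (by fun_prop)
  have hne : ∀ c : ℝ, |c| < ρ → c ≠ 0 → g c ≠ 0 := fun c hc hc0 h0 => by
    have h1 := hN.infDist_eq h ht hy hc
    rw [Metric.infDist_zero_of_mem (by rw [h.frontier_eq ht]; exact h0)] at h1
    exact hc0 (abs_eq_zero.1 h1.symm)
  have hpos : 0 < fderiv ℝ (fun x => φ (t, x)) y (levelSetNormal φ t y) := by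
    rw [levelSetNormal, map_smul, smul_eq_mul]
    exact mul_pos (inv_pos.2 (norm_pos_iff.2 hg)) (fderiv_gradient_pos hg)
  have hev := eventually_sign_along (((h.smooth_slice t).differentiable (by simp)) y) hy0 hpos
  -- by continuity the sign is constant along the half open segments
  have hconst : ∀ c : ℝ, 0 < c → c ≤ 1 → SignType.sign (g (c * s)) = SignType.sign (g s) := by
    intro c hc hc1
    have hpre : IsPreconnected (g '' ((fun a : ℝ => a * s) '' Icc c 1)) :=
      (isPreconnected_Icc.image _ (by fun_prop)).image _ hcont.continuousOn
    have h0 : (0 : ℝ) ∉ g '' ((fun a : ℝ => a * s) '' Icc c 1) := by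
      rintro ⟨-, ⟨a, ha, rfl⟩, h0⟩
      have ha0 : 0 < a := hc.trans_le ha.1
      refine hne (a * s) ?_ (mul_ne_zero ha0.ne' hs0) h0
      rw [abs_mul, abs_of_pos ha0]
      exact (mul_le_of_le_one_left (abs_nonneg s) ha.2).trans_lt hs
    have m1 : g (c * s) ∈ g '' ((fun a : ℝ => a * s) '' Icc c 1) :=
      ⟨_, ⟨c, ⟨le_rfl, hc1⟩, rfl⟩, rfl⟩
    have m2 : g s ∈ g '' ((fun a : ℝ => a * s) '' Icc c 1) :=
      ⟨_, ⟨1, ⟨hc1, le_rfl⟩, rfl⟩, by simp⟩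
    have hord := hpre.ordConnected
    rcases lt_trichotomy (g s) 0 with n1 | n1 | n1
    · have : g (c * s) < 0 := lt_of_not_ge fun n2 => h0 (hord.out m2 m1 ⟨n1.le, n2⟩)
      rw [sign_neg n1, sign_neg this]
    · exact absurd n1 (hne s hs hs0)
    · have : 0 < g (c * s) := lt_of_not_ge fun n2 => h0 (hord.out m1 m2 ⟨n2, n1.le⟩)
      rw [sign_pos n1, sign_pos this]
  have htend : Tendsto (fun c : ℝ => c * s) (𝓝[>] 0) (𝓝 0) := by
    have : Continuous fun c : ℝ => c * s := by fun_prop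
    simpa using (this.tendsto 0).mono_left nhdsWithin_le_nhds
  have hIoc : ∀ᶠ c : ℝ in 𝓝[>] 0, c ∈ Ioc (0 : ℝ) 1 := Ioc_mem_nhdsGT zero_lt_one
  obtain ⟨c, ⟨hc0, hc1⟩, hc2⟩ := (hIoc.and (htend.eventually hev)).exists
  rw [← hconst c hc0 hc1]
  refine hc2.trans ?_
  rw [sign_mul, sign_pos hc0, one_mul]

theorem signedDist_eq (hN : NormalCoordinates T 𝒜 φ ρ) (h : Evolution T R 𝒜 φ) (ht : t ∈ Icc 0 T)
    (hy : y ∈ frontier (𝒜 t)) (hs : |s| < ρ) :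
    signedDist (𝒜 t) (y + s • levelSetNormal φ t y) = s := by
  have h1 := hN.infDist_eq h ht hy hs
  have h2 := hN.sign_eq h ht hy hs
  rw [signedDist, h1]
  have hmem : y + s • levelSetNormal φ t y ∈ 𝒜 t ↔ 0 < s := by
    rw [h.domain_eq t ht, mem_ofPred_eq, ← sign_eq_one_iff, h2, sign_eq_one_iff]
  by_cases hs0 : 0 < s
  · rw [if_pos (hmem.2 hs0), abs_of_pos hs0]
  · rw [if_neg (mt hmem.1 hs0), abs_of_nonpos (not_lt.1 hs0), neg_neg]

theorem exists_smooth_inverse (hN : NormalCoordinates T 𝒜 φ ρ) (h : Evolution T R 𝒜 φ)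
    (ht : t ∈ Icc 0 T) (hx : Metric.infDist x (frontier (𝒜 t)) < ρ) :
    ∃ F : ℝ × Euc d → Euc d × ℝ, ContDiffAt ℝ ∞ F (t, x) ∧
      ∀ᶠ q in 𝓝 (t, x), q.1 ∈ Icc 0 T → (F q).1 ∈ frontier (𝒜 q.1) ∧
        (F q).2 = signedDist (𝒜 q.1) q.2 ∧ |(F q).2| < ρ ∧
        q.2 = (F q).1 + (F q).2 • levelSetNormal φ q.1 (F q).1 := by
  obtain ⟨y, hy, s, rfl, hs⟩ := exists_nearest h ht x
  obtain ⟨F, hF, hev⟩ := hN.smooth t ht y hy s (hs.trans_lt hx)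
  refine ⟨F, hF, hev.mono fun q ⟨q1, q2, q3⟩ hq => ?_⟩
  have hf : (F q).1 ∈ frontier (𝒜 q.1) := by rw [h.frontier_eq hq]; exact q1
  refine ⟨hf, ?_, q2, q3⟩
  conv_rhs => rw [q3]
  exact (hN.signedDist_eq h hq hf q2).symm

/-- The signed distance has unit slope in the direction of N and a gradient of length at most 1,
which forces the gradient to be N. -/
theorem innerNormal_eq (hN : NormalCoordinates T 𝒜 φ ρ) (h : Evolution T R 𝒜 φ)
    (ht : t ∈ Icc 0 T) (hy : y ∈ frontier (𝒜 t)) :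
    innerNormal (𝒜 t) y = levelSetNormal φ t y := by
  obtain ⟨F, hF, hev⟩ := hN.exists_smooth_inverse h ht (x := y)
    (by rw [Metric.infDist_zero_of_mem hy]; exact hN.pos)
  have hmap : ContDiff ℝ ∞ fun x : Euc d => (t, x) := contDiff_const.prodMk contDiff_id
  have hdiff : DifferentiableAt ℝ (signedDist (𝒜 t)) y := by
    have h1 : ContDiffAt ℝ ∞ (fun x => (F (t, x)).2) y :=
      contDiff_snd.contDiffAt.comp y (ContDiffAt.comp (g := F) y hF hmap.contDiffAt)
    refine (h1.differentiableAt (by simp)).congr_of_eventuallyEq ?_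
    filter_upwards [(hmap.continuous.tendsto y).eventually hev] with x hx
    exact (hx ht).2.1.symm
  set N := levelSetNormal φ t y with hNdef
  have h1 : HasDerivAt (fun s : ℝ => signedDist (𝒜 t) (y + s • N)) 1 0 := by
    refine (hasDerivAt_id (0 : ℝ)).congr_of_eventuallyEq ?_
    have : ∀ᶠ s : ℝ in 𝓝 0, |s| < ρ :=
      continuous_abs.continuousAt.eventually_lt_const (by simpa using hN.pos)
    filter_upwards [this] with s hs
    exact hN.signedDist_eq h ht hy hs
  have h2 := hasDerivAt_along (g := signedDist (𝒜 t)) (y := y) N (c := 0) (by simpa using hdiff)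
  have h3 : ⟪innerNormal (𝒜 t) y, N⟫ = 1 := by
    rw [innerNormal, inner_gradient]
    simpa using h2.unique h1
  have h4 := norm_gradient_signedDist_le (𝒜 t) y
  have h5 : ‖N‖ = 1 := norm_normal h ht hy
  have h6 := norm_sub_sq_real (innerNormal (𝒜 t) y) N
  rw [h3, h5] at h6
  have h7 : ‖innerNormal (𝒜 t) y - N‖ ^ 2 ≤ 0 := by
    have : ‖innerNormal (𝒜 t) y‖ ^ 2 ≤ 1 := pow_le_one₀ (norm_nonneg _) h4
    linarith
  exact sub_eq_zero.1 (norm_eq_zero.1 (pow_eq_zero_iff (n := 2) (by norm_num) |>.1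
    (le_antisymm h7 (sq_nonneg _))))

theorem isTubularRadius (hN : NormalCoordinates T 𝒜 φ ρ) (h : Evolution T R 𝒜 φ) {r : ℝ}
    (hr : 0 < r) (hr1 : r < 1) (hrρ : 2 * r ≤ ρ) : IsTubularRadius T 𝒜 r := by
  have habs : ∀ s : ℝ, s ∈ Ioo (-(2 * r)) (2 * r) → |s| < ρ := fun s hs =>
    (abs_lt.2 hs).trans_le hrρ
  refine ⟨hr, hr1, fun t ht => ⟨?_, ?_, ?_⟩, ?_⟩
  · rintro ⟨y, s⟩ ⟨hy, hs⟩
    change Metric.infDist (y + s • innerNormal (𝒜 t) y) (frontier (𝒜 t)) < 2 * r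
    rw [hN.innerNormal_eq h ht hy, hN.infDist_eq h ht hy (habs s hs)]
    exact abs_lt.2 hs
  · rintro ⟨y, s⟩ ⟨hy, hs⟩ ⟨y', s'⟩ ⟨hy', hs'⟩ heq
    simp only at hy hs hy' hs' heq
    rw [hN.innerNormal_eq h ht hy, hN.innerNormal_eq h ht hy'] at heq
    obtain ⟨h1, h2⟩ := hN.injective t ht y hy y' hy' s s' (habs s hs) (habs s' hs') heq
    rw [h1, h2]
  · intro x hx
    obtain ⟨y, hy, s, hxy, hs⟩ := exists_nearest h ht x
    refine ⟨(y, s), ⟨hy, abs_lt.1 (hs.trans_lt hx)⟩, ?_⟩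
    simp only [hN.innerNormal_eq h ht hy]
    exact hxy.symm
  · have hex : ∀ q : ℝ × Euc d, ∃ y : Euc d, q.1 ∈ Icc 0 T →
        Metric.infDist q.2 (frontier (𝒜 q.1)) < 2 * r → y ∈ frontier (𝒜 q.1) ∧
          q.2 = y + signedDist (𝒜 q.1) q.2 • levelSetNormal φ q.1 y := by
      intro q
      by_cases hq : q.1 ∈ Icc 0 T ∧ Metric.infDist q.2 (frontier (𝒜 q.1)) < 2 * r
      · obtain ⟨y, hy, s, hxy, hs⟩ := exists_nearest h hq.1 q.2
        refine ⟨y, fun _ _ => ⟨hy, ?_⟩⟩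
        have h1 := hN.signedDist_eq h hq.1 hy (hs.trans_lt (hq.2.trans_le hrρ))
        rw [← hxy] at h1
        rwa [h1]
      · exact ⟨0, fun h1 h2 => absurd ⟨h1, h2⟩ hq⟩
    choose P hP using hex
    refine ⟨P, fun t ht x hx => ?_, ?_, ?_⟩
    · obtain ⟨h1, h2⟩ := hP (t, x) ht hx
      refine ⟨h1, ?_⟩
      rw [hN.innerNormal_eq h ht h1]
      exact h2
    · rintro ⟨t, x⟩ ⟨ht, hx⟩
      obtain ⟨F, hF, hev⟩ := hN.exists_smooth_inverse h ht (hx.trans_le hrρ)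
      have hF1 : ContDiffAt ℝ ∞ (fun q => (F q).1) (t, x) := contDiff_fst.contDiffAt.comp _ hF
      -- The base point P was chosen without regularity; by injectivity it coincides with the smooth
      -- local inverse.
      have key : ∀ q : ℝ × Euc d, (q.1 ∈ Icc 0 T ∧
          Metric.infDist q.2 (frontier (𝒜 q.1)) < 2 * r) →
          (q.1 ∈ Icc 0 T → (F q).1 ∈ frontier (𝒜 q.1) ∧
            (F q).2 = signedDist (𝒜 q.1) q.2 ∧ |(F q).2| < ρ ∧
            q.2 = (F q).1 + (F q).2 • levelSetNormal φ q.1 (F q).1) → P q = (F q).1 := by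
        intro q hq hFq
        obtain ⟨g1, g2, g3, g4⟩ := hFq hq.1
        obtain ⟨k1, k2⟩ := hP q hq.1 hq.2
        exact (hN.injective q.1 hq.1 _ k1 _ g1 (signedDist (𝒜 q.1) q.2) (F q).2
          (g2 ▸ g3) g3 (k2.symm.trans g4)).1
      refine hF1.contDiffWithinAt.congr_of_eventuallyEq ?_
        (key (t, x) ⟨ht, hx⟩ hev.self_of_nhds)
      filter_upwards [mem_nhdsWithin_of_mem_nhds hev, self_mem_nhdsWithin] with q q1 q2
      exact key q q2 q1
    · rintro ⟨t, x⟩ ⟨ht, hx⟩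
      obtain ⟨F, hF, hev⟩ := hN.exists_smooth_inverse h ht (hx.trans_le hrρ)
      have hF2 : ContDiffAt ℝ ∞ (fun q => (F q).2) (t, x) := contDiff_snd.contDiffAt.comp _ hF
      refine hF2.contDiffWithinAt.congr_of_eventuallyEq ?_
        (hev.self_of_nhds ht).2.1.symm
      filter_upwards [mem_nhdsWithin_of_mem_nhds hev, self_mem_nhdsWithin] with q q1 q2
      exact (q1 q2.1).2.1.symm

end NormalCoordinates

theorem Evolution.exists_isTubularRadius (h : Evolution T R 𝒜 φ) :
    ∃ r, IsTubularRadius T 𝒜 r := by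
  obtain ⟨ρ, hN⟩ := h.exists_normalCoordinates
  have hρ := hN.pos
  refine ⟨min (ρ / 2) (1 / 2), hN.isTubularRadius h (by positivity)
    ((min_le_right _ _).trans_lt (by norm_num)) ?_⟩
  have := min_le_left (ρ / 2) (1 / 2)
  linarith

end

section

/-! ### Existence of the cutoff and of the truncation -/

theorem exists_isCutoff : ∃ κ, IsCutoff κ := by
  let f : ContDiffBump (0 : ℝ) := ⟨1 / 2, 1, by norm_num, by norm_num⟩
  refine ⟨f, f.contDiff, fun s => ⟨f.nonneg, f.le_one⟩, fun s hs => f.one_of_mem_closedBall ?_,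
    fun s hs => f.zero_of_le_dist ?_⟩
  · rw [Metric.mem_closedBall, Real.dist_eq, sub_zero]
    exact abs_le.2 hs
  · rw [Real.dist_eq, sub_zero]
    by_contra! hc
    exact hs (abs_lt.1 hc)

theorem smoothTransition_one_sub (u : ℝ) :
    Real.smoothTransition (1 - u) = 1 - Real.smoothTransition u := by
  have h := Real.smoothTransition.pos_denom u
  rw [Real.smoothTransition, Real.smoothTransition, sub_sub_cancel, add_comm, eq_sub_iff_add_eq,
    ← add_div, add_comm (expNegInvGlue (1 - u)), div_self h.ne']

/-- After clearing denominators the claim is u exp(-1/(1-u)) ≤ (1-u) exp(-1/u). Since 1/u ≤ 2 on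
this range, exp x ≥ 1 + x bounds exp(1/(1-u) - 1/u) below by 1/(1-u) - 1 = u/(1-u). -/
theorem le_smoothTransition {u : ℝ} (h0 : 1 / 2 ≤ u) (h1 : u ≤ 1) :
    u ≤ Real.smoothTransition u := by
  rcases h1.eq_or_lt with rfl | h1
  · rw [Real.smoothTransition.one]
  have hu : 0 < u := by linarith
  have hv : 0 < 1 - u := by linarith
  rw [Real.smoothTransition, le_div_iff₀ (Real.smoothTransition.pos_denom u), mul_add,
    ← le_sub_iff_add_le']
  simp only [expNegInvGlue, hu.not_ge, hv.not_ge, if_false]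
  have key : u * Real.exp (-(1 - u)⁻¹) ≤ (1 - u) * Real.exp (-u⁻¹) := by
    have h2 : Real.exp (-u⁻¹) = Real.exp (-(1 - u)⁻¹) * Real.exp ((1 - u)⁻¹ - u⁻¹) := by
      rw [← Real.exp_add]; ring_nf
    have h3 : u ≤ (1 - u) * Real.exp ((1 - u)⁻¹ - u⁻¹) := by
      have h4 := Real.add_one_le_exp ((1 - u)⁻¹ - u⁻¹)
      have h5 : u⁻¹ ≤ 2 := by rw [inv_le_comm₀ hu two_pos]; linarith
      have h6 : (1 - u) * ((1 - u)⁻¹ - 1) ≤ (1 - u) * Real.exp ((1 - u)⁻¹ - u⁻¹) :=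
        mul_le_mul_of_nonneg_left (by linarith) hv.le
      rw [mul_sub, mul_inv_cancel₀ hv.ne'] at h6
      linarith
    have h7 := mul_le_mul_of_nonneg_left h3 (Real.exp_pos (-(1 - u)⁻¹)).le
    rw [h2]
    linarith
  linarith

theorem deriv_smoothTransition_pos {u : ℝ} (h0 : 0 < u) (h1 : u < 1) :
    0 < deriv Real.smoothTransition u := by
  have hE : ∀ v : ℝ, 0 < v → HasDerivAt expNegInvGlue (Real.exp (-v⁻¹) * (v ^ 2)⁻¹) v := by
    intro v hv
    have h2 : HasDerivAt (fun x : ℝ => Real.exp (-x⁻¹)) (Real.exp (-v⁻¹) * (v ^ 2)⁻¹) v := by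
      have := ((hasDerivAt_inv hv.ne').fun_neg).exp
      simpa using this
    refine h2.congr_of_eventuallyEq ?_
    filter_upwards [lt_mem_nhds hv] with x hx
    simp [expNegInvGlue, hx.not_ge]
  have hv : 0 < 1 - u := by linarith
  have hA := hE u h0
  have hB : HasDerivAt (fun x => expNegInvGlue (1 - x))
      (Real.exp (-(1 - u)⁻¹) * ((1 - u) ^ 2)⁻¹ * (-1)) u :=
    HasDerivAt.comp u (hE (1 - u) hv) ((hasDerivAt_id u).const_sub 1)
  have hD := Real.smoothTransition.pos_denom u
  have hd := hA.fun_div (hA.fun_add hB) hD.ne'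
  have heq : deriv Real.smoothTransition u = _ := hd.deriv
  rw [heq]
  refine div_pos ?_ (by positivity)
  have pA : 0 < expNegInvGlue u := expNegInvGlue.pos_of_pos h0
  have pB : 0 < expNegInvGlue (1 - u) := expNegInvGlue.pos_of_pos hv
  have : 0 < Real.exp (-u⁻¹) * (u ^ 2)⁻¹ * expNegInvGlue (1 - u)
      + expNegInvGlue u * (Real.exp (-(1 - u)⁻¹) * ((1 - u) ^ 2)⁻¹) := by positivity
  linarith

/-- The choice is θ(s) = 1 - 2 S((1+s)/2) with S the smooth transition. The symmetry S(1-u) = 1 -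
S(u) gives θ(0) = 0 and carries `le_smoothTransition` over to negative s. -/
theorem exists_isTruncation : ∃ θ, IsTruncation θ := by
  have hst : ContDiff ℝ ∞ Real.smoothTransition := Real.smoothTransition.contDiff
  refine ⟨fun s => 1 - 2 * Real.smoothTransition ((1 + s) / 2), ?_, fun s => ?_, fun s hs => ?_,
    fun s hs => ?_, fun s hs => ?_, ?_, fun s hs => ?_⟩
  · exact contDiff_const.sub (contDiff_const.mul (hst.comp
      ((contDiff_const.add contDiff_id).div_const 2)))
  · have h1 := Real.smoothTransition.nonneg ((1 + s) / 2)
    have h2 := Real.smoothTransition.le_one ((1 + s) / 2)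
    exact ⟨by linarith, by linarith⟩
  · rw [Real.smoothTransition.zero_of_nonpos (by linarith)]; norm_num
  · rw [Real.smoothTransition.one_of_one_le (by linarith)]; norm_num
  · have h1 : HasDerivAt (fun s : ℝ => (1 + s) / 2) (1 / 2) s :=
      ((hasDerivAt_id s).const_add 1).div_const 2
    have h2 : HasDerivAt Real.smoothTransition (deriv Real.smoothTransition ((1 + s) / 2))
        ((1 + s) / 2) := ((hst.differentiable (by simp)) _).hasDerivAt
    have h3 := ((h2.comp s h1).const_mul 2).const_sub 1
    have h4 : deriv (fun s : ℝ => 1 - 2 * Real.smoothTransition ((1 + s) / 2)) s = _ := h3.deriv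
    rw [h4]
    have := deriv_smoothTransition_pos (u := (1 + s) / 2) (by linarith [hs.1]) (by linarith [hs.2])
    linarith
  · have := smoothTransition_one_sub (1 / 2)
    norm_num at this ⊢
    linarith
  · rcases le_total 0 s with h0 | h0
    · have := le_smoothTransition (u := (1 + s) / 2) (by linarith) (by linarith [hs.2])
      rw [abs_of_nonneg h0]
      exact le_trans (by linarith) (neg_le_abs _)
    · have h1 := le_smoothTransition (u := 1 - (1 + s) / 2) (by linarith) (by linarith [hs.1])
      rw [smoothTransition_one_sub] at h1
      rw [abs_of_nonpos h0]
      exact le_trans (by linarith) (le_abs_self _)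

theorem Evolution.exists_isCalibrationData {d : ℕ} {T R : ℝ} {𝒜 : ℝ → Set (Euc d)}
    {φ : ℝ × Euc d → ℝ} (h : Evolution T R 𝒜 φ) : ∃ r κ θ, IsCalibrationData T 𝒜 r κ θ := by
  obtain ⟨r, hr⟩ := h.exists_isTubularRadius
  obtain ⟨κ, hκ⟩ := exists_isCutoff
  obtain ⟨θ, hθ⟩ := exists_isTruncation
  exact ⟨r, κ, θ, hr, hκ, hθ⟩

end

section

/-! ### Testing measures with smooth functions -/

section Testing

variable {d : ℕ}

theorem exists_test_tendsto_indicator {K : Set (Euc d)} (hK : IsCompact K) :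
    ∃ f : ℕ → Euc d → ℝ, (∀ n, IsTest (f n)) ∧ (∀ n x, f n x ∈ Icc (0 : ℝ) 1) ∧
      ∀ x, Tendsto (fun n => f n x) atTop (𝓝 (K.indicator (fun _ => 1) x)) := by
  have hu : ∀ n : ℕ, 0 < 1 / ((n : ℝ) + 1) := fun n => Nat.one_div_pos_of_nat
  have hex : ∀ n : ℕ, ∃ g : Euc d → ℝ, ContDiff ℝ ∞ g ∧ range g ⊆ Icc 0 1 ∧
      Function.support g = Metric.thickening (1 / ((n : ℝ) + 1)) K ∧ ∀ x ∈ K, g x = 1 := fun n => by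
    obtain ⟨g, g1, g2, g3, g4⟩ := exists_contMDiff_support_eq_eq_one_iff (n := ⊤)
      (modelWithCornersSelf ℝ (Euc d)) Metric.isOpen_thickening hK.isClosed
      (Metric.self_subset_thickening (hu n) K)
    exact ⟨g, g1.contDiff, g2, g3, fun x hx => (g4 x).1 hx⟩
  choose f f1 f2 f3 f4 using hex
  refine ⟨f, fun n => ⟨f1 n, ?_⟩, fun n x => f2 n (mem_range_self x), fun x => ?_⟩
  · have hb : Bornology.IsBounded (Metric.cthickening (1 / ((n : ℝ) + 1)) K) :=
      hK.isBounded.cthickening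
    refine HasCompactSupport.of_support_subset_isCompact
      (Metric.isCompact_of_isClosed_isBounded Metric.isClosed_cthickening hb) ?_
    rw [f3 n]
    exact Metric.thickening_subset_cthickening _ _
  · refine tendsto_const_nhds.congr' ?_
    by_cases hx : x ∈ K
    · exact Eventually.of_forall fun n => by simp [indicator_of_mem hx, f4 n x hx]
    · obtain ⟨ε, hε, hxε⟩ : ∃ ε, 0 < ε ∧ x ∉ Metric.thickening ε K := by
        have h0 := hx
        rw [← hK.isClosed.closure_eq, Metric.closure_eq_iInter_thickening K] at h0
        simpa using h0
      have hlim := (tendsto_one_div_add_atTop_nhds_zero_nat (𝕜 := ℝ)).eventually_lt_const hε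
      filter_upwards [hlim] with n hn
      rw [indicator_of_notMem hx, eq_comm, ← Function.notMem_support, f3 n]
      exact fun hmem => hxε (Metric.thickening_mono hn.le K hmem)

theorem exists_test_tendsto_setIntegral {K : Set (Euc d)} (hK : IsCompact K) :
    ∃ f : ℕ → Euc d → ℝ, (∀ n, IsTest (f n)) ∧ (∀ n x, 0 ≤ f n x) ∧
      ∀ (ν : Measure (Euc d)) (g : Euc d → ℝ), Integrable g ν →
        Tendsto (fun n => ∫ x, f n x * g x ∂ν) atTop (𝓝 (∫ x in K, g x ∂ν)) := by
  obtain ⟨f, f1, f2, f3⟩ := exists_test_tendsto_indicator hK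
  refine ⟨f, f1, fun n x => (f2 n x).1, fun ν g hg => ?_⟩
  rw [← integral_indicator hK.measurableSet]
  refine tendsto_integral_of_dominated_convergence (fun x => ‖g x‖) (fun n => ?_) hg.norm
    (fun n => ?_) (ae_of_all _ fun x => ?_)
  · exact (f1 n).smooth.continuous.aestronglyMeasurable.mul hg.aestronglyMeasurable
  · refine ae_of_all _ fun x => ?_
    rw [norm_mul, Real.norm_of_nonneg (f2 n x).1]
    exact mul_le_of_le_one_left (norm_nonneg _) (f2 n x).2
  · have := (f3 x).mul_const (g x)
    convert this using 2
    by_cases hx : x ∈ K <;> simp [hx]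

/-- By inner regularity it suffices to treat compact sets K on which g is negative. Nonnegative test
functions converging to the indicator of K make the integral of g over K nonnegative, so K is a null
set. -/
theorem ae_nonneg_of_forall_test {ν : Measure (Euc d)} [IsFiniteMeasure ν] {g : Euc d → ℝ}
    (hg : Integrable g ν) (hm : Measurable g)
    (h : ∀ f : Euc d → ℝ, IsTest f → (∀ x, 0 ≤ f x) → 0 ≤ ∫ x, f x * g x ∂ν) :
    ∀ᵐ x ∂ν, 0 ≤ g x := by
  have hE : MeasurableSet {x | ¬ 0 ≤ g x} := (measurableSet_le measurable_const hm).compl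
  rw [ae_iff, hE.measure_eq_iSup_isCompact]
  simp only [ENNReal.iSup_eq_zero]
  intro K hKE hK
  obtain ⟨f, f1, f2, f3⟩ := exists_test_tendsto_setIntegral hK
  have h0 : 0 ≤ ∫ x in K, g x ∂ν :=
    ge_of_tendsto (f3 ν g hg) (Eventually.of_forall fun n => h _ (f1 n) (f2 n))
  have h1 : 0 ≤ ∫ x in K, -g x ∂ν :=
    setIntegral_nonneg hK.measurableSet fun x hx => neg_nonneg.2 (not_le.1 (hKE hx)).le
  rw [integral_neg] at h1
  have h2 : ∫ x in K, -g x ∂ν = 0 := by rw [integral_neg]; linarith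
  rw [setIntegral_eq_zero_iff_of_nonneg_ae (ae_restrict_of_forall_mem hK.measurableSet
    fun x hx => neg_nonneg.2 (not_le.1 (hKE hx)).le) hg.neg.integrableOn] at h2
  rw [← Measure.restrict_apply_univ, Measure.measure_univ_eq_zero, ← ae_eq_bot]
  by_contra hne
  have : NeBot (ae (ν.restrict K)) := ⟨hne⟩
  obtain ⟨x, hx1, hx2⟩ := (h2.and (ae_restrict_mem hK.measurableSet)).exists
  have := hKE hx2
  simp only [Pi.zero_apply, neg_eq_zero] at hx1
  exact this hx1.ge

theorem measure_eq_of_forall_test {ν ν' : Measure (Euc d)} [IsFiniteMeasure ν]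
    [IsFiniteMeasure ν'] (h : ∀ f : Euc d → ℝ, IsTest f → ∫ x, f x ∂ν = ∫ x, f x ∂ν') :
    ν = ν' := by
  have hK : ∀ K : Set (Euc d), IsCompact K → ν K = ν' K := fun K hK => by
    obtain ⟨f, f1, f2, f3⟩ := exists_test_tendsto_setIntegral hK
    have h1 := f3 ν (fun _ => 1) (integrable_const _)
    have h2 := f3 ν' (fun _ => 1) (integrable_const _)
    simp only [mul_one] at h1 h2
    have h3 := tendsto_nhds_unique h1 (h2.congr fun n => (h _ (f1 n)).symm)
    simp only [integral_const, smul_eq_mul, mul_one, measureReal_restrict_apply_univ] at h3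
    exact (measureReal_eq_measureReal_iff).1 h3
  refine Measure.ext fun S hS => ?_
  rw [hS.measure_eq_iSup_isCompact, hS.measure_eq_iSup_isCompact]
  exact iSup_congr fun K => iSup_congr fun _ => iSup_congr fun hc => hK K hc

end Testing

/-! ### The measure theoretic normal of a calibrated domain -/

theorem eq_of_norm_eq_one_of_inner_eq_one {E : Type*} [NormedAddCommGroup E]
    [InnerProductSpace ℝ E] {p v : E} (hp : ‖p‖ = 1) (hv : ‖v‖ ≤ 1) (h : ⟪p, v⟫ = 1) : p = v := by
  have h1 := norm_sub_sq_real p v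
  have h2 : ‖v‖ ^ 2 ≤ 1 := pow_le_one₀ (norm_nonneg _) hv
  rw [h, hp] at h1
  have h3 : ‖p - v‖ ^ 2 = 0 := le_antisymm (by linarith) (sq_nonneg _)
  exact sub_eq_zero.1 (norm_eq_zero.1 (pow_eq_zero_iff (n := 2) (by norm_num) |>.1 h3))

/-- The slice at a fixed time of the part of a calibration that concerns the geometry. -/
structure CalibratedDomain {d : ℕ} (M : ℝ) (ξ : Euc d → Euc d) (w : Euc d → ℝ) : Prop where
  isTest : IsTest ξ
  norm_le : ∀ x, ‖ξ x‖ ≤ 1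
  weight_smooth : ContDiff ℝ ∞ w
  normal : ∀ x, fderiv ℝ w x (ξ x) ≤ 0
  tangential : ∀ x v, |fderiv ℝ w x (v - ⟪v, ξ x⟫ • ξ x)| ≤ M * ‖v‖ * |w x|

variable {d : ℕ} {T M σ : ℝ} {𝒜 : ℝ → Set (Euc d)} {ξ B : ℝ × Euc d → Euc d}
  {ϑ δ : ℝ × Euc d → ℝ} {A : Set (Euc d)} {ν : Measure (Euc d)} {n : Euc d → Sph d}

theorem Calibration.slice (hc : Calibration T M 𝒜 ξ B ϑ δ) {t : ℝ} (ht : t ∈ Icc 0 T) :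
    CalibratedDomain M (fun x => ξ (t, x)) (fun x => ϑ (t, x)) :=
  ⟨hc.xi_field.isTest ht, hc.norm_xi_le t ht, hc.weight_smooth.slice ht, hc.weight_normal t ht,
    hc.weight_tangential t ht⟩

theorem IsTest.smul_field {f : Euc d → ℝ} (hf : IsTest f) {X : Euc d → Euc d}
    (hX : ContDiff ℝ ∞ X) : IsTest fun x => f x • X x :=
  ⟨hf.smooth.smul hX, hf.compact.smul_right⟩

theorem integrable_inner_normal [IsFiniteMeasure ν] (hn : Measurable n) {X : Euc d → Euc d}
    (hX : Measurable X) {C : ℝ} (hC : ∀ x, ‖X x‖ ≤ C) :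
    Integrable (fun x => ⟪X x, (n x : Euc d)⟫) ν := by
  refine Integrable.of_bound (C := C)
    (hX.inner (measurable_subtype_coe.comp hn)).aestronglyMeasurable (ae_of_all _ fun x => ?_)
  refine (norm_inner_le_norm _ _).trans ?_
  rw [norm_sphere, mul_one]
  exact hC x

namespace CalibratedDomain

variable {ξ : Euc d → Euc d} {w : Euc d → ℝ}

/-- The weight does not increase along ξ, so f ξ points into {w < 0}, and the divergence theorem
fixes the sign of the flux. -/
theorem integral_inner_nonneg (h : CalibratedDomain M ξ w) (hA : A =ᵐ[volume] {x | w x < 0})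
    (hn : IsPolarGradient A ν n) {f : Euc d → ℝ} (hf : IsTest f) (h0 : ∀ x, 0 ≤ f x) :
    0 ≤ ∫ x, f x * ⟪ξ x, (n x : Euc d)⟫ ∂ν := by
  have hX : IsTest fun x => f x • ξ x := hf.smul_field h.isTest.smooth
  have h1 := setIntegral_divergence_nonpos h.weight_smooth hX.smooth hX.compact fun x => by
    rw [map_smul, smul_eq_mul]
    exact mul_nonpos_of_nonneg_of_nonpos (h0 x) (h.normal x)
  have h2 := hn.integral_eq _ hX
  rw [setIntegral_congr_set hA] at h2
  simp only [real_inner_smul_left] at h2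
  linarith

theorem integral_tangential_eq_zero (h : CalibratedDomain M ξ w)
    (hA : A =ᵐ[volume] {x | w x < 0}) (hn : IsPolarGradient A ν n) {f : Euc d → ℝ}
    (hf : IsTest f) (v : Euc d) :
    ∫ x, f x * ⟪v - ⟪v, ξ x⟫ • ξ x, (n x : Euc d)⟫ ∂ν = 0 := by
  have hξ := h.isTest.smooth
  have hX : IsTest fun x => f x • (v - ⟪v, ξ x⟫ • ξ x) :=
    hf.smul_field (contDiff_const.sub ((contDiff_const.inner ℝ hξ).smul hξ))
  obtain ⟨C, hC⟩ := hf.exists_bound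
  have h1 := setIntegral_divergence_eq_zero (M := C * (M * ‖v‖)) h.weight_smooth hX.smooth
    hX.compact fun x => by
      rw [map_smul, smul_eq_mul, abs_mul, mul_assoc]
      exact mul_le_mul (hC x) (h.tangential x v) (abs_nonneg _) ((norm_nonneg _).trans (hC x))
  have h2 := hn.integral_eq _ hX
  rw [setIntegral_congr_set hA, h1] at h2
  have h3 : ∀ x, ⟪f x • (v - ⟪v, ξ x⟫ • ξ x), (n x : Euc d)⟫
      = f x * ⟪v - ⟪v, ξ x⟫ • ξ x, (n x : Euc d)⟫ := fun x => real_inner_smul_left _ _ _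
  simp only [h3] at h2
  linarith

/-- The measure theoretic normal of a calibrated domain is the calibrating vector field. -/
theorem normal_eq (h : CalibratedDomain M ξ w) (hA : A =ᵐ[volume] {x | w x < 0})
    (hn : IsPolarGradient A ν n) : ∀ᵐ x ∂ν, (n x : Euc d) = ξ x := by
  have := hn.finite
  have hξ := h.isTest.smooth
  have hnonneg : ∀ᵐ x ∂ν, 0 ≤ ⟪ξ x, (n x : Euc d)⟫ :=
    ae_nonneg_of_forall_test
      (integrable_inner_normal hn.measurable hξ.continuous.measurable h.norm_le)
      (hξ.continuous.measurable.inner (measurable_subtype_coe.comp hn.measurable))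
      fun f hf h0 => h.integral_inner_nonneg hA hn hf h0
  have htan : ∀ i : Fin d, ∀ᵐ x ∂ν,
      ⟪EuclideanSpace.single i (1 : ℝ) - ⟪EuclideanSpace.single i (1 : ℝ), ξ x⟫ • ξ x,
        (n x : Euc d)⟫ = 0 := fun i => by
    have hv : ‖(EuclideanSpace.single i (1 : ℝ) : Euc d)‖ = 1 := by simp
    refine ae_eq_zero_of_integral_contDiff_smul_eq_zero (Integrable.locallyIntegrable
      (integrable_inner_normal (C := 2) hn.measurable ?_ fun x => ?_))
      fun f hf hfc => h.integral_tangential_eq_zero hA hn ⟨hf, hfc⟩ _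
    · exact (contDiff_const.sub ((contDiff_const.inner ℝ hξ).smul hξ)).continuous.measurable
    · refine (norm_sub_le _ _).trans ?_
      rw [norm_smul, hv]
      have h1 := norm_inner_le_norm (𝕜 := ℝ) (EuclideanSpace.single i (1 : ℝ)) (ξ x)
      rw [hv, one_mul] at h1
      have h2 := mul_le_one₀ (h1.trans (h.norm_le x)) (norm_nonneg _) (h.norm_le x)
      linarith
  -- The vanishing tangential components give n = (ξ·n) ξ. As n has length 1 and |ξ| ≤ 1, the
  -- nonnegative number ξ·n must be 1. No information on the support of ν is needed.
  filter_upwards [hnonneg, ae_all_iff.2 htan] with x h1 h2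
  have h3 : (n x : Euc d) = ⟪ξ x, (n x : Euc d)⟫ • ξ x := by
    ext i
    have := h2 i
    rw [inner_sub_left, real_inner_smul_left, EuclideanSpace.inner_single_left,
      EuclideanSpace.inner_single_left] at this
    simp only [map_one, one_mul] at this
    rw [PiLp.smul_apply, smul_eq_mul]
    linarith
  have h4 : ‖(n x : Euc d)‖ = 1 := norm_sphere _
  have h5 : ⟪(n x : Euc d), ξ x⟫ ≤ 1 := (inner_le_norm_of_norm_eq_one h4).trans (h.norm_le x)
  rw [real_inner_comm] at h1 h3
  refine eq_of_norm_eq_one_of_inner_eq_one h4 (h.norm_le x) (le_antisymm h5 ?_)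
  have h6 := congrArg norm h3
  rw [norm_smul, h4, Real.norm_of_nonneg h1] at h6
  rw [h6]
  exact mul_le_of_le_one_right h1 (h.norm_le x)

end CalibratedDomain

/-! ### Unit density varifolds -/

theorem integral_unitDensity (hn : Measurable n) (hσ : 0 < σ) {g : Euc d × Sph d → ℝ}
    (hg : Measurable g) :
    ∫ q, g q ∂(ENNReal.ofReal σ • ν.map (fun x => (x, n x))) = σ * ∫ x, g (x, n x) ∂ν := by
  rw [integral_smul_measure, ENNReal.toReal_ofReal hσ.le, smul_eq_mul,
    integral_map (φ := fun x => (x, n x)) (measurable_id.prodMk hn).aemeasurable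
      hg.aestronglyMeasurable]

theorem measurable_inner_field {X : Euc d → Euc d} (hX : Measurable X) :
    Measurable fun q : Euc d × Sph d => ⟪X q.1, (q.2 : Euc d)⟫ :=
  (hX.comp measurable_fst).inner (measurable_subtype_coe.comp measurable_snd)

theorem IsUnitDensityVarifold.compatible (hσ : 0 < σ) {μ : Measure (Euc d × Sph d)}
    (h : IsUnitDensityVarifold σ A μ) : Compatible σ A μ := by
  obtain ⟨ν, n, hn, rfl⟩ := h
  refine ⟨ν, n, hn, fun X hX => ?_⟩
  exact (integral_unitDensity hn.measurable hσ
    (measurable_inner_field hX.smooth.continuous.measurable)).symm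

namespace CalibratedDomain

variable {ξ : Euc d → Euc d} {w : Euc d → ℝ} {μ : Measure (Euc d × Sph d)}

theorem fieldEntropy_eq_zero (h : CalibratedDomain M ξ w) (hσ : 0 < σ)
    (hA : A =ᵐ[volume] {x | w x < 0}) (hμ : IsUnitDensityVarifold σ A μ) :
    fieldEntropy ξ μ = 0 := by
  obtain ⟨ν, n, hn, rfl⟩ := hμ
  have hm : Measurable fun q : Euc d × Sph d => 1 - ⟪(q.2 : Euc d), ξ q.1⟫ :=
    measurable_const.sub ((measurable_subtype_coe.comp measurable_snd).inner
      (h.isTest.smooth.continuous.measurable.comp measurable_fst))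
  rw [fieldEntropy, integral_unitDensity hn.measurable hσ hm, integral_eq_zero_of_ae, mul_zero]
  filter_upwards [h.normal_eq hA hn] with x hx
  rw [← hx, real_inner_self_eq_norm_sq, norm_sphere, one_pow, sub_self]
  rfl

/-- Zero entropy forces p = ξ(x) for μ-almost every (x, p), while n = ξ holds ν-almost everywhere.
Compatibility tested with f ξ then shows that the mass measure is σν, so μ is its image under x ↦
(x, n(x)). -/
theorem isUnitDensityVarifold (h : CalibratedDomain M ξ w) (hσ : 0 < σ)
    (hA : A =ᵐ[volume] {x | w x < 0}) [IsFiniteMeasure μ] (hμ : Compatible σ A μ)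
    (h0 : fieldEntropy ξ μ = 0) : IsUnitDensityVarifold σ A μ := by
  obtain ⟨ν, n, hn, hcomp⟩ := hμ
  have := hn.finite
  have hν := h.normal_eq hA hn
  have hμξ : ∀ᵐ q ∂μ, (q.2 : Euc d) = ξ q.1 := by
    have hint : Integrable (fun q : Euc d × Sph d => 1 - ⟪(q.2 : Euc d), ξ q.1⟫) μ := by
      have := (integrable_const (1 : ℝ)).sub (h.isTest.integrable_inner μ)
      refine this.congr (ae_of_all _ fun q => ?_)
      simp only [Pi.sub_apply]
      rw [real_inner_comm]
    have hle : ∀ q : Euc d × Sph d, 0 ≤ 1 - ⟪(q.2 : Euc d), ξ q.1⟫ := fun q =>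
      sub_nonneg.2 ((inner_le_norm_of_norm_eq_one (norm_sphere _)).trans (h.norm_le _))
    rw [fieldEntropy, integral_eq_zero_iff_of_nonneg hle hint] at h0
    filter_upwards [h0] with q hq
    exact eq_of_norm_eq_one_of_inner_eq_one (norm_sphere _) (h.norm_le _)
      (sub_eq_zero.1 hq).symm
  have hfst : μ.fst = ENNReal.ofReal σ • ν := by
    have hfin : IsFiniteMeasure (ENNReal.ofReal σ • ν) := ν.smul_finite ENNReal.ofReal_ne_top
    refine measure_eq_of_forall_test fun f hf => ?_
    rw [integral_smul_measure, ENNReal.toReal_ofReal hσ.le, smul_eq_mul,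
      integral_fst_eq μ hf.smooth.continuous.measurable]
    have h1 := hcomp _ (hf.smul_field h.isTest.smooth)
    have h2 : ∫ x, ⟪f x • ξ x, (n x : Euc d)⟫ ∂ν = ∫ x, f x ∂ν := by
      refine integral_congr_ae ?_
      filter_upwards [hν] with x hx
      rw [← hx, real_inner_smul_left, real_inner_self_eq_norm_sq, norm_sphere, one_pow, mul_one]
    have h3 : ∫ q, ⟪f q.1 • ξ q.1, (q.2 : Euc d)⟫ ∂μ = ∫ q, f q.1 ∂μ := by
      refine integral_congr_ae ?_
      filter_upwards [hμξ] with q hq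
      rw [← hq, real_inner_smul_left, real_inner_self_eq_norm_sq, norm_sphere, one_pow, mul_one]
    rw [h2, h3] at h1
    exact h1.symm
  refine ⟨ν, n, hn, ?_⟩
  have hω : ∀ᵐ x ∂μ.fst, (n x : Euc d) = ξ x := by
    rw [hfst]
    exact Measure.ae_smul_measure hν _
  have hω' : ∀ᵐ q ∂μ, (n q.1 : Euc d) = ξ q.1 := by
    have : Measure.QuasiMeasurePreserving Prod.fst μ μ.fst :=
      ⟨measurable_fst, Measure.AbsolutelyContinuous.rfl⟩
    exact this.ae hω
  have hmap : μ.map (fun q : Euc d × Sph d => (q.1, n q.1)) = μ := by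
    conv_rhs => rw [← Measure.map_id (μ := μ)]
    refine Measure.map_congr ?_
    filter_upwards [hω', hμξ] with q h1 h2
    exact Prod.ext rfl (Subtype.ext (h1.trans h2.symm))
  have hg : Measurable fun x : Euc d => (x, n x) := measurable_id.prodMk hn.measurable
  rw [← Measure.map_smul, ← hfst, Measure.fst, Measure.map_map hg measurable_fst]
  exact hmap.symm

end CalibratedDomain

/-! ### Gronwall's inequality -/

/-- The primitive F of f is merely continuous in general, so it is integrated once more. Its
primitive G is differentiable with G' = F ≤ C G and G(0) = 0; the classical Gronwall inequality
gives G = 0, and then F and f vanish in turn. -/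
theorem ae_eq_zero_of_le_integral {T C : ℝ} {f : ℝ → ℝ}
    (hf : IntegrableOn f (Ioc 0 T)) (h0 : ∀ᵐ t ∂(volume.restrict (Ioc 0 T)), 0 ≤ f t)
    (h : ∀ᵐ τ ∂(volume.restrict (Ioc 0 T)), f τ ≤ C * ∫ t in Ioc 0 τ, f t) :
    ∀ᵐ t ∂(volume.restrict (Ioc 0 T)), f t = 0 := by
  -- extend by zero
  set g : ℝ → ℝ := (Ioc 0 T).indicator f with hg
  have hgi : Integrable g := (integrable_indicator_iff measurableSet_Ioc).2 hf
  set F : ℝ → ℝ := fun τ => ∫ t in (0 : ℝ)..τ, g t with hF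
  have hFc : Continuous F := intervalIntegral.continuous_primitive
    (fun a b => hgi.intervalIntegrable) 0
  have hFeq : ∀ τ ∈ Icc 0 T, F τ = ∫ t in Ioc 0 τ, f t := fun τ hτ => by
    simp only [hF]
    rw [intervalIntegral.integral_of_le hτ.1]
    exact setIntegral_congr_fun measurableSet_Ioc fun t ht =>
      indicator_of_mem (show t ∈ Ioc 0 T from ⟨ht.1, ht.2.trans hτ.2⟩) f
  have hF0 : ∀ τ ∈ Icc 0 T, 0 ≤ F τ := fun τ hτ => by
    rw [hFeq τ hτ]
    exact integral_nonneg_of_ae (ae_restrict_of_ae_restrict_of_subset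
      (Ioc_subset_Ioc_right hτ.2) h0)
  set G : ℝ → ℝ := fun τ => ∫ t in (0 : ℝ)..τ, F t with hG
  have hGd : ∀ τ, HasDerivAt G (F τ) τ := fun τ =>
    intervalIntegral.integral_hasDerivAt_right (hFc.intervalIntegrable _ _)
      (hFc.stronglyMeasurableAtFilter _ _) hFc.continuousAt
  have hFG : ∀ τ ∈ Icc 0 T, F τ ≤ C * G τ := fun τ hτ => by
    rw [hFeq τ hτ]
    simp only [hG]
    rw [intervalIntegral.integral_of_le hτ.1, ← integral_const_mul]
    have hsub : Ioc 0 τ ⊆ Ioc 0 T := Ioc_subset_Ioc_right hτ.2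
    refine integral_mono_ae (hf.mono_set hsub) ?_ ?_
    · exact ((hFc.const_mul C).integrableOn_Icc).mono_set Ioc_subset_Icc_self
    · filter_upwards [ae_restrict_of_ae_restrict_of_subset hsub h,
        ae_restrict_mem measurableSet_Ioc] with t ht htm
      rw [hFeq t ⟨htm.1.le, htm.2.trans hτ.2⟩]
      exact ht
  have hG0 : ∀ τ ∈ Icc 0 T, 0 ≤ G τ := fun τ hτ =>
    intervalIntegral.integral_nonneg hτ.1 fun t ht => hF0 t ⟨ht.1, ht.2.trans hτ.2⟩
  have hzero : ∀ τ ∈ Icc 0 T, G τ = 0 := fun τ hτ => by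
    have := norm_le_gronwallBound_of_norm_deriv_right_le (f := G) (f' := F) (δ := 0) (K := C)
      (ε := 0) (a := 0) (b := T) (fun t _ => (hGd t).continuousAt.continuousWithinAt)
      (fun t _ => (hGd t).hasDerivWithinAt) (by simp [hG]) (fun t ht => by
        have ht' := Ico_subset_Icc_self ht
        rw [Real.norm_of_nonneg (hF0 t ht'), Real.norm_of_nonneg (hG0 t ht'), add_zero]
        exact hFG t ht') τ hτ
    rw [gronwallBound_ε0, zero_mul] at this
    exact norm_le_zero_iff.1 this
  filter_upwards [h, h0, ae_restrict_mem measurableSet_Ioc] with τ h1 h2 hτ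
  have hτ' := Ioc_subset_Icc_self hτ
  have h3 := hFG τ hτ'
  rw [hzero τ hτ', mul_zero] at h3
  rw [← hFeq τ hτ', le_antisymm h3 (hF0 τ hτ'), mul_zero] at h1
  exact le_antisymm h1 h2

theorem ae_eq_of_weightedDist_eq_zero {w : Euc d → ℝ} (hA : NullMeasurableSet A volume)
    (hw : Measurable w) (hf : IntegrableOn w A) (hf' : IntegrableOn w {x | w x < 0})
    (hnull : volume {x | w x = 0} = 0) (h : weightedDist w A {x | w x < 0} = 0) :
    A =ᵐ[volume] {x | w x < 0} := by
  have hint := (weightedDist_eq hA hw hf hf').1.1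
  rw [weightedDist, integral_eq_zero_iff_of_nonneg
    (fun x => mul_nonneg (abs_nonneg _) (abs_nonneg _)) hint] at h
  have hne : ∀ᵐ x, w x ≠ 0 := by rw [ae_iff]; simpa using hnull
  filter_upwards [h, hne] with x h1 h2
  have h3 : A.indicator (fun _ => (1 : ℝ)) x - {x | w x < 0}.indicator (fun _ => (1 : ℝ)) x = 0 :=
    abs_eq_zero.1 ((mul_eq_zero.1 h1).resolve_right (abs_ne_zero.2 h2))
  refine propext ?_
  change x ∈ A ↔ x ∈ {x | w x < 0}
  by_cases hxA : x ∈ A <;> by_cases hxw : x ∈ {x | w x < 0} <;>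
    simp_all [indicator]

theorem weightedDist_eq_zero {w : Euc d → ℝ} {S : Set (Euc d)} (h : A =ᵐ[volume] S) :
    weightedDist w A S = 0 := by
  refine integral_eq_zero_of_ae ?_
  filter_upwards [h.mem_iff] with x hx
  have : A.indicator (fun _ => (1 : ℝ)) x = S.indicator (fun _ => (1 : ℝ)) x := by
    by_cases hxS : x ∈ S
    · rw [indicator_of_mem hxS, indicator_of_mem (hx.2 hxS)]
    · rw [indicator_of_notMem hxS, indicator_of_notMem (mt hx.1 hxS)]
  rw [this, sub_self, abs_zero, zero_mul]
  rfl

end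

section


/-! ### Stability and weak-strong uniqueness -/

variable {d : ℕ} {T M σ : ℝ} {𝒜 : ℝ → Set (Euc d)} {ξ B : ℝ × Euc d → Euc d}
  {ϑ δ : ℝ × Euc d → ℝ}

/-- Compatibility of the initial data enters the stability estimates only through this identity. -/
theorem Calibration.entropy_initial (hc : Calibration T M 𝒜 ξ B ϑ δ) (hT : 0 < T)
    {A₀ : Set (Euc d)} {μ₀ : Measure (Euc d × Sph d)} [IsFiniteMeasure μ₀]
    (h : Compatible σ A₀ μ₀) :
    μ₀.real univ + σ * (∫ x in A₀, spaceDiv ξ (0, x)) = fieldEntropy (fun x => ξ (0, x)) μ₀ := by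
  have hX := hc.xi_field.isTest (t := 0) ⟨le_rfl, hT.le⟩
  rw [fieldEntropy_eq hX, sub_eq_add_neg, ← h.integral_eq hX]
  rfl

theorem Calibration.exists_stability (hc : Calibration T M 𝒜 ξ B ϑ δ) (hT : 0 < T) :
    ∃ C : ℝ, 0 < C ∧ ∀ (σ : ℝ), 0 < σ →
      ∀ (μ₀ : Measure (Euc d × Sph d)) (A₀ : Set (Euc d)) (μ : ℝ → Measure (Euc d × Sph d))
        (A : ℝ → Set (Euc d)), IsDeGiorgiSolution σ μ₀ A₀ μ A → Compatible σ A₀ μ₀ →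
        IntegrableOn (fun t => fieldEntropy (fun x => ξ (t, x)) (μ t)) (Ioc 0 T) ∧
        IntegrableOn (fun t => σ * weightedDist (fun x => ϑ (t, x)) (A t) (𝒜 t)) (Ioc 0 T) ∧
        ∀ᵐ τ ∂(volume.restrict (Ioc 0 T)),
          fieldEntropy (fun x => ξ (τ, x)) (μ τ) ≤ fieldEntropy (fun x => ξ (0, x)) μ₀
            + C * ∫ t in Ioc 0 τ, fieldEntropy (fun x => ξ (t, x)) (μ t) ∧
          σ * weightedDist (fun x => ϑ (τ, x)) (A τ) (𝒜 τ)
            ≤ σ * weightedDist (fun x => ϑ (0, x)) A₀ (𝒜 0) + fieldEntropy (fun x => ξ (0, x)) μ₀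
              + C * ∫ t in Ioc 0 τ, (σ * weightedDist (fun x => ϑ (t, x)) (A t) (𝒜 t)
                + fieldEntropy (fun x => ξ (t, x)) (μ t)) := by
  obtain ⟨C₁, hC₁, h₁⟩ := SlabSolution.exists_entropy_inequality hT hc
  obtain ⟨C₂, hC₂, h₂⟩ := SlabSolution.exists_bulk_inequality hT hc
  -- The summand 1 makes the constant positive; enlarging it is harmless because the time integrals
  -- are nonnegative.
  refine ⟨C₁ + C₂ + 1, by positivity, fun σ hσ μ₀ A₀ μ A hsol hcomp => ?_⟩
  obtain ⟨V, H, hsol⟩ := hsol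
  obtain ⟨κ, hs, hκ⟩ := hsol.exists_slabSolution (T := T)
  have := hsol.finite_initial
  have := hs.finite
  have hnull : NullMeasurableSet A₀ volume := hsol.bv_initial.choose_spec.1
  have hE : (fun t => fieldEntropy (fun x => ξ (t, x)) (κ t)) =ᵐ[volume.restrict (Ioc 0 T)]
      fun t => fieldEntropy (fun x => ξ (t, x)) (μ t) := hκ.mono fun t ht => by simp only [ht]
  have hEi := (hc.xi_field.integrable_fieldEntropy (κ := κ)).congr hE
  have hWi := (hs.integrable_weightedDist hT hc).const_mul σ
  have hdom : ∀ t ∈ Icc 0 T, {x | ϑ (t, x) < 0} = 𝒜 t := fun t ht => (hc.domain_eq t ht).symm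
  have hW : (fun t => σ * weightedDist (fun x => ϑ (t, x)) (A t) {x | ϑ (t, x) < 0})
      =ᵐ[volume.restrict (Ioc 0 T)] fun t => σ * weightedDist (fun x => ϑ (t, x)) (A t) (𝒜 t) := by
    filter_upwards [ae_restrict_mem measurableSet_Ioc] with t ht
    rw [hdom t (Ioc_subset_Icc_self ht)]
  refine ⟨hEi, hWi.congr hW, ?_⟩
  filter_upwards [h₁ hs, h₂ hs hσ hnull, hκ, ae_restrict_mem measurableSet_Ioc]
    with τ k₁ k₂ hκτ hτ
  have hsub : Ioc 0 τ ⊆ Ioc 0 T := Ioc_subset_Ioc_right hτ.2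
  rw [hc.entropy_initial hT hcomp] at k₁ k₂
  have e₁ : ∫ t in Ioc 0 τ, fieldEntropy (fun x => ξ (t, x)) (κ t)
      = ∫ t in Ioc 0 τ, fieldEntropy (fun x => ξ (t, x)) (μ t) :=
    integral_congr_ae (ae_restrict_of_ae_restrict_of_subset hsub hE)
  have e₂ : ∫ t in Ioc 0 τ, (σ * weightedDist (fun x => ϑ (t, x)) (A t) {x | ϑ (t, x) < 0}
        + fieldEntropy (fun x => ξ (t, x)) (κ t))
      = ∫ t in Ioc 0 τ, (σ * weightedDist (fun x => ϑ (t, x)) (A t) (𝒜 t)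
        + fieldEntropy (fun x => ξ (t, x)) (μ t)) := by
    refine integral_congr_ae ?_
    filter_upwards [ae_restrict_of_ae_restrict_of_subset hsub hE,
      ae_restrict_of_ae_restrict_of_subset hsub hW] with t t1 t2
    rw [t1, t2]
  rw [e₁, hκτ] at k₁
  rw [e₂, hdom 0 ⟨le_rfl, hT.le⟩, hdom τ (Ioc_subset_Icc_self hτ)] at k₂
  have hE0 : ∀ t ∈ Ioc 0 τ, 0 ≤ fieldEntropy (fun x => ξ (t, x)) (μ t) := fun t ht =>
    fieldEntropy_nonneg (hc.norm_xi_le t (Ioc_subset_Icc_self (hsub ht))) _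
  have n₁ : 0 ≤ ∫ t in Ioc 0 τ, fieldEntropy (fun x => ξ (t, x)) (μ t) :=
    setIntegral_nonneg measurableSet_Ioc hE0
  have n₂ : 0 ≤ ∫ t in Ioc 0 τ, (σ * weightedDist (fun x => ϑ (t, x)) (A t) (𝒜 t)
      + fieldEntropy (fun x => ξ (t, x)) (μ t)) :=
    setIntegral_nonneg measurableSet_Ioc fun t ht =>
      add_nonneg (mul_nonneg hσ.le (weightedDist_nonneg _ _ _)) (hE0 t ht)
  have n₃ : 0 ≤ 2⁻¹ * ∫ t in Ioc 0 τ, ∫ q, (V t q.1 + spaceDiv ξ (t, q.1)) ^ 2 ∂(κ t) :=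
    mul_nonneg (by norm_num) (integral_nonneg fun t => integral_nonneg fun q => sq_nonneg _)
  constructor
  · have := mul_le_mul_of_nonneg_right (show C₁ ≤ C₁ + C₂ + 1 by linarith) n₁
    linarith
  · have := mul_le_mul_of_nonneg_right (show C₂ ≤ C₁ + C₂ + 1 by linarith) n₂
    linarith

/-- Both initial errors vanish. Gronwall's inequality is applied first to the entropy; once that is
zero, the inequality for the bulk error closes by itself. -/
theorem Calibration.weak_strong_uniqueness (hc : Calibration T M 𝒜 ξ B ϑ δ) (hT : 0 < T)
    (hσ : 0 < σ) {μ₀ : Measure (Euc d × Sph d)} {A₀ : Set (Euc d)}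
    {μ : ℝ → Measure (Euc d × Sph d)} {A : ℝ → Set (Euc d)} (h : IsDeGiorgiSolution σ μ₀ A₀ μ A)
    (hA₀ : A₀ =ᵐ[volume] 𝒜 0) (hμ₀ : IsUnitDensityVarifold σ A₀ μ₀) :
    ∀ᵐ t ∂(volume.restrict (Ioc 0 T)),
      A t =ᵐ[volume] 𝒜 t ∧ IsUnitDensityVarifold σ (A t) (μ t) := by
  have h0 : (0 : ℝ) ∈ Icc 0 T := ⟨le_rfl, hT.le⟩
  obtain ⟨C, hC, hstab⟩ := hc.exists_stability hT
  obtain ⟨hEi, hWi, hst⟩ := hstab σ hσ μ₀ A₀ μ A h (hμ₀.compatible hσ)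
  have hA₀' : A₀ =ᵐ[volume] {x | ϑ (0, x) < 0} := by rwa [← hc.domain_eq 0 h0]
  rw [(hc.slice h0).fieldEntropy_eq_zero hσ hA₀' hμ₀, weightedDist_eq_zero hA₀, mul_zero,
    add_zero] at hst
  simp only [zero_add] at hst
  have hE := ae_eq_zero_of_le_integral hEi
    ((ae_restrict_mem measurableSet_Ioc).mono fun t ht =>
      fieldEntropy_nonneg (hc.norm_xi_le t (Ioc_subset_Icc_self ht)) _)
    (hst.mono fun t ht => ht.1)
  have hW := ae_eq_zero_of_le_integral (C := C) hWi
    (ae_of_all _ fun t => mul_nonneg hσ.le (weightedDist_nonneg _ _ _)) (by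
      filter_upwards [hst, ae_restrict_mem measurableSet_Ioc] with τ ht hτ
      refine ht.2.trans_eq ?_
      congr 1
      refine integral_congr_ae ?_
      filter_upwards [ae_restrict_of_ae_restrict_of_subset (Ioc_subset_Ioc_right hτ.2) hE] with t h1
      rw [h1, add_zero])
  obtain ⟨V, H, hsol⟩ := h
  obtain ⟨M', hM'⟩ := hsol.bv_bound
  have hIoc : Ioc 0 T ⊆ Ioi 0 := fun t ht => ht.1
  filter_upwards [hE, hW, ae_restrict_of_ae_restrict_of_subset hIoc hM',
    ae_restrict_of_ae_restrict_of_subset hIoc hsol.compatible,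
    ae_restrict_mem measurableSet_Ioc] with t h1 h2 h3 h4 ht
  have ht' := Ioc_subset_Icc_self ht
  have := hsol.finite t ht.1
  have h5 := (mul_eq_zero.1 h2).resolve_left hσ.ne'
  rw [hc.domain_eq t ht'] at h5
  have hAt := ae_eq_of_weightedDist_eq_zero h3.1
    (hc.weight_smooth.slice ht').continuous.measurable
    (hc.integrableOn_weight ht' (ne_top_of_le_ne_top ENNReal.coe_ne_top h3.2.1))
    (hc.integrableOn_weight ht' (hc.volume_domain_ne_top ht')) (hc.weight_null t ht') h5
  refine ⟨?_, (hc.slice ht').isUnitDensityVarifold hσ hAt h4 h1⟩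
  rwa [hc.domain_eq t ht']

end

end TwoPhaseMCF

end

/-! ### The main theorem. -/

theorem theorem2 {d : ℕ} (hd : 1 ≤ d) {Ts : ℝ} (hTs : 0 < Ts)
    (𝒜 : ℝ → Set (Euc d)) (h𝒜 : IsSmoothMCF Ts 𝒜) :
    -- the data defining the two error functionals exist
    (∃ (r : ℝ) (κ θ : ℝ → ℝ), IsCalibrationData Ts 𝒜 r κ θ) ∧
    -- stability estimates, with a constant independent of the weak solution
    (∀ (r : ℝ) (κ θ : ℝ → ℝ), IsCalibrationData Ts 𝒜 r κ θ →
      ∃ C : ℝ, 0 < C ∧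
        ∀ (σ : ℝ), 0 < σ →
        ∀ (μ₀ : Measure (Euc d × Sph d)) (A₀ : Set (Euc d))
          (μ : ℝ → Measure (Euc d × Sph d)) (A : ℝ → Set (Euc d)),
          IsDeGiorgiSolution σ μ₀ A₀ μ A → Compatible σ A₀ μ₀ →
          ∀ᵐ T ∂(volume.restrict (Icc 0 Ts)),
            relEntropy (𝒜 T) r κ (μ T)
              ≤ relEntropy (𝒜 0) r κ μ₀
                + C * ∫ t in (0 : ℝ)..T, relEntropy (𝒜 t) r κ (μ t) ∧
            bulkError σ (𝒜 T) r θ (A T)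
              ≤ bulkError σ (𝒜 0) r θ A₀ + relEntropy (𝒜 0) r κ μ₀
                + C * ∫ t in (0 : ℝ)..T,
                    (bulkError σ (𝒜 t) r θ (A t) + relEntropy (𝒜 t) r κ (μ t))) ∧
    -- weak-strong uniqueness
    (∀ (σ : ℝ), 0 < σ →
      ∀ (μ₀ : Measure (Euc d × Sph d)) (A₀ : Set (Euc d))
        (μ : ℝ → Measure (Euc d × Sph d)) (A : ℝ → Set (Euc d)),
        IsDeGiorgiSolution σ μ₀ A₀ μ A →
        A₀ =ᵐ[volume] 𝒜 0 → IsUnitDensityVarifold σ A₀ μ₀ →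
        ∀ᵐ t ∂(volume.restrict (Icc 0 Ts)),
          A t =ᵐ[volume] 𝒜 t ∧ IsUnitDensityVarifold σ (A t) (μ t)) := by
  obtain ⟨R, φ, hev⟩ := h𝒜.exists_evolution hd
  -- The time 0 is negligible, and the solution concept concerns positive times only.
  have hIcc : volume.restrict (Icc 0 Ts) = volume.restrict (Ioc 0 Ts) :=
    Measure.restrict_congr_set Ioc_ae_eq_Icc.symm
  refine ⟨hev.exists_isCalibrationData, fun r κ θ hdata => ?_,
    fun σ hσ μ₀ A₀ μ A hsol hA₀ hμ₀ => ?_⟩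
  · obtain ⟨M, B, δ, hc⟩ := hdata.exists_calibration hev hTs
    obtain ⟨C, hC, hstab⟩ := hc.exists_stability hTs
    refine ⟨C, hC, fun σ hσ μ₀ A₀ μ A hsol hcomp => ?_⟩
    obtain ⟨-, -, hst⟩ := hstab σ hσ μ₀ A₀ μ A hsol hcomp
    rw [hIcc]
    filter_upwards [hst, ae_restrict_mem measurableSet_Ioc] with τ h hτ
    rw [intervalIntegral.integral_of_le hτ.1.le, intervalIntegral.integral_of_le hτ.1.le]
    exact h
  -- The uniqueness statement does not involve the calibration data, so any choice serves.
  · obtain ⟨r, κ, θ, hdata⟩ := hev.exists_isCalibrationData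
    obtain ⟨M, B, δ, hc⟩ := hdata.exists_calibration hev hTs
    rw [hIcc]
    exact hc.weak_strong_uniqueness hTs hσ hsol hA₀ hμ₀
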